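/- **Setting.** On the $L\times L$ square lattice with periodic boundary conditions and a qubit on each link, let $\rho^{(L)}_\beta=e^{-\beta H}/\operatorname{tr}e^{-\beta H}$ be the Gibbs state of the toric code $H=-\sum_{\square}\prod_{i\in\square}X_i-\sum_{+}\prod_{i\in +}Z_i$, with $0\le\beta<\infty$; let $\rho^{(L)}_{0}\propto\mathbb I$ be the maximally mixed state, and $p_\beta=e^{-\beta}/(e^\beta+e^{-\beta})$. A *range-$r$ LC transformation* adds qubits in the state $|0\rangle$ at lattice sites, applies a unitary circuit for which (maximal diameter of a gate)$\times$(depth) is at most $r$, and traces out some qubits. $F(\sigma,\rho)=\|\sqrt\sigma\sqrt\rho\|_1$ is the fidelity. A channel acting on a set $A$ of qubits is *correlation-preserving* with respect to a state if it does not change the mutual information between $A$ and the remaining qubits in that state; a circuit of channel gates is *ideal* on a state if every gate is correlation-preserving with respect to its input. **RG step.** Let $M\ge 2$. For a $2\times2$ block of plaquettes let $\mathcal E^X(\cdot)=\sum_{m\in\{0,1\}^4}U_mP_m(\cdot)P_mU_m^\dagger$, where $P_m$ projects onto the anyon configuration $m$ (eigenvalues $(-1)^{m_i}$ of the four plaquette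 operators) and $U_m$ is a product of Pauli $Z$'s on inner links of the block that moves all anyons to one plaquette (site 1), leaving there $\pi(m)=\sum_i m_i \bmod 2$; let $\mathcal E^Z$ be the analogous channel for a $2\times2$ block of vertices. Let $\mathcal D^X(\cdot)=\sum_m\Pr(m|\pi(m))\,U_m^\dagger P^1_{\pi(m)}(\cdot)P^1_{\pi(m)}U_m$, with $P^1_x$ the projector onto $m_1=x$ and $\Pr(\cdot|\cdot)$ computed for independent anyons of probability $p_\beta$, and $\mathcal D^Z$ analogously. One RG step from the $2M\times 2M$ to the $M\times M$ torus is $\mathcal C=\mathcal U\circ\bigotimes\mathcal E^Z\circ\bigotimes\mathcal E^X$ (all blocks), with $\mathcal U$ a fixed disentangling circuit of 13 layers of local CNOT gates, followed by discarding the qubits that do not belong to the coarse lattice. The reversed step adds those qubits in a fixed product state, each in $|0\rangle$ or $|+\rangle$, and applies $\mathcal U^{-1}$, then $\mathcal D^Z$ and $\mathcal D^X$ on all blocks. **Theorem.** 1. *(Exact ideal RG.)* For all $M\ge2$ and $0\le\beta<\infty$, and for every order of the blocks: all gates are channels acting on sets of qubits of diameter at most $4$; the circuit $\mathcal C$ is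 ideal on $\rho_\beta^{(2M)}$; $\mathcal C(\rho^{(2M)}_\beta)$ is the tensor product of $\rho^{(M)}_{\beta'}$ on the coarse lattice with a fixed product state, each remaining qubit being in $|0\rangle$ or $|+\rangle$, where $$\tanh\beta'=\tanh^4\beta\quad\Longleftrightarrow\quad p_{\beta'}=4p_\beta(1-p_\beta)^3+4p_\beta^3(1-p_\beta);$$ and the reversed step maps $\rho^{(M)}_{\beta'}$ back to $\rho^{(2M)}_\beta$ exactly. Consequently, with $\beta_0=\beta$ and $\tanh\beta_{\ell+1}=\tanh^4\beta_\ell$, for every $\ell\ge 0$ the $\ell$-step RG maps $\rho_\beta^{(2^\ell M)}$ to $\rho^{(M)}_{\beta_\ell}$ and the $\ell$-step reversed RG maps it back. 2. *(Flow.)* $\beta_\ell\to0$ as $\ell\to\infty$ for every $0\le\beta<\infty$. 3. *(Fidelity and convergence.)* For $L\ge2$ and $\beta\ge0$, $F(\rho^{(L)}_\beta,\rho^{(L)}_0)\ge e^{-\beta L^2}$; and $\beta'/\beta^4\to1$ as $\beta\to0^+$. There is an absolute constant $K$ such that, on the reference lattice of linear size $2^\ell M$ (with the coarse lattice consisting of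 the retained physical qubits), the $\ell$-step RG and the $\ell$-step reversed RG are LC transformations of range at most $K(\ell+1)2^\ell$. For each $\beta\in[0,\infty)$ there are constants $c>0$, $C$, $k$ such that for all $M\ge2$, $\ell\ge 0$, $\varepsilon\in(0,1)$, with $L=2^\ell M$: if $\ell\ge c\log(1+\log(L/\varepsilon))$, then the $\ell$-step RG maps $\rho^{(L)}_\beta$ to a state of fidelity more than $1-\varepsilon$ with $\rho_0^{(M)}$, and the $\ell$-step reversed RG maps $\rho_0^{(M)}$ to a state of fidelity more than $1-\varepsilon$ with $\rho^{(L)}_\beta$; if $\ell\le c\log(1+\log(L/\varepsilon))+1$, both are LC transformations of range at most $C\log^k(L/\varepsilon)$. 4. *(Trivial phase.)* For each $\beta\in[0,\infty)$ there are constants $C,k$ such that for all $L\ge2$ and $\varepsilon\in(0,1)$ there are LC transformations of range at most $C\log^k(L/\varepsilon)$ on the $L\times L$ torus that map $\rho^{(L)}_\beta$ to $\rho^{(L)}_0$, $\rho^{(L)}_0$ to $\rho_\beta^{(L)}$, and the product state $|0\cdots0\rangle\langle0\cdots0|$ to $\rho_\beta^{(L)}$, each up to fidelity more than $1-\varepsilon$.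 That is, the thermal toric code is two-way LC-connected to the maximally mixed state and is in the trivial phase. -/

import Mathlib

open Filter Topology Matrix

noncomputable section

/-! ### Operators and channels on finitely many qubits -/

/-- Operators on the Hilbert space `(ℂ²)^{⊗Q}`, in the computational basis `Q → {0,1}`. -/
abbrev Op (Q : Type) [Fintype Q] [DecidableEq Q] : Type :=
  Matrix (Q → Fin 2) (Q → Fin 2) ℂ

section Qubits

variable {Q Q' : Type} [Fintype Q] [DecidableEq Q] [Fintype Q'] [DecidableEq Q']

/-- The tensor product of one-qubit operators. -/
def tensorOp (u : Q → Matrix (Fin 2) (Fin 2) ℂ) : Op Q :=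
  Matrix.of fun s t => ∏ q, u q (s q) (t q)

def pauliX : Matrix (Fin 2) (Fin 2) ℂ := !![0, 1; 1, 0]

def pauliZ : Matrix (Fin 2) (Fin 2) ℂ := !![1, 0; 0, -1]

/-- The one-qubit state `|0⟩⟨0|`. -/
def ketZero : Matrix (Fin 2) (Fin 2) ℂ := !![1, 0; 0, 0]

/-- The one-qubit state `|+⟩⟨+|`. -/
def ketPlus : Matrix (Fin 2) (Fin 2) ℂ := !![1 / 2, 1 / 2; 1 / 2, 1 / 2]

/-- `∏_{q ∈ A} X_q`. -/
def xString (A : Finset Q) : Op Q := tensorOp fun q => if q ∈ A then pauliX else 1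

/-- `∏_{q ∈ A} Z_q`. -/
def zString (A : Finset Q) : Op Q := tensorOp fun q => if q ∈ A then pauliZ else 1

/-- The controlled-not gate with control `c` and target `t`. -/
def cnot (c t : Q) : Op Q :=
  Matrix.of fun x y => if x = Function.update y t (y t + y c) then 1 else 0

open Classical in
/-- `u ⊗ 𝟙`, for an operator `u` on the qubits in `A`. -/
def embed (A : Finset Q) (u : Op {q // q ∈ A}) : Op Q :=
  Matrix.of fun s t =>
    if ∀ q, q ∉ A → s q = t q then u (fun q => s q.1) (fun q => t q.1) else 0

open Classical in
/-- Partial trace. For injective `f : Q' → Q`, the qubits outside the range of `f` are traced out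
and the remaining ones are named by `Q'`. -/
def marginal (f : Q' → Q) (ρ : Op Q) : Op Q' :=
  Matrix.of fun s t => ∑ x : Q → Fin 2, ∑ y : Q → Fin 2,
    if x ∘ f = s ∧ y ∘ f = t ∧ ∀ q, q ∉ Set.range f → x q = y q then ρ x y else 0

open Classical in
/-- Adding qubits. For injective `f : Q' → Q`, the state `ρ` is put on the qubits in the range of
`f`, and every other qubit `q` is in the one-qubit state `φ q`. -/
def adjoin (f : Q' → Q) (φ : Q → Matrix (Fin 2) (Fin 2) ℂ) (ρ : Op Q') : Op Q :=
  Matrix.of fun s t =>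
    ρ (s ∘ f) (t ∘ f) * ∏ q ∈ Finset.univ.filter (fun q => q ∉ Set.range f), φ q (s q) (t q)

/-- Von Neumann entropy `- tr (ρ log ρ)`. -/
def vonNeumannEntropy (ρ : Op Q) : ℝ := (cfc Real.negMulLog ρ).trace.re

/-- Mutual information between the qubits in `A` and all the others. -/
def mutualInfo (A : Finset Q) (ρ : Op Q) : ℝ :=
  vonNeumannEntropy (marginal (fun q : {q // q ∈ A} => q.1) ρ)
    + vonNeumannEntropy (marginal (fun q : {q // q ∈ Aᶜ} => q.1) ρ)
    - vonNeumannEntropy ρ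

/-- Trace norm `tr √(Aᴴ A)`. -/
def traceNorm (A : Op Q) : ℝ := (cfc Real.sqrt (Aᴴ * A)).trace.re

/-- Uhlmann fidelity `‖√σ √ρ‖₁`. -/
def fidelity (σ ρ : Op Q) : ℝ := traceNorm (cfc Real.sqrt σ * cfc Real.sqrt ρ)

/-- The maximally mixed state. -/
def maxMixed (Q : Type) [Fintype Q] [DecidableEq Q] : Op Q :=
  ((2 : ℂ) ^ Fintype.card Q)⁻¹ • (1 : Op Q)

/-- The product state `|0…0⟩⟨0…0|`. -/
def zeroState (Q : Type) [Fintype Q] [DecidableEq Q] : Op Q := tensorOp fun _ => ketZero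

/-- `Φ` is a quantum channel (a completely positive trace preserving map in Kraus form) acting on
the qubits in `A` only. -/
def IsChannelOn (A : Finset Q) (Φ : Op Q → Op Q) : Prop :=
  ∃ (n : ℕ) (K : Fin n → Op {q // q ∈ A}),
    ∑ i, (K i)ᴴ * K i = 1 ∧ ∀ ρ, Φ ρ = ∑ i, embed A (K i) * ρ * (embed A (K i))ᴴ

end Qubits

/-- A gate of a circuit of channels: a map together with the set of qubits it acts on. -/
structure ChannelGate (Q : Type) [Fintype Q] [DecidableEq Q] where
  supp : Finset Q
  map : Op Q → Op Q

section Circuits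

variable {Q Q' : Type} [Fintype Q] [DecidableEq Q] [Fintype Q'] [DecidableEq Q']

/-- Apply the gates of a list one after the other, the head of the list first. -/
def runGates (l : List (ChannelGate Q)) (ρ : Op Q) : Op Q := l.foldl (fun σ g => g.map σ) ρ

/-- A gate is correlation-preserving with respect to `ρ` if it does not change the mutual
information between the qubits it acts on and the rest. -/
def CorrelationPreserving (g : ChannelGate Q) (ρ : Op Q) : Prop :=
  mutualInfo g.supp (g.map ρ) = mutualInfo g.supp ρ

/-- Each gate is correlation-preserving with respect to its own input when the circuit is run
on `ρ`. -/
def IsIdeal : List (ChannelGate Q) → Op Q → Prop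
  | [], _ => True
  | g :: l, ρ => CorrelationPreserving g ρ ∧ IsIdeal l (g.map ρ)

end Circuits

/-! ### The periodic square lattice and local channel transformations -/

/-- Vertices (and, by their lower left corner, plaquettes) of the `L × L` torus. -/
abbrev Site (L : ℕ) : Type := ZMod L × ZMod L

/-- Links of the `L × L` torus: `(false, p)` is the horizontal link from `p` to `p + (1,0)`,
`(true, p)` the vertical one from `p` to `p + (0,1)`. The link is located at the site `p`. -/
abbrev Edge (L : ℕ) : Type := Bool × Site L

/-- Graph distance on the torus. -/
def siteDist {L : ℕ} (p q : Site L) : ℕ :=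
  min (p.1 - q.1).val (q.1 - p.1).val + min (p.2 - q.2).val (q.2 - p.2).val

section LC

variable {L : ℕ} {Q Q' : Type} [Fintype Q] [DecidableEq Q] [Fintype Q'] [DecidableEq Q']

/-- One layer of a unitary circuit: unitary gates on pairwise disjoint sets of qubits, each of
diameter at most `g`. The qubit `q` sits at the site `pos q`. -/
def IsGateLayer (pos : Q → Site L) (g : ℕ) (W : Op Q) : Prop :=
  ∃ (n : ℕ) (A : Fin n → Finset Q) (u : (i : Fin n) → Op {q // q ∈ A i}),
    (∀ i j, i ≠ j → Disjoint (A i) (A j)) ∧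
    (∀ i, ∀ x ∈ A i, ∀ y ∈ A i, siteDist (pos x) (pos y) ≤ g) ∧
    (∀ i, (u i)ᴴ * u i = 1 ∧ u i * (u i)ᴴ = 1) ∧
    W = (List.ofFn fun i => embed (A i) (u i)).prod

/-- A unitary circuit whose range (maximal range of a gate times depth) is at most `r`. -/
def IsUnitaryCircuit (pos : Q → Site L) (r : ℕ) (U : Op Q) : Prop :=
  ∃ (g d : ℕ) (W : Fin d → Op Q), g * d ≤ r ∧ (∀ i, IsGateLayer pos g (W i)) ∧
    U = (List.ofFn W).prod

/-- A local channel transformation of range `r` on the `L × L` torus, from qubits `Q` at sites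
`pos` to qubits `Q'` at sites `pos'`: add qubits in the state `|0⟩` at lattice sites, apply a
unitary circuit of range at most `r`, and trace out some qubits. -/
def IsLC (pos : Q → Site L) (pos' : Q' → Site L) (r : ℕ) (Φ : Op Q → Op Q') : Prop :=
  ∃ (n : ℕ) (posAnc : Fin n → Site L) (U : Op (Q ⊕ Fin n)) (keep : Q' → Q ⊕ Fin n),
    IsUnitaryCircuit (Sum.elim pos posAnc) r U ∧
    Function.Injective keep ∧
    (∀ q, Sum.elim pos posAnc (keep q) = pos' q) ∧
    ∀ ρ, Φ ρ = marginal keep (U * adjoin Sum.inl (fun _ => ketZero) ρ * Uᴴ)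

end LC

/-- The family `ρ` can be turned into the family `σ` by LC transformations of polylogarithmic
range: up to fidelity `1 - ε` with range at most `C (log (L/ε))^k`. -/
def LCConvertible (ρ σ : (L : ℕ) → [NeZero L] → Op (Edge L)) : Prop :=
  ∃ (C : ℝ) (k : ℕ), ∀ (L : ℕ) [NeZero L], 2 ≤ L → ∀ ε : ℝ, 0 < ε → ε < 1 →
    ∃ (r : ℕ) (Φ : Op (Edge L) → Op (Edge L)),
      (r : ℝ) ≤ C * Real.log (L / ε) ^ k ∧
      IsLC (L := L) (fun e => e.2) (fun e => e.2) r Φ ∧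
      1 - ε < fidelity (Φ (ρ L)) (σ L)

/-- Two-way LC connection. -/
def SamePhase (ρ σ : (L : ℕ) → [NeZero L] → Op (Edge L)) : Prop :=
  LCConvertible ρ σ ∧ LCConvertible σ ρ

/-- States that can be obtained from the product state by LC transformations. -/
def InTrivialPhase (ρ : (L : ℕ) → [NeZero L] → Op (Edge L)) : Prop :=
  LCConvertible (fun L _ => zeroState (Edge L)) ρ

/-! ### The toric code -/

section ToricCode

variable {L : ℕ}

def horiz (p : Site L) : Edge L := (false, p)

def vert (p : Site L) : Edge L := (true, p)

/-- The four links around a plaquette. -/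
def plaquette (p : Site L) : Finset (Edge L) :=
  {horiz p, horiz (p + (0, 1)), vert p, vert (p + (1, 0))}

/-- The four links at a vertex. -/
def vertexStar (p : Site L) : Finset (Edge L) :=
  {horiz p, horiz (p - (1, 0)), vert p, vert (p - (0, 1))}

end ToricCode

/-- `H = - ∑ A_□ - ∑ B_+` with `A_□ = ∏_{i ∈ □} X_i` and `B_+ = ∏_{i ∈ +} Z_i`. -/
def toricHamiltonian (L : ℕ) [NeZero L] : Op (Edge L) :=
  -(∑ p : Site L, xString (plaquette p)) - ∑ p : Site L, zString (vertexStar p)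

/-- The Gibbs state `exp (-β H) / tr exp (-β H)`. -/
def gibbs (L : ℕ) [NeZero L] (β : ℝ) : Op (Edge L) :=
  (NormedSpace.exp (-(β : ℂ) • toricHamiltonian L)).trace⁻¹ •
    NormedSpace.exp (-(β : ℂ) • toricHamiltonian L)

/-- The probability `p_β` of an anyon. -/
def anyonProb (β : ℝ) : ℝ := Real.exp (-β) / (Real.exp β + Real.exp (-β))

/-! ### Coarse-graining a block of four anyon sites -/

/-- Four anyon sites `0 1 / 2 3`, with their stabilizers `stab`, the Pauli operators `hop 0`,
`hop 1`, `hop 2` that move an anyon between the sites `0,1`, between `0,2`, and between `1,3`,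
and the set of all qubits in the block. -/
structure AnyonBlock (Q : Type) [Fintype Q] [DecidableEq Q] where
  stab : Fin 4 → Op Q
  hop : Fin 3 → Op Q
  supp : Finset Q

/-- Parity of an anyon configuration. -/
def parity (m : Fin 4 → Fin 2) : Fin 2 := ∑ i, m i

/-- Conditional probability `Pr (m | π(m))` of an anyon configuration given its parity, when every
site holds an anyon independently with probability `p_β`. -/
def condProb (β : ℝ) (m : Fin 4 → Fin 2) : ℝ :=
  (∏ i, if m i = 1 then anyonProb β else 1 - anyonProb β) /
    ∑ m' : Fin 4 → Fin 2, if parity m' = parity m then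
      (∏ i, if m' i = 1 then anyonProb β else 1 - anyonProb β) else 0

section Blocks

variable {Q : Type} [Fintype Q] [DecidableEq Q]

/-- The projector onto the eigenvalue `(-1)^x` of the `i`-th stabilizer. -/
def siteProj (B : AnyonBlock Q) (i : Fin 4) (x : Fin 2) : Op Q :=
  (1 / 2 : ℂ) • (1 + (-1 : ℂ) ^ (x : ℕ) • B.stab i)

/-- The projector `P_m` onto the anyon configuration `m`. -/
def configProj (B : AnyonBlock Q) (m : Fin 4 → Fin 2) : Op Q :=
  siteProj B 0 (m 0) * siteProj B 1 (m 1) * siteProj B 2 (m 2) * siteProj B 3 (m 3)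

/-- The Pauli operator `U_m` that moves all the anyons of the configuration `m` to the site `0`. -/
def moveOp (B : AnyonBlock Q) (m : Fin 4 → Fin 2) : Op Q :=
  B.hop 0 ^ ((m 1 : ℕ) + (m 3 : ℕ)) * B.hop 1 ^ (m 2 : ℕ) * B.hop 2 ^ (m 3 : ℕ)

/-- `ρ ↦ ∑_m U_m P_m ρ P_m U_mᴴ`. -/
def coarseGate (B : AnyonBlock Q) : ChannelGate Q where
  supp := B.supp
  map ρ := ∑ m : Fin 4 → Fin 2,
    moveOp B m * configProj B m * ρ * configProj B m * (moveOp B m)ᴴ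

/-- `ρ ↦ ∑_m Pr (m | π(m)) U_mᴴ P¹_{π(m)} ρ P¹_{π(m)} U_m`. -/
def fineGate (β : ℝ) (B : AnyonBlock Q) : ChannelGate Q where
  supp := B.supp
  map ρ := ∑ m : Fin 4 → Fin 2, (condProb β m : ℂ) •
    ((moveOp B m)ᴴ * siteProj B 0 (parity m) * ρ * siteProj B 0 (parity m) * moveOp B m)

/-- Conjugation with a controlled-not. -/
def cnotGate (e : Q × Q) : ChannelGate Q where
  supp := {e.1, e.2}
  map ρ := cnot e.1 e.2 * ρ * (cnot e.1 e.2)ᴴ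

end Blocks

/-! ### One step of the renormalization group, from the `2M × 2M` to the `M × M` torus -/

/-- The lower left vertex of a `2 × 2` block. -/
def corner {M : ℕ} (b : Site M) : Site (2 * M) :=
  (((2 * b.1.val : ℕ) : ZMod (2 * M)), ((2 * b.2.val : ℕ) : ZMod (2 * M)))

/-- The `2 × 2` block of plaquettes at `b`, labelled top left, top right, bottom left, bottom
right; `m`-anyons are moved by `Z` on three of the four inner links. -/
def plaqBlock (M : ℕ) [NeZero M] (b : Site M) : AnyonBlock (Edge (2 * M)) where
  stab := ![xString (plaquette (corner b + (0, 1))), xString (plaquette (corner b + (1, 1))),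
    xString (plaquette (corner b)), xString (plaquette (corner b + (1, 0)))]
  hop := ![zString {vert (corner b + (1, 1))}, zString {horiz (corner b + (0, 1))},
    zString {horiz (corner b + (1, 1))}]
  supp := plaquette (corner b + (0, 1)) ∪ plaquette (corner b + (1, 1)) ∪
    plaquette (corner b) ∪ plaquette (corner b + (1, 0))

/-- The `2 × 2` block of vertices at `b`, labelled bottom left, bottom right, top left, top right;
`e`-anyons are moved by `X` on three of the four inner links. -/
def vertBlock (M : ℕ) [NeZero M] (b : Site M) : AnyonBlock (Edge (2 * M)) where
  stab := ![zString (vertexStar (corner b)), zString (vertexStar (corner b + (1, 0))),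
    zString (vertexStar (corner b + (0, 1))), zString (vertexStar (corner b + (1, 1)))]
  hop := ![xString {horiz (corner b)}, xString {vert (corner b)},
    xString {vert (corner b + (1, 0))}]
  supp := vertexStar (corner b) ∪ vertexStar (corner b + (1, 0)) ∪
    vertexStar (corner b + (0, 1)) ∪ vertexStar (corner b + (1, 1))

/-- The list of all blocks. -/
def blocks (M : ℕ) [NeZero M] : List (Site M) := (Finset.univ : Finset (Site M)).toList

/-- The controlled-nots (control, target) of the disentangling circuit in the block at `b`. For
different blocks `b` the controlled-nots at the same place of the list act on disjoint pairs of
qubits. -/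
def disentanglers {M : ℕ} (b : Site M) : List (Edge (2 * M) × Edge (2 * M)) :=
  [(horiz (corner b + (1, 1)), horiz (corner b + (1, 0))),
   (horiz (corner b + (1, 1)), vert (corner b + (1, 0))),
   (horiz (corner b + (1, 1)), vert (corner b + (2, 0))),
   (horiz (corner b + (0, 1)), horiz (corner b)),
   (horiz (corner b + (0, 1)), vert (corner b)),
   (horiz (corner b + (0, 1)), vert (corner b + (1, 0))),
   (vert (corner b + (1, 1)), horiz (corner b + (1, 2))),
   (vert (corner b + (1, 1)), vert (corner b + (2, 1))),
   (vert (corner b + (1, 1)), horiz (corner b + (1, 0))),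
   (vert (corner b + (1, 1)), vert (corner b + (1, 0))),
   (vert (corner b + (1, 1)), vert (corner b + (2, 0))),
   (horiz (corner b + (1, 0)), horiz (corner b)),
   (vert (corner b + (0, 1)), vert (corner b))]

/-- The disentangling circuit `𝒰`: 13 layers of controlled-nots, each layer applied to all
blocks. -/
def disentangleGates (M : ℕ) [NeZero M] : List (ChannelGate (Edge (2 * M))) :=
  (List.range 13).flatMap fun i => (blocks M).filterMap fun b =>
    ((disentanglers b)[i]?).map cnotGate

/-- The channel gates of one step: `m`-anyons are coarse-grained in the plaquette blocks in the
order `lX`, then `e`-anyons in the vertex blocks in the order `lZ`, then the lattice is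
disentangled. -/
def rgGates (M : ℕ) [NeZero M] (lX lZ : List (Site M)) : List (ChannelGate (Edge (2 * M))) :=
  lX.map (fun b => coarseGate (plaqBlock M b)) ++ lZ.map (fun b => coarseGate (vertBlock M b)) ++
    disentangleGates M

/-- The gates of the reversed step. -/
def fineGates (M : ℕ) [NeZero M] (β : ℝ) (lX lZ : List (Site M)) :
    List (ChannelGate (Edge (2 * M))) :=
  (disentangleGates M).reverse ++ lZ.reverse.map (fun b => fineGate β (vertBlock M b)) ++
    lX.reverse.map (fun b => fineGate β (plaqBlock M b))

/-- The physical qubits that form the coarse lattice. -/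
def coarseEdge (M : ℕ) (e : Edge M) : Edge (2 * M) :=
  if e.1 then vert (corner e.2 + (0, 1)) else horiz (corner e.2 + (1, 0))

/-- The states of the decoupled qubits. -/
def decoupledState (M : ℕ) (e : Edge (2 * M)) : Matrix (Fin 2) (Fin 2) ℂ :=
  if (e.1 = false ∧ Odd e.2.2.val) ∨ (e.1 = true ∧ Odd e.2.1.val ∧ Odd e.2.2.val)
  then ketPlus else ketZero

/-- One step of the renormalization group: run the circuit, discard the decoupled qubits. -/
def rgStep (M : ℕ) [NeZero M] (ρ : Op (Edge (2 * M))) : Op (Edge M) :=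
  marginal (coarseEdge M) (runGates (rgGates M (blocks M) (blocks M)) ρ)

/-- The reversed step: add the decoupled qubits, run the reversed circuit. -/
def fineStep (M : ℕ) [NeZero M] (β : ℝ) (σ : Op (Edge M)) : Op (Edge (2 * M)) :=
  runGates (fineGates M β (blocks M) (blocks M)) (adjoin (coarseEdge M) (decoupledState M) σ)

/-- The renormalized inverse temperature. -/
def rgBeta (β : ℝ) : ℝ := Real.artanh (Real.tanh β ^ 4)

/-! ### Iteration -/

/-- The linear size `2^ℓ M`. -/
def latticeSize (M : ℕ) : ℕ → ℕ
  | 0 => M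
  | ℓ + 1 => 2 * latticeSize M ℓ

theorem latticeSize_ne_zero (M : ℕ) [NeZero M] (ℓ : ℕ) : latticeSize M ℓ ≠ 0 := by
  induction ℓ with
  | zero => exact NeZero.ne M
  | succ ℓ ih => exact Nat.mul_ne_zero two_ne_zero ih

instance latticeSize_neZero (M : ℕ) [NeZero M] (ℓ : ℕ) : NeZero (latticeSize M ℓ) :=
  ⟨latticeSize_ne_zero M ℓ⟩

/-- `ℓ` steps of the renormalization group, from linear size `2^ℓ M` to linear size `M`. -/
def rgIter (M : ℕ) [NeZero M] : (ℓ : ℕ) → Op (Edge (latticeSize M ℓ)) → Op (Edge M)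
  | 0, ρ => ρ
  | ℓ + 1, ρ => rgIter M ℓ (rgStep (latticeSize M ℓ) ρ)

/-- `ℓ` steps of the reversed renormalization group, for a flow that starts at `β` on the lattice
of linear size `2^ℓ M`. -/
def fineIter (M : ℕ) [NeZero M] : (ℓ : ℕ) → ℝ → Op (Edge M) → Op (Edge (latticeSize M ℓ))
  | 0, _, σ => σ
  | ℓ + 1, β, σ => fineStep (latticeSize M ℓ) β (fineIter M ℓ (rgBeta β) σ)

/-- The physical qubits, on the lattice of linear size `2^ℓ M`, that form the lattice of linear
size `M` after `ℓ` steps. -/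
def coarseEdgeIter (M : ℕ) : (ℓ : ℕ) → Edge M → Edge (latticeSize M ℓ)
  | 0, e => e
  | ℓ + 1, e => coarseEdge (latticeSize M ℓ) (coarseEdgeIter M ℓ e)

end

set_option linter.unusedSectionVars false

noncomputable section

/-! ### Pauli strings labelled by bit strings, and controlled-nots -/

section PauliAlgebra

variable {Q : Type} [Fintype Q] [DecidableEq Q]

/-! Put $t=\tanh\beta$. The stabilizers are commuting involutions, so up to a scalar the Gibbs state
is the product of all factors $1+tA_\square$ and $1+tB_+$ (`gibbs_eq`): a law of independent biased
anyons, up to the global relations between stabilizers. These relations never have to be treated.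
All identities hold between products of such factors in the commutative group algebra `GA` of bit
strings and are carried to operators by the homomorphisms `phiX` and `phiZ`.

Exactness. The parity of four independent bits has as its bias the product of the four biases.
Moving the anyons of a block to the root therefore turns $\prod_i(1+f_is_i)$ into
$(1+f_0f_1f_2f_3s_0)(1+s_1)(1+s_2)(1+s_3)$, while everything that commutes with the operators of the
block is a spectator (`coarseGate_map_mul_blockProd`). Bayes' rule undoes this exactly
(`fineGate_map_mul_blockProd`). Hopping uses inner links only, so the blocks do not disturb each
other. Controlled-nots act linearly over $\mathbb F_2$ on Pauli strings, and a finite computation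
(`chainX_allCnots`, `chainZ_allCnots`) shows that the stabilizers of the emptied sites become those
of decoupled single qubits, while the roots become coarse plaquettes and stars times decoupled
stabilizers, which are absorbed (`decouple_factor`). Scalars are never computed: both sides have
trace one (`run_rgGates`).

Ideality. A coarse-graining that is undone by the fine-graining has as input a mixture of mutually
orthogonal unitary copies of parts of its output, with known weights. The entropy lost is then the
expectation of a block operator (`vonNeumannEntropy_coarse`), so it is the same for the global state
and for its marginal on the block. The entropy of the complement does not change, hence neither does
the mutual information.

Fidelity. Estimates go through operator domination. A product of stabilizer factors expands into
Pauli strings, each at most $1$, with nonnegative coefficients; this gives $\rho_0\ge r\rho_\beta$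
with $r=(1+t)^{-2L^2}$ (`maxMixed_sub_stab`). Operator monotonicity of the square root turns this
into $F\ge\sqrt r$ (`sqrt_le_fidelity`). Domination survives positive maps, so the same bound serves
the reversed RG. Since $\tanh\beta_\ell=t^{4^\ell}$, doubly logarithmically many steps suffice
(`exists_flow_constants`).

Locality. Each channel is dilated to a unitary gate with ancillas placed at its support
(`exists_dilation`), and discarded qubits are kept to the end, so that circuits compose with
additive depth (`IsLCd.comp`). Nine colours sort the overlapping blocks into layers, and distances
on the reference lattice double with every step (`IsStretch.coarse`).

Trivial phase. A general $L$ is not of the form $2^\ell M$ with few sites left, so a direct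
construction is used. The torus is cut into horizontal strips of length about $\log(L/\varepsilon)$.
The state in which only the total charge of each strip of length $n$ is biased, by $t^{n}$, is
nearly maximally mixed, and a local circuit splits these charges exactly into independent ones of
bias $t$ (`IsChargeLattice.exists_circuit`). Preceded by complete depolarization, it maps every
state of trace one close to the Gibbs state. -/

theorem fin_two_add_self (x : Fin 2) : x + x = 0 := by revert x; decide

theorem bits_add_self {α : Type*} (a : α → Fin 2) : a + a = 0 := funext fun q => fin_two_add_self (a q)

theorem bits_eq_add_iff {α : Type*} (s t a : α → Fin 2) : s = t + a ↔ s + a = t := by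
  constructor
  · rintro rfl; rw [add_assoc, bits_add_self, add_zero]
  · rintro rfl; rw [add_assoc, bits_add_self, add_zero]

/-- The shift `∏_q X_q ^ (a q)`. -/
def paX (a : Q → Fin 2) : Op Q := Matrix.of fun s t => if s = t + a then 1 else 0

/-- The sign `(-1)^(∑ b q s q)`. -/
def sgn (b s : Q → Fin 2) : ℂ := ∏ q, (-1) ^ ((b q : ℕ) * (s q : ℕ))

/-- The diagonal operator `∏_q Z_q ^ (b q)`. -/
def paZ (b : Q → Fin 2) : Op Q := Matrix.diagonal (sgn b)

/-- The indicator function of a set of qubits. -/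
def ind (A : Finset Q) : Q → Fin 2 := fun q => if q ∈ A then 1 else 0

theorem sgn_comm (b s : Q → Fin 2) : sgn b s = sgn s b := by simp only [sgn, mul_comm]

theorem sgn_add_left (b b' s : Q → Fin 2) : sgn (b + b') s = sgn b s * sgn b' s := by
  simp only [sgn, ← Finset.prod_mul_distrib]
  refine Finset.prod_congr rfl fun q _ => ?_
  rw [Pi.add_apply]
  generalize b q = x, b' q = y, s q = z
  fin_cases x <;> fin_cases y <;> fin_cases z <;> simp

theorem sgn_add_right (b s s' : Q → Fin 2) : sgn b (s + s') = sgn b s * sgn b s' := by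
  rw [sgn_comm, sgn_add_left, sgn_comm s, sgn_comm s']

@[simp] theorem sgn_zero_left (s : Q → Fin 2) : sgn 0 s = 1 := by simp [sgn]

theorem sgn_mul_self (b s : Q → Fin 2) : sgn b s * sgn b s = 1 := by
  rw [← sgn_add_left, bits_add_self, sgn_zero_left]

@[simp] theorem star_sgn (b s : Q → Fin 2) : star (sgn b s) = sgn b s := by simp [sgn]

theorem sgn_single_left (e : Q) (x : Fin 2) (s : Q → Fin 2) :
    sgn (Pi.single e x) s = (-1) ^ ((x : ℕ) * (s e : ℕ)) := by
  rw [sgn, Finset.prod_eq_single e]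
  · simp
  · intro q _ h; simp [Pi.single_eq_of_ne h]
  · simp

theorem sgn_single_right (e : Q) (x : Fin 2) (s : Q → Fin 2) :
    sgn s (Pi.single e x) = (-1) ^ ((x : ℕ) * (s e : ℕ)) := by
  rw [sgn_comm, sgn_single_left]

theorem paX_mul_apply (a : Q → Fin 2) (W : Op Q) (s t : Q → Fin 2) :
    (paX a * W) s t = W (s + a) t := by
  rw [Matrix.mul_apply, Finset.sum_eq_single (s + a)]
  · simp [paX, add_assoc, bits_add_self]
  · intro u _ hu
    have : s ≠ u + a := fun h => hu ((bits_eq_add_iff _ _ _).1 h).symm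
    simp [paX, this]
  · simp

theorem mul_paX_apply (a : Q → Fin 2) (W : Op Q) (s t : Q → Fin 2) :
    (W * paX a) s t = W s (t + a) := by
  rw [Matrix.mul_apply, Finset.sum_eq_single (t + a)]
  · simp [paX]
  · intro u _ hu
    simp [paX, hu]
  · simp

theorem paX_zero : paX (0 : Q → Fin 2) = 1 := by
  ext s t; simp [paX, Matrix.one_apply]

theorem paX_mul (a b : Q → Fin 2) : paX a * paX b = paX (a + b) := by
  ext s t
  rw [mul_paX_apply]
  simp only [paX, Matrix.of_apply]
  rw [add_assoc, add_comm b a]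

theorem paX_mul_self (a : Q → Fin 2) : paX a * paX a = 1 := by
  rw [paX_mul, bits_add_self, paX_zero]

theorem paX_conjTranspose (a : Q → Fin 2) : (paX a)ᴴ = paX a := by
  ext s t
  simp only [Matrix.conjTranspose_apply, paX, Matrix.of_apply]
  have : t = s + a ↔ s = t + a := by rw [bits_eq_add_iff]; exact eq_comm
  simp only [this]
  split_ifs <;> simp

theorem paZ_zero : paZ (0 : Q → Fin 2) = 1 := by
  ext s t; simp [paZ, Matrix.one_apply, Matrix.diagonal_apply]

theorem paZ_mul (a b : Q → Fin 2) : paZ a * paZ b = paZ (a + b) := by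
  rw [paZ, paZ, paZ, Matrix.diagonal_mul_diagonal]
  congr 1; ext s; rw [sgn_add_left]

theorem paZ_mul_self (a : Q → Fin 2) : paZ a * paZ a = 1 := by
  rw [paZ_mul, bits_add_self, paZ_zero]

theorem paZ_conjTranspose (a : Q → Fin 2) : (paZ a)ᴴ = paZ a := by
  rw [paZ, Matrix.diagonal_conjTranspose]
  congr 1; ext s; exact star_sgn a s

/-- Shifting the argument of a character multiplies it by its value on the shift. Every commutation
of Pauli strings in the sequel reduces to this sign. -/
theorem paZ_mul_paX (b a : Q → Fin 2) : paZ b * paX a = sgn b a • (paX a * paZ b) := by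
  ext s t
  rw [mul_paX_apply, Matrix.smul_apply, paX_mul_apply]
  simp only [paZ, Matrix.diagonal_apply]
  by_cases h : s = t + a
  · have h' : s + a = t := (bits_eq_add_iff _ _ _).1 h
    rw [if_pos h, if_pos h', h, add_assoc, bits_add_self, add_zero, sgn_add_right, smul_eq_mul,
      mul_comm]
  · have h' : ¬ s + a = t := fun h' => h ((bits_eq_add_iff _ _ _).2 h')
    rw [if_neg h, if_neg h', smul_zero]

theorem paX_commute (a b : Q → Fin 2) : Commute (paX a) (paX b) := by
  rw [Commute, SemiconjBy, paX_mul, paX_mul, add_comm]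

theorem paZ_commute (a b : Q → Fin 2) : Commute (paZ a) (paZ b) := by
  rw [Commute, SemiconjBy, paZ_mul, paZ_mul, add_comm]

theorem paZ_commute_paX {b a : Q → Fin 2} (h : sgn b a = 1) : Commute (paZ b) (paX a) := by
  rw [Commute, SemiconjBy, paZ_mul_paX, h, one_smul]

/-- A nonzero shift has no diagonal entries. A nontrivial character sums to zero, because
translating the summation variable at a qubit where it is nontrivial reverses the sign of the sum.
-/
theorem trace_paX_mul_paZ (a b : Q → Fin 2) :
    (paX a * paZ b).trace = if a = 0 ∧ b = 0 then (2 : ℂ) ^ Fintype.card Q else 0 := by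
  by_cases ha : a = 0
  · subst ha
    rw [paX_zero, one_mul, paZ, Matrix.trace_diagonal]
    by_cases hb : b = 0
    · subst hb; simp
    · obtain ⟨e, he⟩ := Function.ne_iff.1 hb
      simp only [hb, and_false, if_false]
      have h : ∑ s, sgn b s = ∑ s, sgn b (s + Pi.single e 1) :=
        (Equiv.sum_comp (Equiv.addRight (Pi.single e 1)) (sgn b)).symm
      have he' : b e = 1 := by
        have : ∀ x : Fin 2, x ≠ 0 → x = 1 := by decide
        exact this _ he
      simp only [sgn_add_right, sgn_single_right, he'] at h
      simp at h
      linear_combination h / 2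
  · simp only [ha, false_and, if_false]
    rw [Matrix.trace]
    refine Finset.sum_eq_zero fun s _ => ?_
    rw [Matrix.diag_apply, paX_mul_apply, paZ, Matrix.diagonal_apply, if_neg]
    intro h
    exact ha (by simpa using h)

theorem xString_eq (A : Finset Q) : xString A = paX (ind A) := by
  ext s t
  simp only [xString, tensorOp, Matrix.of_apply, paX]
  have key : ∀ q, (if q ∈ A then pauliX else (1 : Matrix (Fin 2) (Fin 2) ℂ)) (s q) (t q)
      = if s q = t q + ind A q then 1 else 0 := by
    intro q
    by_cases h : q ∈ A
    · simp only [h, if_true, ind]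
      generalize s q = x, t q = y
      fin_cases x <;> fin_cases y <;> simp [pauliX]
    · simp [h, ind, Matrix.one_apply]
  simp only [key]
  rw [Finset.prod_ite_zero]
  simp [funext_iff]

theorem zString_eq (A : Finset Q) : zString A = paZ (ind A) := by
  ext s t
  simp only [zString, tensorOp, Matrix.of_apply, paZ, Matrix.diagonal_apply, sgn]
  have key : ∀ q, (if q ∈ A then pauliZ else (1 : Matrix (Fin 2) (Fin 2) ℂ)) (s q) (t q)
      = if s q = t q then (-1) ^ ((ind A q : ℕ) * (s q : ℕ)) else 0 := by
    intro q
    by_cases h : q ∈ A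
    · simp only [h, if_true, ind]
      generalize s q = x, t q = y
      fin_cases x <;> fin_cases y <;> simp [pauliZ]
    · simp [h, ind, Matrix.one_apply]
  simp only [key]
  rw [Finset.prod_ite_zero]
  simp [funext_iff]

theorem ind_singleton (e : Q) : ind {e} = Pi.single e 1 := by
  ext q; simp [ind, Pi.single_apply]

/-- The action of a controlled-not on `X` strings and on basis states. -/
def cnotMap (c t : Q) (a : Q → Fin 2) : Q → Fin 2 := a + Pi.single t (a c)

theorem cnotMap_add (c t : Q) (a b : Q → Fin 2) :
    cnotMap c t (a + b) = cnotMap c t a + cnotMap c t b := by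
  simp only [cnotMap, Pi.add_apply, Pi.single_add]
  abel

theorem cnotMap_cnotMap {c t : Q} (h : c ≠ t) (a : Q → Fin 2) :
    cnotMap c t (cnotMap c t a) = a := by
  simp only [cnotMap, Pi.add_apply, Pi.single_eq_of_ne h, add_zero]
  rw [add_assoc, ← Pi.single_add, fin_two_add_self, Pi.single_zero, add_zero]

theorem cnot_apply (c t : Q) (x y : Q → Fin 2) :
    cnot c t x y = if x = cnotMap c t y then 1 else 0 := by
  have : Function.update y t (y t + y c) = cnotMap c t y := by
    ext q
    by_cases h : q = t
    · subst h; simp [cnotMap]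
    · simp [cnotMap, h]
  simp only [cnot, Matrix.of_apply, this]

theorem mul_cnot_apply (c t : Q) (W : Op Q) (x y : Q → Fin 2) :
    (W * cnot c t) x y = W x (cnotMap c t y) := by
  rw [Matrix.mul_apply, Finset.sum_eq_single (cnotMap c t y)]
  · simp [cnot_apply]
  · intro u _ hu; simp [cnot_apply, hu]
  · simp

theorem cnot_mul_apply {c t : Q} (h : c ≠ t) (W : Op Q) (x y : Q → Fin 2) :
    (cnot c t * W) x y = W (cnotMap c t x) y := by
  rw [Matrix.mul_apply, Finset.sum_eq_single (cnotMap c t x)]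
  · simp [cnot_apply, cnotMap_cnotMap h]
  · intro u _ hu
    have : x ≠ cnotMap c t u := fun h' => hu (by rw [h', cnotMap_cnotMap h])
    simp [cnot_apply, this]
  · simp

theorem cnot_mul_self {c t : Q} (h : c ≠ t) : cnot c t * cnot c t = 1 := by
  ext x y
  rw [mul_cnot_apply, cnot_apply, cnotMap_cnotMap h, Matrix.one_apply]

theorem cnot_conjTranspose {c t : Q} (h : c ≠ t) : (cnot c t)ᴴ = cnot c t := by
  ext x y
  rw [Matrix.conjTranspose_apply, cnot_apply, cnot_apply]
  have : y = cnotMap c t x ↔ x = cnotMap c t y := by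
    constructor <;> (rintro rfl; rw [cnotMap_cnotMap h])
  simp only [this]
  split_ifs <;> simp

theorem cnot_mul_paX {c t : Q} (h : c ≠ t) (a : Q → Fin 2) :
    cnot c t * paX a = paX (cnotMap c t a) * cnot c t := by
  ext x y
  rw [cnot_mul_apply h, mul_cnot_apply]
  simp only [paX, Matrix.of_apply]
  have : cnotMap c t x = y + a ↔ x = cnotMap c t y + cnotMap c t a := by
    rw [← cnotMap_add]
    constructor
    · intro h'; rw [← h', cnotMap_cnotMap h]
    · rintro rfl; rw [cnotMap_cnotMap h]
  simp only [this]

/-- Characters are pulled back by the transpose of the linear map on configurations, hence control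
and target are exchanged compared with $X$ strings. -/
theorem cnot_mul_paZ {c t : Q} (h : c ≠ t) (b : Q → Fin 2) :
    cnot c t * paZ b = paZ (cnotMap t c b) * cnot c t := by
  ext x y
  rw [cnot_mul_apply h, mul_cnot_apply]
  simp only [paZ, Matrix.diagonal_apply]
  have e1 : cnotMap c t x = y ↔ x = cnotMap c t y := by
    constructor
    · rintro rfl; rw [cnotMap_cnotMap h]
    · rintro rfl; rw [cnotMap_cnotMap h]
  simp only [e1]
  split_ifs with h'
  · subst h'
    rw [cnotMap_cnotMap h]
    rw [cnotMap, cnotMap, sgn_add_left, sgn_add_right, sgn_single_right, sgn_single_left, Pi.add_apply,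
      Pi.single_eq_of_ne h, add_zero, mul_assoc, mul_comm (y c : ℕ), neg_one_mul_self_pow, mul_one]
  · rfl
where
  neg_one_mul_self_pow (x y : Fin 2) :
      (-1 : ℂ) ^ ((x : ℕ) * (y : ℕ)) * (-1) ^ ((x : ℕ) * (y : ℕ)) = 1 := by
    rw [← mul_pow]; simp

end PauliAlgebra

/-! ### Tensor products of one-qubit operators -/

section TensorOp

variable {Q : Type} [Fintype Q] [DecidableEq Q]

theorem tensorOp_mul (u v : Q → Matrix (Fin 2) (Fin 2) ℂ) :
    tensorOp u * tensorOp v = tensorOp fun q => u q * v q := by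
  ext s t
  simp only [Matrix.mul_apply, tensorOp, Matrix.of_apply, ← Finset.prod_mul_distrib]
  rw [Finset.prod_univ_sum]
  simp [Fintype.piFinset_univ]

theorem tensorOp_one : tensorOp (fun _ : Q => (1 : Matrix (Fin 2) (Fin 2) ℂ)) = 1 := by
  ext s t
  simp only [tensorOp, Matrix.of_apply, Matrix.one_apply]
  rw [Finset.prod_ite_zero]
  simp [funext_iff]

theorem tensorOp_conjTranspose (u : Q → Matrix (Fin 2) (Fin 2) ℂ) :
    (tensorOp u)ᴴ = tensorOp fun q => (u q)ᴴ := by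
  ext s t
  simp [tensorOp, Matrix.conjTranspose_apply]

theorem trace_tensorOp (u : Q → Matrix (Fin 2) (Fin 2) ℂ) :
    (tensorOp u).trace = ∏ q, (u q).trace := by
  simp only [Matrix.trace, Matrix.diag_apply, tensorOp, Matrix.of_apply]
  rw [Finset.prod_univ_sum]
  simp [Fintype.piFinset_univ]

end TensorOp

/-! ### Operators on a subsystem and the configurations of its complement -/

section Subsystems

variable {Q Q' Q'' : Type} [Fintype Q] [DecidableEq Q] [Fintype Q'] [DecidableEq Q']
  [Fintype Q''] [DecidableEq Q'']

/-- The qubits outside the range of `f`. -/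
def Cf (f : Q' → Q) : Type := {q // q ∉ Set.range f}

instance (f : Q' → Q) : Fintype (Cf f) := by
  classical exact inferInstanceAs (Fintype {q // q ∉ Set.range f})

instance (f : Q' → Q) : DecidableEq (Cf f) := inferInstanceAs (DecidableEq {q // q ∉ Set.range f})

open Classical in
/-- Join a configuration of the qubits `Q'` and one of the remaining qubits. -/
def glue (f : Q' → Q) (s : Q' → Fin 2) (c : Cf f → Fin 2) : Q → Fin 2 := fun q =>
  if h : q ∈ Set.range f then s h.choose else c ⟨q, h⟩

theorem glue_apply {f : Q' → Q} (hf : f.Injective) (s : Q' → Fin 2) (c : Cf f → Fin 2) (q : Q') :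
    glue f s c (f q) = s q := by
  have h : f q ∈ Set.range f := ⟨q, rfl⟩
  rw [glue, dif_pos h, hf h.choose_spec]

theorem glue_comp {f : Q' → Q} (hf : f.Injective) (s : Q' → Fin 2) (c : Cf f → Fin 2) :
    glue f s c ∘ f = s := funext (glue_apply hf s c)

theorem glue_of_notMem (f : Q' → Q) (s : Q' → Fin 2) (c : Cf f → Fin 2) {q : Q}
    (h : q ∉ Set.range f) : glue f s c q = c ⟨q, h⟩ := dif_neg h

theorem glue_compl (f : Q' → Q) (s : Q' → Fin 2) (c : Cf f → Fin 2) :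
    (fun q : Cf f => glue f s c q.1) = c := funext fun q => glue_of_notMem f s c q.2

theorem glue_restrict {f : Q' → Q} (hf : f.Injective) (x : Q → Fin 2) :
    glue f (x ∘ f) (fun q => x q.1) = x := by
  ext q
  by_cases h : q ∈ Set.range f
  · obtain ⟨q, rfl⟩ := h
    rw [glue_apply hf]; rfl
  · rw [glue_of_notMem _ _ _ h]

/-- The partial isometry that projects the qubits outside the range of `f` onto `⟨c|`. -/
def kap (f : Q' → Q) (c : Cf f → Fin 2) : Matrix (Q' → Fin 2) (Q → Fin 2) ℂ :=
  Matrix.of fun s x => if x ∘ f = s ∧ (fun q : Cf f => x q.1) = c then 1 else 0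

theorem eq_glue_iff {f : Q' → Q} (hf : f.Injective) (s : Q' → Fin 2) (c : Cf f → Fin 2)
    (x : Q → Fin 2) : (x ∘ f = s ∧ (fun q : Cf f => x q.1) = c) ↔ x = glue f s c := by
  constructor
  · rintro ⟨rfl, rfl⟩; rw [glue_restrict hf]
  · rintro rfl; exact ⟨glue_comp hf s c, glue_compl f s c⟩

theorem kap_mul_apply {ι : Type*} {f : Q' → Q} (hf : f.Injective) (c : Cf f → Fin 2)
    (W : Matrix (Q → Fin 2) ι ℂ) (s : Q' → Fin 2) (j : ι) :
    (kap f c * W) s j = W (glue f s c) j := by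
  rw [Matrix.mul_apply, Finset.sum_eq_single (glue f s c)]
  · simp [kap, eq_glue_iff hf]
  · intro u _ hu; simp [kap, eq_glue_iff hf, hu]
  · simp

theorem mul_kap_apply {ι : Type*} {f : Q' → Q} (hf : f.Injective) (c : Cf f → Fin 2)
    (W : Matrix ι (Q → Fin 2) ℂ) (s : Q' → Fin 2) (j : ι) :
    (W * (kap f c)ᴴ) j s = W j (glue f s c) := by
  rw [Matrix.mul_apply, Finset.sum_eq_single (glue f s c)]
  · simp [kap, eq_glue_iff hf]
  · intro u _ hu; simp [kap, eq_glue_iff hf, hu]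
  · simp

theorem kap_mul_kap {f : Q' → Q} (hf : f.Injective) (c c' : Cf f → Fin 2) :
    kap f c * (kap f c')ᴴ = if c = c' then 1 else 0 := by
  ext s t
  rw [kap_mul_apply hf, Matrix.conjTranspose_apply]
  simp only [kap, Matrix.of_apply, glue_comp hf, glue_compl]
  by_cases h : c = c'
  · subst h
    simp only [and_true, if_true, Matrix.one_apply]
    split_ifs <;> simp
  · simp [h]

/-- Together with `kap_mul_kap`, this splits the Hilbert space according to the configuration of the
remaining qubits. It makes `emb` a unital homomorphism. -/
theorem sum_kap_mul_kap (f : Q' → Q) (hf : f.Injective) :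
    ∑ c, (kap f c)ᴴ * kap f c = 1 := by
  ext x y
  rw [Matrix.sum_apply]
  simp only [Matrix.mul_apply, Matrix.conjTranspose_apply, kap, Matrix.of_apply]
  rw [Finset.sum_eq_single (fun q : Cf f => x q.1), Finset.sum_eq_single (x ∘ f)]
  · by_cases h : x = y
    · subst h; simp
    · have : ¬ (y ∘ f = x ∘ f ∧ (fun q : Cf f => y q.1) = fun q : Cf f => x q.1) := by
        rw [eq_glue_iff hf, glue_restrict hf]; exact fun h' => h h'.symm
      rw [if_neg this, mul_zero, Matrix.one_apply_ne h]
  · intro s _ hs; simp [Ne.symm hs]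
  · simp
  · intro c _ hc
    refine Finset.sum_eq_zero fun s _ => ?_
    simp [Ne.symm hc]
  · simp

/-- The operator `u ⊗ 𝟙`, for `u` acting on the qubits named by the injective map `f`. -/
def emb (f : Q' → Q) (U : Op Q') : Op Q := ∑ c, (kap f c)ᴴ * U * kap f c

open Classical in
theorem emb_apply (f : Q' → Q) (U : Op Q') (s t : Q → Fin 2) :
    emb f U s t = if ∀ q, q ∉ Set.range f → s q = t q then U (s ∘ f) (t ∘ f) else 0 := by
  have key : ∀ c : Cf f → Fin 2, ((kap f c)ᴴ * U * kap f c) s t =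
      if (fun q : Cf f => s q.1) = c then
        (if (fun q : Cf f => t q.1) = c then U (s ∘ f) (t ∘ f) else 0) else 0 := by
    intro c
    rw [Matrix.mul_apply, Finset.sum_eq_single (t ∘ f), Matrix.mul_apply,
      Finset.sum_eq_single (s ∘ f)]
    · simp only [Matrix.conjTranspose_apply, kap, Matrix.of_apply, true_and]
      split_ifs <;> simp
    · intro s' _ hs; simp [kap, Ne.symm hs]
    · simp
    · intro s' _ hs; simp [kap, Ne.symm hs]
    · simp
  rw [emb, Matrix.sum_apply]
  simp only [key, Finset.sum_ite_eq, Finset.mem_univ, if_true]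
  have : (fun q : Cf f => t q.1) = (fun q : Cf f => s q.1) ↔ ∀ q, q ∉ Set.range f → s q = t q := by
    rw [funext_iff]
    exact ⟨fun h q hq => (h ⟨q, hq⟩).symm, fun h q => (h q.1 q.2).symm⟩
  simp only [this]

theorem kap_mul_emb {f : Q' → Q} (hf : f.Injective) (c : Cf f → Fin 2) (U : Op Q') :
    kap f c * emb f U = U * kap f c := by
  rw [emb, Matrix.mul_sum, Finset.sum_eq_single c]
  · rw [← Matrix.mul_assoc, ← Matrix.mul_assoc, kap_mul_kap hf, if_pos rfl, Matrix.one_mul]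
  · intro c' _ hc
    rw [← Matrix.mul_assoc, ← Matrix.mul_assoc, kap_mul_kap hf, if_neg (Ne.symm hc), Matrix.zero_mul, Matrix.zero_mul]
  · simp

/-- `emb f` as a homomorphism of star algebras. -/
def embHom (f : Q' → Q) (hf : f.Injective) : Op Q' →⋆ₐ[ℂ] Op Q where
  toFun := emb f
  map_one' := by simp only [emb, Matrix.mul_one]; exact sum_kap_mul_kap f hf
  map_mul' U V := by
    have : ∀ c, (kap f c)ᴴ * (U * V) * kap f c = (kap f c)ᴴ * U * kap f c * emb f V := by
      intro c; rw [Matrix.mul_assoc _ (kap f c), kap_mul_emb hf]; simp only [Matrix.mul_assoc]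
    simp only [emb, this, ← Matrix.sum_mul]
  map_zero' := by simp [emb]
  map_add' U V := by simp [emb, Matrix.mul_add, Matrix.add_mul, Finset.sum_add_distrib]
  commutes' r := by
    simp only [Algebra.algebraMap_eq_smul_one, emb, Matrix.mul_smul, Matrix.smul_mul, Matrix.mul_one]
    rw [← Finset.smul_sum, sum_kap_mul_kap f hf]
  map_star' U := by
    simp only [emb, Matrix.star_eq_conjTranspose, Matrix.conjTranspose_sum,
      Matrix.conjTranspose_mul, Matrix.conjTranspose_conjTranspose, Matrix.mul_assoc]

@[simp] theorem embHom_apply (f : Q' → Q) (hf : f.Injective) (U : Op Q') :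
    embHom f hf U = emb f U := rfl

theorem emb_mul {f : Q' → Q} (hf : f.Injective) (U V : Op Q') :
    emb f (U * V) = emb f U * emb f V := map_mul (embHom f hf) U V

theorem emb_one {f : Q' → Q} (hf : f.Injective) : emb f (1 : Op Q') = 1 := map_one (embHom f hf)

theorem emb_conjTranspose (f : Q' → Q) (U : Op Q') : emb f Uᴴ = (emb f U)ᴴ := by
  simp only [emb, Matrix.conjTranspose_sum,
      Matrix.conjTranspose_mul, Matrix.conjTranspose_conjTranspose, Matrix.mul_assoc]

theorem emb_injective {f : Q' → Q} (hf : f.Injective) : Function.Injective (emb f) := by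
  intro U V h
  have : ∀ W : Op Q', kap f 0 * emb f W * (kap f 0)ᴴ = W := fun W => by
    rw [kap_mul_emb hf, Matrix.mul_assoc, kap_mul_kap hf, if_pos rfl, Matrix.mul_one]
  rw [← this U, ← this V, h]

theorem emb_emb (f : Q' → Q) (g : Q'' → Q') (hf : f.Injective) (U : Op Q'') :
    emb f (emb g U) = emb (f ∘ g) U := by
  ext s t
  rw [emb_apply, emb_apply, emb_apply]
  by_cases h : ∀ q, q ∉ Set.range (f ∘ g) → s q = t q
  · rw [if_pos h, if_pos, if_pos]; · rfl
    · intro q hq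
      refine h (f q) ?_
      rintro ⟨r, hr⟩
      exact hq ⟨r, hf hr⟩
    · intro q hq
      refine h q ?_
      rintro ⟨r, hr⟩
      exact hq ⟨_, hr⟩
  · rw [if_neg h]
    split_ifs with h1 h2
    · refine absurd (fun q hq => ?_) h
      by_cases hq' : q ∈ Set.range f
      · obtain ⟨q, rfl⟩ := hq'
        refine h2 q ?_
        rintro ⟨r, rfl⟩
        exact hq ⟨r, rfl⟩
      · exact h1 q hq'
    · rfl
    · rfl

theorem embed_eq (A : Finset Q) (u : Op {q // q ∈ A}) : embed A u = emb Subtype.val u := by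
  ext s t
  rw [emb_apply]
  simp only [embed, Matrix.of_apply, Subtype.range_coe_subtype, Set.mem_ofPred_eq]
  rfl

open Classical in
theorem emb_mul_emb_apply {f : Q' → Q} {g : Q'' → Q} (hd : ∀ a b, f a ≠ g b)
    (U : Op Q') (V : Op Q'') (s t : Q → Fin 2) :
    (emb f U * emb g V) s t =
      if ∀ q, q ∉ Set.range f → q ∉ Set.range g → s q = t q then
        U (s ∘ f) (t ∘ f) * V (s ∘ g) (t ∘ g) else 0 := by
  -- The only intermediate configuration that contributes: the first factor forces agreement with
  -- `s` off the range of `f`, the second agreement with `t` off the range of `g`, in particular on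
  -- the range of `f`.
  rw [Matrix.mul_apply, Finset.sum_eq_single (fun q => if q ∈ Set.range f then t q else s q)]
  · rw [emb_apply, emb_apply, if_pos]
    · have e1 : (fun q => if q ∈ Set.range f then t q else s q) ∘ f = t ∘ f := by ext q; simp
      have e2 : (fun q => if q ∈ Set.range f then t q else s q) ∘ g = s ∘ g := by
        ext q
        have : g q ∉ Set.range f := by rintro ⟨a, ha⟩; exact hd _ _ ha
        simp only [Function.comp, this, if_false]
      rw [e1, e2]
      by_cases h : ∀ q, q ∉ Set.range f → q ∉ Set.range g → s q = t q
      · rw [if_pos h, if_pos]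
        intro q hq
        by_cases hq' : q ∈ Set.range f
        · simp only [hq', if_true]
        · simp only [hq', if_false]; exact h q hq' hq
      · rw [if_neg h, if_neg, mul_zero]
        intro h'
        refine h fun q hq hq' => ?_
        have := h' q hq'
        simpa only [hq, if_false] using this
    · intro q hq; simp only [hq, if_false]
  · intro x _ hx
    rw [emb_apply, emb_apply]
    by_cases h1 : ∀ q, q ∉ Set.range f → s q = x q
    · by_cases h2 : ∀ q, q ∉ Set.range g → x q = t q
      · refine absurd (funext fun q => ?_) hx
        by_cases hq : q ∈ Set.range f
        · simp only [hq, if_true]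
          refine h2 q ?_
          rintro ⟨b, rfl⟩
          obtain ⟨a, ha⟩ := hq
          exact hd _ _ ha
        · simp only [hq, if_false]; exact (h1 q hq).symm
      · rw [if_neg h2, mul_zero]
    · rw [if_neg h1, zero_mul]
  · simp

theorem emb_commute {f : Q' → Q} {g : Q'' → Q} (hd : ∀ a b, f a ≠ g b)
    (U : Op Q') (V : Op Q'') : Commute (emb f U) (emb g V) := by
  ext s t
  rw [emb_mul_emb_apply hd, emb_mul_emb_apply (fun a b h => hd b a h.symm)]
  have : (∀ q, q ∉ Set.range f → q ∉ Set.range g → s q = t q) ↔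
    (∀ q, q ∉ Set.range g → q ∉ Set.range f → s q = t q) := by tauto
  simp only [this, mul_comm]

/-! ### Partial traces -/

theorem marginal_eq (f : Q' → Q) (ρ : Op Q) :
    marginal f ρ = ∑ c, kap f c * ρ * (kap f c)ᴴ := by
  ext s t
  rw [Matrix.sum_apply]
  simp only [marginal, Matrix.of_apply, Matrix.mul_apply, Matrix.conjTranspose_apply, kap,
    Finset.sum_mul]
  rw [Finset.sum_comm]
  conv_rhs => rw [Finset.sum_comm]
  refine Finset.sum_congr rfl fun y _ => ?_
  rw [Finset.sum_comm]
  refine Finset.sum_congr rfl fun x _ => ?_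
  rw [Finset.sum_eq_single (fun q : Cf f => x q.1)]
  · have : (fun q : Cf f => y q.1) = (fun q : Cf f => x q.1) ↔
        ∀ q, q ∉ Set.range f → x q = y q := by
      rw [funext_iff]
      exact ⟨fun h q hq => (h ⟨q, hq⟩).symm, fun h q => (h q.1 q.2).symm⟩
    simp only [this]
    by_cases h1 : x ∘ f = s <;> by_cases h2 : y ∘ f = t <;>
      by_cases h3 : ∀ q, q ∉ Set.range f → x q = y q <;> simp [h1, h2]
  · intro c _ hc
    simp [Ne.symm hc]
  · simp

theorem marginal_apply {f : Q' → Q} (hf : f.Injective) (ρ : Op Q) (s t : Q' → Fin 2) :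
    marginal f ρ s t = ∑ c, ρ (glue f s c) (glue f t c) := by
  rw [marginal_eq, Matrix.sum_apply]
  refine Finset.sum_congr rfl fun c _ => ?_
  rw [mul_kap_apply hf, kap_mul_apply hf]

/-- The partial trace as a linear map. -/
def marginalHom (f : Q' → Q) : Op Q →ₗ[ℂ] Op Q' where
  toFun := marginal f
  map_add' ρ σ := by simp [marginal_eq, Matrix.mul_add, Matrix.add_mul, Finset.sum_add_distrib]
  map_smul' r ρ := by simp [marginal_eq, Finset.smul_sum]

@[simp] theorem marginalHom_apply (f : Q' → Q) (ρ : Op Q) : marginalHom f ρ = marginal f ρ := rfl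

theorem marginal_emb {f : Q' → Q} (hf : f.Injective) (U V : Op Q') (ρ : Op Q) :
    marginal f (emb f U * ρ * (emb f V)ᴴ) = U * marginal f ρ * Vᴴ := by
  rw [marginal_eq, marginal_eq, Matrix.mul_sum, Matrix.sum_mul]
  refine Finset.sum_congr rfl fun c _ => ?_
  calc kap f c * (emb f U * ρ * (emb f V)ᴴ) * (kap f c)ᴴ
      = (kap f c * emb f U) * ρ * (kap f c * emb f V)ᴴ := by
        simp only [Matrix.conjTranspose_mul, Matrix.mul_assoc]
    _ = _ := by
        rw [kap_mul_emb hf, kap_mul_emb hf]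
        simp only [Matrix.conjTranspose_mul, Matrix.mul_assoc]

/-- The partial trace is the adjoint of `emb f` for the trace pairing. Identities between marginals
are proved by testing against operators and moving `emb` across. -/
theorem trace_emb_mul (f : Q' → Q) (W : Op Q') (ρ : Op Q) :
    (emb f W * ρ).trace = (W * marginal f ρ).trace := by
  rw [emb, marginal_eq, Matrix.sum_mul, Matrix.mul_sum, Matrix.trace_sum, Matrix.trace_sum]
  refine Finset.sum_congr rfl fun c _ => ?_
  rw [Matrix.mul_assoc, Matrix.mul_assoc, Matrix.trace_mul_comm]
  simp only [Matrix.mul_assoc]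

theorem trace_marginal {f : Q' → Q} (hf : f.Injective) (ρ : Op Q) :
    (marginal f ρ).trace = ρ.trace := by
  have := trace_emb_mul f 1 ρ
  rwa [emb_one hf, Matrix.one_mul, Matrix.one_mul, eq_comm] at this

theorem op_ext_trace {A B : Op Q} (h : ∀ W : Op Q, (W * A).trace = (W * B).trace) : A = B :=
  Matrix.ext_iff_trace_mul_left.2 h

theorem marginal_marginal {f : Q' → Q} (hf : f.Injective) (g : Q'' → Q') (ρ : Op Q) :
    marginal g (marginal f ρ) = marginal (f ∘ g) ρ := by
  refine op_ext_trace fun W => ?_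
  rw [← trace_emb_mul, ← trace_emb_mul, emb_emb f g hf, trace_emb_mul]

/-- No signalling: a test operator outside the support commutes with the Kraus operators, and these
then cancel by cyclicity of the trace. -/
theorem marginal_disjoint {ι : Type*} [Fintype ι] {f : Q' → Q} {g : Q'' → Q}
    (hd : ∀ a b, f a ≠ g b) (hf : f.Injective) (K : ι → Op Q')
    (hK : ∑ i, (K i)ᴴ * K i = 1) (ρ : Op Q) :
    marginal g (∑ i, emb f (K i) * ρ * (emb f (K i))ᴴ) = marginal g ρ := by
  refine op_ext_trace fun W => ?_
  rw [← trace_emb_mul, ← trace_emb_mul, Matrix.mul_sum, Matrix.trace_sum]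
  have : ∀ i, (emb g W * (emb f (K i) * ρ * (emb f (K i))ᴴ)).trace =
      (emb f ((K i)ᴴ * K i) * (emb g W * ρ)).trace := by
    intro i
    rw [← Matrix.mul_assoc, Matrix.trace_mul_comm, emb_mul hf, emb_conjTranspose, Matrix.mul_assoc _ (emb f (K i)),
      ← Matrix.mul_assoc (emb f (K i)), (emb_commute hd (K i) W).eq, Matrix.mul_assoc (emb g W)]
  simp only [this]
  rw [← Matrix.trace_sum, ← Matrix.sum_mul]
  have h2 : ∑ i, emb f ((K i)ᴴ * K i) = 1 := by
    have := congrArg (embHom f hf) hK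
    rwa [map_sum, map_one] at this
  rw [h2, Matrix.one_mul]

/-! ### Adding qubits in pure states -/

open Classical in
/-- The isometry that adds the qubits outside the range of `f` in the pure states `v`. -/
def adjV (f : Q' → Q) (v : Q → Fin 2 → ℂ) : Matrix (Q → Fin 2) (Q' → Fin 2) ℂ :=
  Matrix.of fun x s => if x ∘ f = s then
    ∏ q ∈ Finset.univ.filter (fun q => q ∉ Set.range f), v q (x q) else 0

theorem adjoin_eq (f : Q' → Q) (φ : Q → Matrix (Fin 2) (Fin 2) ℂ) (v : Q → Fin 2 → ℂ)
    (h : ∀ q x y, φ q x y = v q x * star (v q y)) (ρ : Op Q') :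
    adjoin f φ ρ = adjV f v * ρ * (adjV f v)ᴴ := by
  ext s t
  rw [Matrix.mul_apply, Finset.sum_eq_single (t ∘ f), Matrix.mul_apply,
    Finset.sum_eq_single (s ∘ f)]
  · simp only [adjoin, adjV, Matrix.of_apply, Matrix.conjTranspose_apply, if_true, h,
      Finset.prod_mul_distrib, star_prod]
    ring
  · intro s' _ hs; simp [adjV, Ne.symm hs]
  · simp
  · intro s' _ hs; simp [adjV, Ne.symm hs]
  · simp

theorem emb_mul_adjV {f : Q' → Q} (hf : f.Injective) (v : Q → Fin 2 → ℂ) (U : Op Q') :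
    emb f U * adjV f v = adjV f v * U := by
  ext x s
  rw [Matrix.mul_apply, Matrix.mul_apply, Finset.sum_eq_single (x ∘ f),
    Finset.sum_eq_single (glue f s fun q => x q.1)]
  · rw [emb_apply, if_pos, glue_comp hf]
    · simp only [adjV, Matrix.of_apply, glue_comp hf, if_true]
      rw [mul_comm]
      congr 1
      refine Finset.prod_congr rfl fun q hq => ?_
      rw [glue_of_notMem _ _ _ (Finset.mem_filter.1 hq).2]
    · intro q hq; rw [glue_of_notMem _ _ _ hq]
  · intro y _ hy
    rw [emb_apply]
    by_cases h1 : ∀ q, q ∉ Set.range f → x q = y q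
    · by_cases h2 : y ∘ f = s
      · refine absurd ?_ hy
        subst h2
        have : (fun q : Cf f => x q.1) = fun q : Cf f => y q.1 := funext fun q => h1 q.1 q.2
        rw [this, glue_restrict hf]
      · simp [adjV, h2]
    · rw [if_neg h1, zero_mul]
  · simp
  · intro s' _ hs; simp [adjV, Ne.symm hs]
  · simp

/-- The amplitudes of the state `|0⟩`. -/
def amp0 : Fin 2 → ℂ := ![1, 0]

theorem ketZero_apply (x y : Fin 2) : ketZero x y = amp0 x * star (amp0 y) := by
  fin_cases x <;> fin_cases y <;> simp [ketZero, amp0]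

theorem adjoin_ketZero (f : Q' → Q) (ρ : Op Q') :
    adjoin f (fun _ => ketZero) ρ = adjV f (fun _ => amp0) * ρ * (adjV f (fun _ => amp0))ᴴ :=
  adjoin_eq f _ _ (fun _ => ketZero_apply) ρ

/-- Gates on the old qubits commute with adding fresh ones; this allows all ancillas of a composite
circuit to be added at the start. -/
theorem adjoin_emb {f : Q' → Q} (hf : f.Injective) (U : Op Q') (ρ : Op Q') :
    adjoin f (fun _ => ketZero) (U * ρ * Uᴴ) =
      emb f U * adjoin f (fun _ => ketZero) ρ * (emb f U)ᴴ := by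
  rw [adjoin_ketZero, adjoin_ketZero]
  calc _ = (adjV f (fun _ => amp0) * U) * ρ * (adjV f (fun _ => amp0) * U)ᴴ := by
        simp only [Matrix.conjTranspose_mul, Matrix.mul_assoc]
    _ = _ := by
        rw [← emb_mul_adjV hf]
        simp only [Matrix.conjTranspose_mul, Matrix.mul_assoc]

theorem adjoin_adjoin {f : Q' → Q} (hf : f.Injective) (g : Q'' → Q')
    (φ : Matrix (Fin 2) (Fin 2) ℂ) (ρ : Op Q'') :
    adjoin f (fun _ => φ) (adjoin g (fun _ => φ) ρ) = adjoin (f ∘ g) (fun _ => φ) ρ := by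
  classical
  ext s t
  simp only [adjoin, Matrix.of_apply]
  rw [mul_assoc]
  congr 1
  have e : ∏ q ∈ Finset.univ.filter (fun q => q ∉ Set.range g), φ ((s ∘ f) q) ((t ∘ f) q) =
      ∏ q ∈ (Finset.univ.filter (fun q => q ∉ Set.range g)).map ⟨f, hf⟩, φ (s q) (t q) := by
    rw [Finset.prod_map]; rfl
  rw [e, mul_comm, ← Finset.prod_union]
  · refine Finset.prod_congr ?_ fun _ _ => rfl
    ext q
    simp only [Finset.mem_union, Finset.mem_filter, Finset.mem_univ, true_and, Finset.mem_map,
      Function.Embedding.coeFn_mk]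
    constructor
    · rintro (h | ⟨r, h, rfl⟩)
      · rintro ⟨r, rfl⟩; exact h ⟨_, rfl⟩
      · rintro ⟨r', hr⟩; exact h ⟨r', hf hr⟩
    · intro h
      by_cases hq : q ∈ Set.range f
      · obtain ⟨r, rfl⟩ := hq
        exact Or.inr ⟨r, fun ⟨r', hr⟩ => h ⟨r', by rw [← hr]; rfl⟩, rfl⟩
      · exact Or.inl hq
  · rw [Finset.disjoint_left]
    intro q hq hq'
    obtain ⟨r, _, rfl⟩ := Finset.mem_map.1 hq'
    exact (Finset.mem_filter.1 hq).2 ⟨r, rfl⟩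

theorem marginal_adjoin {f : Q' → Q} (hf : f.Injective) (φ : Q → Matrix (Fin 2) (Fin 2) ℂ)
    (h : ∀ q, (φ q).trace = 1) (ρ : Op Q') : marginal f (adjoin f φ ρ) = ρ := by
  classical
  ext s t
  rw [marginal_apply hf]
  simp only [adjoin, Matrix.of_apply, glue_comp hf]
  rw [← Finset.mul_sum]
  have : ∑ c : Cf f → Fin 2, ∏ q ∈ Finset.univ.filter (fun q => q ∉ Set.range f),
      φ q (glue f s c q) (glue f t c q) = ∏ q : Cf f, (φ q.1).trace := by
    simp only [Matrix.trace]
    rw [Finset.prod_univ_sum]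
    simp only [Fintype.piFinset_univ]
    refine Finset.sum_congr rfl fun c _ => ?_
    rw [Finset.prod_subtype (p := fun q => q ∉ Set.range f) _ (by simp)]
    refine Finset.prod_congr (by congr) fun q _ => ?_
    rw [glue_of_notMem _ _ _ q.2, glue_of_notMem _ _ _ q.2]; rfl
  rw [this]
  simp [h]

/-! ### Operators on a set of qubits -/

/-- The operators that act on the qubits in `A` only. -/
def localAlg (A : Finset Q) : StarSubalgebra ℂ (Op Q) :=
  (embHom (Subtype.val : {q // q ∈ A} → Q) Subtype.val_injective).range

theorem mem_localAlg {A : Finset Q} {W : Op Q} : W ∈ localAlg A ↔ ∃ u, embed A u = W := by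
  simp only [embed_eq]
  exact Iff.rfl

theorem localAlg_mono {A B : Finset Q} (h : A ⊆ B) : localAlg A ≤ localAlg B := by
  intro W hW
  obtain ⟨u, rfl⟩ := hW
  refine ⟨emb (fun q : {q // q ∈ A} => (⟨q.1, h q.2⟩ : {q // q ∈ B})) u, ?_⟩
  exact emb_emb _ _ Subtype.val_injective u

theorem localAlg_commute {A B : Finset Q} (h : Disjoint A B) {V W : Op Q} (hV : V ∈ localAlg A)
    (hW : W ∈ localAlg B) : Commute V W := by
  obtain ⟨u, rfl⟩ := hV
  obtain ⟨w, rfl⟩ := hW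
  refine emb_commute (fun a b hab => ?_) u w
  exact Finset.disjoint_left.1 h a.2 (hab ▸ b.2)

/-- A criterion in matrix elements: the operator does not change configurations off `A`, and its
entries depend only on the restrictions to `A`. -/
theorem mem_localAlg_of {A : Finset Q} {W : Op Q}
    (h1 : ∀ s t q, q ∉ A → s q ≠ t q → W s t = 0)
    (h2 : ∀ s t s' t', (∀ q ∈ A, s q = s' q) → (∀ q ∈ A, t q = t' q) → (∀ q, q ∉ A → s q = t q) →
      (∀ q, q ∉ A → s' q = t' q) → W s t = W s' t') : W ∈ localAlg A := by
  set f : {q // q ∈ A} → Q := Subtype.val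
  have hf : f.Injective := Subtype.val_injective
  have hr : ∀ q, q ∉ Set.range f ↔ q ∉ A := by simp [f]
  -- The local operator is read off with all other qubits set to zero; `h2` says that this choice
  -- does not matter.
  refine ⟨Matrix.of fun s t => W (glue f s 0) (glue f t 0), ?_⟩
  change emb f _ = W
  ext s t
  rw [emb_apply]
  split_ifs with h
  · refine h2 _ _ _ _ ?_ ?_ ?_ fun q hq => h q ((hr q).2 hq)
    · exact fun q hq => glue_apply hf _ _ (⟨q, hq⟩ : {q // q ∈ A})
    · exact fun q hq => glue_apply hf _ _ (⟨q, hq⟩ : {q // q ∈ A})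
    · intro q hq; rw [glue_of_notMem _ _ _ ((hr q).2 hq), glue_of_notMem _ _ _ ((hr q).2 hq)]
  · push Not at h
    obtain ⟨q, hq, hne⟩ := h
    exact (h1 s t q ((hr q).1 hq) hne).symm

theorem paX_mem_localAlg {A : Finset Q} {a : Q → Fin 2} (h : ∀ q, q ∉ A → a q = 0) :
    paX a ∈ localAlg A := by
  refine mem_localAlg_of (fun s t q hq hne => ?_) (fun s t s' t' hs ht hst hst' => ?_)
  · simp only [paX, Matrix.of_apply]
    rw [if_neg]
    rintro rfl
    exact hne (by simp [h q hq])
  · simp only [paX, Matrix.of_apply]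
    have : s = t + a ↔ s' = t' + a := by
      simp only [funext_iff]
      refine forall_congr' fun q => ?_
      by_cases hq : q ∈ A
      · rw [Pi.add_apply, Pi.add_apply, hs q hq, ht q hq]
      · simp [hst q hq, hst' q hq, h q hq]
    simp only [this]

theorem paZ_mem_localAlg {A : Finset Q} {b : Q → Fin 2} (h : ∀ q, q ∉ A → b q = 0) :
    paZ b ∈ localAlg A := by
  refine mem_localAlg_of (fun s t q hq hne => ?_) (fun s t s' t' hs ht hst hst' => ?_)
  · simp only [paZ, Matrix.diagonal_apply]
    rw [if_neg]
    rintro rfl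
    exact hne rfl
  · simp only [paZ, Matrix.diagonal_apply]
    have : s = t ↔ s' = t' := by
      simp only [funext_iff]
      refine forall_congr' fun q => ?_
      by_cases hq : q ∈ A
      · rw [hs q hq, ht q hq]
      · simp [hst q hq, hst' q hq]
    simp only [this]
    congr 1
    refine Finset.prod_congr rfl fun q _ => ?_
    by_cases hq : q ∈ A
    · rw [hs q hq]
    · simp [h q hq]

theorem cnot_mem_localAlg {c t : Q} : cnot c t ∈ localAlg ({c, t} : Finset Q) := by
  refine mem_localAlg_of (fun x y q hq hne => ?_) (fun x y x' y' hx hy hxy hxy' => ?_)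
  · rw [cnot_apply, if_neg]
    rintro rfl
    simp only [Finset.mem_insert, Finset.mem_singleton, not_or] at hq
    exact hne (by simp [cnotMap, hq.2])
  · rw [cnot_apply, cnot_apply]
    have : x = cnotMap c t y ↔ x' = cnotMap c t y' := by
      simp only [funext_iff]
      refine forall_congr' fun q => ?_
      simp only [cnotMap, Pi.add_apply]
      by_cases hq : q ∈ ({c, t} : Finset Q)
      · rw [hx q hq, hy q hq, hy c (by simp)]
      · have : q ≠ t := by simp at hq; exact hq.2
        simp [hxy q hq, hxy' q hq, Pi.single_eq_of_ne this]
    simp only [this]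

end Subsystems

/-! ### Functional calculus and entropy of orthogonal mixtures -/

section Entropy

variable {Q Q' : Type} [Fintype Q] [DecidableEq Q] [Fintype Q'] [DecidableEq Q']

/-- Spectra of matrices are finite, so interpolation replaces any function by a polynomial, and
identities for `cfc` reduce to identities between powers. -/
theorem exists_polynomial_eval_eq (f : ℝ → ℝ) {s : Set ℝ} (hs : s.Finite) :
    ∃ p : Polynomial ℝ, ∀ x ∈ s, p.eval x = f x := by
  refine ⟨Lagrange.interpolate hs.toFinset id f, fun x hx => ?_⟩
  exact Lagrange.eval_interpolate_at_node (v := id) f (Set.injOn_id _) (hs.mem_toFinset.2 hx)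

theorem cfc_eq_aeval {A : Op Q} (hA : A.IsHermitian) {f : ℝ → ℝ} {p : Polynomial ℝ}
    (h : ∀ x ∈ spectrum ℝ A, p.eval x = f x) : cfc f A = Polynomial.aeval A p := by
  rw [← cfc_polynomial p A hA.isSelfAdjoint]
  exact cfc_congr fun x hx => (h x hx).symm

theorem sum_pow_of_orthogonal {ι : Type*} [Fintype ι] [DecidableEq ι] (Y : ι → Op Q)
    (h : ∀ i j, i ≠ j → Y i * Y j = 0) (n : ℕ) : (∑ i, Y i) ^ (n + 1) = ∑ i, Y i ^ (n + 1) := by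
  induction n with
  | zero => simp
  | succ n ih =>
    rw [pow_succ, ih, Finset.sum_mul]
    refine Finset.sum_congr rfl fun i _ => ?_
    rw [Finset.mul_sum, Finset.sum_eq_single i]
    · rw [pow_succ _ (n + 1)]
    · intro j _ hj; rw [pow_succ, mul_assoc, h i j hj.symm, mul_zero]
    · simp

theorem cfc_sum_of_orthogonal {ι : Type*} [Fintype ι] [DecidableEq ι] (Y : ι → Op Q)
    (hY : ∀ i, (Y i).IsHermitian) (h : ∀ i j, i ≠ j → Y i * Y j = 0) (f : ℝ → ℝ) (hf : f 0 = 0) :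
    cfc f (∑ i, Y i) = ∑ i, cfc f (Y i) := by
  have hfin : ({0} ∪ (spectrum ℝ (∑ i, Y i) ∪ ⋃ i, spectrum ℝ (Y i))).Finite :=
    (Set.finite_singleton 0).union
      (Matrix.finite_real_spectrum.union (Set.finite_iUnion fun i => Matrix.finite_real_spectrum))
  obtain ⟨p, hp⟩ := exists_polynomial_eval_eq f hfin
  -- Positive powers are additive over mutually annihilating summands, but the zeroth power is not;
  -- this is where `f 0 = 0` enters.
  have h0 : p.coeff 0 = 0 := by
    rw [Polynomial.coeff_zero_eq_eval_zero, hp 0 (by simp), hf]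
  have hs : (∑ i, Y i).IsHermitian := by
    rw [Matrix.IsHermitian, Matrix.conjTranspose_sum]
    exact Finset.sum_congr rfl fun i _ => hY i
  rw [cfc_eq_aeval hs (p := p) fun x hx => hp x (by simp [hx])]
  have : ∀ i, cfc f (Y i) = Polynomial.aeval (Y i) p := fun i =>
    cfc_eq_aeval (hY i) fun x hx => hp x (Or.inr (Or.inr (Set.mem_iUnion.2 ⟨i, hx⟩)))
  simp only [this, Polynomial.aeval_eq_sum_range]
  rw [Finset.sum_comm]
  refine Finset.sum_congr rfl fun n _ => ?_
  cases n with
  | zero => simp [h0]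
  | succ n => rw [sum_pow_of_orthogonal Y h, Finset.smul_sum]

theorem conj_pow_unitary {V Y : Op Q} (hV : Vᴴ * V = 1) (n : ℕ) :
    (V * Y * Vᴴ) ^ n = V * Y ^ n * Vᴴ := by
  have hV' : V * Vᴴ = 1 := mul_eq_one_comm.1 hV
  induction n with
  | zero => simp [hV']
  | succ n ih =>
    rw [pow_succ, ih, pow_succ]
    calc V * Y ^ n * Vᴴ * (V * Y * Vᴴ) = V * Y ^ n * (Vᴴ * V) * Y * Vᴴ := by
          simp only [mul_assoc]
      _ = _ := by rw [hV]; simp only [mul_assoc, one_mul]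

theorem cfc_unitary_conj {V Y : Op Q} (hV : Vᴴ * V = 1) (hY : Y.IsHermitian) (f : ℝ → ℝ) :
    cfc f (V * Y * Vᴴ) = V * cfc f Y * Vᴴ := by
  have hfin : (spectrum ℝ (V * Y * Vᴴ) ∪ spectrum ℝ Y).Finite :=
    Matrix.finite_real_spectrum.union Matrix.finite_real_spectrum
  obtain ⟨p, hp⟩ := exists_polynomial_eval_eq f hfin
  have hs : (V * Y * Vᴴ).IsHermitian := Matrix.isHermitian_mul_mul_conjTranspose V hY
  rw [cfc_eq_aeval hs (p := p) fun x hx => hp x (by simp [hx]),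
    cfc_eq_aeval hY (p := p) fun x hx => hp x (by simp [hx])]
  simp only [Polynomial.aeval_eq_sum_range, conj_pow_unitary hV, Finset.mul_sum, Finset.sum_mul]
  simp

theorem vonNeumannEntropy_unitary_conj {V Y : Op Q} (hV : Vᴴ * V = 1) (hY : Y.IsHermitian) :
    vonNeumannEntropy (V * Y * Vᴴ) = vonNeumannEntropy Y := by
  rw [vonNeumannEntropy, cfc_unitary_conj hV hY, mul_assoc, Matrix.trace_mul_comm, mul_assoc, hV,
    mul_one, vonNeumannEntropy]

theorem vonNeumannEntropy_smul (c : ℝ) {Y : Op Q} (hY : Y.IsHermitian) :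
    vonNeumannEntropy ((c : ℂ) • Y) = c * vonNeumannEntropy Y + Real.negMulLog c * Y.trace.re := by
  have h1 : cfc Real.negMulLog ((c : ℂ) • Y) =
      c • cfc Real.negMulLog Y + Real.negMulLog c • Y := by
    have hY' : IsSelfAdjoint Y := hY.isSelfAdjoint
    rw [Complex.coe_smul, ← cfc_comp_smul c Real.negMulLog Y
      (Real.continuous_negMulLog.continuousOn)]
    have e : (fun x : ℝ => Real.negMulLog (c • x)) =
        fun x => c • Real.negMulLog x + Real.negMulLog c • id x := by
      ext x; simp only [smul_eq_mul, Real.negMulLog_mul, id]; ring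
    rw [e, cfc_add (a := Y) (fun x => c • Real.negMulLog x) (fun x => Real.negMulLog c • id x)
      ((Real.continuous_negMulLog.const_smul c).continuousOn) (by fun_prop),
      cfc_smul c Real.negMulLog Y (Real.continuous_negMulLog.continuousOn),
      cfc_smul (Real.negMulLog c) id Y (by fun_prop), cfc_id ℝ Y]
  rw [vonNeumannEntropy, h1, Matrix.trace_add, Matrix.trace_smul, Matrix.trace_smul,
    vonNeumannEntropy]
  simp

/-- Orthogonality makes the functional calculus act on each summand separately. The `τ i` are not
normalized, so the Shannon term carries their traces. -/
theorem vonNeumannEntropy_mixture {ι : Type*} [Fintype ι] [DecidableEq ι] (c : ι → ℝ)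
    (V τ : ι → Op Q) (hV : ∀ i, (V i)ᴴ * V i = 1) (hτ : ∀ i, (τ i).IsHermitian)
    (h : ∀ i j, i ≠ j → (V i * τ i * (V i)ᴴ) * (V j * τ j * (V j)ᴴ) = 0) :
    vonNeumannEntropy (∑ i, (c i : ℂ) • (V i * τ i * (V i)ᴴ)) =
      ∑ i, (c i * vonNeumannEntropy (τ i) + Real.negMulLog (c i) * (τ i).trace.re) := by
  have hs : ∀ i, (V i * τ i * (V i)ᴴ).IsHermitian := fun i =>
    Matrix.isHermitian_mul_mul_conjTranspose _ (hτ i)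
  rw [vonNeumannEntropy, cfc_sum_of_orthogonal _ _ _ _ (by simp), Matrix.trace_sum, Complex.re_sum]
  · refine Finset.sum_congr rfl fun i _ => ?_
    rw [← vonNeumannEntropy, vonNeumannEntropy_smul _ (hs i),
      vonNeumannEntropy_unitary_conj (hV i) (hτ i), mul_assoc, Matrix.trace_mul_comm, mul_assoc,
      hV i, mul_one]
  · intro i
    rw [Matrix.IsHermitian, Matrix.conjTranspose_smul, hs i]
    simp
  · intro i j hij
    rw [Matrix.smul_mul, Matrix.mul_smul, h i j hij, smul_zero, smul_zero]

/-- A channel on the qubits in the support of a gate preserves the correlations if it changes the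
entropies of the support and of the whole system by the same amount. -/
theorem correlationPreserving_of_entropy {ι : Type*} [Fintype ι] (g : ChannelGate Q) (ρ : Op Q)
    (K : ι → Op {q // q ∈ g.supp}) (hK : ∑ i, (K i)ᴴ * K i = 1)
    (hg : g.map ρ = ∑ i, emb Subtype.val (K i) * ρ * (emb Subtype.val (K i))ᴴ)
    (hS : vonNeumannEntropy (marginal (Subtype.val : {q // q ∈ g.supp} → Q) (g.map ρ))
        - vonNeumannEntropy (g.map ρ) =
      vonNeumannEntropy (marginal (Subtype.val : {q // q ∈ g.supp} → Q) ρ)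
        - vonNeumannEntropy ρ) : CorrelationPreserving g ρ := by
  have h2 : marginal (fun q : {q // q ∈ g.suppᶜ} => q.1) (g.map ρ) =
      marginal (fun q : {q // q ∈ g.suppᶜ} => q.1) ρ := by
    rw [hg]
    refine marginal_disjoint (fun a b hab => ?_) Subtype.val_injective K hK ρ
    have hb := b.2
    rw [← hab] at hb
    exact (Finset.mem_compl.1 hb) a.2
  rw [CorrelationPreserving, mutualInfo, mutualInfo, h2]
  have e : (fun q : {q // q ∈ g.supp} => q.1) = Subtype.val := rfl
  rw [e]
  linarith

end Entropy

/-! ### Coarse- and fine-graining of an abstract block of four anyon sites -/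

section AbstractBlock

variable {Q Q' : Type} [Fintype Q] [DecidableEq Q] [Fintype Q'] [DecidableEq Q']

/-- `hopBit k i = 1` if the `k`-th hopping operator changes the occupation of the site `i`. -/
def hopBit (k : Fin 3) (i : Fin 4) : Fin 2 :=
  (![![1, 1, 0, 0], ![1, 0, 1, 0], ![0, 1, 0, 1]] : Fin 3 → Fin 4 → Fin 2) k i

/-- The algebraic relations of a block of four anyon sites. -/
structure IsAnyonBlock (B : AnyonBlock Q) : Prop where
  stab_mul_self : ∀ i, B.stab i * B.stab i = 1
  stab_comm : ∀ i j, B.stab i * B.stab j = B.stab j * B.stab i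
  stab_herm : ∀ i, (B.stab i)ᴴ = B.stab i
  hop_mul_self : ∀ k, B.hop k * B.hop k = 1
  hop_herm : ∀ k, (B.hop k)ᴴ = B.hop k
  hop_stab : ∀ k i, B.hop k * B.stab i = (-1 : ℂ) ^ (hopBit k i : ℕ) • (B.stab i * B.hop k)

theorem neg_one_pow_fin_two_add (x y : Fin 2) :
    (-1 : ℂ) ^ ((x + y : Fin 2) : ℕ) = (-1) ^ (x : ℕ) * (-1) ^ (y : ℕ) := by
  fin_cases x <;> fin_cases y <;> simp

theorem sum_bits_four {M : Type*} [AddCommMonoid M] (F : (Fin 4 → Fin 2) → M) :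
    ∑ m, F m = ∑ a, ∑ b, ∑ c, ∑ d, F ![a, b, c, d] := by
  let e : Fin 2 × Fin 2 × Fin 2 × Fin 2 ≃ (Fin 4 → Fin 2) :=
    { toFun := fun p => ![p.1, p.2.1, p.2.2.1, p.2.2.2]
      invFun := fun m => (m 0, m 1, m 2, m 3)
      left_inv := fun p => rfl
      right_inv := fun m => by ext i; fin_cases i <;> rfl }
  rw [← Equiv.sum_comp e]
  simp only [Fintype.sum_prod_type]
  rfl

namespace IsAnyonBlock

variable {B : AnyonBlock Q} (hB : IsAnyonBlock B)
include hB

theorem stab_mul_siteProj (i : Fin 4) (x : Fin 2) :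
    B.stab i * siteProj B i x = (-1 : ℂ) ^ (x : ℕ) • siteProj B i x := by
  rw [siteProj, Matrix.mul_smul, mul_add, mul_one, Matrix.mul_smul, hB.stab_mul_self]
  fin_cases x <;> simp [add_comm, smul_add, smul_sub, ← sub_eq_add_neg]

theorem siteProj_mul_siteProj (i : Fin 4) (x y : Fin 2) :
    siteProj B i x * siteProj B i y = if x = y then siteProj B i y else 0 := by
  conv_lhs => rw [siteProj]
  rw [Matrix.smul_mul, add_mul, one_mul, Matrix.smul_mul, hB.stab_mul_siteProj, smul_smul]
  fin_cases x <;> fin_cases y <;> simp [← two_smul ℂ]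

theorem siteProj_comm (i j : Fin 4) (x y : Fin 2) :
    Commute (siteProj B i x) (siteProj B j y) := by
  have : Commute (B.stab i) (B.stab j) := hB.stab_comm i j
  refine Commute.smul_left (Commute.smul_right ?_ _) _
  refine Commute.add_left (Commute.one_left _) (Commute.smul_left ?_ _)
  exact Commute.add_right (Commute.one_right _) (Commute.smul_right this _)

omit hB in
theorem siteProj_sum (i : Fin 4) : siteProj B i 0 + siteProj B i 1 = 1 := by
  simp only [siteProj, Fin.val_zero, Fin.val_one, pow_zero, pow_one, one_smul, neg_smul]
  rw [← smul_add]
  have : (1 : Op Q) + B.stab i + (1 + -B.stab i) = (2 : ℂ) • 1 := by rw [two_smul]; abel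
  rw [this, smul_smul]; norm_num

theorem siteProj_herm (i : Fin 4) (x : Fin 2) : (siteProj B i x)ᴴ = siteProj B i x := by
  simp [siteProj, Matrix.conjTranspose_smul, Matrix.conjTranspose_add, hB.stab_herm]

theorem hop_mul_siteProj (k : Fin 3) (i : Fin 4) (x : Fin 2) :
    B.hop k * siteProj B i x = siteProj B i (x + hopBit k i) * B.hop k := by
  simp only [siteProj, Matrix.mul_smul, Matrix.smul_mul, mul_add, add_mul, mul_one, one_mul,
    hB.hop_stab, smul_smul, neg_one_pow_fin_two_add]

theorem hop_pow_mul_siteProj (k : Fin 3) (n : ℕ) (i : Fin 4) (x : Fin 2) :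
    B.hop k ^ n * siteProj B i x = siteProj B i (x + n • hopBit k i) * B.hop k ^ n := by
  induction n generalizing x with
  | zero => simp
  | succ n ih =>
    rw [pow_succ, mul_assoc, hB.hop_mul_siteProj, ← mul_assoc, ih, mul_assoc, succ_nsmul]
    congr 2
    abel

theorem moveOp_mul_siteProj (m : Fin 4 → Fin 2) (i : Fin 4) (x : Fin 2) :
    moveOp B m * siteProj B i x =
      siteProj B i (x + ((m 3 : ℕ) • hopBit 2 i + ((m 2 : ℕ) • hopBit 1 i +
        ((m 1 : ℕ) + (m 3 : ℕ)) • hopBit 0 i))) * moveOp B m := by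
  rw [moveOp, mul_assoc, hB.hop_pow_mul_siteProj, mul_assoc (B.hop 0 ^ _),
    ← mul_assoc (B.hop 1 ^ _), hB.hop_pow_mul_siteProj, mul_assoc (siteProj B i _),
    ← mul_assoc (B.hop 0 ^ _), hB.hop_pow_mul_siteProj]
  simp only [mul_assoc, add_assoc]

theorem hop_pow_unitary (k : Fin 3) (n : ℕ) : (B.hop k ^ n)ᴴ * B.hop k ^ n = 1 := by
  rw [Matrix.conjTranspose_pow, hB.hop_herm, ← mul_pow_of_commute_self, hB.hop_mul_self, one_pow]
where
  mul_pow_of_commute_self {a : Op Q} {n : ℕ} : (a * a) ^ n = a ^ n * a ^ n :=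
    (Commute.refl a).mul_pow n

theorem moveOp_unitary (m : Fin 4 → Fin 2) : (moveOp B m)ᴴ * moveOp B m = 1 := by
  rw [moveOp, Matrix.conjTranspose_mul, Matrix.conjTranspose_mul]
  calc _ = (B.hop 2 ^ (m 3 : ℕ))ᴴ * ((B.hop 1 ^ (m 2 : ℕ))ᴴ *
        ((B.hop 0 ^ ((m 1 : ℕ) + (m 3 : ℕ)))ᴴ * B.hop 0 ^ ((m 1 : ℕ) + (m 3 : ℕ))) *
          B.hop 1 ^ (m 2 : ℕ)) * B.hop 2 ^ (m 3 : ℕ) := by simp only [mul_assoc]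
    _ = 1 := by
      rw [hB.hop_pow_unitary, mul_one, hB.hop_pow_unitary, mul_one, hB.hop_pow_unitary]

theorem moveOp_unitary' (m : Fin 4 → Fin 2) : moveOp B m * (moveOp B m)ᴴ = 1 :=
  mul_eq_one_comm.1 (hB.moveOp_unitary m)

theorem configProj_herm (m : Fin 4 → Fin 2) : (configProj B m)ᴴ = configProj B m := by
  simp only [configProj, Matrix.conjTranspose_mul, hB.siteProj_herm]
  rw [(hB.siteProj_comm 1 0 _ _).eq, (hB.siteProj_comm 2 _ _ _ |>.mul_right
    (hB.siteProj_comm 2 _ _ _)).eq, ((hB.siteProj_comm 3 _ _ _ |>.mul_right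
    (hB.siteProj_comm 3 _ _ _)).mul_right (hB.siteProj_comm 3 _ _ _)).eq]

theorem siteProj_comm_configProj (i : Fin 4) (x : Fin 2) (m : Fin 4 → Fin 2) :
    Commute (siteProj B i x) (configProj B m) :=
  ((hB.siteProj_comm _ _ _ _ |>.mul_right (hB.siteProj_comm _ _ _ _)).mul_right
    (hB.siteProj_comm _ _ _ _)).mul_right (hB.siteProj_comm _ _ _ _)

theorem siteProj_self_mul_configProj (i : Fin 4) (m : Fin 4 → Fin 2) :
    siteProj B i (m i) * configProj B m = configProj B m := by
  have c := hB.siteProj_comm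
  have s := hB.siteProj_mul_siteProj
  fin_cases i
  · simp only [configProj, Fin.zero_eta, ← mul_assoc, s, if_true]
  · simp only [configProj, Fin.mk_one, ← mul_assoc]
    rw [(c 1 0 _ _).eq, mul_assoc (siteProj B 0 _) (siteProj B 1 _), s, if_pos rfl]
  · change siteProj B 2 (m 2) * _ = _
    simp only [configProj]
    rw [← mul_assoc, ← mul_assoc, ((c 2 0 _ _).mul_right (c 2 1 _ _)).eq,
      mul_assoc _ (siteProj B 2 _) (siteProj B 2 _), s, if_pos rfl]
  · change siteProj B 3 (m 3) * _ = _
    simp only [configProj]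
    rw [← mul_assoc, (((c 3 0 _ _).mul_right (c 3 1 _ _)).mul_right (c 3 2 _ _)).eq,
      mul_assoc _ (siteProj B 3 _) (siteProj B 3 _), s, if_pos rfl]

theorem siteProj_mul_configProj (i : Fin 4) (x : Fin 2) (m : Fin 4 → Fin 2) :
    siteProj B i x * configProj B m = if x = m i then configProj B m else 0 := by
  conv_lhs => rw [← hB.siteProj_self_mul_configProj i m, ← mul_assoc, hB.siteProj_mul_siteProj]
  split_ifs with h
  · rw [hB.siteProj_self_mul_configProj]
  · rw [zero_mul]

theorem configProj_mul_configProj (m m' : Fin 4 → Fin 2) :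
    configProj B m * configProj B m' = if m = m' then configProj B m' else 0 := by
  conv_lhs => rw [configProj]
  simp only [mul_assoc, hB.siteProj_mul_configProj]
  by_cases h3 : m 3 = m' 3
  · by_cases h2 : m 2 = m' 2
    · by_cases h1 : m 1 = m' 1
      · by_cases h0 : m 0 = m' 0
        · have : m = m' := by ext i; fin_cases i <;> simp [*]
          subst this
          simp [hB.siteProj_mul_configProj]
        · have : m ≠ m' := fun h => h0 (by rw [h])
          simp [h1, h2, h3, h0, hB.siteProj_mul_configProj, this]
      · have : m ≠ m' := fun h => h1 (by rw [h])
        simp [h1, h2, h3, hB.siteProj_mul_configProj, this]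
    · have : m ≠ m' := fun h => h2 (by rw [h])
      simp [h2, h3, hB.siteProj_mul_configProj, this]
  · have : m ≠ m' := fun h => h3 (by rw [h])
    simp [h3, this]

omit hB in
theorem sum_configProj : ∑ m, configProj B m = 1 := by
  rw [sum_bits_four]
  simp only [configProj, Matrix.cons_val]
  simp only [← Finset.mul_sum, Fin.sum_univ_two, siteProj_sum, mul_one]

/-- All the anyons have been moved to the root, which holds `x` of them modulo two. -/
theorem moveOp_mul_configProj (m : Fin 4 → Fin 2) :
    moveOp B m * configProj B m = configProj B ![parity m, 0, 0, 0] * moveOp B m := by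
  have e : ∀ m : Fin 4 → Fin 2, ∀ i, m i + ((m 3 : ℕ) • hopBit 2 i + ((m 2 : ℕ) • hopBit 1 i +
      ((m 1 : ℕ) + (m 3 : ℕ)) • hopBit 0 i)) = ![parity m, 0, 0, 0] i := by decide
  have h : ∀ i, moveOp B m * siteProj B i (m i) =
      siteProj B i (![parity m, 0, 0, 0] i) * moveOp B m := fun i => by
    rw [hB.moveOp_mul_siteProj, e]
  rw [configProj, configProj, ← mul_assoc, ← mul_assoc, ← mul_assoc, h 0, mul_assoc _ (moveOp B m),
    h 1, ← mul_assoc, mul_assoc _ (moveOp B m), h 2, ← mul_assoc, mul_assoc _ (moveOp B m), h 3,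
    ← mul_assoc]

theorem moveOp_conj_configProj (m : Fin 4 → Fin 2) :
    moveOp B m * configProj B m * (moveOp B m)ᴴ = configProj B ![parity m, 0, 0, 0] := by
  rw [hB.moveOp_mul_configProj, mul_assoc, hB.moveOp_unitary', mul_one]

theorem moveOp_conj_root (m : Fin 4 → Fin 2) :
    (moveOp B m)ᴴ * configProj B ![parity m, 0, 0, 0] * moveOp B m = configProj B m := by
  rw [mul_assoc, ← hB.moveOp_mul_configProj, ← mul_assoc, hB.moveOp_unitary, one_mul]

end IsAnyonBlock

/-- The Kraus operators of the coarse-graining channel. -/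
def coarseK (B : AnyonBlock Q) (m : Fin 4 → Fin 2) : Op Q := moveOp B m * configProj B m

/-- The Kraus operators of the fine-graining channel. -/
def fineK (β : ℝ) (B : AnyonBlock Q) (m : Fin 4 → Fin 2) : Op Q :=
  (Real.sqrt (condProb β m) : ℂ) • ((moveOp B m)ᴴ * siteProj B 0 (parity m))

theorem anyonProb_eq (β : ℝ) : anyonProb β = (1 - Real.tanh β) / 2 := by
  have h1 := Real.cosh_pos β
  rw [anyonProb, Real.tanh_eq_sinh_div_cosh, ← Real.cosh_add_sinh β, ← Real.cosh_sub_sinh β]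
  rw [show Real.cosh β + Real.sinh β + (Real.cosh β - Real.sinh β) = 2 * Real.cosh β by ring]
  field_simp

/-- Each occupation has bias $1-2p_\beta=\tanh\beta$, and the bias of a sum of independent bits
modulo two is the product of their biases. -/
theorem sum_site_weights (β : ℝ) (x : Fin 2) :
    ∑ m' : Fin 4 → Fin 2, (if parity m' = x then
      (∏ i, if m' i = 1 then anyonProb β else 1 - anyonProb β) else 0) =
      (1 + (-1) ^ (x : ℕ) * Real.tanh β ^ 4) / 2 := by
  rw [sum_bits_four, anyonProb_eq]
  simp only [parity, Fin.prod_univ_four, Fin.sum_univ_four, Matrix.cons_val, Fin.sum_univ_two]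
  fin_cases x <;> simp <;> ring

theorem tanh_pow_four_lt (β : ℝ) : Real.tanh β ^ 4 < 1 := by
  have h1 := Real.tanh_lt_one β
  have h2 := Real.neg_one_lt_tanh β
  have : Real.tanh β ^ 2 < 1 := by nlinarith
  nlinarith [sq_nonneg (Real.tanh β)]

theorem sum_site_weights_pos (β : ℝ) (x : Fin 2) :
    0 < (1 + (-1) ^ (x : ℕ) * Real.tanh β ^ 4) / 2 := by
  have h1 := tanh_pow_four_lt β
  have h2 : 0 ≤ Real.tanh β ^ 4 := by positivity
  fin_cases x <;> simp <;> linarith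

theorem condProb_eq (β : ℝ) (m : Fin 4 → Fin 2) :
    condProb β m = (∏ i, (1 + (-1) ^ (m i : ℕ) * Real.tanh β) / 2) /
      ((1 + (-1) ^ (parity m : ℕ) * Real.tanh β ^ 4) / 2) := by
  rw [condProb, sum_site_weights, anyonProb_eq]
  congr 1
  refine Finset.prod_congr rfl fun i _ => ?_
  generalize m i = x
  fin_cases x <;> simp <;> ring

theorem condProb_nonneg (β : ℝ) (m : Fin 4 → Fin 2) : 0 ≤ condProb β m := by
  rw [condProb_eq]
  refine div_nonneg (Finset.prod_nonneg fun i _ => ?_) (sum_site_weights_pos β _).le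
  have h1 := Real.tanh_lt_one β
  have h2 := Real.neg_one_lt_tanh β
  generalize m i = x
  fin_cases x <;> simp <;> linarith

theorem sum_condProb (β : ℝ) (x : Fin 2) :
    ∑ m : Fin 4 → Fin 2, (if parity m = x then condProb β m else 0) = 1 := by
  have : ∀ m : Fin 4 → Fin 2, (if parity m = x then condProb β m else 0) =
      (if parity m = x then (∏ i, if m i = 1 then anyonProb β else 1 - anyonProb β) else 0) /
        ((1 + (-1) ^ (x : ℕ) * Real.tanh β ^ 4) / 2) := by
    intro m
    split_ifs with h
    · rw [condProb, sum_site_weights, h]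
    · rw [zero_div]
  simp only [this]
  rw [← Finset.sum_div, sum_site_weights, div_self (sum_site_weights_pos β x).ne']

theorem sum_condProb_mul {V : Type*} [AddCommGroup V] [Module ℝ V] (β : ℝ) (g : Fin 2 → V) :
    ∑ m : Fin 4 → Fin 2, condProb β m • g (parity m) = g 0 + g 1 := by
  have : ∀ m : Fin 4 → Fin 2, condProb β m • g (parity m) =
      ∑ x, (if parity m = x then condProb β m else 0) • g x := by
    intro m; simp [ite_smul]
  simp only [this]
  rw [Finset.sum_comm]
  simp only [← Finset.sum_smul, sum_condProb, one_smul, Fin.sum_univ_two]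

section

variable {B : AnyonBlock Q}

theorem coarseGate_map_eq (hB : IsAnyonBlock B) (ρ : Op Q) :
    (coarseGate B).map ρ = ∑ m, coarseK B m * ρ * (coarseK B m)ᴴ := by
  simp only [coarseGate, coarseK, Matrix.conjTranspose_mul, hB.configProj_herm, mul_assoc]

theorem fineGate_map_eq (hB : IsAnyonBlock B) (β : ℝ) (ρ : Op Q) :
    (fineGate β B).map ρ = ∑ m, fineK β B m * ρ * (fineK β B m)ᴴ := by
  have h : (fineGate β B).map ρ = ∑ m : Fin 4 → Fin 2, (condProb β m : ℂ) •
    ((moveOp B m)ᴴ * siteProj B 0 (parity m) * ρ * siteProj B 0 (parity m) * moveOp B m) := rfl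
  rw [h]
  refine Finset.sum_congr rfl fun m _ => ?_
  have hc : star (Real.sqrt (condProb β m) : ℂ) * (Real.sqrt (condProb β m) : ℂ) =
      (condProb β m : ℂ) := by
    rw [Complex.star_def, Complex.conj_ofReal, ← Complex.ofReal_mul,
      Real.mul_self_sqrt (condProb_nonneg β m)]
  rw [fineK, Matrix.conjTranspose_smul, Matrix.conjTranspose_mul, hB.siteProj_herm,
    Matrix.conjTranspose_conjTranspose, Matrix.smul_mul, Matrix.mul_smul, Matrix.smul_mul,
    smul_smul, hc]
  simp only [mul_assoc]

theorem sum_coarseK (hB : IsAnyonBlock B) : ∑ m, (coarseK B m)ᴴ * coarseK B m = 1 := by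
  rw [← IsAnyonBlock.sum_configProj (B := B)]
  refine Finset.sum_congr rfl fun m _ => ?_
  rw [coarseK, Matrix.conjTranspose_mul, mul_assoc, ← mul_assoc _ _ (configProj B m),
    hB.moveOp_unitary, one_mul, hB.configProj_herm, hB.configProj_mul_configProj, if_pos rfl]

theorem sum_fineK (hB : IsAnyonBlock B) (β : ℝ) : ∑ m, (fineK β B m)ᴴ * fineK β B m = 1 := by
  rw [← IsAnyonBlock.siteProj_sum (B := B) 0, ← sum_condProb_mul β (siteProj B 0)]
  refine Finset.sum_congr rfl fun m _ => ?_
  simp only [fineK, Matrix.conjTranspose_smul, Matrix.conjTranspose_mul,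
    Matrix.conjTranspose_conjTranspose, Matrix.smul_mul, Matrix.mul_smul, smul_smul]
  rw [mul_assoc, ← mul_assoc (moveOp B m), hB.moveOp_unitary', one_mul, hB.siteProj_herm,
    hB.siteProj_mul_siteProj, if_pos rfl]
  simp only [Complex.star_def, Complex.conj_ofReal]
  rw [← Complex.ofReal_mul, Real.mul_self_sqrt (condProb_nonneg β m), Complex.coe_smul]

/-- The unnormalized product distribution `∏ (1 + f_i a_i)` of anyons in a block. -/
def blockProd (B : AnyonBlock Q) (f : Fin 4 → ℂ) : Op Q :=
  (1 + f 0 • B.stab 0) * (1 + f 1 • B.stab 1) * (1 + f 2 • B.stab 2) * (1 + f 3 • B.stab 3)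

theorem blockProd_mul_configProj (hB : IsAnyonBlock B) (f : Fin 4 → ℂ) (m : Fin 4 → Fin 2) :
    blockProd B f * configProj B m = (∏ i, (1 + (-1) ^ (m i : ℕ) * f i)) • configProj B m := by
  have h1 : ∀ i, B.stab i * configProj B m = (-1 : ℂ) ^ (m i : ℕ) • configProj B m := by
    intro i
    have : configProj B m = siteProj B i (m i) * configProj B m := by
      rw [hB.siteProj_mul_configProj, if_pos rfl]
    conv_lhs => rw [this]
    rw [← mul_assoc, hB.stab_mul_siteProj, Matrix.smul_mul, ← this]
  have h2 : ∀ i, (1 + f i • B.stab i) * configProj B m =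
      (1 + (-1) ^ (m i : ℕ) * f i) • configProj B m := by
    intro i
    rw [add_mul, one_mul, Matrix.smul_mul, h1, smul_smul, add_smul, one_smul, mul_comm]
  rw [blockProd, mul_assoc, h2, Matrix.mul_smul, mul_assoc, h2, Matrix.mul_smul, mul_assoc, h2,
    Matrix.mul_smul, h2, smul_smul, smul_smul, smul_smul, Fin.prod_univ_four]
  congr 1; ring

theorem blockProd_eq_sum (hB : IsAnyonBlock B) (f : Fin 4 → ℂ) :
    blockProd B f = ∑ m : Fin 4 → Fin 2, (∏ i, (1 + (-1) ^ (m i : ℕ) * f i)) • configProj B m := by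
  rw [← mul_one (blockProd B f), ← IsAnyonBlock.sum_configProj, Finset.mul_sum]
  exact Finset.sum_congr rfl fun m _ => blockProd_mul_configProj hB f m

/-- A factor with coefficient $1$ kills the configurations in which its site is occupied and
contributes $2$ otherwise. Only two configurations survive, with the factor $2^3=8$. -/
theorem blockProd_root (hB : IsAnyonBlock B) (F : ℂ) :
    blockProd B ![F, 1, 1, 1] =
      (8 * (1 + F)) • configProj B ![0, 0, 0, 0] + (8 * (1 - F)) • configProj B ![1, 0, 0, 0] := by
  rw [blockProd_eq_sum hB, sum_bits_four]
  simp only [Fin.sum_univ_two, Fin.prod_univ_four, Matrix.cons_val, Fin.val_zero, Fin.val_one,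
    pow_zero, pow_one]
  have e1 : (1 : ℂ) + -1 * 1 = 0 := by norm_num
  simp only [e1, mul_zero, zero_mul, zero_smul, add_zero]
  congr 2 <;> ring

/-- `R` stands for the rest of the lattice. The gate remembers only the parity of the configuration,
and summing the weights $\prod_i(1\pm f_i)$ over one parity gives $8(1\pm f_0f_1f_2f_3)$. -/
theorem coarseGate_map_mul_blockProd (hB : IsAnyonBlock B) (R : Op Q) (f : Fin 4 → ℂ)
    (hs : ∀ i, Commute R (B.stab i)) (hh : ∀ k, Commute R (B.hop k)) :
    (coarseGate B).map (R * blockProd B f) = R * blockProd B ![f 0 * f 1 * f 2 * f 3, 1, 1, 1] := by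
  have hU : ∀ m, Commute R (moveOp B m) := fun m =>
    (((hh 0).pow_right _).mul_right ((hh 1).pow_right _)).mul_right ((hh 2).pow_right _)
  have hS : ∀ i x, Commute R (siteProj B i x) := fun i x =>
    Commute.smul_right ((Commute.one_right R).add_right ((hs i).smul_right _)) _
  have hP : ∀ m, Commute R (configProj B m) := fun m =>
    (((hS _ _).mul_right (hS _ _)).mul_right (hS _ _)).mul_right (hS _ _)
  have key : ∀ m : Fin 4 → Fin 2,
      moveOp B m * configProj B m * (R * blockProd B f) * configProj B m * (moveOp B m)ᴴ =
      R * ((∏ i, (1 + (-1) ^ (m i : ℕ) * f i)) • configProj B ![parity m, 0, 0, 0]) := by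
    intro m
    calc moveOp B m * configProj B m * (R * blockProd B f) * configProj B m * (moveOp B m)ᴴ
        = (moveOp B m * configProj B m * R) * (blockProd B f * configProj B m) * (moveOp B m)ᴴ := by
          simp only [mul_assoc]
      _ = R * (moveOp B m * configProj B m * (blockProd B f * configProj B m) * (moveOp B m)ᴴ) := by
          rw [← ((hU m).mul_right (hP m)).eq]; simp only [mul_assoc]
      _ = _ := by
          rw [blockProd_mul_configProj hB, Matrix.mul_smul, mul_assoc (moveOp B m),
            hB.configProj_mul_configProj, if_pos rfl, Matrix.smul_mul, hB.moveOp_conj_configProj]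
  simp only [coarseGate, key]
  rw [← Finset.mul_sum, blockProd_root hB, sum_bits_four]
  congr 1
  simp only [Fin.sum_univ_two, Fin.prod_univ_four, Matrix.cons_val, Fin.val_zero, Fin.val_one,
    pow_zero, pow_one, parity, Fin.sum_univ_four, add_zero, zero_add, fin_two_add_self]
  module

/-- Bayes' rule: the conditional probability times the weight of the parity, which sits at the root,
is the original weight of the configuration. -/
theorem fineGate_map_mul_blockProd (hB : IsAnyonBlock B) (R : Op Q) (β : ℝ)
    (hs : ∀ i, Commute R (B.stab i)) (hh : ∀ k, Commute R (B.hop k)) :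
    (fineGate β B).map (R * blockProd B ![(Real.tanh β : ℂ) ^ 4, 1, 1, 1]) =
      R * blockProd B fun _ => (Real.tanh β : ℂ) := by
  have hU : ∀ m, Commute R (moveOp B m) := fun m =>
    (((hh 0).pow_right _).mul_right ((hh 1).pow_right _)).mul_right ((hh 2).pow_right _)
  -- `R` need not be Hermitian, so this is deduced from unitarity by multiplying the commutation
  -- relation with the adjoint on both sides.
  have hU' : ∀ m, Commute R (moveOp B m)ᴴ := by
    intro m
    have h1 : (moveOp B m)ᴴ * (R * moveOp B m) * (moveOp B m)ᴴ =
        (moveOp B m)ᴴ * (moveOp B m * R) * (moveOp B m)ᴴ := by rw [(hU m).eq]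
    rw [← mul_assoc ((moveOp B m)ᴴ) (moveOp B m), hB.moveOp_unitary, one_mul, mul_assoc,
      mul_assoc R, hB.moveOp_unitary', mul_one] at h1
    exact h1.symm
  have hS : ∀ i x, Commute R (siteProj B i x) := fun i x =>
    Commute.smul_right ((Commute.one_right R).add_right ((hs i).smul_right _)) _
  set T := blockProd B ![(Real.tanh β : ℂ) ^ 4, 1, 1, 1] with hT
  have hST : ∀ x, siteProj B 0 x * T * siteProj B 0 x =
      (8 * (1 + (-1) ^ (x : ℕ) * (Real.tanh β : ℂ) ^ 4)) • configProj B ![x, 0, 0, 0] := by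
    intro x
    rw [hT, blockProd_root hB, mul_add, Matrix.mul_smul, Matrix.mul_smul,
      hB.siteProj_mul_configProj, hB.siteProj_mul_configProj]
    fin_cases x
    · have := (hB.siteProj_comm_configProj 0 0 ![0, 0, 0, 0]).eq
      simp [← this, hB.siteProj_mul_configProj]
    · have := (hB.siteProj_comm_configProj 0 1 ![1, 0, 0, 0]).eq
      simp [← this, hB.siteProj_mul_configProj, sub_eq_add_neg]
  have key : ∀ m : Fin 4 → Fin 2, (condProb β m : ℂ) • ((moveOp B m)ᴴ * siteProj B 0 (parity m) *
      (R * T) * siteProj B 0 (parity m) * moveOp B m) =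
      R * ((∏ i, (1 + (-1) ^ (m i : ℕ) * (Real.tanh β : ℂ))) • configProj B m) := by
    intro m
    calc (condProb β m : ℂ) • ((moveOp B m)ᴴ * siteProj B 0 (parity m) *
          (R * T) * siteProj B 0 (parity m) * moveOp B m)
        = (condProb β m : ℂ) • (((moveOp B m)ᴴ * siteProj B 0 (parity m) *
          R) * T * siteProj B 0 (parity m) * moveOp B m) := by simp only [mul_assoc]
      _ = R * ((condProb β m : ℂ) • ((moveOp B m)ᴴ * (siteProj B 0 (parity m) *
          T * siteProj B 0 (parity m)) * moveOp B m)) := by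
          rw [← ((hU' m).mul_right (hS _ _)).eq, Matrix.mul_smul]; simp only [mul_assoc]
      _ = _ := by
          simp only [hST, Matrix.mul_smul, Matrix.smul_mul, hB.moveOp_conj_root, smul_smul]
          congr 1
          have h1 := (sum_site_weights_pos β (parity m)).ne'
          have h2 := condProb_eq β m
          rw [eq_div_iff h1] at h2
          -- The factor $16$ clears the four halves in the site weights; it turns the weight $(1\pm
          -- t^4)/2$ of a parity into the coefficient $8(1\pm t^4)$.
          have h3 := congrArg (fun x : ℝ => (16 * x : ℂ)) h2
          simp only [Fin.prod_univ_four] at h3 ⊢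
          push_cast at h3 ⊢
          linear_combination h3
  simp only [fineGate, key]
  rw [← Finset.mul_sum, blockProd_eq_sum hB]

end

end AbstractBlock

/-! ### Block channels on subsystems, entropy loss, and preservation of correlations -/

section BlockChannels

variable {Q Q' : Type} [Fintype Q] [DecidableEq Q] [Fintype Q'] [DecidableEq Q']

/-- A block of anyon sites all of whose operators act on the qubits in its support. -/
structure IsLocalBlock (B : AnyonBlock Q) : Prop extends IsAnyonBlock B where
  stab_mem : ∀ i, B.stab i ∈ localAlg B.supp
  hop_mem : ∀ k, B.hop k ∈ localAlg B.supp

/-- A block of anyon sites in a subsystem, as a block of the whole system. -/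
def liftBlock (f : Q' → Q) (B : AnyonBlock Q') (A : Finset Q) : AnyonBlock Q :=
  ⟨fun i => emb f (B.stab i), fun k => emb f (B.hop k), A⟩

section Lift

variable {f : Q' → Q} (hf : f.Injective) (B : AnyonBlock Q') (A : Finset Q)
include hf

theorem siteProj_lift (i : Fin 4) (x : Fin 2) :
    siteProj (liftBlock f B A) i x = emb f (siteProj B i x) := by
  simp only [siteProj, liftBlock, ← embHom_apply f hf, map_smul, map_add, map_one]

theorem configProj_lift (m : Fin 4 → Fin 2) :
    configProj (liftBlock f B A) m = emb f (configProj B m) := by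
  simp only [configProj, siteProj_lift hf, emb_mul hf]

theorem moveOp_lift (m : Fin 4 → Fin 2) :
    moveOp (liftBlock f B A) m = emb f (moveOp B m) := by
  simp only [moveOp, liftBlock, ← embHom_apply f hf, map_mul, map_pow]

theorem coarseK_lift (m : Fin 4 → Fin 2) :
    coarseK (liftBlock f B A) m = emb f (coarseK B m) := by
  simp only [coarseK, configProj_lift hf, moveOp_lift hf, emb_mul hf]

theorem fineK_lift (β : ℝ) (m : Fin 4 → Fin 2) :
    fineK β (liftBlock f B A) m = emb f (fineK β B m) := by
  simp only [fineK, siteProj_lift hf, moveOp_lift hf, ← emb_conjTranspose, ← emb_mul hf]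
  simp only [← embHom_apply f hf, map_smul]

theorem isAnyonBlock_of_lift (h : IsAnyonBlock (liftBlock f B A)) : IsAnyonBlock B where
  stab_mul_self i := emb_injective hf (by rw [emb_mul hf, emb_one hf]; exact h.stab_mul_self i)
  stab_comm i j := emb_injective hf (by rw [emb_mul hf, emb_mul hf]; exact h.stab_comm i j)
  stab_herm i := emb_injective hf (by rw [emb_conjTranspose]; exact h.stab_herm i)
  hop_mul_self k := emb_injective hf (by rw [emb_mul hf, emb_one hf]; exact h.hop_mul_self k)
  hop_herm k := emb_injective hf (by rw [emb_conjTranspose]; exact h.hop_herm k)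
  hop_stab k i := emb_injective hf (by
    have := h.hop_stab k i
    simp only [liftBlock, ← embHom_apply f hf, ← map_mul, ← map_smul] at this
    exact this)

end Lift

/-- A local block is also a block inside its own support. The gate therefore acts on the marginal by
the same formula, and the entropy balance applies to both. -/
theorem IsLocalBlock.exists_restrict {B : AnyonBlock Q} (h : IsLocalBlock B) :
    ∃ B' : AnyonBlock {q // q ∈ B.supp},
      IsAnyonBlock B' ∧ liftBlock Subtype.val B' B.supp = B := by
  have h1 : ∀ i, ∃ u, emb Subtype.val u = B.stab i := fun i => h.stab_mem i
  have h2 : ∀ k, ∃ u, emb Subtype.val u = B.hop k := fun k => h.hop_mem k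
  choose S hS using h1
  choose T hT using h2
  have e : liftBlock Subtype.val ⟨S, T, ∅⟩ B.supp = B := by
    simp only [liftBlock, hS, hT]
  refine ⟨⟨S, T, ∅⟩, ?_, e⟩
  refine isAnyonBlock_of_lift (f := Subtype.val) Subtype.val_injective _ B.supp ?_
  rw [e]
  exact h.toIsAnyonBlock

theorem marginal_coarse {f : Q' → Q} (hf : f.Injective) (B : AnyonBlock Q') (A : Finset Q)
    (hB : IsAnyonBlock B) (hB' : IsAnyonBlock (liftBlock f B A)) (ρ : Op Q) :
    marginal f ((coarseGate (liftBlock f B A)).map ρ) = (coarseGate B).map (marginal f ρ) := by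
  rw [coarseGate_map_eq hB', coarseGate_map_eq hB, ← marginalHom_apply, map_sum]
  simp only [coarseK_lift hf, marginalHom_apply, marginal_emb hf]

theorem marginal_fine {f : Q' → Q} (hf : f.Injective) (B : AnyonBlock Q') (A : Finset Q)
    (hB : IsAnyonBlock B) (hB' : IsAnyonBlock (liftBlock f B A)) (β : ℝ) (ρ : Op Q) :
    marginal f ((fineGate β (liftBlock f B A)).map ρ) = (fineGate β B).map (marginal f ρ) := by
  rw [fineGate_map_eq hB', fineGate_map_eq hB, ← marginalHom_apply, map_sum]
  simp only [fineK_lift hf, marginalHom_apply, marginal_emb hf]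

theorem marginal_isHermitian {f : Q' → Q} {ρ : Op Q} (hρ : ρ.IsHermitian) :
    (marginal f ρ).IsHermitian := by
  rw [marginal_eq, Matrix.IsHermitian, Matrix.conjTranspose_sum]
  exact Finset.sum_congr rfl fun c _ => Matrix.isHermitian_mul_mul_conjTranspose _ hρ

theorem kraus_isHermitian {ι : Type*} [Fintype ι] (K : ι → Op Q) {ρ : Op Q}
    (hρ : ρ.IsHermitian) : (∑ i, K i * ρ * (K i)ᴴ).IsHermitian := by
  rw [Matrix.IsHermitian, Matrix.conjTranspose_sum]
  exact Finset.sum_congr rfl fun c _ => Matrix.isHermitian_mul_mul_conjTranspose _ hρ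

/-- The entropy lost in a reversible coarse-graining. -/
theorem vonNeumannEntropy_coarse {B : AnyonBlock Q} (hB : IsAnyonBlock B) (β : ℝ) {ρ : Op Q}
    (hρ : ρ.IsHermitian) (h : (fineGate β B).map ((coarseGate B).map ρ) = ρ) :
    vonNeumannEntropy ρ = vonNeumannEntropy ((coarseGate B).map ρ) +
      ∑ m : Fin 4 → Fin 2, Real.negMulLog (condProb β m) *
        (configProj B ![parity m, 0, 0, 0] * (coarseGate B).map ρ).trace.re := by
  set σ := (coarseGate B).map ρ with hσ
  have hσh : σ.IsHermitian := by
    rw [hσ, coarseGate_map_eq hB]; exact kraus_isHermitian _ hρ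
  -- After coarse-graining only the root can be occupied, so these two projectors carry the whole of
  -- `σ`.
  set P : Fin 2 → Op Q := fun x => configProj B ![x, 0, 0, 0] with hP
  have hPP : ∀ x y, P x * P y = if x = y then P y else 0 := by
    intro x y
    simp only [hP, hB.configProj_mul_configProj]
    by_cases hxy : x = y
    · subst hxy; simp
    · rw [if_neg hxy, if_neg]; intro h'; exact hxy (congrFun h' 0)
  have hPh : ∀ x, (P x)ᴴ = P x := fun x => hB.configProj_herm _
  have hsum : σ = ∑ m, P (parity m) * (moveOp B m * ρ * (moveOp B m)ᴴ) * P (parity m) := by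
    rw [hσ, coarseGate_map_eq hB]
    refine Finset.sum_congr rfl fun m _ => ?_
    rw [coarseK, hB.moveOp_mul_configProj, Matrix.conjTranspose_mul, hB.configProj_herm]
    simp only [hP, mul_assoc]
  set τ : Fin 2 → Op Q := fun x => P x * σ * P x with hτ
  have hτh : ∀ x, (τ x).IsHermitian := fun x => by
    simp only [hτ, Matrix.IsHermitian, Matrix.conjTranspose_mul, hPh, hσh.eq, mul_assoc]
  have hττ : ∀ x y, x ≠ y → τ x * τ y = 0 := by
    intro x y hxy
    calc τ x * τ y = P x * σ * (P x * P y) * σ * P y := by simp only [hτ, mul_assoc]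
      _ = 0 := by rw [hPP, if_neg hxy, mul_zero, zero_mul, zero_mul]
  have hleft : (P 0 + P 1) * σ = σ := by
    conv_rhs => rw [hsum]
    rw [hsum, Finset.mul_sum]
    refine Finset.sum_congr rfl fun m _ => ?_
    rw [← mul_assoc, ← mul_assoc]
    congr 2
    generalize parity m = x
    fin_cases x <;> simp [add_mul, hPP]
  have hright : ∀ x, P x * σ = τ x := by
    intro x
    have h1 : P x * σ * (P 0 + P 1) = P x * σ := by
      have := congrArg Matrix.conjTranspose hleft
      rw [Matrix.conjTranspose_mul, Matrix.conjTranspose_add, hPh, hPh, hσh.eq] at this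
      rw [mul_assoc, this]
    -- Every Kraus term of `σ` lies between projectors of one parity, so there is no coherence
    -- between the two parities.
    have h2 : ∀ x y, x ≠ y → P x * σ * P y = 0 := by
      intro x y hxy
      rw [hsum, Finset.mul_sum, Finset.sum_mul]
      refine Finset.sum_eq_zero fun m _ => ?_
      by_cases hx : x = parity m
      · have hy : parity m ≠ y := hx ▸ hxy
        rw [mul_assoc, mul_assoc _ (P (parity m)) (P y), hPP, if_neg hy, mul_zero, mul_zero]
      · rw [mul_assoc (P (parity m)), ← mul_assoc (P x), hPP, if_neg hx, zero_mul, zero_mul]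
    rw [← h1, mul_add, hτ]
    fin_cases x
    · simp [h2 0 1]
    · simp [h2 1 0]
  have hστ : σ = ∑ x, τ x := by
    rw [Fin.sum_univ_two, ← hright, ← hright, ← add_mul, hleft]
  have hS : ∀ x, siteProj B 0 x * σ * siteProj B 0 x = τ x := by
    intro x
    have hSP : ∀ x y, siteProj B 0 x * P y = if x = y then P y else 0 := fun x y =>
      hB.siteProj_mul_configProj 0 x ![y, 0, 0, 0]
    have hPS : ∀ x y, P y * siteProj B 0 x = if x = y then P y else 0 := fun x y => by
      rw [← hSP]; exact ((hB.siteProj_comm_configProj 0 x ![y, 0, 0, 0]).eq).symm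
    have hSτ : ∀ x y, siteProj B 0 x * τ y * siteProj B 0 x = if x = y then τ y else 0 := by
      intro x y
      simp only [hτ]
      rw [mul_assoc, mul_assoc _ (P y), hPS, ← mul_assoc, ← mul_assoc, hSP]
      split_ifs <;> simp
    rw [hστ, Fin.sum_univ_two, mul_add, add_mul, hSτ, hSτ]
    fin_cases x <;> simp
  -- Reversibility exhibits the input as a mixture of unitary copies of the two parts of `σ`. The
  -- copies lie in different anyon configurations, so they are mutually orthogonal.
  have hD : ρ = ∑ m : Fin 4 → Fin 2, (condProb β m : ℂ) •
      ((moveOp B m)ᴴ * τ (parity m) * ((moveOp B m)ᴴ)ᴴ) := by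
    conv_lhs => rw [← h]
    have e : (fineGate β B).map σ = ∑ m : Fin 4 → Fin 2, (condProb β m : ℂ) •
      ((moveOp B m)ᴴ * siteProj B 0 (parity m) * σ * siteProj B 0 (parity m) * moveOp B m) := rfl
    rw [e]
    refine Finset.sum_congr rfl fun m _ => ?_
    rw [← hS, Matrix.conjTranspose_conjTranspose]
    simp only [mul_assoc]
  have hUU : ∀ m, ((moveOp B m)ᴴ)ᴴ * (moveOp B m)ᴴ = 1 := fun m => by
    rw [Matrix.conjTranspose_conjTranspose, hB.moveOp_unitary']
  have hconj : ∀ m, (moveOp B m)ᴴ * τ (parity m) * ((moveOp B m)ᴴ)ᴴ =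
      configProj B m * ((moveOp B m)ᴴ * σ * moveOp B m) * configProj B m := by
    intro m
    have e1 : (moveOp B m)ᴴ * P (parity m) = configProj B m * (moveOp B m)ᴴ := by
      rw [← hB.moveOp_conj_root m, mul_assoc, hB.moveOp_unitary', mul_one]
    have e2 : P (parity m) * moveOp B m = moveOp B m * configProj B m :=
      (hB.moveOp_mul_configProj m).symm
    rw [Matrix.conjTranspose_conjTranspose]
    calc (moveOp B m)ᴴ * τ (parity m) * moveOp B m
        = ((moveOp B m)ᴴ * P (parity m)) * σ * (P (parity m) * moveOp B m) := by
          simp only [hτ, mul_assoc]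
      _ = _ := by rw [e1, e2]; simp only [mul_assoc]
  have hent : vonNeumannEntropy ρ = ∑ m : Fin 4 → Fin 2,
      (condProb β m * vonNeumannEntropy (τ (parity m)) +
        Real.negMulLog (condProb β m) * (τ (parity m)).trace.re) := by
    conv_lhs => rw [hD]
    refine vonNeumannEntropy_mixture (condProb β) (fun m => (moveOp B m)ᴴ) (fun m => τ (parity m))
      hUU (fun m => hτh _) fun m m' hmm => ?_
    rw [hconj, hconj, mul_assoc, ← mul_assoc (configProj B m) (configProj B m' * _),
      ← mul_assoc (configProj B m) (configProj B m'), hB.configProj_mul_configProj, if_neg hmm]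
    simp
  have hentσ : vonNeumannEntropy σ = vonNeumannEntropy (τ 0) + vonNeumannEntropy (τ 1) := by
    rw [vonNeumannEntropy, hστ, cfc_sum_of_orthogonal τ hτh hττ _ (by simp), Fin.sum_univ_two,
      Matrix.trace_add, Complex.add_re, ← vonNeumannEntropy, ← vonNeumannEntropy]
  -- The conditional probabilities sum to one for each parity, so the entropies of the copies add up
  -- to that of `σ`; only the Shannon term remains.
  have hmix := sum_condProb_mul β fun x => vonNeumannEntropy (τ x)
  simp only [smul_eq_mul] at hmix
  have htr : ∀ m : Fin 4 → Fin 2, configProj B ![parity m, 0, 0, 0] * σ = τ (parity m) :=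
    fun m => hright _
  simp only [htr]
  rw [hent, Finset.sum_add_distrib, hmix, hentσ]

/-- A coarse-graining that can be reversed is correlation-preserving. -/
theorem coarseGate_correlationPreserving {B : AnyonBlock Q} (hB : IsLocalBlock B) (β : ℝ)
    {ρ : Op Q} (hρ : ρ.IsHermitian) (h : (fineGate β B).map ((coarseGate B).map ρ) = ρ) :
    CorrelationPreserving (coarseGate B) ρ := by
  obtain ⟨B', hB', e⟩ := hB.exists_restrict
  set f : {q // q ∈ B.supp} → Q := Subtype.val with hfdef
  have hf : f.Injective := Subtype.val_injective
  have hBl : IsAnyonBlock (liftBlock f B' B.supp) := by rw [e]; exact hB.toIsAnyonBlock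
  refine correlationPreserving_of_entropy (coarseGate B) ρ (coarseK B') (sum_coarseK hB') ?_ ?_
  · have h1 := coarseGate_map_eq hBl ρ
    simp only [coarseK_lift hf] at h1
    have h2 : (coarseGate (liftBlock f B' B.supp)).map ρ = (coarseGate B).map ρ := by rw [e]
    exact h2.symm.trans h1
  · have hm : marginal f ((coarseGate B).map ρ) = (coarseGate B').map (marginal f ρ) := by
      have := marginal_coarse hf B' B.supp hB' hBl ρ
      rwa [e] at this
    have h' : (fineGate β B').map ((coarseGate B').map (marginal f ρ)) = marginal f ρ := by
      rw [← hm]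
      have := marginal_fine hf B' B.supp hB' hBl β ((coarseGate B).map ρ)
      rw [e, h] at this
      exact this.symm
    have h1 := vonNeumannEntropy_coarse hB.toIsAnyonBlock β hρ h
    have h2 := vonNeumannEntropy_coarse hB' β (marginal_isHermitian (f := f) hρ) h'
    -- The entropy lost is an expectation of block operators. It is the same for the whole state and
    -- for the marginal on the support, and cancels in the mutual information.
    have h3 : ∀ m, (configProj B m * (coarseGate B).map ρ).trace =
        (configProj B' m * (coarseGate B').map (marginal f ρ)).trace := by
      intro m
      rw [← hm, ← trace_emb_mul, ← configProj_lift hf B' B.supp, e]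
    simp only [h3] at h1
    change vonNeumannEntropy (marginal f ((coarseGate B).map ρ)) - _ =
      vonNeumannEntropy (marginal f ρ) - _
    rw [hm, h1, h2]
    ring

theorem unitary_correlationPreserving (g : ChannelGate Q) {V : Op Q} (hV : V ∈ localAlg g.supp)
    (hVV : Vᴴ * V = 1) (hg : ∀ ρ, g.map ρ = V * ρ * Vᴴ) {ρ : Op Q} (hρ : ρ.IsHermitian) :
    CorrelationPreserving g ρ := by
  obtain ⟨u, hu⟩ := hV
  change emb Subtype.val u = V at hu
  have hf : Function.Injective (Subtype.val : {q // q ∈ g.supp} → Q) := Subtype.val_injective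
  have huu : uᴴ * u = 1 := emb_injective hf (by
    rw [emb_mul hf, emb_conjTranspose, hu, hVV, emb_one hf])
  refine correlationPreserving_of_entropy g ρ (fun _ : Unit => u) (by simpa using huu) ?_ ?_
  · simp [hg, hu]
  · rw [hg, ← hu, marginal_emb hf, hu, vonNeumannEntropy_unitary_conj hVV hρ,
      vonNeumannEntropy_unitary_conj huu (marginal_isHermitian hρ)]

theorem isChannelOn_of_kraus {ι : Type*} [Fintype ι] {A : Finset Q} {Φ : Op Q → Op Q}
    (K : ι → Op Q) (hK : ∀ i, K i ∈ localAlg A) (h1 : ∑ i, (K i)ᴴ * K i = 1)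
    (hΦ : ∀ ρ, Φ ρ = ∑ i, K i * ρ * (K i)ᴴ) : IsChannelOn A Φ := by
  choose u hu using fun i => mem_localAlg.1 (hK i)
  have hf : Function.Injective (Subtype.val : {q // q ∈ A} → Q) := Subtype.val_injective
  let e := Fintype.equivFin ι
  refine ⟨Fintype.card ι, fun i => u (e.symm i), ?_, fun ρ => ?_⟩
  · refine emb_injective hf ?_
    rw [emb_one hf, ← h1, Equiv.sum_comp e.symm fun i => (u i)ᴴ * u i, ← embHom_apply _ hf, map_sum]
    refine Finset.sum_congr rfl fun i _ => ?_
    rw [embHom_apply, emb_mul hf, emb_conjTranspose, ← embed_eq, hu]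
  · rw [hΦ, ← Equiv.sum_comp e.symm]
    simp only [hu]

theorem IsLocalBlock.siteProj_mem {B : AnyonBlock Q} (h : IsLocalBlock B) (i : Fin 4) (x : Fin 2) :
    siteProj B i x ∈ localAlg B.supp :=
  (localAlg B.supp).smul_mem (add_mem (one_mem _) ((localAlg B.supp).smul_mem (h.stab_mem i) _)) _

theorem IsLocalBlock.moveOp_mem {B : AnyonBlock Q} (h : IsLocalBlock B) (m : Fin 4 → Fin 2) :
    moveOp B m ∈ localAlg B.supp :=
  mul_mem (mul_mem (pow_mem (h.hop_mem _) _) (pow_mem (h.hop_mem _) _)) (pow_mem (h.hop_mem _) _)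

theorem IsLocalBlock.coarse_isChannelOn {B : AnyonBlock Q} (h : IsLocalBlock B) :
    IsChannelOn (coarseGate B).supp (coarseGate B).map := by
  refine isChannelOn_of_kraus (coarseK B) (fun m => ?_) (sum_coarseK h.toIsAnyonBlock)
    (coarseGate_map_eq h.toIsAnyonBlock)
  exact mul_mem (h.moveOp_mem m) (mul_mem (mul_mem (mul_mem (h.siteProj_mem _ _)
    (h.siteProj_mem _ _)) (h.siteProj_mem _ _)) (h.siteProj_mem _ _))

theorem IsLocalBlock.fine_isChannelOn {B : AnyonBlock Q} (h : IsLocalBlock B) (β : ℝ) :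
    IsChannelOn (fineGate β B).supp (fineGate β B).map := by
  refine isChannelOn_of_kraus (fineK β B) (fun m => ?_) (sum_fineK h.toIsAnyonBlock β)
    (fineGate_map_eq h.toIsAnyonBlock β)
  exact (localAlg B.supp).smul_mem (mul_mem (star_mem (h.moveOp_mem m)) (h.siteProj_mem _ _)) _

theorem cnotGate_isChannelOn {e : Q × Q} (h : e.1 ≠ e.2) :
    IsChannelOn (cnotGate e).supp (cnotGate e).map := by
  refine isChannelOn_of_kraus (fun _ : Unit => cnot e.1 e.2) (fun _ => cnot_mem_localAlg) ?_ ?_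
  · simp [cnot_conjTranspose h, cnot_mul_self h]
  · intro ρ; simp [cnotGate]

theorem cnotGate_correlationPreserving {e : Q × Q} (h : e.1 ≠ e.2) {ρ : Op Q}
    (hρ : ρ.IsHermitian) : CorrelationPreserving (cnotGate e) ρ :=
  unitary_correlationPreserving (cnotGate e) (V := cnot e.1 e.2) cnot_mem_localAlg
    (by rw [cnot_conjTranspose h, cnot_mul_self h]) (fun _ => rfl) hρ

end BlockChannels

/-! ### Plaquettes, stars and blocks on the torus -/

section Geometry

theorem zmod_one_ne_zero {L : ℕ} (h : 2 ≤ L) : (1 : ZMod L) ≠ 0 := by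
  have : Fact (1 < L) := ⟨h⟩
  exact one_ne_zero

theorem mem_plaquette_horiz {L : ℕ} (p q : Site L) :
    horiz q ∈ plaquette p ↔ p = q ∨ p + (0, 1) = q := by
  simp only [plaquette, horiz, vert, Finset.mem_insert, Finset.mem_singleton, Prod.mk.injEq,
    true_and, Bool.false_eq_true, false_and, or_false]
  constructor <;> rintro (h | h) <;> simp [h]

theorem mem_plaquette_vert {L : ℕ} (p q : Site L) :
    vert q ∈ plaquette p ↔ p = q ∨ p + (1, 0) = q := by
  simp only [plaquette, horiz, vert, Finset.mem_insert, Finset.mem_singleton, Prod.mk.injEq,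
    true_and, Bool.true_eq_false, false_and, false_or]
  constructor <;> rintro (h | h) <;> simp [h]

theorem mem_vertexStar_horiz {L : ℕ} (p q : Site L) :
    horiz q ∈ vertexStar p ↔ p = q ∨ p = q + (1, 0) := by
  simp only [vertexStar, horiz, vert, Finset.mem_insert, Finset.mem_singleton, Prod.mk.injEq,
    true_and, Bool.false_eq_true, false_and, or_false, eq_sub_iff_add_eq]
  constructor <;> rintro (h | h) <;> simp [h]

theorem mem_vertexStar_vert {L : ℕ} (p q : Site L) :
    vert q ∈ vertexStar p ↔ p = q ∨ p = q + (0, 1) := by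
  simp only [vertexStar, horiz, vert, Finset.mem_insert, Finset.mem_singleton, Prod.mk.injEq,
    true_and, Bool.true_eq_false, false_and, false_or, eq_sub_iff_add_eq]
  constructor <;> rintro (h | h) <;> simp [h]

theorem site_add_ne {L : ℕ} (h : 2 ≤ L) (p : Site L) :
    p + (0, 1) ≠ p ∧ p + (1, 0) ≠ p := by
  have := zmod_one_ne_zero h
  constructor <;> intro h' <;> simp [Prod.ext_iff, this] at h'

/-- The indicator of a proposition. -/
def ibit (p : Prop) [Decidable p] : Fin 2 := if p then 1 else 0

theorem ibit_or {p q : Prop} [Decidable p] [Decidable q] (h : p → ¬ q) :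
    ibit (p ∨ q) = ibit p + ibit q := by
  by_cases hp : p
  · simp [ibit, hp, h hp]
  · simp [ibit, hp]

section Chains

variable {L : ℕ} (hL : 2 ≤ L)
include hL

/-- For `2 ≤ L` the two parallel links are distinct, so the disjunction is exclusive and becomes a
sum modulo two. -/
theorem ind_plaquette_horiz (p q : Site L) :
    ind (plaquette p) (horiz q) = ibit (p = q) + ibit (p + (0, 1) = q) := by
  rw [← ibit_or]
  · simp only [ind, mem_plaquette_horiz, ibit]
  · rintro rfl h; exact (site_add_ne hL p).1 h

theorem ind_plaquette_vert (p q : Site L) :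
    ind (plaquette p) (vert q) = ibit (p = q) + ibit (p + (1, 0) = q) := by
  rw [← ibit_or]
  · simp only [ind, mem_plaquette_vert, ibit]
  · rintro rfl h; exact (site_add_ne hL p).2 h

theorem ind_vertexStar_horiz (p q : Site L) :
    ind (vertexStar p) (horiz q) = ibit (p = q) + ibit (p = q + (1, 0)) := by
  rw [← ibit_or]
  · simp only [ind, mem_vertexStar_horiz, ibit]
  · rintro rfl h; exact (site_add_ne hL p).2 h.symm

theorem ind_vertexStar_vert (p q : Site L) :
    ind (vertexStar p) (vert q) = ibit (p = q) + ibit (p = q + (0, 1)) := by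
  rw [← ibit_or]
  · simp only [ind, mem_vertexStar_vert, ibit]
  · rintro rfl h; exact (site_add_ne hL p).1 h.symm

theorem ind_plaquette_eq (p : Site L) : ind (plaquette p) = Pi.single (horiz p) 1 +
    Pi.single (horiz (p + (0, 1))) 1 + Pi.single (vert p) 1 + Pi.single (vert (p + (1, 0))) 1 := by
  ext1 e
  obtain ⟨σ, q⟩ := e
  cases σ
  · change ind (plaquette p) (horiz q) = _
    rw [ind_plaquette_horiz hL]
    simp only [Pi.add_apply, Pi.single_apply, horiz, vert, Prod.mk.injEq, true_and,
      Bool.false_eq_true, false_and, if_false, add_zero, ibit, eq_comm (a := q)]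
  · change ind (plaquette p) (vert q) = _
    rw [ind_plaquette_vert hL]
    simp only [Pi.add_apply, Pi.single_apply, horiz, vert, Prod.mk.injEq, true_and,
      Bool.true_eq_false, false_and, if_false, zero_add, ibit, eq_comm (a := q)]

/-- Each of the four coincidences between the corners of the plaquette and the vertex is met by
exactly two links, so every sign occurs twice. The argument by parity also covers small tori, where
incidences may overlap. -/
theorem sgn_vertexStar_plaquette [NeZero L] (p v : Site L) :
    sgn (ind (vertexStar v)) (ind (plaquette p)) = 1 := by
  rw [ind_plaquette_eq hL]
  simp only [sgn_add_right, sgn_single_right, ind_vertexStar_horiz hL, ind_vertexStar_vert hL]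
  have e : p + (0, 1) + (1, 0) = p + (1, 0) + (0, 1) := by abel
  rw [e]
  have key : ∀ a b c d : Fin 2, (-1 : ℂ) ^ (((1 : Fin 2) : ℕ) * ((a + b : Fin 2) : ℕ)) *
      (-1) ^ (((1 : Fin 2) : ℕ) * ((c + d : Fin 2) : ℕ)) *
      (-1) ^ (((1 : Fin 2) : ℕ) * ((a + c : Fin 2) : ℕ)) *
      (-1) ^ (((1 : Fin 2) : ℕ) * ((b + d : Fin 2) : ℕ)) = 1 := by
    intro a b c d
    simp only [Fin.val_one, one_mul, neg_one_pow_fin_two_add]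
    have h : ∀ x : Fin 2, (-1 : ℂ) ^ (x : ℕ) * (-1) ^ (x : ℕ) = 1 := by
      intro x; rw [← mul_pow]; simp
    linear_combination (-1 : ℂ) ^ (b : ℕ) * (-1) ^ (b : ℕ) * ((-1) ^ (c : ℕ) * (-1) ^ (c : ℕ)) *
      ((-1) ^ (d : ℕ) * (-1) ^ (d : ℕ)) * h a +
      ((-1) ^ (c : ℕ) * (-1) ^ (c : ℕ)) * ((-1) ^ (d : ℕ) * (-1) ^ (d : ℕ)) * h b +
      ((-1) ^ (d : ℕ) * (-1) ^ (d : ℕ)) * h c + h d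
  exact key _ _ _ _

end Chains

/-! ### Doubling the lattice -/

section Double

variable {M : ℕ} [NeZero M]

/-- Doubling is a well-defined additive map from $\mathbb Z/M$ to $\mathbb Z/2M$; hence `corner` is
additive. -/
theorem natCast_two_mul_val_add (x y : ZMod M) :
    ((2 * (x + y).val : ℕ) : ZMod (2 * M)) = ((2 * x.val : ℕ) : ZMod (2 * M)) +
      ((2 * y.val : ℕ) : ZMod (2 * M)) := by
  rw [ZMod.val_add, ← Nat.cast_add, ZMod.natCast_eq_natCast_iff, ← mul_add]
  exact Nat.ModEq.mul_left' 2 (Nat.mod_modEq _ _)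

theorem corner_add (b c : Site M) : corner (b + c) = corner b + corner c := by
  simp only [corner, Prod.fst_add, Prod.snd_add, natCast_two_mul_val_add, Prod.mk_add_mk]

theorem natCast_two_mul_val_one : ((2 * (1 : ZMod M).val : ℕ) : ZMod (2 * M)) = 2 := by
  have : ((2 : ℕ) : ZMod (2 * M)) = 2 := rfl
  rw [← this, ZMod.natCast_eq_natCast_iff, ZMod.val_one_eq_one_mod]
  conv_rhs => rw [← mul_one 2]
  exact Nat.ModEq.mul_left' 2 (Nat.mod_modEq _ _)

theorem corner_add_one_zero (b : Site M) : corner (b + (1, 0)) = corner b + (2, 0) := by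
  rw [corner_add]; congr 1
  simp only [corner, natCast_two_mul_val_one]; simp

theorem corner_add_zero_one (b : Site M) : corner (b + (0, 1)) = corner b + (0, 2) := by
  rw [corner_add]; congr 1
  simp only [corner, natCast_two_mul_val_one]; simp

/-- The site at position `(i, j)` in the block at `b`. -/
def cell (i j : Fin 2) (b : Site M) : Site (2 * M) :=
  corner b + (((i : ℕ) : ZMod (2 * M)), ((j : ℕ) : ZMod (2 * M)))

theorem val_two_mul_add (x : ZMod M) (i : Fin 2) :
    (((2 * x.val : ℕ) : ZMod (2 * M)) + ((i : ℕ) : ZMod (2 * M))).val = 2 * x.val + i := by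
  rw [← Nat.cast_add, ZMod.val_natCast, Nat.mod_eq_of_lt]
  have := ZMod.val_lt x
  omega

theorem cell_fst_val (i j : Fin 2) (b : Site M) : (cell i j b).1.val = 2 * b.1.val + i :=
  val_two_mul_add b.1 i

theorem cell_snd_val (i j : Fin 2) (b : Site M) : (cell i j b).2.val = 2 * b.2.val + j :=
  val_two_mul_add b.2 j

theorem cell_inj {i j i' j' : Fin 2} {b b' : Site M} :
    cell i j b = cell i' j' b' ↔ i = i' ∧ j = j' ∧ b = b' := by
  constructor
  · intro h
    have h1 := cell_fst_val i j b
    have h2 := cell_snd_val i j b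
    rw [h, cell_fst_val] at h1
    rw [h, cell_snd_val] at h2
    refine ⟨Fin.ext (by omega), Fin.ext (by omega), Prod.ext ?_ ?_⟩
    · exact ZMod.val_injective M (by omega)
    · exact ZMod.val_injective M (by omega)
  · rintro ⟨rfl, rfl, rfl⟩; rfl

theorem cell_surj (p : Site (2 * M)) : ∃ i j b, cell (M := M) i j b = p := by
  have h1 := ZMod.val_lt p.1
  have h2 := ZMod.val_lt p.2
  have e1 : ((p.1.val / 2 : ℕ) : ZMod M).val = p.1.val / 2 := by
    rw [ZMod.val_natCast, Nat.mod_eq_of_lt (by omega)]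
  have e2 : ((p.2.val / 2 : ℕ) : ZMod M).val = p.2.val / 2 := by
    rw [ZMod.val_natCast, Nat.mod_eq_of_lt (by omega)]
  refine ⟨⟨p.1.val % 2, by omega⟩, ⟨p.2.val % 2, by omega⟩,
    (((p.1.val / 2 : ℕ) : ZMod M), ((p.2.val / 2 : ℕ) : ZMod M)), Prod.ext ?_ ?_⟩
  · apply ZMod.val_injective
    rw [cell_fst_val, e1]; dsimp only; omega
  · apply ZMod.val_injective
    rw [cell_snd_val, e2]; dsimp only; omega

theorem cell_zero_zero (b : Site M) : cell 0 0 b = corner b := by simp [cell]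
theorem cell_one_zero (b : Site M) : cell 1 0 b = corner b + (1, 0) := by simp [cell]
theorem cell_zero_one (b : Site M) : cell 0 1 b = corner b + (0, 1) := by simp [cell]
theorem cell_one_one (b : Site M) : cell 1 1 b = corner b + (1, 1) := by simp [cell]

/-- The coordinates of the four sites of a plaquette block. -/
def plaqCoord (i : Fin 4) : Fin 2 × Fin 2 := (![(0, 1), (1, 1), (0, 0), (1, 0)] : Fin 4 → _) i

/-- The coordinates of the four sites of a vertex block. -/
def vertCoord (i : Fin 4) : Fin 2 × Fin 2 := (![(0, 0), (1, 0), (0, 1), (1, 1)] : Fin 4 → _) i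

/-- The four plaquettes of a block. -/
def plaqSite (b : Site M) (i : Fin 4) : Site (2 * M) := cell (plaqCoord i).1 (plaqCoord i).2 b

/-- The four vertices of a block. -/
def vertSite (b : Site M) (i : Fin 4) : Site (2 * M) := cell (vertCoord i).1 (vertCoord i).2 b

theorem plaqCoord_bij : Function.Bijective plaqCoord := by decide
theorem vertCoord_bij : Function.Bijective vertCoord := by decide

theorem plaqSite_bij : Function.Bijective fun x : Site M × Fin 4 => plaqSite x.1 x.2 := by
  constructor
  · rintro ⟨b, i⟩ ⟨b', i'⟩ h
    obtain ⟨h1, h2, h3⟩ := cell_inj.1 h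
    exact Prod.ext h3 (plaqCoord_bij.1 (Prod.ext h1 h2))
  · intro p
    obtain ⟨i, j, b, rfl⟩ := cell_surj (M := M) p
    obtain ⟨k, hk⟩ := plaqCoord_bij.2 (i, j)
    exact ⟨(b, k), by simp only [plaqSite, hk]⟩

theorem vertSite_bij : Function.Bijective fun x : Site M × Fin 4 => vertSite x.1 x.2 := by
  constructor
  · rintro ⟨b, i⟩ ⟨b', i'⟩ h
    obtain ⟨h1, h2, h3⟩ := cell_inj.1 h
    exact Prod.ext h3 (vertCoord_bij.1 (Prod.ext h1 h2))
  · intro p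
    obtain ⟨i, j, b, rfl⟩ := cell_surj (M := M) p
    obtain ⟨k, hk⟩ := vertCoord_bij.2 (i, j)
    exact ⟨(b, k), by simp only [vertSite, hk]⟩

theorem plaqBlock_stab (b : Site M) (i : Fin 4) :
    (plaqBlock M b).stab i = paX (ind (plaquette (plaqSite b i))) := by
  rw [← xString_eq]
  fin_cases i
  · simp [plaqBlock, plaqSite, plaqCoord, cell_zero_one]
  · simp [plaqBlock, plaqSite, plaqCoord, cell_one_one]
  · simp [plaqBlock, plaqSite, plaqCoord, cell_zero_zero]
  · simp [plaqBlock, plaqSite, plaqCoord, cell_one_zero]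

theorem vertBlock_stab (b : Site M) (i : Fin 4) :
    (vertBlock M b).stab i = paZ (ind (vertexStar (vertSite b i))) := by
  rw [← zString_eq]
  fin_cases i
  · simp [vertBlock, vertSite, vertCoord, cell_zero_zero]
  · simp [vertBlock, vertSite, vertCoord, cell_one_zero]
  · simp [vertBlock, vertSite, vertCoord, cell_zero_one]
  · simp [vertBlock, vertSite, vertCoord, cell_one_one]

/-- The links on which the hopping operators of a plaquette block act. -/
def plaqLink (b : Site M) (k : Fin 3) : Edge (2 * M) :=
  (![vert (cell 1 1 b), horiz (cell 0 1 b), horiz (cell 1 1 b)] : Fin 3 → _) k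

/-- The links on which the hopping operators of a vertex block act. -/
def vertLink (b : Site M) (k : Fin 3) : Edge (2 * M) :=
  (![horiz (cell 0 0 b), vert (cell 0 0 b), vert (cell 1 0 b)] : Fin 3 → _) k

theorem plaqBlock_hop (b : Site M) (k : Fin 3) :
    (plaqBlock M b).hop k = paZ (Pi.single (plaqLink b k) 1) := by
  rw [← ind_singleton, ← zString_eq]
  fin_cases k <;> simp [plaqBlock, plaqLink, cell_one_one, cell_zero_one]

theorem vertBlock_hop (b : Site M) (k : Fin 3) :
    (vertBlock M b).hop k = paX (Pi.single (vertLink b k) 1) := by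
  rw [← ind_singleton, ← xString_eq]
  fin_cases k <;> simp [vertBlock, vertLink, cell_zero_zero, cell_one_zero]

theorem cell_add_right (j : Fin 2) (b : Site M) :
    cell 0 j b + (1, 0) = cell 1 j b := by
  simp only [cell, add_assoc]; congr 1; simp

theorem cell_add_up (i : Fin 2) (b : Site M) :
    cell i 0 b + (0, 1) = cell i 1 b := by
  simp only [cell, add_assoc]; congr 1; simp

theorem cell_add_right' (j : Fin 2) (b : Site M) :
    cell 1 j b + (1, 0) = cell 0 j (b + (1, 0)) := by
  simp only [cell, add_assoc, corner_add_one_zero]; congr 1; simp; norm_num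

theorem cell_add_up' (i : Fin 2) (b : Site M) :
    cell i 1 b + (0, 1) = cell i 0 (b + (0, 1)) := by
  simp only [cell, add_assoc, corner_add_zero_one]; congr 1; simp; norm_num

theorem add_eq_cell_right (p : Site (2 * M)) (j : Fin 2) (b : Site M) :
    p + (1, 0) = cell 1 j b ↔ p = cell 0 j b := by rw [← cell_add_right, add_left_inj]

theorem add_eq_cell_up (p : Site (2 * M)) (i : Fin 2) (b : Site M) :
    p + (0, 1) = cell i 1 b ↔ p = cell i 0 b := by rw [← cell_add_up, add_left_inj]

/-- A hopping link is an inner link: both plaquettes that contain it belong to its block, so other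
blocks do not notice the hopping. -/
theorem ind_plaquette_plaqLink (b b' : Site M) (k : Fin 3) (i : Fin 4) :
    ind (plaquette (plaqSite b' i)) (plaqLink b k) = if b' = b then hopBit k i else 0 := by
  fin_cases k
  · simp only [plaqLink, ind, Fin.zero_eta, Matrix.cons_val, mem_plaquette_vert,
      add_eq_cell_right, plaqSite, cell_inj]
    by_cases h : b' = b
    · simp only [h, if_true, and_true]; revert i; decide
    · simp [h]
  · simp only [plaqLink, ind, Fin.mk_one, Matrix.cons_val, mem_plaquette_horiz,
      add_eq_cell_up, plaqSite, cell_inj]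
    by_cases h : b' = b
    · simp only [h, if_true, and_true]; revert i; decide
    · simp [h]
  · simp only [plaqLink, ind, Fin.reduceFinMk, Matrix.cons_val, mem_plaquette_horiz,
      add_eq_cell_up, plaqSite, cell_inj]
    by_cases h : b' = b
    · simp only [h, if_true, and_true]; revert i; decide
    · simp [h]

theorem ind_vertexStar_vertLink (b b' : Site M) (k : Fin 3) (i : Fin 4) :
    ind (vertexStar (vertSite b' i)) (vertLink b k) = if b' = b then hopBit k i else 0 := by
  fin_cases k
  · simp only [vertLink, ind, Fin.zero_eta, Matrix.cons_val, mem_vertexStar_horiz,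
      cell_add_right, vertSite, cell_inj]
    by_cases h : b' = b
    · simp only [h, if_true, and_true]; revert i; decide
    · simp [h]
  · simp only [vertLink, ind, Fin.mk_one, Matrix.cons_val, mem_vertexStar_vert,
      cell_add_up, vertSite, cell_inj]
    by_cases h : b' = b
    · simp only [h, if_true, and_true]; revert i; decide
    · simp [h]
  · simp only [vertLink, ind, Fin.reduceFinMk, Matrix.cons_val, mem_vertexStar_vert,
      cell_add_up, vertSite, cell_inj]
    by_cases h : b' = b
    · simp only [h, if_true, and_true]; revert i; decide
    · simp [h]

theorem exists_hopBit (k : Fin 3) : ∃ i, hopBit k i = 1 := by revert k; decide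

theorem plaqBlock_hop_stab (b b' : Site M) (k : Fin 3) (i : Fin 4) :
    (plaqBlock M b).hop k * (plaqBlock M b').stab i =
      (-1 : ℂ) ^ ((if b' = b then hopBit k i else 0 : Fin 2) : ℕ) •
        ((plaqBlock M b').stab i * (plaqBlock M b).hop k) := by
  rw [plaqBlock_hop, plaqBlock_stab, paZ_mul_paX, sgn_single_left, ind_plaquette_plaqLink]
  simp

theorem vertBlock_hop_stab (b b' : Site M) (k : Fin 3) (i : Fin 4) :
    (vertBlock M b).hop k * (vertBlock M b').stab i =
      (-1 : ℂ) ^ ((if b' = b then hopBit k i else 0 : Fin 2) : ℕ) •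
        ((vertBlock M b').stab i * (vertBlock M b).hop k) := by
  rw [vertBlock_hop, vertBlock_stab, paZ_mul_paX, sgn_single_right, ind_vertexStar_vertLink,
    smul_smul, Fin.val_one, one_mul, ← mul_pow]
  simp

theorem plaquette_subset_supp (b : Site M) (i : Fin 4) :
    plaquette (plaqSite b i) ⊆ (plaqBlock M b).supp := by
  intro q h
  fin_cases i <;> simp only [plaqSite, plaqCoord, Fin.zero_eta, Fin.mk_one, Fin.reduceFinMk,
    Matrix.cons_val, cell_zero_zero, cell_zero_one, cell_one_zero, cell_one_one] at h <;>
    simp only [plaqBlock, Finset.mem_union, h, true_or, or_true]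

theorem plaqBlock_isLocal (b : Site M) : IsLocalBlock (plaqBlock M b) where
  stab_mul_self i := by rw [plaqBlock_stab, paX_mul_self]
  stab_comm i j := by rw [plaqBlock_stab, plaqBlock_stab, (paX_commute _ _).eq]
  stab_herm i := by rw [plaqBlock_stab, paX_conjTranspose]
  hop_mul_self k := by rw [plaqBlock_hop, paZ_mul_self]
  hop_herm k := by rw [plaqBlock_hop, paZ_conjTranspose]
  hop_stab k i := by rw [plaqBlock_hop_stab, if_pos rfl]
  stab_mem i := by
    rw [plaqBlock_stab]
    refine paX_mem_localAlg fun q hq => ?_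
    rw [ind, if_neg]
    exact fun h => hq (plaquette_subset_supp b i h)
  hop_mem k := by
    rw [plaqBlock_hop]
    refine paZ_mem_localAlg fun q hq => ?_
    rw [Pi.single_apply, if_neg]
    rintro rfl
    -- The link lies in the support because it belongs to a plaquette of the block whose charge it
    -- changes.
    obtain ⟨i, hi⟩ := exists_hopBit k
    have h := ind_plaquette_plaqLink b b k i
    rw [if_pos rfl, hi, ind] at h
    refine hq (plaquette_subset_supp b i ?_)
    by_contra hn
    rw [if_neg hn] at h
    exact absurd h (by decide)

theorem vertexStar_subset_supp (b : Site M) (i : Fin 4) :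
    vertexStar (vertSite b i) ⊆ (vertBlock M b).supp := by
  intro q h
  fin_cases i <;> simp only [vertSite, vertCoord, Fin.zero_eta, Fin.mk_one, Fin.reduceFinMk,
    Matrix.cons_val, cell_zero_zero, cell_zero_one, cell_one_zero, cell_one_one] at h <;>
    simp only [vertBlock, Finset.mem_union, h, true_or, or_true]

theorem vertBlock_isLocal (b : Site M) : IsLocalBlock (vertBlock M b) where
  stab_mul_self i := by rw [vertBlock_stab, paZ_mul_self]
  stab_comm i j := by rw [vertBlock_stab, vertBlock_stab, (paZ_commute _ _).eq]
  stab_herm i := by rw [vertBlock_stab, paZ_conjTranspose]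
  hop_mul_self k := by rw [vertBlock_hop, paX_mul_self]
  hop_herm k := by rw [vertBlock_hop, paX_conjTranspose]
  hop_stab k i := by rw [vertBlock_hop_stab, if_pos rfl]
  stab_mem i := by
    rw [vertBlock_stab]
    refine paZ_mem_localAlg fun q hq => ?_
    rw [ind, if_neg]
    exact fun h => hq (vertexStar_subset_supp b i h)
  hop_mem k := by
    rw [vertBlock_hop]
    refine paX_mem_localAlg fun q hq => ?_
    rw [Pi.single_apply, if_neg]
    rintro rfl
    obtain ⟨i, hi⟩ := exists_hopBit k
    have h := ind_vertexStar_vertLink b b k i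
    rw [if_pos rfl, hi, ind] at h
    refine hq (vertexStar_subset_supp b i ?_)
    by_contra hn
    rw [if_neg hn] at h
    exact absurd h (by decide)

end Double

end Geometry

/-! ### Exponentials of involutions -/

section Exponential

variable {Q : Type} [Fintype Q] [DecidableEq Q]

open scoped Nat in
theorem exp_smul_of_mul_self {𝔸 : Type*} [NormedRing 𝔸] [NormedAlgebra ℂ 𝔸] [CompleteSpace 𝔸] {P : 𝔸} (hP : P * P = P) (c : ℂ) :
    NormedSpace.exp (c • P) = 1 + (Complex.exp c - 1) • P := by
  have h1 : HasSum (fun n : ℕ => ((n ! : ℂ)⁻¹) • (c • P) ^ n) (NormedSpace.exp (c • P)) :=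
    NormedSpace.exp_series_hasSum_exp' (𝕂 := ℂ) (c • P)
  have h2 : HasSum (fun n : ℕ => ((n ! : ℂ)⁻¹) • c ^ n) (Complex.exp c) := by
    rw [Complex.exp_eq_exp_ℂ]
    exact NormedSpace.exp_series_hasSum_exp' (𝕂 := ℂ) c
  have h3 : HasSum (fun n : ℕ => (((n ! : ℂ)⁻¹) • c ^ n) • P) (Complex.exp c • P) :=
    h2.smul_const P
  have h4 : HasSum (fun n : ℕ => if n = 0 then (1 - P : 𝔸) else 0) (1 - P) := hasSum_ite_eq 0 _
  have h5 := h3.add h4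
  have hpow : ∀ n : ℕ, P ^ (n + 1) = P := by
    intro n
    induction n with
    | zero => simp
    | succ n ih => rw [pow_succ, ih, hP]
  have e : (fun n : ℕ => ((n ! : ℂ)⁻¹) • (c • P) ^ n) =
      fun n : ℕ => (((n ! : ℂ)⁻¹) • c ^ n) • P + if n = 0 then (1 - P : 𝔸) else 0 := by
    ext1 n
    cases n with
    | zero => simp
    | succ n => rw [smul_pow, hpow, if_neg (Nat.succ_ne_zero n), add_zero, smul_assoc]
  rw [e] at h1
  rw [h1.unique h5, sub_smul, one_smul]
  abel

open scoped Norms.Operator in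
theorem exp_smul_idempotent {P : Op Q} (hP : P * P = P) (c : ℂ) :
    NormedSpace.exp (c • P) = 1 + (Complex.exp c - 1) • P := 
  exp_smul_of_mul_self hP c

/-- With the projector $P=(1+A)/2$ one has $bA=-b+2bP$, so only exponentials of multiples of
idempotents are needed. Factoring out $\cosh b$ leaves the bias $\tanh b$. -/
theorem exp_smul_involution {A : Op Q} (hA : A * A = 1) (b : ℝ) :
    NormedSpace.exp ((b : ℂ) • A) = (Real.cosh b : ℂ) • (1 + (Real.tanh b : ℂ) • A) := by
  set P : Op Q := (1 / 2 : ℂ) • (1 + A) with hPdef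
  have hP : P * P = P := by
    rw [hPdef, Matrix.smul_mul, Matrix.mul_smul, add_mul, mul_add, mul_add, hA, one_mul, one_mul,
      mul_one]
    module
  have e : (b : ℂ) • A = (-b : ℂ) • (1 : Op Q) + (2 * b : ℂ) • P := by rw [hPdef]; module
  have hc : Commute ((-b : ℂ) • (1 : Op Q)) ((2 * b : ℂ) • P) :=
    ((Commute.one_left P).smul_left _).smul_right _
  rw [e, Matrix.exp_add_of_commute _ _ hc, exp_smul_idempotent hP,
    exp_smul_idempotent (one_mul (1 : Op Q))]
  have hb : (Real.cosh b : ℂ) ≠ 0 := by exact_mod_cast (Real.cosh_pos b).ne'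
  have h1 : Complex.exp (-b) = (Real.cosh b : ℂ) - (Real.sinh b : ℂ) := by
    rw [← Complex.ofReal_sub, Real.cosh_sub_sinh]; simp
  have h2 : Complex.exp (2 * b) = ((Real.cosh b : ℂ) + (Real.sinh b : ℂ)) ^ 2 := by
    rw [← Complex.ofReal_add, Real.cosh_add_sinh]
    push_cast
    rw [← Complex.exp_nat_mul]; push_cast; rfl
  have h3 : (Real.cosh b : ℂ) ^ 2 - (Real.sinh b : ℂ) ^ 2 = 1 := by
    exact_mod_cast Real.cosh_sq_sub_sinh_sq b
  have h4 : (Real.tanh b : ℂ) = (Real.sinh b : ℂ) / (Real.cosh b : ℂ) := by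
    rw [Real.tanh_eq_sinh_div_cosh]; push_cast; rfl
  have h5 : (Real.cosh b : ℂ) * ((Real.sinh b : ℂ) / (Real.cosh b : ℂ)) = Real.sinh b := by
    field_simp
  have hR : (Real.cosh b : ℂ) • ((1 : Op Q) + (Real.tanh b : ℂ) • A) =
      (Real.cosh b : ℂ) • 1 + (Real.sinh b : ℂ) • A := by
    rw [h4, smul_add, smul_smul, h5]
  rw [hR, h1, h2, hPdef]
  generalize (Real.cosh b : ℂ) = x at h3 ⊢
  generalize (Real.sinh b : ℂ) = y at h3 ⊢
  have e1 : (1 : Op Q) + (x - y - 1) • (1 : Op Q) = (x - y) • 1 := by module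
  have e2 : (x - y) * (((x + y) ^ 2 - 1) * (1 / 2)) = y := by
    linear_combination (1 / 2 * (x + y)) * h3
  rw [e1, Matrix.smul_mul, one_mul, smul_add, smul_smul, smul_smul, mul_assoc, e2]
  module

end Exponential

/-! ### The group algebra of bit strings and products of stabilizer factors -/

section GroupAlgebra

variable {Q : Type} [Fintype Q] [DecidableEq Q]

/-- The group algebra of the group of bit strings. -/
abbrev GA (Q : Type) : Type := AddMonoidAlgebra ℂ (Q → Fin 2)

/-- The group element of a bit string. -/
def xx (a : Q → Fin 2) : GA Q := AddMonoidAlgebra.single a 1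

theorem xx_mul (a b : Q → Fin 2) : xx a * xx b = xx (a + b) := by
  simp [xx, AddMonoidAlgebra.single_mul_single]

theorem xx_zero : xx (0 : Q → Fin 2) = 1 := rfl

theorem xx_mul_self (a : Q → Fin 2) : xx a * xx a = 1 := by
  rw [xx_mul, bits_add_self, xx_zero]

theorem prod_smul_xx {ι : Type*} (s : Finset ι) (f : ι → ℂ) (a : ι → Q → Fin 2) :
    ∏ i ∈ s, f i • xx (a i) = (∏ i ∈ s, f i) • xx (∑ i ∈ s, a i) := by
  classical
  induction s using Finset.induction_on with
  | empty => simp [xx_zero]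
  | insert i s hi ih =>
    rw [Finset.prod_insert hi, Finset.prod_insert hi, Finset.sum_insert hi, ih, ← xx_mul,
      smul_mul_smul_comm]

/-- The representation of bit strings by `X` strings. -/
def phiX : GA Q →ₐ[ℂ] Op Q :=
  AddMonoidAlgebra.lift ℂ (Op Q) (Q → Fin 2)
    { toFun := fun a => paX a.toAdd
      map_one' := paX_zero
      map_mul' := fun a b => (paX_mul _ _).symm }

/-- The representation of bit strings by `Z` strings. -/
def phiZ : GA Q →ₐ[ℂ] Op Q :=
  AddMonoidAlgebra.lift ℂ (Op Q) (Q → Fin 2)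
    { toFun := fun a => paZ a.toAdd
      map_one' := paZ_zero
      map_mul' := fun a b => (paZ_mul _ _).symm }

theorem phiX_single (a : Q → Fin 2) (r : ℂ) :
    phiX (AddMonoidAlgebra.single a r) = r • paX a := by
  rw [phiX, AddMonoidAlgebra.lift_single]; rfl

theorem phiZ_single (a : Q → Fin 2) (r : ℂ) :
    phiZ (AddMonoidAlgebra.single a r) = r • paZ a := by
  rw [phiZ, AddMonoidAlgebra.lift_single]; rfl

@[simp] theorem phiX_xx (a : Q → Fin 2) : phiX (xx a) = paX a := by
  rw [xx, phiX_single, one_smul]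

@[simp] theorem phiZ_xx (a : Q → Fin 2) : phiZ (xx a) = paZ a := by
  rw [xx, phiZ_single, one_smul]

/-- `Finset` products need a commutative ring, so products of stabilizers are formed in the source
of `φ`, and commutation with an operator is checked factor by factor. -/
theorem commute_algHom_prod {𝒜 : Type*} [CommRing 𝒜] [Algebra ℂ 𝒜] (φ : 𝒜 →ₐ[ℂ] Op Q) {ι : Type*}
    (s : Finset ι) (u : ι → 𝒜) {W : Op Q} (h : ∀ i ∈ s, Commute (φ (u i)) W) :
    Commute (φ (∏ i ∈ s, u i)) W := by
  classical
  induction s using Finset.induction_on with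
  | empty => simp
  | insert i s hi ih =>
    rw [Finset.prod_insert hi, map_mul]
    exact (h i (Finset.mem_insert_self _ _)).mul_left
      (ih fun j hj => h j (Finset.mem_insert_of_mem hj))

theorem commute_algHom_one_add {𝒜 : Type*} [CommRing 𝒜] [Algebra ℂ 𝒜] (φ : 𝒜 →ₐ[ℂ] Op Q) (r : ℂ)
    {u : 𝒜} {W : Op Q} (h : Commute (φ u) W) : Commute (φ (1 + r • u)) W := by
  rw [map_add, map_one, map_smul]
  exact (Commute.one_left W).add_left (h.smul_left r)

theorem exp_sum_involution {𝒜 : Type*} [CommRing 𝒜] [Algebra ℂ 𝒜] (φ : 𝒜 →ₐ[ℂ] Op Q) {ι : Type*}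
    (s : Finset ι) (u : ι → 𝒜) (hu : ∀ i, u i * u i = 1) (b : ℝ) :
    NormedSpace.exp ((b : ℂ) • ∑ i ∈ s, φ (u i)) =
      (Real.cosh b : ℂ) ^ s.card • φ (∏ i ∈ s, (1 + (Real.tanh b : ℂ) • u i)) := by
  classical
  induction s using Finset.induction_on with
  | empty => simp
  | insert i s hi ih =>
    have hc : Commute ((b : ℂ) • φ (u i)) ((b : ℂ) • ∑ j ∈ s, φ (u j)) := by
      refine (Commute.smul_left (Commute.smul_right ?_ _) _)
      rw [← map_sum, Commute, SemiconjBy, ← map_mul, ← map_mul, mul_comm]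
    rw [Finset.sum_insert hi, smul_add, Matrix.exp_add_of_commute _ _ hc, ih,
      exp_smul_involution (by rw [← map_mul, hu, map_one]), Finset.prod_insert hi, map_mul, map_add,
      map_one, map_smul, Finset.card_insert_of_notMem hi, pow_succ', Matrix.smul_mul,
      Matrix.mul_smul, smul_smul]

/-- The product of the factors `1 + f_i a_i` for a family of stabilizers. -/
def stabProd {ι : Type*} [Fintype ι] (a : ι → Q → Fin 2) (f : ι → ℂ) : GA Q :=
  ∏ i, (1 + f i • xx (a i))

theorem stabProd_eq_sum {ι : Type*} [Fintype ι] (a : ι → Q → Fin 2) (f : ι → ℂ) :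
    stabProd a f = ∑ S : Finset ι, (∏ i ∈ S, f i) • xx (∑ i ∈ S, a i) := by
  rw [stabProd, Finset.prod_one_add, Finset.powerset_univ]
  exact Finset.sum_congr rfl fun S _ => prod_smul_xx S f a

/-- In the expansion into Pauli strings only strings equal to the identity have a trace. The
coefficients are nonnegative, so relations between the stabilizers can only increase the
contribution $2^{|Q|}$ of the empty sets. -/
theorem trace_stabProd {ι κ : Type*} [Fintype ι] [Fintype κ] (a : ι → Q → Fin 2)
    (b : κ → Q → Fin 2) (f : ι → ℝ) (g : κ → ℝ) (hf : ∀ i, 0 ≤ f i) (hg : ∀ j, 0 ≤ g j) :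
    ∃ r : ℝ, (2 : ℝ) ^ Fintype.card Q ≤ r ∧
      (phiX (stabProd a fun i => (f i : ℂ)) * phiZ (stabProd b fun j => (g j : ℂ))).trace = r := by
  classical
  refine ⟨∑ S : Finset ι, ∑ T : Finset κ, (∏ i ∈ S, f i) * (∏ j ∈ T, g j) *
    (if ∑ i ∈ S, a i = 0 ∧ ∑ j ∈ T, b j = 0 then (2 : ℝ) ^ Fintype.card Q else 0), ?_, ?_⟩
  · have h0 : ∀ S : Finset ι, ∀ T : Finset κ, 0 ≤ (∏ i ∈ S, f i) * (∏ j ∈ T, g j) *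
        (if ∑ i ∈ S, a i = 0 ∧ ∑ j ∈ T, b j = 0 then (2 : ℝ) ^ Fintype.card Q else 0) := by
      intro S T
      have h1 := Finset.prod_nonneg fun i (_ : i ∈ S) => hf i
      have h2 := Finset.prod_nonneg fun i (_ : i ∈ T) => hg i
      positivity
    refine le_trans ?_ (Finset.single_le_sum (fun S _ => Finset.sum_nonneg fun T _ => h0 S T)
      (Finset.mem_univ ∅))
    refine le_trans ?_ (Finset.single_le_sum (fun T _ => h0 ∅ T) (Finset.mem_univ ∅))
    simp
  · rw [stabProd_eq_sum, stabProd_eq_sum, map_sum, map_sum, Finset.sum_mul, Matrix.trace_sum]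
    push_cast
    refine Finset.sum_congr rfl fun S _ => ?_
    rw [Finset.mul_sum, Matrix.trace_sum]
    refine Finset.sum_congr rfl fun T _ => ?_
    rw [map_smul, map_smul, phiX_xx, phiZ_xx, smul_mul_smul_comm, Matrix.trace_smul,
      trace_paX_mul_paZ, smul_eq_mul]
    split_ifs <;> simp

end GroupAlgebra

/-! ### The Gibbs state as a product of stabilizer factors -/

section GibbsState

variable {L : ℕ} [NeZero L]

/-- The unnormalized thermal distribution of `m`-anyons. -/
def thermX (L : ℕ) [NeZero L] (β : ℝ) : GA (Edge L) :=
  stabProd (fun p : Site L => ind (plaquette p)) fun _ => (Real.tanh β : ℂ)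

/-- The unnormalized thermal distribution of `e`-anyons. -/
def thermZ (L : ℕ) [NeZero L] (β : ℝ) : GA (Edge L) :=
  stabProd (fun p : Site L => ind (vertexStar p)) fun _ => (Real.tanh β : ℂ)

/-- The unnormalized Gibbs state. -/
def therm (L : ℕ) [NeZero L] (β : ℝ) : Op (Edge L) := phiX (thermX L β) * phiZ (thermZ L β)

theorem real_tanh_nonneg {β : ℝ} (hβ : 0 ≤ β) : 0 ≤ Real.tanh β := by
  rw [Real.tanh_eq_sinh_div_cosh]
  exact div_nonneg (Real.sinh_nonneg_iff.2 hβ) (Real.cosh_pos β).le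

theorem trace_therm {β : ℝ} (hβ : 0 ≤ β) :
    ∃ r : ℝ, (2 : ℝ) ^ Fintype.card (Edge L) ≤ r ∧ (therm L β).trace = r :=
  trace_stabProd _ _ _ _ (fun _ => real_tanh_nonneg hβ) fun _ => real_tanh_nonneg hβ

theorem trace_therm_ne_zero {β : ℝ} (hβ : 0 ≤ β) : (therm L β).trace ≠ 0 := by
  obtain ⟨r, hr, h⟩ := trace_therm (L := L) hβ
  rw [h]
  have : (0 : ℝ) < 2 ^ Fintype.card (Edge L) := by positivity
  exact_mod_cast (this.trans_le hr).ne'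

theorem plaquette_commute_star (hL : 2 ≤ L) (p v : Site L) :
    Commute (paX (ind (plaquette p))) (paZ (ind (vertexStar v))) :=
  (paZ_commute_paX (sgn_vertexStar_plaquette hL p v)).symm

/-- The plaquette and vertex terms commute for `2 ≤ L`, so the exponential is a product over the
sites; the powers of $\cosh\beta$ cancel in the normalization. -/
theorem gibbs_eq (hL : 2 ≤ L) (β : ℝ) :
    gibbs L β = (therm L β).trace⁻¹ • therm L β := by
  have e : -(β : ℂ) • toricHamiltonian L =
      (β : ℂ) • ∑ p : Site L, phiX (xx (ind (plaquette p))) +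
        (β : ℂ) • ∑ p : Site L, phiZ (xx (ind (vertexStar p))) := by
    simp only [toricHamiltonian, xString_eq, zString_eq, phiX_xx, phiZ_xx]
    module
  have hc : Commute ((β : ℂ) • ∑ p : Site L, phiX (xx (ind (plaquette p))))
      ((β : ℂ) • ∑ p : Site L, phiZ (xx (ind (vertexStar p)))) := by
    refine Commute.smul_left (Commute.smul_right ?_ _) _
    refine Commute.sum_left _ _ _ fun p _ => Commute.sum_right _ _ _ fun v _ => ?_
    rw [phiX_xx, phiZ_xx]
    exact plaquette_commute_star hL p v
  have h : NormedSpace.exp (-(β : ℂ) • toricHamiltonian L) =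
      ((Real.cosh β : ℂ) ^ (Finset.univ : Finset (Site L)).card *
        (Real.cosh β : ℂ) ^ (Finset.univ : Finset (Site L)).card) • therm L β := by
    rw [e, Matrix.exp_add_of_commute _ _ hc,
      exp_sum_involution phiX _ _ (fun p => xx_mul_self _),
      exp_sum_involution phiZ _ _ (fun p => xx_mul_self _), smul_mul_smul_comm]
    rfl
  have hcosh : (Real.cosh β : ℂ) ≠ 0 := by exact_mod_cast (Real.cosh_pos β).ne'
  rw [gibbs, h, Matrix.trace_smul, smul_eq_mul, smul_smul, mul_inv, mul_comm, ← mul_assoc,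
    mul_inv_cancel₀ (mul_ne_zero (pow_ne_zero _ hcosh) (pow_ne_zero _ hcosh)), one_mul]

theorem trace_gibbs (hL : 2 ≤ L) {β : ℝ} (hβ : 0 ≤ β) : (gibbs L β).trace = 1 := by
  rw [gibbs_eq hL, Matrix.trace_smul, smul_eq_mul, inv_mul_cancel₀ (trace_therm_ne_zero hβ)]

theorem gibbs_zero : gibbs L 0 = maxMixed (Edge L) := by
  rw [gibbs, maxMixed]
  simp only [Complex.ofReal_zero, neg_zero, zero_smul, NormedSpace.exp_zero, Matrix.trace_one]
  congr 2
  simp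

end GibbsState

/-! ### Running a family of block gates or a list of controlled-nots -/

section Runs

variable {Q : Type} [Fintype Q] [DecidableEq Q]

theorem runGates_append (l l' : List (ChannelGate Q)) (ρ : Op Q) :
    runGates (l ++ l') ρ = runGates l' (runGates l ρ) := List.foldl_append ..

theorem isIdeal_append (l l' : List (ChannelGate Q)) (ρ : Op Q) :
    IsIdeal (l ++ l') ρ ↔ IsIdeal l ρ ∧ IsIdeal l' (runGates l ρ) := by
  induction l generalizing ρ with
  | nil => simp [IsIdeal, runGates]
  | cons g l ih =>
    rw [List.cons_append, IsIdeal, IsIdeal, ih, and_assoc]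
    rfl

theorem runGates_cons (g : ChannelGate Q) (l : List (ChannelGate Q)) (ρ : Op Q) :
    runGates (g :: l) ρ = runGates l (g.map ρ) := rfl

variable {ι : Type} [Fintype ι] [DecidableEq ι]

/-- The factors in the thermal distribution of one block, before or after coarse graining. -/
def factors (t : ℂ) (S : Finset ι) (b : ι) : Fin 4 → ℂ :=
  if b ∈ S then ![t ^ 4, 1, 1, 1] else fun _ => t

/-- The product over all blocks of the factors `1 + F b i • x b i`. -/
def blocksProd (x : ι → Fin 4 → Q → Fin 2) (F : ι → Fin 4 → ℂ) : GA Q :=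
  ∏ b, ∏ i, (1 + F b i • xx (x b i))

/-- A family of blocks whose stabilizers are represented by bit strings. -/
structure IsBlockFamily (φ : GA Q →ₐ[ℂ] Op Q) (x : ι → Fin 4 → Q → Fin 2)
    (B : ι → AnyonBlock Q) : Prop where
  isLocal : ∀ b, IsLocalBlock (B b)
  stab_eq : ∀ b i, (B b).stab i = φ (xx (x b i))
  cross : ∀ b b' k i, b ≠ b' → Commute ((B b).hop k) ((B b').stab i)

variable {φ : GA Q →ₐ[ℂ] Op Q} {x : ι → Fin 4 → Q → Fin 2} {B : ι → AnyonBlock Q}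

/-- The factors of one block are split off. The remainder `R` does not depend on the factors of that
block, so the same `R` serves before and after its gate. -/
theorem IsBlockFamily.exists_blocksProd (h : IsBlockFamily φ x B) (b : ι)
    (F : ι → Fin 4 → ℂ) : ∃ R : Op Q, (∀ i, Commute R ((B b).stab i)) ∧
      (∀ k, Commute R ((B b).hop k)) ∧ ∀ F' : ι → Fin 4 → ℂ, (∀ b', b' ≠ b → F' b' = F b') →
        φ (blocksProd x F') = R * blockProd (B b) (F' b) := by
  refine ⟨φ (∏ b' ∈ Finset.univ.erase b, ∏ i, (1 + F b' i • xx (x b' i))), ?_, ?_, ?_⟩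
  · intro i
    rw [h.stab_eq, Commute, SemiconjBy, ← map_mul, ← map_mul, mul_comm]
  · intro k
    refine commute_algHom_prod φ _ _ fun b' hb' => commute_algHom_prod φ _ _ fun i _ =>
      commute_algHom_one_add φ _ ?_
    rw [← h.stab_eq]
    exact (h.cross b b' k i (Finset.ne_of_mem_erase hb').symm).symm
  · intro F' hF'
    have e : blockProd (B b) (F' b) = φ (∏ i, (1 + F' b i • xx (x b i))) := by
      simp only [Fin.prod_univ_four, blockProd, map_mul, map_add, map_one, map_smul, h.stab_eq]
    have e2 : ∏ b' ∈ Finset.univ.erase b, ∏ i, (1 + F b' i • xx (x b' i)) =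
        ∏ b' ∈ Finset.univ.erase b, ∏ i, (1 + F' b' i • xx (x b' i)) :=
      Finset.prod_congr rfl fun b' hb' => by rw [hF' b' (Finset.ne_of_mem_erase hb')]
    rw [e, ← map_mul, e2, Finset.prod_erase_mul _ _ (Finset.mem_univ b)]
    rfl

theorem IsBlockFamily.coarse_step (h : IsBlockFamily φ x B) (t : ℂ) {S : Finset ι} {b : ι}
    (hb : b ∉ S) {Y : Op Q} (hs : ∀ i, Commute Y ((B b).stab i))
    (hh : ∀ k, Commute Y ((B b).hop k)) :
    (coarseGate (B b)).map (Y * φ (blocksProd x (factors t S))) =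
      Y * φ (blocksProd x (factors t (insert b S))) := by
  obtain ⟨R, h1, h2, h3⟩ := h.exists_blocksProd b (factors t S)
  have e1 : factors t S b = fun _ => t := if_neg hb
  have e2 : factors t (insert b S) b = ![t ^ 4, 1, 1, 1] := if_pos (Finset.mem_insert_self _ _)
  rw [h3 _ fun _ _ => rfl, h3 (factors t (insert b S)) fun b' hb' => by
    simp [factors, Finset.mem_insert, hb'], ← mul_assoc, ← mul_assoc,
    coarseGate_map_mul_blockProd (h.isLocal b).toIsAnyonBlock _ _
      (fun i => (hs i).mul_left (h1 i)) (fun k => (hh k).mul_left (h2 k)), e1, e2]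
  congr 3
  simp only [pow_succ, pow_zero, one_mul]

theorem IsBlockFamily.fine_step (h : IsBlockFamily φ x B) (β : ℝ) {S : Finset ι} {b : ι}
    (hb : b ∉ S) {Y : Op Q} (hs : ∀ i, Commute Y ((B b).stab i))
    (hh : ∀ k, Commute Y ((B b).hop k)) :
    (fineGate β (B b)).map (Y * φ (blocksProd x (factors (Real.tanh β : ℂ) (insert b S)))) =
      Y * φ (blocksProd x (factors (Real.tanh β : ℂ) S)) := by
  obtain ⟨R, h1, h2, h3⟩ := h.exists_blocksProd b (factors (Real.tanh β : ℂ) S)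
  have e1 : factors (Real.tanh β : ℂ) S b = fun _ => (Real.tanh β : ℂ) := if_neg hb
  have e2 : factors (Real.tanh β : ℂ) (insert b S) b = ![(Real.tanh β : ℂ) ^ 4, 1, 1, 1] :=
    if_pos (Finset.mem_insert_self _ _)
  rw [h3 _ fun _ _ => rfl, h3 (factors _ (insert b S)) fun b' hb' => by
    simp [factors, Finset.mem_insert, hb'], ← mul_assoc, ← mul_assoc, e1, e2,
    fineGate_map_mul_blockProd (h.isLocal b).toIsAnyonBlock _ _
      (fun i => (hs i).mul_left (h1 i)) (fun k => (hh k).mul_left (h2 k))]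

/-- Induction on the blocks still to be treated, with `S` the set of those already coarse-grained.
Since the order is arbitrary, `S` is generalized. -/
theorem IsBlockFamily.run_coarse (h : IsBlockFamily φ x B) (β : ℝ) {Y : Op Q}
    (hs : ∀ b i, Commute Y ((B b).stab i)) (hh : ∀ b k, Commute Y ((B b).hop k)) (l : List ι)
    (hl : l.Nodup) (S : Finset ι) (hS : ∀ b ∈ l, b ∉ S)
    (hY : (Y * φ (blocksProd x (factors (Real.tanh β : ℂ) S))).IsHermitian) :
    IsIdeal (l.map fun b => coarseGate (B b))
      (Y * φ (blocksProd x (factors (Real.tanh β : ℂ) S))) ∧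
    runGates (l.map fun b => coarseGate (B b))
      (Y * φ (blocksProd x (factors (Real.tanh β : ℂ) S))) =
        Y * φ (blocksProd x (factors (Real.tanh β : ℂ) (S ∪ l.toFinset))) := by
  induction l generalizing S with
  | nil => simp [IsIdeal, runGates]
  | cons b l ih =>
    have hb : b ∉ S := hS b List.mem_cons_self
    have h1 := h.coarse_step (Real.tanh β : ℂ) hb (hs b) (hh b)
    have h2 := h.fine_step β hb (hs b) (hh b)
    have h3 := ih (List.nodup_cons.1 hl).2 (insert b S) (fun c hc hc' => by
      rcases Finset.mem_insert.1 hc' with rfl | hc'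
      · exact (List.nodup_cons.1 hl).1 hc
      · exact hS c (List.mem_cons_of_mem _ hc) hc') (by
        rw [← h1, coarseGate_map_eq (h.isLocal b).toIsAnyonBlock]
        exact kraus_isHermitian _ hY)
    rw [List.map_cons, runGates_cons, IsIdeal, h1]
    -- The fine gate of this one block undoes its coarse gate on the current state, which is the
    -- reversibility needed for the entropy balance.
    refine ⟨⟨coarseGate_correlationPreserving (h.isLocal b) β hY (by rw [h1, h2]), h3.1⟩, ?_⟩
    rw [h3.2, List.toFinset_cons, Finset.insert_union, Finset.union_insert]

theorem IsBlockFamily.run_fine (h : IsBlockFamily φ x B) (β : ℝ) {Y : Op Q}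
    (hs : ∀ b i, Commute Y ((B b).stab i)) (hh : ∀ b k, Commute Y ((B b).hop k)) (l : List ι)
    (hl : l.Nodup) (S : Finset ι) (hS : ∀ b ∈ l, b ∉ S) :
    runGates (l.reverse.map fun b => fineGate β (B b))
      (Y * φ (blocksProd x (factors (Real.tanh β : ℂ) (S ∪ l.toFinset)))) =
        Y * φ (blocksProd x (factors (Real.tanh β : ℂ) S)) := by
  induction l generalizing S with
  | nil => simp [runGates]
  | cons b l ih =>
    have hb : b ∉ S := hS b List.mem_cons_self
    have h3 := ih (List.nodup_cons.1 hl).2 (insert b S) (fun c hc hc' => by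
      rcases Finset.mem_insert.1 hc' with rfl | hc'
      · exact (List.nodup_cons.1 hl).1 hc
      · exact hS c (List.mem_cons_of_mem _ hc) hc')
    rw [List.reverse_cons, List.map_append, runGates_append, List.toFinset_cons,
      Finset.union_insert, ← Finset.insert_union, h3]
    exact h.fine_step β hb (hs b) (hh b)

theorem blocksProd_factors_empty (x : ι → Fin 4 → Q → Fin 2) (t : ℂ) {κ : Type*} [Fintype κ]
    (e : ι × Fin 4 → κ) (he : e.Bijective) (a : κ → Q → Fin 2) (ha : ∀ b i, x b i = a (e (b, i))) :
    blocksProd x (factors t ∅) = stabProd a fun _ => t := by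
  rw [stabProd, ← Fintype.prod_bijective e he (fun y => 1 + t • xx (a (e y))) _ fun _ => rfl,
    Fintype.prod_prod_type, blocksProd]
  refine Finset.prod_congr rfl fun b _ => Finset.prod_congr rfl fun i _ => ?_
  rw [ha]; rfl

theorem runGates_trace (l : List (ChannelGate Q))
    (hl : ∀ g ∈ l, IsChannelOn g.supp g.map) (ρ : Op Q) : (runGates l ρ).trace = ρ.trace := by
  induction l generalizing ρ with
  | nil => rfl
  | cons g l ih =>
    rw [runGates_cons, ih fun g' hg' => hl g' (List.mem_cons_of_mem _ hg')]
    obtain ⟨n, K, hK, h⟩ := hl g List.mem_cons_self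
    rw [h, Matrix.trace_sum]
    have : ∀ i, (embed g.supp (K i) * ρ * (embed g.supp (K i))ᴴ).trace =
        (embed g.supp ((K i)ᴴ * K i) * ρ).trace := by
      intro i
      rw [Matrix.trace_mul_comm, ← Matrix.mul_assoc, embed_eq, embed_eq,
        emb_mul Subtype.val_injective, emb_conjTranspose]
    rw [Finset.sum_congr rfl fun i _ => this i, ← Matrix.trace_sum, ← Matrix.sum_mul]
    simp only [embed_eq]
    have e := map_sum (embHom (Subtype.val : {q // q ∈ g.supp} → Q) Subtype.val_injective)
      (fun i => (K i)ᴴ * K i) Finset.univ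
    rw [hK, map_one] at e
    have e' : (1 : Op Q) = ∑ i, emb Subtype.val ((K i)ᴴ * K i) := e
    rw [← e', Matrix.one_mul]

theorem runGates_isHermitian (l : List (ChannelGate Q))
    (hl : ∀ g ∈ l, IsChannelOn g.supp g.map) {ρ : Op Q} (hρ : ρ.IsHermitian) :
    (runGates l ρ).IsHermitian := by
  induction l generalizing ρ with
  | nil => exact hρ
  | cons g l ih =>
    rw [runGates_cons]
    refine ih (fun g' hg' => hl g' (List.mem_cons_of_mem _ hg')) ?_
    obtain ⟨n, K, -, h⟩ := hl g List.mem_cons_self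
    rw [h]
    exact kraus_isHermitian _ hρ

theorem isIdeal_cnot (l : List (Q × Q)) (hl : ∀ e ∈ l, e.1 ≠ e.2) {ρ : Op Q}
    (hρ : ρ.IsHermitian) : IsIdeal (l.map cnotGate) ρ := by
  induction l generalizing ρ with
  | nil => trivial
  | cons e l ih =>
    refine ⟨cnotGate_correlationPreserving (hl e List.mem_cons_self) hρ,
      ih (fun e' he' => hl e' (List.mem_cons_of_mem _ he')) ?_⟩
    exact Matrix.isHermitian_mul_mul_conjTranspose _ hρ

/-- The composition of a list of controlled-nots. -/
def cnots (l : List (Q × Q)) : Op Q := l.foldl (fun W e => cnot e.1 e.2 * W) 1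

theorem cnots_append (l l' : List (Q × Q)) : cnots (l ++ l') = cnots l' * cnots l := by
  have : ∀ W : Op Q, l'.foldl (fun W e => cnot e.1 e.2 * W) W = cnots l' * W := by
    induction l' with
    | nil => intro W; simp [cnots]
    | cons e l' ih =>
      intro W
      rw [List.foldl_cons, ih, ← Matrix.mul_assoc]
      congr 1
      change cnots l' * _ = l'.foldl _ (cnot e.1 e.2 * 1)
      rw [ih, Matrix.mul_one]
  rw [cnots, List.foldl_append, this]
  rfl

theorem cnots_cons (e : Q × Q) (l : List (Q × Q)) :
    cnots (e :: l) = cnots l * cnot e.1 e.2 := by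
  rw [← List.singleton_append, cnots_append]
  congr 1
  simp [cnots]

theorem runGates_cnots (l : List (Q × Q)) (ρ : Op Q) :
    runGates (l.map cnotGate) ρ = cnots l * ρ * (cnots l)ᴴ := by
  induction l generalizing ρ with
  | nil => simp [runGates, cnots]
  | cons e l ih =>
    rw [List.map_cons, runGates_cons, ih, cnots_cons, Matrix.conjTranspose_mul]
    simp only [cnotGate, Matrix.mul_assoc]

theorem runGates_cnots_reverse (l : List (Q × Q)) (hl : ∀ e ∈ l, e.1 ≠ e.2) (ρ : Op Q) :
    runGates (l.map cnotGate).reverse (runGates (l.map cnotGate) ρ) = ρ := by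
  induction l generalizing ρ with
  | nil => rfl
  | cons e l ih =>
    have he := hl e List.mem_cons_self
    rw [List.map_cons, runGates_cons, List.reverse_cons, runGates_append,
      ih fun e' he' => hl e' (List.mem_cons_of_mem _ he')]
    change cnot e.1 e.2 * (cnot e.1 e.2 * ρ * (cnot e.1 e.2)ᴴ) * (cnot e.1 e.2)ᴴ = ρ
    rw [cnot_conjTranspose he, ← Matrix.mul_assoc, ← Matrix.mul_assoc, cnot_mul_self he,
      Matrix.one_mul, Matrix.mul_assoc, cnot_mul_self he, Matrix.mul_one]

/-- The action of a list of controlled-nots on `X` strings. -/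
def chainX (l : List (Q × Q)) (a : Q → Fin 2) : Q → Fin 2 :=
  l.foldl (fun a e => cnotMap e.1 e.2 a) a

/-- The action of a list of controlled-nots on `Z` strings. -/
def chainZ (l : List (Q × Q)) (a : Q → Fin 2) : Q → Fin 2 :=
  l.foldl (fun a e => cnotMap e.2 e.1 a) a

theorem cnots_mul_paX (l : List (Q × Q)) (hl : ∀ e ∈ l, e.1 ≠ e.2) (a : Q → Fin 2) :
    cnots l * paX a = paX (chainX l a) * cnots l := by
  induction l generalizing a with
  | nil => simp [cnots, chainX]
  | cons e l ih =>
    rw [cnots_cons, Matrix.mul_assoc, cnot_mul_paX (hl e List.mem_cons_self), ← Matrix.mul_assoc,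
      ih fun e' he' => hl e' (List.mem_cons_of_mem _ he'), Matrix.mul_assoc]
    rfl

theorem cnots_mul_paZ (l : List (Q × Q)) (hl : ∀ e ∈ l, e.1 ≠ e.2) (a : Q → Fin 2) :
    cnots l * paZ a = paZ (chainZ l a) * cnots l := by
  induction l generalizing a with
  | nil => simp [cnots, chainZ]
  | cons e l ih =>
    rw [cnots_cons, Matrix.mul_assoc, cnot_mul_paZ (hl e List.mem_cons_self), ← Matrix.mul_assoc,
      ih fun e' he' => hl e' (List.mem_cons_of_mem _ he'), Matrix.mul_assoc]
    rfl

theorem cnots_unitary (l : List (Q × Q)) (hl : ∀ e ∈ l, e.1 ≠ e.2) :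
    cnots l * (cnots l)ᴴ = 1 := by
  induction l with
  | nil => simp [cnots]
  | cons e l ih =>
    have he := hl e List.mem_cons_self
    rw [cnots_cons, Matrix.conjTranspose_mul, Matrix.mul_assoc, ← Matrix.mul_assoc (cnot e.1 e.2),
      cnot_conjTranspose he, cnot_mul_self he, Matrix.one_mul,
      ih fun e' he' => hl e' (List.mem_cons_of_mem _ he')]

theorem intertwine_prod (φ : GA Q →ₐ[ℂ] Op Q) (W : Op Q) {κ : Type*} (s : Finset κ)
    (u v : κ → GA Q) (h : ∀ i ∈ s, W * φ (u i) = φ (v i) * W) :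
    W * φ (∏ i ∈ s, u i) = φ (∏ i ∈ s, v i) * W := by
  classical
  induction s using Finset.induction_on with
  | empty => simp
  | insert i s hi ih =>
    rw [Finset.prod_insert hi, Finset.prod_insert hi, map_mul, map_mul, ← mul_assoc,
      h i (Finset.mem_insert_self _ _), mul_assoc, mul_assoc,
      ih fun j hj => h j (Finset.mem_insert_of_mem hj)]

theorem intertwine_blocksProd (φ : GA Q →ₐ[ℂ] Op Q) (W : Op Q) (x y : ι → Fin 4 → Q → Fin 2)
    (F : ι → Fin 4 → ℂ) (h : ∀ b i, W * φ (xx (x b i)) = φ (xx (y b i)) * W) :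
    W * φ (blocksProd x F) = φ (blocksProd y F) * W := by
  refine intertwine_prod φ W _ _ _ fun b _ => intertwine_prod φ W _ _ _ fun i _ => ?_
  rw [map_add, map_add, map_one, map_smul, map_smul, mul_add, add_mul, Matrix.mul_smul,
    Matrix.smul_mul, h, mul_one, one_mul]

/-- Conjugation only replaces each stabilizer by its image; controlled-nots map $X$ strings to $X$
strings and $Z$ strings to $Z$ strings. -/
theorem cnots_conj_blocksProd (l : List (Q × Q)) (hl : ∀ e ∈ l, e.1 ≠ e.2)
    (x z : ι → Fin 4 → Q → Fin 2) (F G : ι → Fin 4 → ℂ) :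
    cnots l * (phiX (blocksProd x F) * phiZ (blocksProd z G)) * (cnots l)ᴴ =
      phiX (blocksProd (fun b i => chainX l (x b i)) F) *
        phiZ (blocksProd (fun b i => chainZ l (z b i)) G) := by
  have h1 := intertwine_blocksProd phiX (cnots l) x (fun b i => chainX l (x b i)) F
    fun b i => by rw [phiX_xx, phiX_xx, cnots_mul_paX l hl]
  have h2 := intertwine_blocksProd phiZ (cnots l) z (fun b i => chainZ l (z b i)) G
    fun b i => by rw [phiZ_xx, phiZ_xx, cnots_mul_paZ l hl]
  rw [← Matrix.mul_assoc, h1, Matrix.mul_assoc _ (cnots l), h2, Matrix.mul_assoc, Matrix.mul_assoc,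
    cnots_unitary l hl, Matrix.mul_one]

end Runs

/-! ### The block gates of the toric code -/

section ToricRuns

variable {M : ℕ} [NeZero M]

theorem plaqBlock_family : IsBlockFamily phiX
    (fun (b : Site M) i => ind (plaquette (plaqSite b i))) (plaqBlock M) where
  isLocal b := plaqBlock_isLocal b
  stab_eq b i := by rw [plaqBlock_stab, phiX_xx]
  cross b b' k i h := by
    have := plaqBlock_hop_stab b b' k i
    rwa [if_neg h.symm, Fin.val_zero, pow_zero, one_smul] at this

theorem vertBlock_family : IsBlockFamily phiZ
    (fun (b : Site M) i => ind (vertexStar (vertSite b i))) (vertBlock M) where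
  isLocal b := vertBlock_isLocal b
  stab_eq b i := by rw [vertBlock_stab, phiZ_xx]
  cross b b' k i h := by
    have := vertBlock_hop_stab b b' k i
    rwa [if_neg h.symm, Fin.val_zero, pow_zero, one_smul] at this

/-- The distribution of `m`-anyons when the blocks in `S` are coarse-grained. -/
def partX (M : ℕ) [NeZero M] (β : ℝ) (S : Finset (Site M)) : Op (Edge (2 * M)) :=
  phiX (blocksProd (fun b i => ind (plaquette (plaqSite b i))) (factors (Real.tanh β : ℂ) S))

/-- The distribution of `e`-anyons when the blocks in `S` are coarse-grained. -/
def partZ (M : ℕ) [NeZero M] (β : ℝ) (S : Finset (Site M)) : Op (Edge (2 * M)) :=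
  phiZ (blocksProd (fun b i => ind (vertexStar (vertSite b i))) (factors (Real.tanh β : ℂ) S))

theorem therm_eq_part (β : ℝ) : therm (2 * M) β = partX M β ∅ * partZ M β ∅ := by
  rw [therm, partX, partZ, thermX, thermZ,
    ← blocksProd_factors_empty _ _ _ plaqSite_bij (fun p => ind (plaquette p)) fun _ _ => rfl,
    ← blocksProd_factors_empty _ _ _ vertSite_bij (fun p => ind (vertexStar p)) fun _ _ => rfl]

theorem partX_commute_partZ (β : ℝ) (S T : Finset (Site M)) :
    Commute (partX M β S) (partZ M β T) := by
  have h2 : 2 ≤ 2 * M := by have := NeZero.pos M; omega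
  refine commute_algHom_prod _ _ _ fun b _ => commute_algHom_prod _ _ _ fun i _ =>
    commute_algHom_one_add _ _ ?_
  refine (commute_algHom_prod _ _ _ fun b' _ => commute_algHom_prod _ _ _ fun i' _ =>
    commute_algHom_one_add _ _ ?_).symm
  rw [phiX_xx, phiZ_xx]
  exact (plaquette_commute_star h2 _ _).symm

theorem partZ_commute_stab (β : ℝ) (S : Finset (Site M)) (b : Site M) (i : Fin 4) :
    Commute (partZ M β S) ((plaqBlock M b).stab i) := by
  have h2 : 2 ≤ 2 * M := by have := NeZero.pos M; omega
  refine commute_algHom_prod _ _ _ fun b' _ => commute_algHom_prod _ _ _ fun i' _ =>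
    commute_algHom_one_add _ _ ?_
  rw [phiZ_xx, plaqBlock_stab]
  exact (plaquette_commute_star h2 _ _).symm

theorem partX_commute_stab (β : ℝ) (S : Finset (Site M)) (b : Site M) (i : Fin 4) :
    Commute (partX M β S) ((vertBlock M b).stab i) := by
  have h2 : 2 ≤ 2 * M := by have := NeZero.pos M; omega
  refine commute_algHom_prod _ _ _ fun b' _ => commute_algHom_prod _ _ _ fun i' _ =>
    commute_algHom_one_add _ _ ?_
  rw [phiX_xx, vertBlock_stab]
  exact plaquette_commute_star h2 _ _

theorem partZ_commute_hop (β : ℝ) (S : Finset (Site M)) (b : Site M) (k : Fin 3) :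
    Commute (partZ M β S) ((plaqBlock M b).hop k) := by
  refine commute_algHom_prod _ _ _ fun b' _ => commute_algHom_prod _ _ _ fun i' _ =>
    commute_algHom_one_add _ _ ?_
  rw [phiZ_xx, plaqBlock_hop]
  exact paZ_commute _ _

theorem partX_commute_hop (β : ℝ) (S : Finset (Site M)) (b : Site M) (k : Fin 3) :
    Commute (partX M β S) ((vertBlock M b).hop k) := by
  refine commute_algHom_prod _ _ _ fun b' _ => commute_algHom_prod _ _ _ fun i' _ =>
    commute_algHom_one_add _ _ ?_
  rw [phiX_xx, vertBlock_hop]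
  exact paX_commute _ _

theorem toFinset_of_perm_blocks {l : List (Site M)} (hl : l.Perm (blocks M)) :
    l.toFinset = Finset.univ := by
  rw [List.toFinset_eq_of_perm _ _ hl, blocks, Finset.toList_toFinset]

theorem nodup_of_perm_blocks {l : List (Site M)} (hl : l.Perm (blocks M)) : l.Nodup :=
  hl.nodup_iff.2 (Finset.nodup_toList _)

/-- The vertex factors commute with the plaquette stabilizers and with the $Z$ hops, so they are
spectators of the plaquette gates; then the coarse-grained plaquette factors are spectators of the
vertex gates. -/
theorem run_coarse_toric (c : ℂ) (β : ℝ) {lX lZ : List (Site M)} (hX : lX.Perm (blocks M))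
    (hZ : lZ.Perm (blocks M)) (hρ : (c • therm (2 * M) β).IsHermitian) :
    IsIdeal (lX.map (fun b => coarseGate (plaqBlock M b)) ++
        lZ.map (fun b => coarseGate (vertBlock M b))) (c • therm (2 * M) β) ∧
      runGates (lX.map (fun b => coarseGate (plaqBlock M b)) ++
        lZ.map (fun b => coarseGate (vertBlock M b))) (c • therm (2 * M) β) =
          c • (partX M β Finset.univ * partZ M β Finset.univ) := by
  have e1 : c • therm (2 * M) β = (c • partZ M β ∅) * partX M β ∅ := by
    rw [therm_eq_part, (partX_commute_partZ β ∅ ∅).eq, Matrix.smul_mul]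
  have h1 := plaqBlock_family.run_coarse β (Y := c • partZ M β ∅)
    (fun b i => (partZ_commute_stab β ∅ b i).smul_left c)
    (fun b i => (partZ_commute_hop β ∅ b i).smul_left c) lX (nodup_of_perm_blocks hX) ∅
    (fun _ _ h => Finset.notMem_empty _ h) (by rw [e1] at hρ; exact hρ)
  have e2 : (c • partZ M β ∅) * partX M β Finset.univ =
      (c • partX M β Finset.univ) * partZ M β ∅ := by
    rw [Matrix.smul_mul, Matrix.smul_mul, (partX_commute_partZ β Finset.univ ∅).eq]
  rw [Finset.empty_union, toFinset_of_perm_blocks hX] at h1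
  change IsIdeal _ ((c • partZ M β ∅) * partX M β ∅) ∧ runGates _ ((c • partZ M β ∅) * partX M β ∅)
    = (c • partZ M β ∅) * partX M β Finset.univ at h1
  -- Hermiticity of the intermediate state is inherited through the channels, so nothing is needed
  -- about the scalar `c`.
  have hρ2 : ((c • partX M β Finset.univ) * partZ M β ∅).IsHermitian := by
    rw [← e2, ← h1.2, ← e1]
    refine runGates_isHermitian _ (fun g hg => ?_) hρ
    obtain ⟨b, -, rfl⟩ := List.mem_map.1 hg
    exact (plaqBlock_isLocal b).coarse_isChannelOn
  have h2 := vertBlock_family.run_coarse β (Y := c • partX M β Finset.univ)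
    (fun b i => (partX_commute_stab β _ b i).smul_left c)
    (fun b i => (partX_commute_hop β _ b i).smul_left c) lZ (nodup_of_perm_blocks hZ) ∅
    (fun _ _ h => Finset.notMem_empty _ h) hρ2
  rw [Finset.empty_union, toFinset_of_perm_blocks hZ] at h2
  change IsIdeal _ ((c • partX M β Finset.univ) * partZ M β ∅) ∧
    runGates _ ((c • partX M β Finset.univ) * partZ M β ∅)
      = (c • partX M β Finset.univ) * partZ M β Finset.univ at h2
  rw [isIdeal_append, runGates_append, e1, h1.2, e2]
  exact ⟨⟨h1.1, h2.1⟩, by rw [h2.2, Matrix.smul_mul]⟩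

theorem run_fine_toric (c : ℂ) (β : ℝ) {lX lZ : List (Site M)} (hX : lX.Perm (blocks M))
    (hZ : lZ.Perm (blocks M)) :
    runGates (lZ.reverse.map (fun b => fineGate β (vertBlock M b)) ++
        lX.reverse.map (fun b => fineGate β (plaqBlock M b)))
          (c • (partX M β Finset.univ * partZ M β Finset.univ)) = c • therm (2 * M) β := by
  have e1 : c • therm (2 * M) β = (c • partZ M β ∅) * partX M β ∅ := by
    rw [therm_eq_part, (partX_commute_partZ β ∅ ∅).eq, Matrix.smul_mul]
  have e2 : (c • partZ M β ∅) * partX M β Finset.univ =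
      (c • partX M β Finset.univ) * partZ M β ∅ := by
    rw [Matrix.smul_mul, Matrix.smul_mul, (partX_commute_partZ β Finset.univ ∅).eq]
  have h1 := plaqBlock_family.run_fine β (Y := c • partZ M β ∅)
    (fun b i => (partZ_commute_stab β ∅ b i).smul_left c)
    (fun b i => (partZ_commute_hop β ∅ b i).smul_left c) lX (nodup_of_perm_blocks hX) ∅
    (fun _ _ h => Finset.notMem_empty _ h)
  have h2 := vertBlock_family.run_fine β (Y := c • partX M β Finset.univ)
    (fun b i => (partX_commute_stab β _ b i).smul_left c)
    (fun b i => (partX_commute_hop β _ b i).smul_left c) lZ (nodup_of_perm_blocks hZ) ∅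
    (fun _ _ h => Finset.notMem_empty _ h)
  rw [Finset.empty_union, toFinset_of_perm_blocks hX] at h1
  rw [Finset.empty_union, toFinset_of_perm_blocks hZ] at h2
  change runGates _ ((c • partZ M β ∅) * partX M β Finset.univ) =
    (c • partZ M β ∅) * partX M β ∅ at h1
  change runGates _ ((c • partX M β Finset.univ) * partZ M β Finset.univ) =
    (c • partX M β Finset.univ) * partZ M β ∅ at h2
  rw [runGates_append, ← Matrix.smul_mul, h2, ← e2, h1, e1]

end ToricRuns

/-! ### The disentangling circuit as a linear map on bit strings -/

section Layers

variable {Q : Type} [Fintype Q] [DecidableEq Q]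

theorem chainX_append (l l' : List (Q × Q)) (a : Q → Fin 2) :
    chainX (l ++ l') a = chainX l' (chainX l a) := List.foldl_append ..

theorem chainZ_append (l l' : List (Q × Q)) (a : Q → Fin 2) :
    chainZ (l ++ l') a = chainZ l' (chainZ l a) := List.foldl_append ..

/-- No control of the layer is a target of the layer, so every controlled-not reads the original
value and all of them act at once. -/
theorem foldl_cnotMap {ι : Type} (e f : ι → Q) (h : ∀ b b', e b ≠ f b') (l : List ι)
    (a : Q → Fin 2) : l.foldl (fun a b => cnotMap (e b) (f b) a) a =
      a + (l.map fun b => Pi.single (f b) (a (e b))).sum := by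
  induction l generalizing a with
  | nil => simp
  | cons b l ih =>
    rw [List.foldl_cons, ih, List.map_cons, List.sum_cons, ← add_assoc]
    have : ∀ b', cnotMap (e b) (f b) a (e b') = a (e b') := by
      intro b'
      simp [cnotMap, Pi.single_eq_of_ne (h b' b)]
    simp only [this]
    rfl

/-- The positions of a link within its block. -/
abbrev Species : Type := Bool × Fin 2 × Fin 2

variable {M : ℕ} [NeZero M]

/-- The link of a given species in the block at `b`. -/
def link (s : Species) (b : Site M) : Edge (2 * M) := (s.1, cell s.2.1 s.2.2 b)

theorem link_inj {s s' : Species} {b b' : Site M} : link s b = link s' b' ↔ s = s' ∧ b = b' := by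
  obtain ⟨o, i, j⟩ := s
  obtain ⟨o', i', j'⟩ := s'
  simp only [link, Prod.mk.injEq, cell_inj]
  tauto

theorem link_surj (e : Edge (2 * M)) : ∃ s b, link (M := M) s b = e := by
  obtain ⟨i, j, b, h⟩ := cell_surj (M := M) e.2
  exact ⟨(e.1, i, j), b, Prod.ext rfl h⟩

/-- A layer of controlled-nots, one for each block. -/
def layerCnots (M : ℕ) [NeZero M] (S T : Species) (d : Site M) :
    List (Edge (2 * M) × Edge (2 * M)) :=
  (blocks M).map fun b => (link S b, link T (b + d))

theorem sum_blocks {N : Type*} [AddCommMonoid N] (F : Site M → N) :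
    ((blocks M).map F).sum = ∑ b, F b := by
  rw [blocks, Finset.sum_map_toList]

theorem chainX_layer (S T : Species) (hST : S ≠ T) (d : Site M) (a : Edge (2 * M) → Fin 2)
    (U : Species) (c : Site M) : chainX (layerCnots M S T d) a (link U c) =
      a (link U c) + if U = T then a (link S (c - d)) else 0 := by
  rw [chainX, layerCnots, List.foldl_map,
    foldl_cnotMap (link S) (fun b => link T (b + d)) fun b b' h => hST (link_inj.1 h).1, sum_blocks,
    Pi.add_apply, Finset.sum_apply]
  congr 1
  rw [Finset.sum_eq_single (c - d)]
  · rw [sub_add_cancel, Pi.single_apply]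
    simp only [link_inj, and_true]
  · intro b _ hb
    refine Pi.single_eq_of_ne (fun h => hb ?_) _
    rw [(link_inj.1 h).2, add_sub_cancel_right]
  · simp

/-- $Z$ strings travel against the controlled-not, from the target in the displaced block back to
the control; hence `c + d` in place of `c - d`. -/
theorem chainZ_layer (S T : Species) (hST : S ≠ T) (d : Site M) (a : Edge (2 * M) → Fin 2)
    (U : Species) (c : Site M) : chainZ (layerCnots M S T d) a (link U c) =
      a (link U c) + if U = S then a (link T (c + d)) else 0 := by
  rw [chainZ, layerCnots, List.foldl_map,
    foldl_cnotMap (fun b => link T (b + d)) (link S) fun b b' h => hST (link_inj.1 h).1.symm,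
    sum_blocks, Pi.add_apply, Finset.sum_apply]
  congr 1
  rw [Finset.sum_eq_single c]
  · rw [Pi.single_apply]
    simp only [link_inj, and_true]
  · intro b _ hb
    exact Pi.single_eq_of_ne (fun h => hb (link_inj.1 h).2.symm) _
  · simp

/-- The controls, the targets and the displacements in the layers of the disentangling circuit. -/
def layerData (M : ℕ) [NeZero M] : List (Species × Species × Site M) :=
  [((false, 1, 1), (false, 1, 0), 0), ((false, 1, 1), (true, 1, 0), 0),
   ((false, 1, 1), (true, 0, 0), (1, 0)), ((false, 0, 1), (false, 0, 0), 0),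
   ((false, 0, 1), (true, 0, 0), 0), ((false, 0, 1), (true, 1, 0), 0),
   ((true, 1, 1), (false, 1, 0), (0, 1)), ((true, 1, 1), (true, 0, 1), (1, 0)),
   ((true, 1, 1), (false, 1, 0), 0), ((true, 1, 1), (true, 1, 0), 0),
   ((true, 1, 1), (true, 0, 0), (1, 0)), ((false, 1, 0), (false, 0, 0), 0),
   ((true, 0, 1), (true, 0, 0), 0)]

/-- The controlled-nots of the disentangling circuit. -/
def allCnots (M : ℕ) [NeZero M] : List (Edge (2 * M) × Edge (2 * M)) :=
  (layerData M).flatMap fun x => layerCnots M x.1 x.2.1 x.2.2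

theorem disentanglers_eq (b : Site M) : disentanglers b =
    (layerData M).map fun x => (link x.1 b, link x.2.1 (b + x.2.2)) := by
  have e1 : corner b + (2, 0) = cell 0 0 (b + (1, 0)) := by
    rw [cell_zero_zero, corner_add_one_zero]
  have e2 : corner b + (2, 1) = cell 0 1 (b + (1, 0)) := by
    rw [cell_zero_one, corner_add_one_zero, add_assoc]; simp
  have e3 : corner b + (1, 2) = cell 1 0 (b + (0, 1)) := by
    rw [cell_one_zero, corner_add_zero_one, add_assoc]; simp
  simp only [disentanglers, layerData, List.map_cons, List.map_nil, link, horiz, vert, e1, e2, e3,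
    add_zero, cell_zero_zero b, cell_one_zero b, cell_zero_one b, cell_one_one b]

theorem disentangleGates_eq : disentangleGates M = (allCnots M).map cnotGate := by
  have h : ∀ i ∈ List.range 13, (blocks M).filterMap (fun b =>
      ((disentanglers b)[i]?).map cnotGate) =
      (((layerData M)[i]?.toList).flatMap fun x => layerCnots M x.1 x.2.1 x.2.2).map cnotGate := by
    intro i hi
    have hi' : i < (layerData M).length := List.mem_range.1 hi
    simp only [disentanglers_eq, List.getElem?_map, List.getElem?_eq_getElem hi', Option.map_some,
      Option.toList_some, List.flatMap_singleton, layerCnots, List.map_map]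
    exact congrFun List.filterMap_eq_map _
  have e : layerData M = (List.range 13).flatMap fun i => (layerData M)[i]?.toList := rfl
  rw [disentangleGates, allCnots, e, List.flatMap_assoc, List.map_flatMap]
  exact List.flatMap_congr h

theorem allCnots_ne (e : Edge (2 * M) × Edge (2 * M)) (he : e ∈ allCnots M) : e.1 ≠ e.2 := by
  obtain ⟨x, hx, he⟩ := List.mem_flatMap.1 he
  obtain ⟨b, -, rfl⟩ := List.mem_map.1 he
  have : ∀ x ∈ layerData M, x.1 ≠ x.2.1 := by simp [layerData]
  exact fun h => this x hx (link_inj.1 h).1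

/-- The boundary of a set of plaquettes, by species. -/
def boundaryX (w : Fin 2 → Fin 2 → Site M → Fin 2) (s : Species) (c : Site M) : Fin 2 :=
  if s.1 then (if s.2.1 = 0 then w 0 s.2.2 c + w 1 s.2.2 (c - (1, 0))
    else w 1 s.2.2 c + w 0 s.2.2 c)
  else (if s.2.2 = 0 then w s.2.1 0 c + w s.2.1 1 (c - (0, 1)) else w s.2.1 1 c + w s.2.1 0 c)

/-- The coboundary of a set of vertices, by species. -/
def boundaryZ (w : Fin 2 → Fin 2 → Site M → Fin 2) (s : Species) (c : Site M) : Fin 2 :=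
  if s.1 then (if s.2.2 = 0 then w s.2.1 0 c + w s.2.1 1 c
    else w s.2.1 1 c + w s.2.1 0 (c + (0, 1)))
  else (if s.2.1 = 0 then w 0 s.2.2 c + w 1 s.2.2 c else w 1 s.2.2 c + w 0 s.2.2 (c + (1, 0)))

/-- The image of `boundaryX w` under the disentangling circuit. -/
def imageX (w : Fin 2 → Fin 2 → Site M → Fin 2) (s : Species) (c : Site M) : Fin 2 :=
  if s = (false, 1, 0) then w 0 1 c + w 0 1 (c - (0, 1)) else
  if s = (true, 0, 1) then w 0 1 c + w 0 1 (c - (1, 0)) else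
  if s = (false, 0, 1) then w 0 1 c + w 0 0 c else
  if s = (false, 1, 1) then w 1 1 c + w 1 0 c else
  if s = (true, 1, 1) then w 0 1 c + w 1 1 c else 0

/-- The image of `boundaryZ w` under the disentangling circuit. -/
def imageZ (w : Fin 2 → Fin 2 → Site M → Fin 2) (s : Species) (c : Site M) : Fin 2 :=
  if s = (false, 1, 0) then w 0 0 c + w 0 0 (c + (1, 0)) else
  if s = (true, 0, 1) then w 0 0 c + w 0 0 (c + (0, 1)) else
  if s = (false, 0, 0) then w 0 0 c + w 1 0 c else
  if s = (true, 1, 0) then w 1 0 c + w 1 1 c else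
  if s = (true, 0, 0) then w 0 0 c + w 0 1 c else 0

/-- The circuit is translation invariant, so it suffices to follow the eight species of links
through the thirteen layers; terms cancel in pairs modulo two. -/
theorem chainX_allCnots (w : Fin 2 → Fin 2 → Site M → Fin 2) (a : Edge (2 * M) → Fin 2)
    (ha : ∀ s c, a (link s c) = boundaryX w s c) (s : Species) (c : Site M) :
    chainX (allCnots M) a (link s c) = imageX w s c := by
  simp only [allCnots, layerData, List.flatMap_cons, List.flatMap_nil, chainX_append]
  rw [chainX, List.foldl_nil]
  obtain ⟨o, i, j⟩ := s
  fin_cases o <;> fin_cases i <;> fin_cases j <;>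
  simp [chainX_layer, imageX, ha, boundaryX] <;> grind

theorem chainZ_allCnots (w : Fin 2 → Fin 2 → Site M → Fin 2) (a : Edge (2 * M) → Fin 2)
    (ha : ∀ s c, a (link s c) = boundaryZ w s c) (s : Species) (c : Site M) :
    chainZ (allCnots M) a (link s c) = imageZ w s c := by
  simp only [allCnots, layerData, List.flatMap_cons, List.flatMap_nil, chainZ_append]
  rw [chainZ, List.foldl_nil]
  obtain ⟨o, i, j⟩ := s
  fin_cases o <;> fin_cases i <;> fin_cases j <;>
  simp [chainZ_layer, imageZ, ha, boundaryZ] <;>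
    try rw [add_right_comm c (0, 1) (1, 0)]
  all_goals grind

/-- The indicator of one site of a block. -/
def siteInd (k : Fin 2 × Fin 2) (b : Site M) (i j : Fin 2) (c : Site M) : Fin 2 :=
  if k = (i, j) ∧ b = c then 1 else 0

theorem siteInd_eq (k : Fin 2 × Fin 2) (b c : Site M) (i j : Fin 2) :
    siteInd k b i j c = ibit (cell k.1 k.2 b = cell i j c) := by
  obtain ⟨k, l⟩ := k
  simp only [siteInd, ibit, cell_inj, Prod.mk.injEq, and_assoc]

theorem two_le_two_mul : 2 ≤ 2 * M := by have := NeZero.pos M; omega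

theorem plaquette_eq_boundary (k : Fin 2 × Fin 2) (b : Site M) (s : Species) (c : Site M) :
    ind (plaquette (cell k.1 k.2 b)) (link s c) = boundaryX (siteInd k b) s c := by
  obtain ⟨o, i, j⟩ := s
  have h2 := two_le_two_mul (M := M)
  have hu : ∀ i, cell i 0 c = cell i 1 (c - (0, 1)) + (0, 1) := fun i => by
    rw [cell_add_up', sub_add_cancel]
  have hr : ∀ j, cell 0 j c = cell 1 j (c - (1, 0)) + (1, 0) := fun j => by
    rw [cell_add_right', sub_add_cancel]
  cases o
  · rw [show link (false, i, j) c = horiz (cell i j c) from rfl, ind_plaquette_horiz h2]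
    fin_cases j
    · simp only [boundaryX, siteInd_eq, Fin.zero_eta, hu, add_left_inj]; simp [← hu]
    · simp only [boundaryX, siteInd_eq, Fin.mk_one, add_eq_cell_up]; simp
  · rw [show link (true, i, j) c = vert (cell i j c) from rfl, ind_plaquette_vert h2]
    fin_cases i
    · simp only [boundaryX, siteInd_eq, Fin.zero_eta, hr, add_left_inj]; simp [← hr]
    · simp only [boundaryX, siteInd_eq, Fin.mk_one, add_eq_cell_right]; simp

theorem star_eq_boundary (k : Fin 2 × Fin 2) (b : Site M) (s : Species) (c : Site M) :
    ind (vertexStar (cell k.1 k.2 b)) (link s c) = boundaryZ (siteInd k b) s c := by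
  obtain ⟨o, i, j⟩ := s
  have h2 := two_le_two_mul (M := M)
  cases o
  · rw [show link (false, i, j) c = horiz (cell i j c) from rfl, ind_vertexStar_horiz h2]
    fin_cases i
    · simp only [boundaryZ, siteInd_eq, Fin.zero_eta, cell_add_right]; simp
    · simp only [boundaryZ, siteInd_eq, Fin.mk_one, cell_add_right']; simp
  · rw [show link (true, i, j) c = vert (cell i j c) from rfl, ind_vertexStar_vert h2]
    fin_cases j
    · simp only [boundaryZ, siteInd_eq, Fin.zero_eta, cell_add_up]; simp
    · simp only [boundaryZ, siteInd_eq, Fin.mk_one, cell_add_up']; simp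

theorem coarseEdge_eq (e : Edge M) :
    coarseEdge M e = link (if e.1 then (true, 0, 1) else (false, 1, 0)) e.2 := by
  obtain ⟨o, b⟩ := e
  cases o
  · simp [coarseEdge, link, horiz, cell_one_zero]
  · simp [coarseEdge, link, vert, cell_zero_one]

theorem coarseEdge_injective : Function.Injective (coarseEdge M) := by
  rintro ⟨o, b⟩ ⟨o', b'⟩ h
  rw [coarseEdge_eq, coarseEdge_eq, link_inj] at h
  obtain ⟨h1, h2⟩ := h
  cases o <;> cases o' <;> simp_all

/-- The species of the decoupled qubits in the state `|+⟩`. -/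
def plusSpecies : Fin 3 → Species := ![(false, 0, 1), (true, 1, 1), (false, 1, 1)]

/-- The species of the decoupled qubits in the state `|0⟩`. -/
def zeroSpecies : Fin 3 → Species := ![(true, 0, 0), (false, 0, 0), (true, 1, 0)]

theorem link_mem_range_coarseEdge (s : Species) (c : Site M) :
    link s c ∈ Set.range (coarseEdge M) ↔ s = (true, 0, 1) ∨ s = (false, 1, 0) := by
  constructor
  · rintro ⟨⟨o, b⟩, h⟩
    rw [coarseEdge_eq, link_inj] at h
    rw [← h.1]
    cases o <;> simp
  · rintro (rfl | rfl)
    · exact ⟨(true, c), by rw [coarseEdge_eq]; rfl⟩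
    · exact ⟨(false, c), by rw [coarseEdge_eq]; rfl⟩

/-- The extension by zero of a bit string on the coarse lattice. -/
def extend (a : Edge M → Fin 2) : Edge (2 * M) → Fin 2 := glue (coarseEdge M) a 0

theorem extend_horiz (a : Edge M → Fin 2) (c : Site M) :
    extend a (link (false, 1, 0) c) = a (horiz c) := by
  have : link (false, 1, 0) c = coarseEdge M (horiz c) := by rw [coarseEdge_eq]; rfl
  rw [this, extend, glue_apply coarseEdge_injective]

theorem extend_vert (a : Edge M → Fin 2) (c : Site M) :
    extend a (link (true, 0, 1) c) = a (vert c) := by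
  have : link (true, 0, 1) c = coarseEdge M (vert c) := by rw [coarseEdge_eq]; rfl
  rw [this, extend, glue_apply coarseEdge_injective]

theorem extend_link (a : Edge M → Fin 2) (s : Species) (c : Site M) :
    extend a (link s c) = if s = (false, 1, 0) then a (horiz c) else
      if s = (true, 0, 1) then a (vert c) else 0 := by
  split_ifs with h1 h2
  · rw [h1, extend_horiz]
  · rw [h2, extend_vert]
  · rw [extend, glue_of_notMem _ _ _ fun h => ?_]
    · rfl
    · rcases (link_mem_range_coarseEdge s c).1 h with h | h
      exacts [h2 h, h1 h]

/-- The decoupled `X` stabilizers of a block. -/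
def plusBits (b : Site M) (k : Fin 3) : Edge (2 * M) → Fin 2 :=
  Pi.single (link (plusSpecies k) b) 1

/-- The decoupled `Z` stabilizers of a block. -/
def zeroBits (b : Site M) (k : Fin 3) : Edge (2 * M) → Fin 2 :=
  Pi.single (link (zeroSpecies k) b) 1

theorem single_link (s s' : Species) (b c : Site M) :
    (Pi.single (link s b) 1 : Edge (2 * M) → Fin 2) (link s' c) = ibit (s = s' ∧ b = c) := by
  rw [Pi.single_apply]
  simp only [link_inj, ibit]
  congr 1
  exact propext ⟨fun h => ⟨h.1.symm, h.2.symm⟩, fun h => ⟨h.1.symm, h.2.symm⟩⟩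

/-- The stabilizers of the three emptied sites generate those of the three decoupled qubits of the
block. The root becomes the coarse plaquette times two of these. For `2 ≤ M` the coarse plaquette
has four distinct links. -/
theorem chainX_plaquette (hM : 2 ≤ M) (b : Site M) (i : Fin 4) :
    chainX (allCnots M) (ind (plaquette (plaqSite b i))) =
      (![extend (ind (plaquette b)) + plusBits b 0 + plusBits b 1, plusBits b 2 + plusBits b 1,
        plusBits b 0, plusBits b 2] : Fin 4 → _) i := by
  ext1 e
  obtain ⟨s, c, rfl⟩ := link_surj e
  refine (chainX_allCnots (siteInd (plaqCoord i) b) _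
    (plaquette_eq_boundary (plaqCoord i) b) s c).trans ?_
  have h1 := ind_plaquette_horiz hM b c
  have h2 := ind_plaquette_vert hM b c
  simp only [← eq_sub_iff_add_eq] at h1 h2
  obtain ⟨o, k, l⟩ := s
  fin_cases i <;> fin_cases o <;> fin_cases k <;> fin_cases l <;>
  simp [imageX, plaqCoord, siteInd, plusBits, plusSpecies, single_link, extend_link, h1, h2, ibit]

theorem chainZ_star (hM : 2 ≤ M) (b : Site M) (i : Fin 4) :
    chainZ (allCnots M) (ind (vertexStar (vertSite b i))) =
      (![extend (ind (vertexStar b)) + zeroBits b 0 + zeroBits b 1, zeroBits b 2 + zeroBits b 1,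
        zeroBits b 0, zeroBits b 2] : Fin 4 → _) i := by
  ext1 e
  obtain ⟨s, c, rfl⟩ := link_surj e
  refine (chainZ_allCnots (siteInd (vertCoord i) b) _
    (star_eq_boundary (vertCoord i) b) s c).trans ?_
  have h1 := ind_vertexStar_horiz hM b c
  have h2 := ind_vertexStar_vert hM b c
  obtain ⟨o, k, l⟩ := s
  fin_cases i <;> fin_cases o <;> fin_cases k <;> fin_cases l <;>
  simp [imageZ, vertCoord, siteInd, zeroBits, zeroSpecies, single_link, extend_link, h1, h2, ibit]

end Layers

/-! ### Embedded stabilizers and product states -/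

section Decoupling

variable {Q Q' : Type} [Fintype Q] [DecidableEq Q] [Fintype Q'] [DecidableEq Q']

theorem glue_zero_notMem (f : Q' → Q) (a : Q' → Fin 2) {q : Q} (h : q ∉ Set.range f) :
    glue f a 0 q = 0 := glue_of_notMem f a 0 h

theorem emb_paX {f : Q' → Q} (hf : f.Injective) (a : Q' → Fin 2) :
    emb f (paX a) = paX (glue f a 0) := by
  ext s t
  rw [emb_apply]
  simp only [paX, Matrix.of_apply]
  rw [← ite_and]
  congr 1
  refine propext ⟨fun h => funext fun q => ?_, fun h => ⟨fun q hq => ?_, ?_⟩⟩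
  · by_cases hq : q ∈ Set.range f
    · obtain ⟨q', rfl⟩ := hq
      rw [Pi.add_apply, glue_apply hf]
      exact congrFun h.2 q'
    · rw [Pi.add_apply, glue_zero_notMem f a hq, add_zero, h.1 q hq]
  · rw [h, Pi.add_apply, glue_zero_notMem f a hq, add_zero]
  · rw [h]
    funext q'
    simp [glue_apply hf]

theorem sgn_glue_zero {f : Q' → Q} (hf : f.Injective) (a : Q' → Fin 2) (s : Q → Fin 2) :
    sgn (glue f a 0) s = sgn a (s ∘ f) := by
  classical
  have h : sgn a (s ∘ f) = ∏ q ∈ Finset.univ.image f, (-1 : ℂ) ^ ((glue f a 0 q : ℕ) * (s q : ℕ)) := by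
    rw [Finset.prod_image fun x _ y _ h => hf h]
    exact Finset.prod_congr rfl fun q _ => by rw [glue_apply hf]; rfl
  rw [h, sgn]
  refine (Finset.prod_subset (Finset.subset_univ _) fun q _ hq => ?_).symm
  rw [glue_zero_notMem f a fun ⟨q', h⟩ => hq (Finset.mem_image.2 ⟨q', Finset.mem_univ _, h⟩)]
  simp

theorem emb_paZ {f : Q' → Q} (hf : f.Injective) (a : Q' → Fin 2) :
    emb f (paZ a) = paZ (glue f a 0) := by
  ext s t
  rw [emb_apply, paZ, paZ, Matrix.diagonal_apply, Matrix.diagonal_apply, ← ite_and,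
    ← sgn_glue_zero hf]
  congr 1
  refine propext ⟨fun h => funext fun q => ?_, fun h => ⟨fun q _ => by rw [h], by rw [h]⟩⟩
  by_cases hq : q ∈ Set.range f
  · obtain ⟨q', rfl⟩ := hq
    exact congrFun h.2 q'
  · exact h.1 q hq

theorem algHom_prod_congr (ψ : GA Q' →ₐ[ℂ] Op Q) (φ : GA Q →ₐ[ℂ] Op Q) {κ : Type*}
    (s : Finset κ) (u : κ → GA Q') (v : κ → GA Q) (h : ∀ i ∈ s, ψ (u i) = φ (v i)) :
    ψ (∏ i ∈ s, u i) = φ (∏ i ∈ s, v i) := by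
  classical
  induction s using Finset.induction_on with
  | empty => simp
  | insert i s hi ih =>
    rw [Finset.prod_insert hi, Finset.prod_insert hi, map_mul, map_mul,
      h i (Finset.mem_insert_self _ _), ih fun j hj => h j (Finset.mem_insert_of_mem hj)]

theorem emb_phiX_stabProd {f : Q' → Q} (hf : f.Injective) {κ : Type*} [Fintype κ]
    (a : κ → Q' → Fin 2) (g : κ → ℂ) :
    emb f (phiX (stabProd a g)) = phiX (stabProd (fun k => glue f (a k) 0) g) := by
  refine algHom_prod_congr ((embHom f hf).toAlgHom.comp phiX) phiX _ _ _ fun k _ => ?_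
  have e : (embHom f hf).toAlgHom (paX (a k)) = paX (glue f (a k) 0) := emb_paX hf _
  simp only [map_add, map_one, map_smul, AlgHom.comp_apply, phiX_xx, e]

theorem emb_phiZ_stabProd {f : Q' → Q} (hf : f.Injective) {κ : Type*} [Fintype κ]
    (a : κ → Q' → Fin 2) (g : κ → ℂ) :
    emb f (phiZ (stabProd a g)) = phiZ (stabProd (fun k => glue f (a k) 0) g) := by
  refine algHom_prod_congr ((embHom f hf).toAlgHom.comp phiZ) phiZ _ _ _ fun k _ => ?_
  have e : (embHom f hf).toAlgHom (paZ (a k)) = paZ (glue f (a k) 0) := emb_paZ hf _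
  simp only [map_add, map_one, map_smul, AlgHom.comp_apply, phiZ_xx, e]

theorem tensorOp_add_single (e : Q) (A : Matrix (Fin 2) (Fin 2) ℂ) :
    1 + tensorOp (fun q => if q = e then A else 1) =
      tensorOp fun q => if q = e then 1 + A else 1 := by
  ext s t
  have h : ∀ B : Matrix (Fin 2) (Fin 2) ℂ, tensorOp (fun q => if q = e then B else 1) s t =
      B (s e) (t e) * ∏ q ∈ Finset.univ.erase e, (1 : Matrix (Fin 2) (Fin 2) ℂ) (s q) (t q) := by
    intro B
    rw [tensorOp, Matrix.of_apply, ← Finset.mul_prod_erase _ _ (Finset.mem_univ e), if_pos rfl]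
    congr 1
    exact Finset.prod_congr rfl fun q hq => by rw [if_neg (Finset.ne_of_mem_erase hq)]
  have h1 : (1 : Op Q) = tensorOp fun q => if q = e then 1 else 1 := by simp [tensorOp_one]
  rw [Matrix.add_apply, h1, h, h, h, Matrix.add_apply]
  ring

theorem phi_prod_eq_tensorOp (φ : GA Q →ₐ[ℂ] Op Q) (A : Matrix (Fin 2) (Fin 2) ℂ)
    (hφ : ∀ e : Q, φ (xx (Pi.single e 1)) = tensorOp fun q => if q = e then A else 1)
    {κ : Type*} (e : κ → Q) (he : e.Injective) (s : Finset κ) :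
    φ (∏ k ∈ s, (1 + xx (Pi.single (e k) 1))) =
      tensorOp fun q => open scoped Classical in if ∃ k ∈ s, e k = q then 1 + A else 1 := by
  classical
  induction s using Finset.induction_on with
  | empty => simp [tensorOp_one]
  | insert k s hk ih =>
    rw [Finset.prod_insert hk, map_mul, ih, map_add, map_one, hφ, tensorOp_add_single,
      tensorOp_mul]
    congr 1
    funext q
    by_cases hq : q = e k
    · subst hq
      rw [if_pos rfl, if_neg, if_pos, mul_one]
      · exact ⟨k, Finset.mem_insert_self _ _, rfl⟩
      · rintro ⟨k', hk', h⟩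
        exact hk (he h ▸ hk')
    · rw [if_neg hq, one_mul]
      congr 1
      refine propext ⟨fun ⟨k', h1, h2⟩ => ⟨k', Finset.mem_insert_of_mem h1, h2⟩, ?_⟩
      rintro ⟨k', h1, h2⟩
      rcases Finset.mem_insert.1 h1 with rfl | h1
      · exact absurd h2.symm hq
      · exact ⟨k', h1, h2⟩

theorem phiX_single_tensorOp (e : Q) :
    phiX (xx (Pi.single e 1)) = tensorOp fun q => if q = e then pauliX else 1 := by
  rw [phiX_xx, ← ind_singleton, ← xString_eq, xString]
  simp only [Finset.mem_singleton]

theorem phiZ_single_tensorOp (e : Q) :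
    phiZ (xx (Pi.single e 1)) = tensorOp fun q => if q = e then pauliZ else 1 := by
  rw [phiZ_xx, ← ind_singleton, ← zString_eq, zString]
  simp only [Finset.mem_singleton]

theorem one_add_pauliX : 1 + pauliX = (2 : ℂ) • ketPlus := by
  ext i j
  fin_cases i <;> fin_cases j <;> simp [pauliX, ketPlus]

theorem one_add_pauliZ : 1 + pauliZ = (2 : ℂ) • ketZero := by
  ext i j
  fin_cases i <;> fin_cases j <;> norm_num [pauliZ, ketZero]

theorem tensorOp_smul (c : Q → ℂ) (u : Q → Matrix (Fin 2) (Fin 2) ℂ) :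
    tensorOp (fun q => c q • u q) = (∏ q, c q) • tensorOp u := by
  ext s t
  simp [tensorOp, Finset.prod_mul_distrib]

/-- Amplitudes of `|+⟩`. -/
def ampPlus : Fin 2 → ℂ := fun _ => (Real.sqrt (1 / 2) : ℂ)

theorem ketPlus_apply (x y : Fin 2) : ketPlus x y = ampPlus x * star (ampPlus y) := by
  have h : (Real.sqrt (1 / 2) : ℂ) * (Real.sqrt (1 / 2) : ℂ) = 1 / 2 := by
    rw [← Complex.ofReal_mul, Real.mul_self_sqrt (by norm_num)]; simp
  have : ampPlus x * star (ampPlus y) = 1 / 2 := by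
    simp only [ampPlus, Complex.star_def, Complex.conj_ofReal, h]
  rw [this]
  fin_cases x <;> fin_cases y <;> simp [ketPlus]

theorem adjoin_eq_emb_mul {f : Q' → Q} (hf : f.Injective) (φ : Q → Matrix (Fin 2) (Fin 2) ℂ)
    (v : Q → Fin 2 → ℂ) (h : ∀ q x y, φ q x y = v q x * star (v q y)) (ρ : Op Q') :
    adjoin f φ ρ = emb f ρ * adjoin f φ 1 := by
  rw [adjoin_eq f φ v h, adjoin_eq f φ v h, Matrix.mul_one, ← Matrix.mul_assoc, emb_mul_adjV hf]

theorem adjoin_one (f : Q' → Q) (φ : Q → Matrix (Fin 2) (Fin 2) ℂ) :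
    adjoin f φ 1 = tensorOp fun q => open scoped Classical in
      if q ∈ Set.range f then 1 else φ q := by
  classical
  ext s t
  rw [adjoin, tensorOp, Matrix.of_apply, Matrix.of_apply,
    ← Finset.prod_filter_mul_prod_filter_not Finset.univ (fun q => q ∈ Set.range f)]
  congr 1
  · rw [Finset.prod_congr rfl fun q hq => by rw [if_pos (Finset.mem_filter.1 hq).2]]
    simp only [Matrix.one_apply]
    rw [Finset.prod_ite_zero]
    simp only [Finset.prod_const_one]
    congr 1
    refine propext ⟨fun h q hq => ?_, fun h => funext fun q => h (f q) (by simp)⟩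
    obtain ⟨q', rfl⟩ := (Finset.mem_filter.1 hq).2
    exact congrFun h q'
  · exact (Finset.prod_congr rfl fun q hq => by rw [if_neg (Finset.mem_filter.1 hq).2]).symm

end Decoupling

/-! ### One exact step of the RG, its reversal, and iteration -/

section DecoupledStep

variable {M : ℕ} [NeZero M]

/-- For an involution `p` one has $p(1+p)=1+p$: next to $1+p$, $1+q$ and $1+r$ the decoupled
stabilizers can be replaced by $1$. -/
theorem decouple_factor {R : Type*} [CommRing R] (C p q r : R) (hp : p * p = 1) (hq : q * q = 1)
    (hr : r * r = 1) : (1 + C * p * q) * (1 + r * q) * (1 + p) * (1 + r) =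
      (1 + C) * ((1 + p) * (1 + q) * (1 + r)) := by
  have h1 : (1 + r * q) * (1 + r) = (1 + q) * (1 + r) := by linear_combination q * hr
  have h2 : (1 + C * p * q) * (1 + p) = (1 + C * q) * (1 + p) := by linear_combination C * q * hp
  have h3 : (1 + C * q) * (1 + q) = (1 + C) * (1 + q) := by linear_combination C * hq
  linear_combination (1 + C * p * q) * (1 + p) * h1 + (1 + q) * (1 + r) * h2 + (1 + p) * (1 + r) * h3

theorem blocksProd_decouple (t : ℂ) (C : Site M → Edge (2 * M) → Fin 2)
    (P : Site M → Fin 3 → Edge (2 * M) → Fin 2) :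
    blocksProd (fun b => ![C b + P b 0 + P b 1, P b 2 + P b 1, P b 0, P b 2])
        (factors t Finset.univ) =
      stabProd C (fun _ => t ^ 4) * ∏ x : Site M × Fin 3, (1 + xx (P x.1 x.2)) := by
  rw [Fintype.prod_prod_type, stabProd, ← Finset.prod_mul_distrib, blocksProd]
  refine Finset.prod_congr rfl fun b _ => ?_
  have e : factors t Finset.univ b = ![t ^ 4, 1, 1, 1] := if_pos (Finset.mem_univ _)
  have := decouple_factor (t ^ 4 • xx (C b)) (xx (P b 0)) (xx (P b 1)) (xx (P b 2))
    (xx_mul_self _) (xx_mul_self _) (xx_mul_self _)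
  rw [e, Fin.prod_univ_four, Fin.prod_univ_three, ← this]
  simp [xx_mul]

theorem plusLink_injective : Function.Injective fun x : Site M × Fin 3 =>
    link (plusSpecies x.2) x.1 := by
  rintro ⟨b, k⟩ ⟨b', k'⟩ h
  obtain ⟨h1, h2⟩ := link_inj.1 h
  have : ∀ k k', plusSpecies k = plusSpecies k' → k = k' := by decide
  exact Prod.ext h2 (this _ _ h1)

theorem zeroLink_injective : Function.Injective fun x : Site M × Fin 3 =>
    link (zeroSpecies x.2) x.1 := by
  rintro ⟨b, k⟩ ⟨b', k'⟩ h
  obtain ⟨h1, h2⟩ := link_inj.1 h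
  have : ∀ k k', zeroSpecies k = zeroSpecies k' → k = k' := by decide
  exact Prod.ext h2 (this _ _ h1)

theorem decoupledState_link (s : Species) (c : Site M) : decoupledState M (link s c) =
    if ∃ k, plusSpecies k = s then ketPlus else ketZero := by
  obtain ⟨o, i, j⟩ := s
  have h : ∀ n : ℕ, ¬ Odd (2 * n) := fun n => by simp
  rw [decoupledState]
  simp only [link, cell_fst_val, cell_snd_val]
  fin_cases o <;> fin_cases i <;> fin_cases j <;>
    simp [plusSpecies, Fin.exists_fin_succ, h]

/-- $1+X$ and $1+Z$ are twice the projectors onto $|+\rangle$ and $|0\rangle$. The scalar is left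
open, since it is fixed by the trace in `run_rgGates`. -/
theorem adjoin_coarse_one : ∃ c : ℂ,
    phiX (∏ x : Site M × Fin 3, (1 + xx (plusBits x.1 x.2))) *
      phiZ (∏ x : Site M × Fin 3, (1 + xx (zeroBits x.1 x.2))) =
        c • adjoin (coarseEdge M) (decoupledState M) 1 := by
  classical
  have h1 := phi_prod_eq_tensorOp phiX pauliX phiX_single_tensorOp _
    (plusLink_injective (M := M)) Finset.univ
  have h2 := phi_prod_eq_tensorOp phiZ pauliZ phiZ_single_tensorOp _
    (zeroLink_injective (M := M)) Finset.univ
  refine ⟨∏ q : Edge (2 * M), if q ∈ Set.range (coarseEdge M) then 1 else 2, ?_⟩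
  simp only [plusBits, zeroBits]
  rw [h1, h2, tensorOp_mul, adjoin_one, ← tensorOp_smul]
  congr 1
  funext q
  obtain ⟨s, c, rfl⟩ := link_surj q
  simp only [link_mem_range_coarseEdge, decoupledState_link, one_add_pauliX, one_add_pauliZ,
    Finset.mem_univ, true_and, link_inj, Prod.exists, exists_and_right, exists_and_left]
  obtain ⟨o, i, j⟩ := s
  fin_cases o <;> fin_cases i <;> fin_cases j <;>
    simp [plusSpecies, zeroSpecies, Fin.exists_fin_succ]

theorem tanh_rgBeta (β : ℝ) : Real.tanh (rgBeta β) = Real.tanh β ^ 4 := by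
  refine Real.tanh_artanh ⟨?_, tanh_pow_four_lt β⟩
  have : 0 ≤ Real.tanh β ^ 4 := by positivity
  linarith

theorem rgBeta_nonneg (β : ℝ) : 0 ≤ rgBeta β := Real.artanh_nonneg (by positivity)

theorem decoupledState_apply (q : Edge (2 * M)) (x y : Fin 2) : decoupledState M q x y =
    (if decoupledState M q = ketPlus then ampPlus else amp0) x *
      star ((if decoupledState M q = ketPlus then ampPlus else amp0) y) := by
  split_ifs with h
  · rw [h, ketPlus_apply]
  · have : decoupledState M q = ketZero := by
      unfold decoupledState at h ⊢
      split_ifs at h ⊢ <;> simp_all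
    rw [this, ketZero_apply]

theorem adjoin_decoupled (ρ : Op (Edge M)) : adjoin (coarseEdge M) (decoupledState M) ρ =
    emb (coarseEdge M) ρ * adjoin (coarseEdge M) (decoupledState M) 1 := by
  exact adjoin_eq_emb_mul coarseEdge_injective _ _ decoupledState_apply ρ

theorem trace_decoupledState (q : Edge (2 * M)) : (decoupledState M q).trace = 1 := by
  unfold decoupledState
  split_ifs <;> norm_num [ketPlus, ketZero, Matrix.trace_fin_two]

/-- The embedded coarse stars avoid the qubits in $|+\rangle$, so the plus factors can be moved past
them to join the zero factors. -/
theorem emb_phiZ_commute_plus (t : ℂ) :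
    Commute (phiX (∏ x : Site M × Fin 3, (1 + xx (plusBits x.1 x.2))))
      (phiZ (stabProd (fun p : Site M => extend (ind (vertexStar p))) fun _ => t)) := by
  refine commute_algHom_prod _ _ _ fun x _ => (Commute.symm ?_)
  refine commute_algHom_prod _ _ _ fun p _ => commute_algHom_one_add _ _ (Commute.symm ?_)
  rw [map_add, map_one, phiX_xx, phiZ_xx]
  refine (Commute.one_left _).add_left (paZ_commute_paX ?_).symm
  rw [plusBits, sgn_single_right]
  beta_reduce
  rw [extend_link, if_neg, if_neg]
  · simp
  · generalize x.2 = k; revert k; decide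
  · generalize x.2 = k; revert k; decide

theorem run_disentangle_gen (hM : 2 ≤ M) (β : ℝ) : ∃ c : ℂ,
    runGates (disentangleGates M) (partX M β Finset.univ * partZ M β Finset.univ) =
      c • adjoin (coarseEdge M) (decoupledState M) (therm M (rgBeta β)) := by
  obtain ⟨c, hc⟩ := adjoin_coarse_one (M := M)
  refine ⟨c, ?_⟩
  have hX : (fun (b : Site M) i => chainX (allCnots M) (ind (plaquette (plaqSite b i)))) =
      fun b => ![extend (ind (plaquette b)) + plusBits b 0 + plusBits b 1,
        plusBits b 2 + plusBits b 1, plusBits b 0, plusBits b 2] :=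
    funext fun b => funext fun i => chainX_plaquette hM b i
  have hZ : (fun (b : Site M) i => chainZ (allCnots M) (ind (vertexStar (vertSite b i)))) =
      fun b => ![extend (ind (vertexStar b)) + zeroBits b 0 + zeroBits b 1,
        zeroBits b 2 + zeroBits b 1, zeroBits b 0, zeroBits b 2] :=
    funext fun b => funext fun i => chainZ_star hM b i
  have ht : (Real.tanh (rgBeta β) : ℂ) = (Real.tanh β : ℂ) ^ 4 := by
    rw [tanh_rgBeta]; push_cast; rfl
  have hcm := emb_phiZ_commute_plus (M := M) ((Real.tanh β : ℂ) ^ 4)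
  rw [disentangleGates_eq, runGates_cnots, partX, partZ,
    cnots_conj_blocksProd _ allCnots_ne, hX, hZ, blocksProd_decouple, blocksProd_decouple,
    adjoin_decoupled, therm, emb_mul coarseEdge_injective, thermX, thermZ,
    emb_phiX_stabProd coarseEdge_injective, emb_phiZ_stabProd coarseEdge_injective, ht,
    ← Matrix.mul_smul, ← hc, map_mul, map_mul]
  simp only [Matrix.mul_assoc]
  rw [← Matrix.mul_assoc (phiX (∏ x : Site M × Fin 3, _)), hcm.eq, Matrix.mul_assoc]
  rfl

theorem rgGates_isChannelOn (lX lZ : List (Site M)) :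
    ∀ g ∈ rgGates M lX lZ, IsChannelOn g.supp g.map := by
  intro g hg
  rw [rgGates, List.mem_append, List.mem_append, List.mem_map, List.mem_map, disentangleGates_eq,
    List.mem_map] at hg
  rcases hg with (⟨b, -, rfl⟩ | ⟨b, -, rfl⟩) | ⟨e, he, rfl⟩
  · exact (plaqBlock_isLocal b).coarse_isChannelOn
  · exact (vertBlock_isLocal b).coarse_isChannelOn
  · exact cnotGate_isChannelOn (allCnots_ne e he)

theorem fineGates_isChannelOn (β : ℝ) (lX lZ : List (Site M)) :
    ∀ g ∈ fineGates M β lX lZ, IsChannelOn g.supp g.map := by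
  intro g hg
  rw [fineGates, List.mem_append, List.mem_append, List.mem_map, List.mem_map, disentangleGates_eq,
    List.mem_reverse, List.mem_map] at hg
  rcases hg with (⟨e, he, rfl⟩ | ⟨b, -, rfl⟩) | ⟨b, -, rfl⟩
  · exact cnotGate_isChannelOn (allCnots_ne e he)
  · exact (vertBlock_isLocal b).fine_isChannelOn β
  · exact (plaqBlock_isLocal b).fine_isChannelOn β

theorem trace_adjoin_decoupled (ρ : Op (Edge M)) :
    (adjoin (coarseEdge M) (decoupledState M) ρ).trace = ρ.trace := by
  rw [← trace_marginal coarseEdge_injective, marginal_adjoin coarseEdge_injective _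
    trace_decoupledState]

theorem gibbs_isHermitian {L : ℕ} [NeZero L] (β : ℝ) : (gibbs L β).IsHermitian := by
  have h : (-(β : ℂ) • toricHamiltonian L).IsHermitian := by
    rw [Matrix.IsHermitian, Matrix.conjTranspose_smul, toricHamiltonian]
    simp only [xString_eq, zString_eq, Matrix.conjTranspose_sub, Matrix.conjTranspose_neg,
      Matrix.conjTranspose_sum, paX_conjTranspose, paZ_conjTranspose, star_neg, Complex.star_def,
      Complex.conj_ofReal]
  have h2 := h.exp
  rw [gibbs, Matrix.IsHermitian, Matrix.conjTranspose_smul, h2.eq, star_inv₀]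
  congr 2
  rw [← Matrix.trace_conjTranspose, h2.eq]

theorem run_coarse_part (β : ℝ) {lX lZ : List (Site M)} (hX : lX.Perm (blocks M))
    (hZ : lZ.Perm (blocks M)) :
    IsIdeal (lX.map (fun b => coarseGate (plaqBlock M b)) ++
        lZ.map (fun b => coarseGate (vertBlock M b))) (gibbs (2 * M) β) ∧
      runGates (lX.map (fun b => coarseGate (plaqBlock M b)) ++
        lZ.map (fun b => coarseGate (vertBlock M b))) (gibbs (2 * M) β) =
          (therm (2 * M) β).trace⁻¹ • (partX M β Finset.univ * partZ M β Finset.univ) := by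
  have := run_coarse_toric (therm (2 * M) β).trace⁻¹ β hX hZ
  rw [← gibbs_eq two_le_two_mul] at this
  exact this (gibbs_isHermitian β)

/-- Both sides are multiples of the same operator and have trace one, so the scalars agree without
being computed. -/
theorem run_rgGates (hM : 2 ≤ M) {β : ℝ} (hβ : 0 ≤ β) {lX lZ : List (Site M)}
    (hX : lX.Perm (blocks M)) (hZ : lZ.Perm (blocks M)) :
    runGates (rgGates M lX lZ) (gibbs (2 * M) β) =
      adjoin (coarseEdge M) (decoupledState M) (gibbs M (rgBeta β)) := by
  have htr : (runGates (rgGates M lX lZ) (gibbs (2 * M) β)).trace = 1 := by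
    rw [runGates_trace _ (rgGates_isChannelOn lX lZ), trace_gibbs two_le_two_mul hβ]
  have htr' : (adjoin (coarseEdge M) (decoupledState M) (gibbs M (rgBeta β))).trace = 1 := by
    rw [trace_adjoin_decoupled, trace_gibbs hM (rgBeta_nonneg β)]
  obtain ⟨c, hc⟩ := run_disentangle_gen hM β
  have hs : ∀ (r : ℂ) (ρ : Op (Edge (2 * M))), runGates (disentangleGates M) (r • ρ) =
      r • runGates (disentangleGates M) ρ := by
    intro r ρ
    rw [disentangleGates_eq, runGates_cnots, runGates_cnots, Matrix.mul_smul, Matrix.smul_mul]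
  have hs' : ∀ (r : ℂ) (ρ : Op (Edge M)), adjoin (coarseEdge M) (decoupledState M) (r • ρ) =
      r • adjoin (coarseEdge M) (decoupledState M) ρ := by
    intro r ρ
    ext s t
    simp [adjoin, mul_assoc]
  rw [rgGates, runGates_append, (run_coarse_part β hX hZ).2, hs, hc, smul_smul] at htr ⊢
  rw [gibbs_eq hM, hs'] at htr' ⊢
  rw [Matrix.trace_smul, smul_eq_mul] at htr htr'
  have h0 : (adjoin (coarseEdge M) (decoupledState M) (therm M (rgBeta β))).trace ≠ 0 := by
    rintro h
    rw [h, mul_zero] at htr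
    exact zero_ne_one htr
  rw [mul_right_cancel₀ h0 (htr.trans htr'.symm)]

theorem rgGates_isIdeal (β : ℝ) {lX lZ : List (Site M)}
    (hX : lX.Perm (blocks M)) (hZ : lZ.Perm (blocks M)) :
    IsIdeal (rgGates M lX lZ) (gibbs (2 * M) β) := by
  rw [rgGates, isIdeal_append]
  refine ⟨(run_coarse_part β hX hZ).1, ?_⟩
  rw [disentangleGates_eq]
  refine isIdeal_cnot _ allCnots_ne (runGates_isHermitian _ (fun g hg => ?_) (gibbs_isHermitian β))
  exact rgGates_isChannelOn lX lZ g (List.mem_append_left _ hg)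

theorem run_fineGates (β : ℝ) {lX lZ : List (Site M)}
    (hX : lX.Perm (blocks M)) (hZ : lZ.Perm (blocks M)) :
    runGates (fineGates M β lX lZ) (runGates (rgGates M lX lZ) (gibbs (2 * M) β)) =
      gibbs (2 * M) β := by
  rw [rgGates, runGates_append, (run_coarse_part β hX hZ).2, fineGates, List.append_assoc,
    runGates_append, disentangleGates_eq, runGates_cnots_reverse _ allCnots_ne,
    run_fine_toric _ β hX hZ, gibbs_eq two_le_two_mul]

theorem rgStep_gibbs (hM : 2 ≤ M) {β : ℝ} (hβ : 0 ≤ β) :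
    rgStep M (gibbs (2 * M) β) = gibbs M (rgBeta β) := by
  rw [rgStep, run_rgGates hM hβ (List.Perm.refl _) (List.Perm.refl _),
    marginal_adjoin coarseEdge_injective _ trace_decoupledState]

theorem fineStep_gibbs (hM : 2 ≤ M) {β : ℝ} (hβ : 0 ≤ β) :
    fineStep M β (gibbs M (rgBeta β)) = gibbs (2 * M) β := by
  rw [fineStep, ← run_rgGates hM hβ (List.Perm.refl _) (List.Perm.refl _),
    run_fineGates β (List.Perm.refl _) (List.Perm.refl _)]

theorem two_le_latticeSize (hM : 2 ≤ M) (ℓ : ℕ) : 2 ≤ latticeSize M ℓ := by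
  induction ℓ with
  | zero => exact hM
  | succ ℓ ih => rw [latticeSize]; omega

theorem rgIter_gibbs (hM : 2 ≤ M) (ℓ : ℕ) {β : ℝ} (hβ : 0 ≤ β) :
    rgIter M ℓ (gibbs (latticeSize M ℓ) β) = gibbs M (rgBeta^[ℓ] β) := by
  induction ℓ generalizing β with
  | zero => rfl
  | succ ℓ ih =>
    change rgIter M ℓ (rgStep (latticeSize M ℓ) (gibbs (2 * latticeSize M ℓ) β)) = _
    rw [rgStep_gibbs (two_le_latticeSize hM ℓ) hβ, ih (rgBeta_nonneg β), Function.iterate_succ_apply]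

theorem fineIter_gibbs (hM : 2 ≤ M) (ℓ : ℕ) {β : ℝ} (hβ : 0 ≤ β) :
    fineIter M ℓ β (gibbs M (rgBeta^[ℓ] β)) = gibbs (latticeSize M ℓ) β := by
  induction ℓ generalizing β with
  | zero => rfl
  | succ ℓ ih =>
    change fineStep (latticeSize M ℓ) β (fineIter M ℓ (rgBeta β) _) = gibbs (2 * latticeSize M ℓ) β
    rw [Function.iterate_succ_apply, ih (rgBeta_nonneg β),
      fineStep_gibbs (two_le_latticeSize hM ℓ) hβ]

end DecoupledStep

/-! ### Diameters of the gates -/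

section Distances

variable {L : ℕ} [NeZero L]

theorem min_val_le (x : ZMod L) (n a a' : ℕ) (ha : a ≤ n) (ha' : a' ≤ n) :
    min ((x + a) - (x + a')).val ((x + a') - (x + a)).val ≤ n := by
  rcases le_total a a' with h | h
  · refine (min_le_right _ _).trans ?_
    rw [add_sub_add_left_eq_sub, ← Nat.cast_sub h, ZMod.val_natCast]
    exact (Nat.mod_le _ _).trans ((Nat.sub_le _ _).trans ha')
  · refine (min_le_left _ _).trans ?_
    rw [add_sub_add_left_eq_sub, ← Nat.cast_sub h, ZMod.val_natCast]
    exact (Nat.mod_le _ _).trans ((Nat.sub_le _ _).trans ha)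

/-- The square with lower left corner `w` and side length `n`. -/
def InWindow (w : Site L) (n : ℕ) (p : Site L) : Prop :=
  ∃ a b : ℕ, a ≤ n ∧ b ≤ n ∧ p = w + ((a : ZMod L), (b : ZMod L))

theorem siteDist_le_of_window {w p q : Site L} {n : ℕ} (hp : InWindow w n p)
    (hq : InWindow w n q) : siteDist p q ≤ 2 * n := by
  obtain ⟨a, b, ha, hb, rfl⟩ := hp
  obtain ⟨a', b', ha', hb', rfl⟩ := hq
  have h1 := min_val_le w.1 n a a' ha ha'
  have h2 := min_val_le w.2 n b b' hb hb'
  rw [siteDist, two_mul]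
  exact add_le_add h1 h2

variable {M : ℕ} [NeZero M]

/-- Supports are placed in a square of side two, whose diameter in the graph distance is at most
$2\cdot 2=4$. -/
theorem plaqBlock_supp_window (b : Site M) {e : Edge (2 * M)} (he : e ∈ (plaqBlock M b).supp) :
    InWindow (corner b) 2 e.2 := by
  simp only [plaqBlock, plaquette, Finset.mem_union, Finset.mem_insert, Finset.mem_singleton] at he
  have h : ∀ i j : ℕ, i ≤ 2 → j ≤ 2 → ∀ p, p = corner b + ((i : ZMod (2 * M)), (j : ZMod (2 * M))) →
      InWindow (corner b) 2 p := fun i j hi hj p hp => ⟨i, j, hi, hj, hp⟩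
  rcases he with (((he | he | he | he) | (he | he | he | he)) | (he | he | he | he)) |
    (he | he | he | he) <;> subst he
  · exact h 0 1 (by omega) (by omega) _ (by simp [horiz])
  · exact h 0 2 (by omega) (by omega) _ (by simp [horiz, add_assoc]; norm_num)
  · exact h 0 1 (by omega) (by omega) _ (by simp [vert])
  · exact h 1 1 (by omega) (by omega) _ (by simp [vert, add_assoc])
  · exact h 1 1 (by omega) (by omega) _ (by simp [horiz])
  · exact h 1 2 (by omega) (by omega) _ (by simp [horiz, add_assoc]; norm_num)
  · exact h 1 1 (by omega) (by omega) _ (by simp [vert])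
  · exact h 2 1 (by omega) (by omega) _ (by simp [vert, add_assoc]; norm_num)
  · exact h 0 0 (by omega) (by omega) _ (by simp [horiz])
  · exact h 0 1 (by omega) (by omega) _ (by simp [horiz, add_assoc])
  · exact h 0 0 (by omega) (by omega) _ (by simp [vert])
  · exact h 1 0 (by omega) (by omega) _ (by simp [vert, add_assoc])
  · exact h 1 0 (by omega) (by omega) _ (by simp [horiz])
  · exact h 1 1 (by omega) (by omega) _ (by simp [horiz, add_assoc])
  · exact h 1 0 (by omega) (by omega) _ (by simp [vert])
  · exact h 2 0 (by omega) (by omega) _ (by simp [vert, add_assoc]; norm_num)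

/-- Stars reach one link to the left and one down, so the window starts at `corner b - (1, 1)`;
coordinates are compared after adding `(1, 1)`. -/
theorem vertBlock_supp_window (b : Site M) {e : Edge (2 * M)} (he : e ∈ (vertBlock M b).supp) :
    InWindow (corner b - (1, 1)) 2 e.2 := by
  simp only [vertBlock, vertexStar, Finset.mem_union, Finset.mem_insert,
    Finset.mem_singleton] at he
  have h : ∀ i j : ℕ, i ≤ 2 → j ≤ 2 → ∀ p, p + (1, 1) = corner b +
      ((i : ZMod (2 * M)), (j : ZMod (2 * M))) → InWindow (corner b - (1, 1)) 2 p :=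
    fun i j hi hj p hp => ⟨i, j, hi, hj, by rw [sub_add_eq_add_sub, ← hp, add_sub_cancel_right]⟩
  rcases he with (((he | he | he | he) | (he | he | he | he)) | (he | he | he | he)) |
    (he | he | he | he) <;> subst he
  · exact h 1 1 (by omega) (by omega) _ (by ext <;> simp [horiz])
  · exact h 0 1 (by omega) (by omega) _ (by ext <;> simp [horiz])
  · exact h 1 1 (by omega) (by omega) _ (by ext <;> simp [vert])
  · exact h 1 0 (by omega) (by omega) _ (by ext <;> simp [vert])
  · exact h 2 1 (by omega) (by omega) _ (by ext <;> simp [horiz] <;> ring)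
  · exact h 1 1 (by omega) (by omega) _ (by ext <;> simp [horiz])
  · exact h 2 1 (by omega) (by omega) _ (by ext <;> simp [vert] <;> ring)
  · exact h 2 0 (by omega) (by omega) _ (by ext <;> simp [vert] <;> ring)
  · exact h 1 2 (by omega) (by omega) _ (by ext <;> simp [horiz] <;> ring)
  · exact h 0 2 (by omega) (by omega) _ (by ext <;> simp [horiz] <;> ring)
  · exact h 1 2 (by omega) (by omega) _ (by ext <;> simp [vert] <;> ring)
  · exact h 1 1 (by omega) (by omega) _ (by ext <;> simp [vert])
  · exact h 2 2 (by omega) (by omega) _ (by ext <;> simp [horiz] <;> ring)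
  · exact h 1 2 (by omega) (by omega) _ (by ext <;> simp [horiz] <;> ring)
  · exact h 2 2 (by omega) (by omega) _ (by ext <;> simp [vert] <;> ring)
  · exact h 2 1 (by omega) (by omega) _ (by ext <;> simp [vert] <;> ring)

theorem allCnots_window {e : Edge (2 * M) × Edge (2 * M)} (he : e ∈ allCnots M) :
    ∃ w, InWindow w 2 e.1.2 ∧ InWindow w 2 e.2.2 := by
  obtain ⟨x, hx, he⟩ := List.mem_flatMap.1 he
  obtain ⟨b, -, rfl⟩ := List.mem_map.1 he
  have hm : (link x.1 b, link x.2.1 (b + x.2.2)) ∈ disentanglers b := by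
    rw [disentanglers_eq]; exact List.mem_map.2 ⟨x, hx, rfl⟩
  revert hm
  generalize (link x.1 b, link x.2.1 (b + x.2.2)) = y
  intro hm
  refine ⟨corner b, ?_⟩
  have h : ∀ i j : ℕ, i ≤ 2 → j ≤ 2 → InWindow (corner b) 2
      (corner b + ((i : ZMod (2 * M)), (j : ZMod (2 * M)))) := fun i j hi hj => ⟨i, j, hi, hj, rfl⟩
  have h00 := h 0 0 (by omega) (by omega)
  have h10 := h 1 0 (by omega) (by omega)
  have h01 := h 0 1 (by omega) (by omega)
  have h11 := h 1 1 (by omega) (by omega)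
  have h20 := h 2 0 (by omega) (by omega)
  have h21 := h 2 1 (by omega) (by omega)
  have h12 := h 1 2 (by omega) (by omega)
  simp only [Nat.cast_zero, Nat.cast_one, Nat.cast_ofNat, Prod.mk_zero_zero, add_zero] at *
  simp only [disentanglers, List.mem_cons, List.not_mem_nil, or_false] at hm
  rcases hm with hm | hm | hm | hm | hm | hm | hm | hm | hm | hm | hm | hm | hm <;> subst hm <;>
    simp only [horiz, vert] <;> constructor <;> assumption

theorem gates_diameter (β : ℝ) (lX lZ : List (Site M)) :
    ∀ g ∈ rgGates M lX lZ ++ fineGates M β lX lZ,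
      ∀ x ∈ g.supp, ∀ y ∈ g.supp, siteDist x.2 y.2 ≤ 4 := by
  have h1 : ∀ b : Site M, ∀ x ∈ (plaqBlock M b).supp, ∀ y ∈ (plaqBlock M b).supp,
      siteDist x.2 y.2 ≤ 4 := fun b x hx y hy =>
    siteDist_le_of_window (plaqBlock_supp_window b hx) (plaqBlock_supp_window b hy)
  have h2 : ∀ b : Site M, ∀ x ∈ (vertBlock M b).supp, ∀ y ∈ (vertBlock M b).supp,
      siteDist x.2 y.2 ≤ 4 := fun b x hx y hy =>
    siteDist_le_of_window (vertBlock_supp_window b hx) (vertBlock_supp_window b hy)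
  have h3 : ∀ e ∈ allCnots M, ∀ x ∈ (cnotGate e).supp, ∀ y ∈ (cnotGate e).supp,
      siteDist x.2 y.2 ≤ 4 := by
    intro e he x hx y hy
    obtain ⟨w, hw1, hw2⟩ := allCnots_window he
    have hw : ∀ z ∈ (cnotGate e).supp, InWindow w 2 z.2 := by
      intro z hz
      rcases Finset.mem_insert.1 hz with rfl | hz
      · exact hw1
      · rw [Finset.mem_singleton.1 hz]; exact hw2
    exact siteDist_le_of_window (hw x hx) (hw y hy)
  intro g hg
  simp only [rgGates, fineGates, disentangleGates_eq, List.mem_append, List.mem_map,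
    List.mem_reverse] at hg
  rcases hg with (((⟨b, -, rfl⟩ | ⟨b, -, rfl⟩) | ⟨e, he, rfl⟩) |
    ((⟨e, he, rfl⟩ | ⟨b, -, rfl⟩) | ⟨b, -, rfl⟩))
  exacts [h1 b, h2 b, h3 e he, h3 e he, h2 b, h1 b]

end Distances

/-! ### Operator domination and lower bounds on the fidelity -/

section Fidelity

open scoped ComplexOrder

variable {Q Q' Q'' : Type} [Fintype Q] [DecidableEq Q] [Fintype Q'] [DecidableEq Q']
  [Fintype Q''] [DecidableEq Q'']

theorem exists_diagonalization {A : Op Q} (hA : A.IsHermitian) :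
    ∃ (U : Op Q) (d : (Q → Fin 2) → ℝ), Uᴴ * U = 1 ∧ U * Uᴴ = 1 ∧
      A = U * Matrix.diagonal (fun i => (d i : ℂ)) * Uᴴ ∧
      ∀ f : ℝ → ℝ, cfc f A = U * Matrix.diagonal (fun i => (f (d i) : ℂ)) * Uᴴ := by
  refine ⟨hA.eigenvectorUnitary, hA.eigenvalues, ?_, ?_, ?_, fun f => ?_⟩
  · exact (Matrix.mem_unitaryGroup_iff'.1 hA.eigenvectorUnitary.2)
  · exact (Matrix.mem_unitaryGroup_iff.1 hA.eigenvectorUnitary.2)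
  · conv_lhs => rw [hA.spectral_theorem]
    rfl
  · rw [hA.cfc_eq]
    rfl

theorem posSemidef_cfc_sqrt {A : Op Q} (hA : A.PosSemidef) :
    (cfc Real.sqrt A).PosSemidef ∧ cfc Real.sqrt A * cfc Real.sqrt A = A := by
  obtain ⟨U, d, h1, h2, h3, h4⟩ := exists_diagonalization hA.1
  have hd : ∀ i, 0 ≤ d i := by
    intro i
    have h5 := hA.conjTranspose_mul_mul_same U
    rw [h3, Matrix.mul_assoc, Matrix.mul_assoc _ Uᴴ, h1, Matrix.mul_one, ← Matrix.mul_assoc, h1,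
      Matrix.one_mul] at h5
    have := h5.diag_nonneg (i := i)
    rw [Matrix.diagonal_apply_eq] at this
    exact_mod_cast this
  have h6 := h4 Real.sqrt
  constructor
  · rw [h6]
    refine Matrix.PosSemidef.mul_mul_conjTranspose_same (Matrix.PosSemidef.diagonal fun i => ?_) U
    simp only [Pi.zero_apply]
    exact_mod_cast Real.sqrt_nonneg (d i)
  · have e : Matrix.diagonal (fun i => (Real.sqrt (d i) : ℂ)) *
        Matrix.diagonal (fun i => (Real.sqrt (d i) : ℂ)) = Matrix.diagonal fun i => (d i : ℂ) := by
      rw [Matrix.diagonal_mul_diagonal]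
      congr 1
      funext i
      rw [← Complex.ofReal_mul, Real.mul_self_sqrt (hd i)]
    rw [h6]
    conv_rhs => rw [h3, ← e]
    simp only [Matrix.mul_assoc]
    rw [← Matrix.mul_assoc Uᴴ U, h1, Matrix.one_mul]

theorem re_trace_mul_nonneg {A B : Op Q} (hA : A.PosSemidef) (hB : B.PosSemidef) :
    0 ≤ (A * B).trace.re := by
  obtain ⟨h1, h2⟩ := posSemidef_cfc_sqrt hB
  rw [← h2, ← Matrix.mul_assoc, Matrix.trace_mul_comm, ← Matrix.mul_assoc]
  have := (hA.mul_mul_conjTranspose_same (cfc Real.sqrt B)).trace_nonneg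
  rw [h1.1] at this
  exact (Complex.le_def.1 this).1

/-- Operator monotonicity of the square root, read off the diagonal in an eigenbasis of `A - D`. -/
theorem posSemidef_sub_of_sq {A D : Op Q} (hA : A.PosSemidef) (hD : D.PosSemidef)
    (h : (A * A - D * D).PosSemidef) : (A - D).PosSemidef := by
  obtain ⟨U, c, h1, h2, h3, -⟩ := exists_diagonalization (hA.1.sub hD.1)
  have hA' := hA.conjTranspose_mul_mul_same U
  have hD' := hD.conjTranspose_mul_mul_same U
  have h' := h.conjTranspose_mul_mul_same U
  have e1 : Uᴴ * A * U = Uᴴ * D * U + Matrix.diagonal fun i => (c i : ℂ) := by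
    have : Uᴴ * (A - D) * U = Matrix.diagonal fun i => (c i : ℂ) := by
      rw [h3]
      simp only [Matrix.mul_assoc]
      rw [h1, Matrix.mul_one, ← Matrix.mul_assoc, h1, Matrix.one_mul]
    rw [← this, ← Matrix.add_mul, ← Matrix.mul_add, add_sub_cancel]
  have e2 : ∀ X : Op Q, Uᴴ * (X * X) * U = (Uᴴ * X * U) * (Uᴴ * X * U) := by
    intro X
    simp only [Matrix.mul_assoc]
    rw [← Matrix.mul_assoc U Uᴴ, h2, Matrix.one_mul]
  rw [Matrix.mul_sub, Matrix.sub_mul, e2, e2, e1] at h'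
  rw [e1] at hA'
  rw [h3]
  refine Matrix.PosSemidef.mul_mul_conjTranspose_same (Matrix.PosSemidef.diagonal fun j => ?_) U
  simp only [Pi.zero_apply]
  suffices 0 ≤ c j by exact_mod_cast this
  -- For an eigenvalue $c<0$ of the difference, the diagonal entry of $A^2-D^2$ is
  -- $c(A_{jj}+D_{jj})$. Here $A_{jj}=D_{jj}+c\ge0$ forces $D_{jj}\ge -c>0$, so this entry would be
  -- negative.
  by_contra! hc
  have a1 := (Complex.le_def.1 (hA'.diag_nonneg (i := j))).1
  have a2 := (Complex.le_def.1 (hD'.diag_nonneg (i := j))).1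
  have a3 := (Complex.le_def.1 (h'.diag_nonneg (i := j))).1
  generalize Uᴴ * D * U = Y at a1 a2 a3
  have e3 : (Y + Matrix.diagonal fun i => (c i : ℂ)) * (Y + Matrix.diagonal fun i => (c i : ℂ)) -
      Y * Y = Y * (Matrix.diagonal fun i => (c i : ℂ)) + (Matrix.diagonal fun i => (c i : ℂ)) * Y +
        (Matrix.diagonal fun i => (c i : ℂ)) * (Matrix.diagonal fun i => (c i : ℂ)) := by
    rw [add_mul, mul_add, mul_add]; abel
  rw [e3, Matrix.add_apply, Matrix.add_apply, Matrix.mul_diagonal, Matrix.diagonal_mul,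
    Matrix.diagonal_mul_diagonal, Matrix.diagonal_apply_eq] at a3
  rw [Matrix.add_apply, Matrix.diagonal_apply_eq] at a1
  simp only [Complex.zero_re, Complex.add_re, Complex.mul_re, Complex.ofReal_re, Complex.ofReal_im,
    mul_zero, zero_mul, sub_zero] at a1 a2 a3
  nlinarith

/-- In an eigenbasis of $X^\dagger X$ the singular values are the norms of the columns, and each
bounds the diagonal entry of its column. -/
theorem re_trace_le_traceNorm (X : Op Q) : X.trace.re ≤ traceNorm X := by
  obtain ⟨U, d, h1, h2, h3, h4⟩ :=
    exists_diagonalization (Matrix.isHermitian_conjTranspose_mul_self X)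
  have ht : ∀ Y : Op Q, (Uᴴ * Y * U).trace = Y.trace := by
    intro Y
    rw [Matrix.mul_assoc, Matrix.trace_mul_comm, Matrix.mul_assoc, h2, Matrix.mul_one]
  have e1 : traceNorm X = ∑ i, Real.sqrt (d i) := by
    rw [traceNorm, h4, ← ht, Matrix.mul_assoc, Matrix.mul_assoc _ Uᴴ, h1, Matrix.mul_one,
      ← Matrix.mul_assoc, h1, Matrix.one_mul, Matrix.trace_diagonal, Complex.re_sum]
    simp
  have e2 : (Uᴴ * X * U)ᴴ * (Uᴴ * X * U) = Matrix.diagonal fun i => (d i : ℂ) := by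
    calc (Uᴴ * X * U)ᴴ * (Uᴴ * X * U) = Uᴴ * (Xᴴ * ((U * Uᴴ) * X)) * U := by
          simp only [Matrix.conjTranspose_mul, Matrix.conjTranspose_conjTranspose, Matrix.mul_assoc]
      _ = Uᴴ * (U * Matrix.diagonal (fun i => (d i : ℂ)) * Uᴴ) * U := by
          rw [h2, Matrix.one_mul, h3]
      _ = _ := by
          simp only [Matrix.mul_assoc]
          rw [h1, Matrix.mul_one, ← Matrix.mul_assoc, h1, Matrix.one_mul]
  rw [e1, ← ht, Matrix.trace, Complex.re_sum]
  generalize Uᴴ * X * U = Y at e2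
  refine Finset.sum_le_sum fun i _ => ?_
  rw [Matrix.diag_apply]
  refine (Complex.re_le_norm _).trans (Real.le_sqrt_of_sq_le ?_)
  have h5 := congrFun (congrFun e2 i) i
  rw [Matrix.mul_apply, Matrix.diagonal_apply_eq] at h5
  have h6 : (d i : ℝ) = ∑ k, ‖Y k i‖ ^ 2 := by
    have : ((∑ k, ‖Y k i‖ ^ 2 : ℝ) : ℂ) = d i := by
      rw [← h5]
      push_cast
      refine Finset.sum_congr rfl fun k _ => ?_
      rw [Matrix.conjTranspose_apply, Complex.star_def, Complex.conj_mul']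
    exact_mod_cast this.symm
  rw [h6]
  exact Finset.single_le_sum (f := fun k => ‖Y k i‖ ^ 2) (fun k _ => by positivity)
    (Finset.mem_univ i)

/-- From $\sigma\ge r\rho$ follows $\sqrt\sigma\ge\sqrt r\sqrt\rho$; pairing with $\sqrt\rho\ge0$
gives $\sqrt r\operatorname{tr}\rho$. -/
theorem sqrt_le_re_trace {σ ρ : Op Q} (hσ : σ.PosSemidef) (hρ : ρ.PosSemidef)
    (htr : ρ.trace = 1) {r : ℝ} (hr : 0 ≤ r) (h : (σ - (r : ℂ) • ρ).PosSemidef) :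
    Real.sqrt r ≤ (cfc Real.sqrt σ * cfc Real.sqrt ρ).trace.re := by
  obtain ⟨hA, hA2⟩ := posSemidef_cfc_sqrt hσ
  obtain ⟨hB, hB2⟩ := posSemidef_cfc_sqrt hρ
  generalize cfc Real.sqrt σ = A at hA hA2 ⊢
  generalize cfc Real.sqrt ρ = B at hB hB2 ⊢
  have hs : (0 : ℂ) ≤ (Real.sqrt r : ℂ) := by exact_mod_cast Real.sqrt_nonneg r
  have h1 : (A - (Real.sqrt r : ℂ) • B).PosSemidef := by
    refine posSemidef_sub_of_sq hA (hB.smul hs) ?_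
    rw [hA2, smul_mul_smul_comm, hB2, ← Complex.ofReal_mul, Real.mul_self_sqrt hr]
    exact h
  have h2 := re_trace_mul_nonneg h1 hB
  rw [sub_mul, Matrix.trace_sub, Complex.sub_re, Matrix.smul_mul, hB2, Matrix.trace_smul, htr] at h2
  simpa using h2

theorem sqrt_le_fidelity {σ ρ : Op Q} (hσ : σ.PosSemidef) (hρ : ρ.PosSemidef)
    (htr : ρ.trace = 1) {r : ℝ} (hr : 0 ≤ r) (h : (σ - (r : ℂ) • ρ).PosSemidef) :
    Real.sqrt r ≤ fidelity σ ρ :=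
  (sqrt_le_re_trace hσ hρ htr hr h).trans (re_trace_le_traceNorm _)

theorem sqrt_le_fidelity' {σ ρ : Op Q} (hσ : σ.PosSemidef) (hρ : ρ.PosSemidef)
    (htr : ρ.trace = 1) {r : ℝ} (hr : 0 ≤ r) (h : (σ - (r : ℂ) • ρ).PosSemidef) :
    Real.sqrt r ≤ fidelity ρ σ := by
  refine (sqrt_le_re_trace hσ hρ htr hr h).trans ?_
  rw [Matrix.trace_mul_comm]
  exact re_trace_le_traceNorm _

/-- Linear maps that preserve positivity. -/
def IsPositiveMap (Φ : Op Q → Op Q') : Prop :=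
  (∃ T : Op Q →ₗ[ℂ] Op Q', ∀ ρ, T ρ = Φ ρ) ∧ ∀ ρ, ρ.PosSemidef → (Φ ρ).PosSemidef

theorem IsPositiveMap.id : IsPositiveMap (fun ρ : Op Q => ρ) :=
  ⟨⟨LinearMap.id, fun _ => rfl⟩, fun _ h => h⟩

theorem IsPositiveMap.comp {Ψ : Op Q' → Op Q''} {Φ : Op Q → Op Q'} (hΨ : IsPositiveMap Ψ)
    (hΦ : IsPositiveMap Φ) : IsPositiveMap fun ρ => Ψ (Φ ρ) := by
  obtain ⟨⟨T, hT⟩, h1⟩ := hΦ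
  obtain ⟨⟨S, hS⟩, h2⟩ := hΨ
  exact ⟨⟨S ∘ₗ T, fun ρ => by rw [LinearMap.comp_apply, hT, hS]⟩, fun ρ h => h2 _ (h1 _ h)⟩

/-- Domination passes through positive linear maps. This takes the place of monotonicity of the
fidelity under channels. -/
theorem IsPositiveMap.sub_smul {Φ : Op Q → Op Q'} (hΦ : IsPositiveMap Φ) {σ ρ : Op Q} {r : ℂ}
    (h : (σ - r • ρ).PosSemidef) : (Φ σ - r • Φ ρ).PosSemidef := by
  obtain ⟨⟨T, hT⟩, h1⟩ := hΦ
  have := h1 _ h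
  rwa [← hT, map_sub, map_smul, hT, hT] at this

theorem isPositiveMap_kraus {ι : Type*} [Fintype ι]
    (K : ι → Matrix (Q' → Fin 2) (Q → Fin 2) ℂ) :
    IsPositiveMap fun ρ : Op Q => ∑ i, K i * ρ * (K i)ᴴ := by
  refine ⟨⟨{ toFun := fun ρ => ∑ i, K i * ρ * (K i)ᴴ, map_add' := ?_, map_smul' := ?_ },
    fun _ => rfl⟩, fun ρ h => ?_⟩
  · intro x y
    simp only [Matrix.mul_add, Matrix.add_mul, Finset.sum_add_distrib]
  · intro r x
    simp only [Matrix.mul_smul, Matrix.smul_mul, Finset.smul_sum, RingHom.id_apply]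
  · exact Matrix.posSemidef_sum _ fun i _ => h.mul_mul_conjTranspose_same (K i)

theorem isPositiveMap_conj (K : Matrix (Q' → Fin 2) (Q → Fin 2) ℂ) :
    IsPositiveMap fun ρ : Op Q => K * ρ * Kᴴ := by
  simpa using isPositiveMap_kraus fun _ : Unit => K

theorem isPositiveMap_runGates (l : List (ChannelGate Q))
    (hl : ∀ g ∈ l, IsChannelOn g.supp g.map) : IsPositiveMap (runGates l) := by
  induction l with
  | nil => exact IsPositiveMap.id
  | cons g l ih =>
    have h1 := ih fun g' hg' => hl g' (List.mem_cons_of_mem _ hg')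
    obtain ⟨n, K, -, h⟩ := hl g List.mem_cons_self
    have h2 : IsPositiveMap g.map := by
      have := isPositiveMap_kraus fun i => embed g.supp (K i)
      rwa [← funext h] at this
    exact h1.comp h2

theorem one_sub_posSemidef {W : Op Q} (hW : W * W = 1) (hW' : Wᴴ = W) : (1 - W).PosSemidef := by
  have e : (1 : Op Q) - W = (1 / 2 : ℂ) • ((1 - W)ᴴ * (1 - W)) := by
    rw [Matrix.conjTranspose_sub, Matrix.conjTranspose_one, hW', sub_mul, mul_sub, mul_sub, hW,
      mul_one, mul_one, one_mul]
    module
  rw [e]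
  refine (Matrix.posSemidef_conjTranspose_mul_self _).smul ?_
  rw [Complex.le_def]; norm_num

theorem maxMixed_posSemidef : (maxMixed Q).PosSemidef := by
  refine Matrix.PosSemidef.one.smul ?_
  have : (0 : ℂ) ≤ (2 : ℂ) ^ Fintype.card Q := pow_nonneg (by norm_num) _
  exact inv_nonneg.2 this

theorem trace_maxMixed : (maxMixed Q).trace = 1 := by
  rw [maxMixed, Matrix.trace_smul, Matrix.trace_one, smul_eq_mul]
  simp

theorem string_involution {a b : Q → Fin 2} (h : sgn b a = 1) :
    paX a * paZ b * (paX a * paZ b) = 1 ∧ (paX a * paZ b)ᴴ = paX a * paZ b := by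
  have hc : Commute (paZ b) (paX a) := paZ_commute_paX h
  constructor
  · rw [Matrix.mul_assoc, ← Matrix.mul_assoc (paZ _), hc.eq, Matrix.mul_assoc, paZ_mul_self,
      Matrix.mul_one, paX_mul_self]
  · rw [Matrix.conjTranspose_mul, paX_conjTranspose, paZ_conjTranspose, hc.eq]

theorem sgn_sum_left {ι : Type*} (S : Finset ι) (b : ι → Q → Fin 2) (a : Q → Fin 2)
    (h : ∀ i ∈ S, sgn (b i) a = 1) : sgn (∑ i ∈ S, b i) a = 1 := by
  classical
  induction S using Finset.induction_on with
  | empty => simp [sgn]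
  | insert i S hi ih =>
    rw [Finset.sum_insert hi, sgn_add_left, h i (Finset.mem_insert_self _ _),
      ih fun j hj => h j (Finset.mem_insert_of_mem hj), one_mul]

theorem sgn_sum_sum {ι κ : Type*} (S : Finset ι) (T : Finset κ) (a : ι → Q → Fin 2)
    (b : κ → Q → Fin 2) (h : ∀ i j, sgn (b j) (a i) = 1) :
    sgn (∑ j ∈ T, b j) (∑ i ∈ S, a i) = 1 := by
  refine sgn_sum_left _ _ _ fun j _ => ?_
  rw [sgn_comm]
  refine sgn_sum_left _ _ _ fun i _ => ?_
  rw [sgn_comm]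
  exact h i j

variable {ι κ : Type*} [Fintype ι] [Fintype κ] {a : ι → Q → Fin 2} {b : κ → Q → Fin 2}

/-- Each Pauli string in the expansion is a Hermitian involution, hence at most $1$, and comes with
a nonnegative coefficient; the coefficients sum to the product on the left. -/
theorem stab_le (h : ∀ i j, sgn (b j) (a i) = 1) {f : ι → ℝ} {g : κ → ℝ} (hf : ∀ i, 0 ≤ f i)
    (hg : ∀ j, 0 ≤ g j) : ((((∏ i, (1 + f i)) * ∏ j, (1 + g j) : ℝ) : ℂ) • (1 : Op Q) -
      phiX (stabProd a fun i => (f i : ℂ)) * phiZ (stabProd b fun j => (g j : ℂ))).PosSemidef := by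
  classical
  have e1 : phiX (stabProd a fun i => (f i : ℂ)) * phiZ (stabProd b fun j => (g j : ℂ)) =
      ∑ S : Finset ι, ∑ T : Finset κ, (((∏ i ∈ S, f i) * ∏ j ∈ T, g j : ℝ) : ℂ) •
        (paX (∑ i ∈ S, a i) * paZ (∑ j ∈ T, b j)) := by
    rw [stabProd_eq_sum, stabProd_eq_sum, map_sum, map_sum, Finset.sum_mul]
    refine Finset.sum_congr rfl fun S _ => ?_
    rw [Finset.mul_sum]
    refine Finset.sum_congr rfl fun T _ => ?_
    rw [map_smul, map_smul, phiX_xx, phiZ_xx, smul_mul_smul_comm]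
    push_cast
    rfl
  have e2 : (∏ i, (1 + f i)) * ∏ j, (1 + g j) = ∑ S : Finset ι, ∑ T : Finset κ,
      (∏ i ∈ S, f i) * ∏ j ∈ T, g j := by
    rw [Finset.prod_one_add, Finset.prod_one_add, Finset.powerset_univ, Finset.powerset_univ,
      Finset.sum_mul_sum]
  rw [e1, e2, Complex.ofReal_sum, Finset.sum_smul, ← Finset.sum_sub_distrib]
  refine Matrix.posSemidef_sum _ fun S _ => ?_
  rw [Complex.ofReal_sum, Finset.sum_smul, ← Finset.sum_sub_distrib]
  refine Matrix.posSemidef_sum _ fun T _ => ?_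
  rw [← smul_sub]
  obtain ⟨h1, h2⟩ := string_involution (sgn_sum_sum S T a b h)
  refine (one_sub_posSemidef h1 h2).smul ?_
  have : (0 : ℝ) ≤ (∏ i ∈ S, f i) * ∏ j ∈ T, g j :=
    mul_nonneg (Finset.prod_nonneg fun i _ => hf i) (Finset.prod_nonneg fun j _ => hg j)
  exact_mod_cast this

theorem maxMixed_sub_stab (h : ∀ i j, sgn (b j) (a i) = 1) {f : ι → ℝ} {g : κ → ℝ}
    (hf : ∀ i, 0 ≤ f i) (hg : ∀ j, 0 ≤ g j) {r : ℝ} (hr : (2 : ℝ) ^ Fintype.card Q ≤ r) :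
    (maxMixed Q - ((((∏ i, (1 + f i)) * ∏ j, (1 + g j)) * r : ℝ) : ℂ)⁻¹ •
      (phiX (stabProd a fun i => (f i : ℂ)) * phiZ (stabProd b fun j => (g j : ℂ)))).PosSemidef := by
  have hn : (0 : ℝ) < 2 ^ Fintype.card Q := by positivity
  have hr0 : 0 < r := hn.trans_le hr
  have h1 := stab_le h hf hg
  have hT : (0 : ℝ) < (∏ i, (1 + f i)) * ∏ j, (1 + g j) :=
    mul_pos (Finset.prod_pos fun i _ => by linarith [hf i])
      (Finset.prod_pos fun j _ => by linarith [hg j])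
  rw [maxMixed]
  generalize (∏ i, (1 + f i)) * ∏ j, (1 + g j) = T at h1 hT ⊢
  generalize phiX (stabProd a fun i => (f i : ℂ)) * phiZ (stabProd b fun j => (g j : ℂ)) = σ at h1 ⊢
  set n : ℝ := 2 ^ Fintype.card Q with hnd
  -- The difference is a sum of two positive terms; the first is nonnegative because $r\ge 2^{|Q|}$,
  -- the second by `stab_le`.
  have e : ((2 : ℂ) ^ Fintype.card Q)⁻¹ • (1 : Op Q) - ((T * r : ℝ) : ℂ)⁻¹ • σ =
      ((n⁻¹ - r⁻¹ : ℝ) : ℂ) • (1 : Op Q) + ((T⁻¹ * r⁻¹ : ℝ) : ℂ) • ((T : ℂ) • (1 : Op Q) - σ) := by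
    have hTc : (T : ℂ) ≠ 0 := by exact_mod_cast hT.ne'
    have : ((2 : ℂ) ^ Fintype.card Q) = (n : ℂ) := by rw [hnd]; push_cast; rfl
    rw [this, smul_sub, smul_smul]
    push_cast
    have : (T : ℂ)⁻¹ * (r : ℂ)⁻¹ * T = (r : ℂ)⁻¹ := by field_simp
    rw [this, mul_inv]
    module
  rw [e]
  refine (Matrix.PosSemidef.one.smul ?_).add (h1.smul ?_)
  · have : 0 ≤ n⁻¹ - r⁻¹ := sub_nonneg.2 (inv_anti₀ hn hr)
    exact_mod_cast this
  · have : 0 ≤ T⁻¹ * r⁻¹ := by positivity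
    exact_mod_cast this

end Fidelity

/-! ### Fidelity of Gibbs states with the maximally mixed state -/

section GibbsBounds

open scoped ComplexOrder

variable {L : ℕ} [NeZero L]

theorem gibbs_posSemidef (β : ℝ) : (gibbs L β).PosSemidef := by
  have h : (-(β : ℂ) • toricHamiltonian L).IsHermitian := by
    rw [Matrix.IsHermitian, Matrix.conjTranspose_smul, toricHamiltonian]
    simp only [xString_eq, zString_eq, Matrix.conjTranspose_sub, Matrix.conjTranspose_neg,
      Matrix.conjTranspose_sum, paX_conjTranspose, paZ_conjTranspose, star_neg, Complex.star_def,
      Complex.conj_ofReal]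
  rw [gibbs]
  generalize -(β : ℂ) • toricHamiltonian L = A at h
  have h2 : ((1 / 2 : ℂ) • A).IsHermitian := by
    rw [Matrix.IsHermitian, Matrix.conjTranspose_smul, h.eq]; norm_num
  have e : NormedSpace.exp A = (NormedSpace.exp ((1 / 2 : ℂ) • A))ᴴ *
      NormedSpace.exp ((1 / 2 : ℂ) • A) := by
    rw [h2.exp.eq, ← Matrix.exp_add_of_commute _ _ (Commute.refl _)]
    congr 1
    module
  have hp : (NormedSpace.exp A).PosSemidef := by
    rw [e]; exact Matrix.posSemidef_conjTranspose_mul_self _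
  exact hp.smul (inv_nonneg.2 hp.trace_nonneg)

theorem maxMixed_sub_gibbs (hL : 2 ≤ L) {β : ℝ} (hβ : 0 ≤ β) :
    (maxMixed (Edge L) - (((1 + Real.tanh β) ^ (2 * L ^ 2) : ℝ)⁻¹ : ℂ) • gibbs L β).PosSemidef := by
  obtain ⟨r, hr, h⟩ := trace_therm (L := L) hβ
  have ht := real_tanh_nonneg hβ
  have h1 := maxMixed_sub_stab (fun p v : Site L => sgn_vertexStar_plaquette hL p v)
    (f := fun _ => Real.tanh β) (g := fun _ => Real.tanh β) (fun _ => ht) (fun _ => ht) hr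
  have hp : (∏ _p : Site L, (1 + Real.tanh β)) * ∏ _p : Site L, (1 + Real.tanh β) =
      (1 + Real.tanh β) ^ (2 * L ^ 2) := by
    rw [Finset.prod_const, Finset.card_univ, Fintype.card_prod, ZMod.card, ← pow_add, ← two_mul,
      ← sq]
  rw [hp] at h1
  have e : ((((1 + Real.tanh β) ^ (2 * L ^ 2) * r : ℝ) : ℂ))⁻¹ • therm L β =
      (((1 + Real.tanh β) ^ (2 * L ^ 2) : ℝ)⁻¹ : ℂ) • gibbs L β := by
    rw [gibbs_eq hL, h, smul_smul, ← mul_inv, Complex.ofReal_mul]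
  rw [← e]
  exact h1

theorem sqrt_inv_ge (L : ℕ) {β : ℝ} (hβ : 0 ≤ β) : Real.exp (-(β * (L : ℝ) ^ 2)) ≤
    Real.sqrt (((1 + Real.tanh β) ^ (2 * L ^ 2))⁻¹) := by
  have ht := real_tanh_nonneg hβ
  -- Indeed $1+\tanh\beta=e^\beta/\cosh\beta$. The square root halves the exponent $2L^2$ coming
  -- from plaquettes and vertices.
  have h1 : 1 + Real.tanh β ≤ Real.exp β := by
    rw [Real.tanh_eq_sinh_div_cosh, one_add_div (Real.cosh_pos β).ne', Real.cosh_add_sinh]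
    exact div_le_self (Real.exp_pos β).le (Real.one_le_cosh β)
  refine Real.le_sqrt_of_sq_le ?_
  rw [Real.exp_neg, inv_pow, ← Real.exp_nat_mul]
  refine inv_anti₀ (by positivity) ((pow_le_pow_left₀ (by linarith) h1 _).trans_eq ?_)
  rw [← Real.exp_nat_mul]
  push_cast
  ring_nf

theorem fidelity_gibbs_maxMixed (hL : 2 ≤ L) {β : ℝ} (hβ : 0 ≤ β) :
    Real.exp (-(β * (L : ℝ) ^ 2)) ≤ fidelity (gibbs L β) (maxMixed (Edge L)) := by
  refine (sqrt_inv_ge L hβ).trans (sqrt_le_fidelity' maxMixed_posSemidef (gibbs_posSemidef β)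
    (trace_gibbs hL hβ) ?_ ?_)
  · have := real_tanh_nonneg hβ; positivity
  · have := maxMixed_sub_gibbs hL hβ
    push_cast at this ⊢
    exact this

variable {M : ℕ} [NeZero M]

theorem fineStep_isPositiveMap (β : ℝ) : IsPositiveMap (fineStep M β) := by
  have h1 := isPositiveMap_runGates _ (fineGates_isChannelOn (M := M) β (blocks M) (blocks M))
  have h2 : IsPositiveMap (adjoin (coarseEdge M) (decoupledState M)) := by
    have := isPositiveMap_conj (adjV (coarseEdge M) (fun q => if decoupledState M q = ketPlus
      then ampPlus else amp0))
    have e : adjoin (coarseEdge M) (decoupledState M) = fun ρ => adjV (coarseEdge M)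
        (fun q => if decoupledState M q = ketPlus then ampPlus else amp0) * ρ *
        (adjV (coarseEdge M) (fun q => if decoupledState M q = ketPlus
      then ampPlus else amp0))ᴴ := funext fun ρ => adjoin_eq _ _ _ decoupledState_apply ρ
    rw [e]
    exact this
  exact h1.comp h2

theorem fineIter_isPositiveMap (ℓ : ℕ) (β : ℝ) : IsPositiveMap (fineIter M ℓ β) := by
  induction ℓ generalizing β with
  | zero => exact IsPositiveMap.id
  | succ ℓ ih => exact (fineStep_isPositiveMap β).comp (ih (rgBeta β))

theorem iterate_rgBeta_nonneg (ℓ : ℕ) {β : ℝ} (hβ : 0 ≤ β) : 0 ≤ rgBeta^[ℓ] β := by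
  cases ℓ with
  | zero => exact hβ
  | succ ℓ => rw [Function.iterate_succ_apply']; exact rgBeta_nonneg _

/-- The domination on the small lattice is pushed through the reversed RG, which maps the
renormalized Gibbs state exactly to the fine one. The bound thus involves `M`, not the size of the
fine lattice. -/
theorem fidelity_fineIter (hM : 2 ≤ M) (ℓ : ℕ) {β : ℝ} (hβ : 0 ≤ β) :
    Real.exp (-(rgBeta^[ℓ] β * (M : ℝ) ^ 2)) ≤
      fidelity (fineIter M ℓ β (maxMixed (Edge M))) (gibbs (latticeSize M ℓ) β) := by
  have hβ' := iterate_rgBeta_nonneg ℓ hβ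
  have h1 := fineIter_isPositiveMap (M := M) ℓ β
  refine (sqrt_inv_ge M hβ').trans (sqrt_le_fidelity (h1.2 _ maxMixed_posSemidef)
    (gibbs_posSemidef β) (trace_gibbs (two_le_latticeSize hM ℓ) hβ) ?_ ?_)
  · have := real_tanh_nonneg hβ'; positivity
  · have := h1.sub_smul (maxMixed_sub_gibbs hM hβ')
    rw [fineIter_gibbs hM ℓ hβ] at this
    push_cast at this ⊢
    exact this

end GibbsBounds

/-! ### The flow of the temperature and the number of steps -/

section Flow

theorem anyonProb_iff (β β' : ℝ) : anyonProb β' =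
    4 * anyonProb β * (1 - anyonProb β) ^ 3 + 4 * anyonProb β ^ 3 * (1 - anyonProb β) ↔
      Real.tanh β' = Real.tanh β ^ 4 := by
  rw [anyonProb_eq, anyonProb_eq]
  constructor
  · intro h; linear_combination -2 * h
  · intro h; linear_combination -1 / 2 * h

theorem artanh_le {x : ℝ} (h0 : 0 ≤ x) (h1 : x < 1) : Real.artanh x ≤ x / (1 - x) := by
  have h2 : 0 < 1 - x := by linarith
  rw [Real.artanh_eq_half_log ⟨by linarith, h1.le⟩]
  have := Real.log_le_sub_one_of_pos (x := (1 + x) / (1 - x)) (by positivity)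
  have e : (1 + x) / (1 - x) - 1 = 2 * (x / (1 - x)) := by field_simp; ring
  rw [e] at this
  linarith

theorem le_artanh {x : ℝ} (h0 : 0 ≤ x) (h1 : x < 1) : x / (1 + x) ≤ Real.artanh x := by
  have h2 : 0 < 1 - x := by linarith
  have h3 : 0 < 1 + x := by linarith
  rw [Real.artanh_eq_half_log ⟨by linarith, h1.le⟩]
  have := Real.one_sub_inv_le_log_of_pos (x := (1 + x) / (1 - x)) (by positivity)
  have e : 1 - ((1 + x) / (1 - x))⁻¹ = 2 * (x / (1 + x)) := by field_simp; ring
  rw [e] at this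
  linarith

theorem real_tanh_lt_one (β : ℝ) : Real.tanh β < 1 := by
  rw [Real.tanh_eq_sinh_div_cosh, div_lt_one (Real.cosh_pos β)]
  exact Real.sinh_lt_cosh β

theorem tanh_iterate (ℓ : ℕ) (β : ℝ) : Real.tanh (rgBeta^[ℓ] β) = Real.tanh β ^ 4 ^ ℓ := by
  induction ℓ with
  | zero => simp
  | succ ℓ ih => rw [Function.iterate_succ_apply', tanh_rgBeta, ih, ← pow_mul, pow_succ]

/-- This is $\operatorname{artanh}x\le x/(1-x)$ at $x=t^{4^\ell}$, with $x\le t$ in the denominator.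
-/
theorem iterate_rgBeta_le (ℓ : ℕ) {β : ℝ} (hβ : 0 ≤ β) :
    rgBeta^[ℓ] β ≤ Real.tanh β ^ 4 ^ ℓ / (1 - Real.tanh β) := by
  have h0 := real_tanh_nonneg hβ
  have h1 := real_tanh_lt_one β
  have h2 : Real.tanh β ^ 4 ^ ℓ ≤ Real.tanh β :=
    pow_le_of_le_one h0 h1.le (by positivity)
  have h3 := artanh_le (x := Real.tanh (rgBeta^[ℓ] β))
    (real_tanh_nonneg (iterate_rgBeta_nonneg ℓ hβ)) (real_tanh_lt_one _)
  rw [Real.artanh_tanh, tanh_iterate] at h3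
  exact h3.trans (div_le_div_of_nonneg_left (by positivity) (by linarith) (by linarith))

theorem tendsto_iterate_rgBeta {β : ℝ} (hβ : 0 ≤ β) :
    Tendsto (fun ℓ : ℕ => rgBeta^[ℓ] β) atTop (𝓝 0) := by
  have h0 := real_tanh_nonneg hβ
  have h1 := real_tanh_lt_one β
  have h2 : Tendsto (fun ℓ : ℕ => Real.tanh β ^ ℓ / (1 - Real.tanh β)) atTop (𝓝 0) := by
    simpa using (tendsto_pow_atTop_nhds_zero_of_lt_one h0 h1).div_const (1 - Real.tanh β)
  refine squeeze_zero (fun ℓ => iterate_rgBeta_nonneg ℓ hβ) (fun ℓ => ?_) h2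
  refine (iterate_rgBeta_le ℓ hβ).trans (div_le_div_of_nonneg_right ?_ (by linarith))
  exact pow_le_pow_of_le_one h0 h1.le (Nat.lt_pow_self (by norm_num)).le

theorem tendsto_tanh_div : Tendsto (fun β : ℝ => Real.tanh β / β) (𝓝[>] 0) (𝓝 1) := by
  have h : HasDerivAt Real.sinh (Real.cosh 0) 0 := Real.hasDerivAt_sinh 0
  rw [hasDerivAt_iff_tendsto_slope, Real.cosh_zero] at h
  have h2 := h.mono_left (nhdsWithin_mono 0 fun x (hx : 0 < x) => hx.ne')
  have h3 : Tendsto Real.cosh (𝓝[>] 0) (𝓝 1) := by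
    have := (Real.continuous_cosh.tendsto 0).mono_left (nhdsWithin_le_nhds (s := Set.Ioi (0 : ℝ)))
    rwa [Real.cosh_zero] at this
  have h4 := h2.div h3 one_ne_zero
  rw [div_one] at h4
  refine h4.congr fun β => ?_
  rw [Pi.div_apply, slope_def_field, Real.sinh_zero, Real.tanh_eq_sinh_div_cosh, sub_zero, sub_zero,
    div_right_comm]

/-- Squeezed between $x/(1+x)\le\operatorname{artanh}x\le x/(1-x)$ at $x=\tanh^4\beta$, since
$\tanh\beta/\beta\to1$. -/
theorem tendsto_rgBeta_div : Tendsto (fun β : ℝ => rgBeta β / β ^ 4) (𝓝[>] 0) (𝓝 1) := by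
  have h1 := tendsto_tanh_div.pow 4
  rw [one_pow] at h1
  have h2 : Tendsto (fun β : ℝ => Real.tanh β ^ 4) (𝓝[>] 0) (𝓝 0) := by
    have h3 : Continuous fun β : ℝ => Real.tanh β ^ 4 := by
      simp only [Real.tanh_eq_sinh_div_cosh]
      exact (Real.continuous_sinh.div Real.continuous_cosh fun x => (Real.cosh_pos x).ne').pow 4
    have := (h3.tendsto 0).mono_left (nhdsWithin_le_nhds (s := Set.Ioi (0 : ℝ)))
    simpa using this
  have hl : Tendsto (fun β : ℝ => 1 / (1 + Real.tanh β ^ 4) * (Real.tanh β / β) ^ 4)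
      (𝓝[>] 0) (𝓝 1) := by
    simpa using ((tendsto_const_nhds (x := (1 : ℝ))).div (h2.const_add 1) (by norm_num)).mul h1
  have hu : Tendsto (fun β : ℝ => 1 / (1 - Real.tanh β ^ 4) * (Real.tanh β / β) ^ 4)
      (𝓝[>] 0) (𝓝 1) := by
    simpa using ((tendsto_const_nhds (x := (1 : ℝ))).div (h2.const_sub 1) (by norm_num)).mul h1
  have hx : ∀ β : ℝ, (0 : ℝ) ≤ Real.tanh β ^ 4 := fun β => by positivity
  refine tendsto_of_tendsto_of_tendsto_of_le_of_le' hl hu ?_ ?_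
  · filter_upwards [self_mem_nhdsWithin] with β (hβ : 0 < β)
    have := le_artanh (hx β) (tanh_pow_four_lt β)
    rw [rgBeta, div_pow, ← mul_div_assoc]
    refine div_le_div_of_nonneg_right (le_trans (le_of_eq ?_) this) (by positivity)
    ring
  · filter_upwards [self_mem_nhdsWithin] with β (hβ : 0 < β)
    have := artanh_le (hx β) (tanh_pow_four_lt β)
    rw [rgBeta, div_pow, ← mul_div_assoc]
    refine div_le_div_of_nonneg_right (this.trans (le_of_eq ?_)) (by positivity)
    ring

theorem latticeSize_eq (M ℓ : ℕ) : latticeSize M ℓ = 2 ^ ℓ * M := by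
  induction ℓ with
  | zero => simp [latticeSize]
  | succ ℓ ih => rw [latticeSize, ih, pow_succ]; ring

theorem log_two_le_log_div {L : ℕ} (hL : 2 ≤ L) {ε : ℝ} (h0 : 0 < ε) (h1 : ε < 1) :
    Real.log 2 ≤ Real.log (L / ε) := by
  refine Real.log_le_log (by norm_num) ?_
  rw [le_div_iff₀ h0]
  have : (2 : ℝ) ≤ L := by exact_mod_cast hL
  nlinarith

theorem exists_flow_constants {β : ℝ} (hβ : 0 ≤ β) (K : ℕ) : ∃ (c C : ℝ) (k : ℕ), 0 < c ∧
    ∀ M : ℕ, 2 ≤ M → ∀ (ℓ : ℕ) (ε : ℝ), 0 < ε → ε < 1 →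
      (c * Real.log (1 + Real.log ((latticeSize M ℓ : ℝ) / ε)) ≤ ℓ →
        rgBeta^[ℓ] β * (M : ℝ) ^ 2 < ε) ∧
      ((ℓ : ℝ) ≤ c * Real.log (1 + Real.log ((latticeSize M ℓ : ℝ) / ε)) + 1 →
        ((K * (ℓ + 1) * 2 ^ ℓ : ℕ) : ℝ) ≤ C * Real.log ((latticeSize M ℓ : ℝ) / ε) ^ k) := by
  have ht0 := real_tanh_nonneg hβ
  have ht1 := real_tanh_lt_one β
  set t := Real.tanh β with ht
  -- At $\beta=0$ the base $t$ vanishes and has no useful logarithm; a number strictly between $t$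
  -- and $1$ serves as base instead.
  obtain ⟨t', ht', ht'1⟩ := exists_between ht1
  have ht'0 : 0 < t' := ht0.trans_lt ht'
  have ha : 0 < -Real.log t' := by have := Real.log_neg ht'0 ht'1; linarith
  set a := -Real.log t' with had
  set B := -Real.log (1 - t) with hBd
  have hB : 0 ≤ B := by
    have := Real.log_nonpos (x := 1 - t) (by linarith) (by linarith); linarith
  -- Chosen so that $a\kappa=2+B+a$; then $4^\ell\ge(1+\Lambda)\kappa$ gives $a4^\ell>2\Lambda+B$.
  set κ := (2 + B) / a + 1 with hκ
  have hκ1 : 1 ≤ κ := by rw [hκ]; have : 0 ≤ (2 + B) / a := by positivity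
                         linarith
  have hl2 : 0 < Real.log 2 := Real.log_pos (by norm_num)
  have hl12 : 0 < Real.log (1 + Real.log 2) := Real.log_pos (by linarith)
  have hl4 : 0 < Real.log 4 := Real.log_pos (by norm_num)
  -- With $c\log4=1+b$ one gets $4^\ell\ge(1+\Lambda)^{1+b}$, and $(1+\Lambda)^b\ge\kappa$ because
  -- $\Lambda\ge\log2$.
  set b := Real.log κ / Real.log (1 + Real.log 2) with hb
  have hb0 : 0 ≤ b := div_nonneg (Real.log_nonneg hκ1) hl12.le
  have hc : 0 < (1 + b) / Real.log 4 := by positivity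
  set c := (1 + b) / Real.log 4 with hcd
  have hcl : c * Real.log 4 = 1 + b := by rw [hcd]; field_simp
  set k := ⌈1 + b⌉₊ with hk
  refine ⟨c, 4 * K * (1 / Real.log 2 + 1) ^ k, k, hc, fun M hM ℓ ε hε0 hε1 => ?_⟩
  have hL : 2 ≤ latticeSize M ℓ := by
    rw [latticeSize_eq]; exact hM.trans (Nat.le_mul_of_pos_left _ (by positivity))
  have hML : M ≤ latticeSize M ℓ := by
    rw [latticeSize_eq]; exact Nat.le_mul_of_pos_left _ (by positivity)
  generalize latticeSize M ℓ = L at hL hML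
  have hΛ := log_two_le_log_div hL hε0 hε1
  have hL0 : (0 : ℝ) < L := by positivity
  have hM0 : (0 : ℝ) < M := by positivity
  have hΛe : Real.log (L / ε) = Real.log L - Real.log ε := Real.log_div hL0.ne' hε0.ne'
  have hlε : Real.log ε ≤ 0 := Real.log_nonpos hε0.le hε1.le
  set Λ := Real.log (L / ε) with hΛd
  have hΛp : 0 < Λ := by linarith
  have hΛ1 : 0 < Real.log (1 + Λ) := Real.log_pos (by linarith)
  constructor
  · intro h
    have h1 : Real.log (1 + Λ) + Real.log κ ≤ ℓ * Real.log 4 := by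
      have e1 : Real.log κ = b * Real.log (1 + Real.log 2) := by rw [hb]; field_simp
      have e2 : Real.log (1 + Real.log 2) ≤ Real.log (1 + Λ) :=
        Real.log_le_log (by linarith) (by linarith)
      have e3 : c * Real.log (1 + Λ) * Real.log 4 ≤ ℓ * Real.log 4 :=
        mul_le_mul_of_nonneg_right h hl4.le
      have e4 : c * Real.log (1 + Λ) * Real.log 4 = (1 + b) * Real.log (1 + Λ) := by
        rw [← hcl]; ring
      have e5 := mul_le_mul_of_nonneg_left e2 hb0
      linarith
    have h2 : (1 + Λ) * κ ≤ (4 : ℝ) ^ ℓ := by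
      rw [← Real.log_mul (by linarith) (by linarith), ← Real.log_pow] at h1
      exact (Real.log_le_log_iff (by nlinarith) (by positivity)).1 h1
    have h3 : 2 * Λ + B < a * 4 ^ ℓ := by
      have e1 : a * κ = 2 + B + a := by rw [hκ]; field_simp
      have e2 := mul_le_mul_of_nonneg_left h2 ha.le
      have e3 : a * ((1 + Λ) * κ) = (1 + Λ) * (2 + B + a) := by rw [← e1]; ring
      nlinarith
    have h4 : t ^ 4 ^ ℓ ≤ Real.exp (-(a * 4 ^ ℓ)) := by
      refine (pow_le_pow_left₀ ht0 ht'.le _).trans (le_of_eq ?_)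
      rw [had, neg_mul, neg_neg, mul_comm, ← Real.log_rpow ht'0, Real.exp_log (by positivity)]
      exact_mod_cast rfl
    have h5 := iterate_rgBeta_le ℓ hβ
    -- Here $2\Lambda=2\log L-2\log\varepsilon\ge2\log L-\log\varepsilon$. The term $B=-\log(1-t)$
    -- pays for the denominator in `iterate_rgBeta_le`.
    have h6 : Real.exp (-(a * 4 ^ ℓ)) < Real.exp (Real.log ε - 2 * Real.log L - B) :=
      Real.exp_lt_exp.2 (by linarith)
    have h7 : Real.exp (Real.log ε - 2 * Real.log L - B) = ε / L ^ 2 * (1 - t) := by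
      rw [hBd, sub_neg_eq_add, Real.exp_add, Real.exp_sub, Real.exp_log hε0,
        Real.exp_log (by linarith), two_mul, Real.exp_add, Real.exp_log hL0, sq]
    have h8 : rgBeta^[ℓ] β < ε / L ^ 2 := by
      refine h5.trans_lt ?_
      rw [div_lt_iff₀ (by linarith), ← h7]
      exact h4.trans_lt h6
    have h9 : (M : ℝ) ^ 2 ≤ L ^ 2 := by
      have : (M : ℝ) ≤ L := by exact_mod_cast hML
      gcongr
    calc rgBeta^[ℓ] β * (M : ℝ) ^ 2 ≤ rgBeta^[ℓ] β * (L : ℝ) ^ 2 :=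
          mul_le_mul_of_nonneg_left h9 (iterate_rgBeta_nonneg ℓ hβ)
      _ < ε / L ^ 2 * L ^ 2 := mul_lt_mul_of_pos_right h8 (by positivity)
      _ = ε := by field_simp
  · intro h
    have h1 : (4 : ℝ) ^ ℓ ≤ 4 * (1 + Λ) ^ k := by
      rw [← Real.log_le_log_iff (by positivity) (by positivity), Real.log_pow,
        Real.log_mul (by norm_num) (by positivity), Real.log_pow]
      have e1 := mul_le_mul_of_nonneg_right h hl4.le
      have e2 : (c * Real.log (1 + Λ) + 1) * Real.log 4 =
          Real.log 4 + (1 + b) * Real.log (1 + Λ) := by rw [← hcl]; ring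
      have e3 : 1 + b ≤ k := Nat.le_ceil _
      have e4 := mul_le_mul_of_nonneg_right e3 hΛ1.le
      linarith
    -- The bound $\Lambda\ge\log2$ allows the additive $1$ to be absorbed, so that a pure power of
    -- $\Lambda$ results.
    have h2 : 1 + Λ ≤ (1 / Real.log 2 + 1) * Λ := by
      have : 1 ≤ 1 / Real.log 2 * Λ := by
        rw [one_div, inv_mul_eq_div, le_div_iff₀ hl2]; linarith
      linarith
    -- Absorbs the number of steps: the range $(\ell+1)2^\ell$ is at most $4^\ell$, which is bounded
    -- by $4(1+\Lambda)^k$.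
    have h3 : ((ℓ + 1 : ℕ) : ℝ) ≤ 2 ^ ℓ := by
      exact_mod_cast Nat.succ_le_of_lt (Nat.lt_two_pow_self)
    have h4 : (4 : ℝ) ^ ℓ = 2 ^ ℓ * 2 ^ ℓ := by rw [← mul_pow]; norm_num
    push_cast at h3 ⊢
    calc (K : ℝ) * (ℓ + 1) * 2 ^ ℓ ≤ K * 2 ^ ℓ * 2 ^ ℓ := by gcongr
      _ = K * 4 ^ ℓ := by rw [h4]; ring
      _ ≤ K * (4 * (1 + Λ) ^ k) := by gcongr
      _ ≤ K * (4 * ((1 / Real.log 2 + 1) * Λ) ^ k) := by gcongr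
      _ = 4 * K * (1 / Real.log 2 + 1) ^ k * Λ ^ k := by rw [mul_pow]; ring

theorem one_sub_lt_of_exp_le {x ε F : ℝ} (hx : x < ε) (h : Real.exp (-x) ≤ F) : 1 - ε < F := by
  have := Real.add_one_le_exp (-x)
  linarith

end Flow

/-! ### Ancillas in computational basis states -/

section Ancillas

variable {Q A : Type} [Fintype Q] [DecidableEq Q] [Fintype A] [DecidableEq A]

/-- The isometry that adds the ancillas `A` in the basis state `c`. -/
def ancV (Q : Type) [Fintype Q] [DecidableEq Q] (c : A → Fin 2) :
    Matrix (Q ⊕ A → Fin 2) (Q → Fin 2) ℂ :=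
  Matrix.of fun x s => if x ∘ Sum.inl = s ∧ x ∘ Sum.inr = c then 1 else 0

theorem ancV_mul_apply {ι : Type*} (c : A → Fin 2) (W : Matrix (Q → Fin 2) ι ℂ)
    (x : Q ⊕ A → Fin 2) (j : ι) :
    (ancV Q c * W) x j = if x ∘ Sum.inr = c then W (x ∘ Sum.inl) j else 0 := by
  rw [Matrix.mul_apply]
  simp only [ancV, Matrix.of_apply, ite_mul, one_mul, zero_mul]
  split_ifs with h
  · simp [h]
  · simp [h]

theorem mul_ancV_apply {ι : Type*} (c : A → Fin 2) (W : Matrix ι (Q ⊕ A → Fin 2) ℂ)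
    (j : ι) (s : Q → Fin 2) : (W * ancV Q c) j s = W j (Sum.elim s c) := by
  rw [Matrix.mul_apply, Finset.sum_eq_single (Sum.elim s c)]
  · simp [ancV]
  · intro x _ hx
    rw [ancV, Matrix.of_apply, if_neg, mul_zero]
    rintro ⟨h1, h2⟩
    apply hx
    rw [← h1, ← h2, Sum.elim_comp_inl_inr]
  · simp

theorem mul_ancV_conjTranspose_apply {ι : Type*} (c : A → Fin 2) (W : Matrix ι (Q → Fin 2) ℂ)
    (j : ι) (x : Q ⊕ A → Fin 2) :
    (W * (ancV Q c)ᴴ) j x = if x ∘ Sum.inr = c then W j (x ∘ Sum.inl) else 0 := by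
  rw [Matrix.mul_apply]
  simp only [ancV, Matrix.conjTranspose_apply, Matrix.of_apply, apply_ite star, star_one, star_zero,
    mul_ite, mul_one, mul_zero]
  split_ifs with h
  · simp [h]
  · simp [h]

theorem range_inl_compl (q : Q ⊕ A) : q ∉ Set.range (Sum.inl : Q → Q ⊕ A) ↔ ∃ a, q = Sum.inr a := by
  cases q <;> simp

theorem adjoin_inl (ρ : Op Q) : adjoin (Sum.inl : Q → Q ⊕ A) (fun _ => ketZero) ρ =
    ancV Q 0 * ρ * (ancV Q (0 : A → Fin 2))ᴴ := by
  classical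
  have e : adjV (Sum.inl : Q → Q ⊕ A) (fun _ => amp0) = ancV Q 0 := by
    ext x s
    simp only [adjV, ancV, Matrix.of_apply, ite_and]
    split_ifs with h1 h2
    · refine Finset.prod_eq_one fun q hq => ?_
      obtain ⟨a, rfl⟩ := (range_inl_compl q).1 (Finset.mem_filter.1 hq).2
      have : x (Sum.inr a) = 0 := congrFun h2 a
      simp [this, amp0]
    · obtain ⟨a, ha⟩ := Function.ne_iff.1 h2
      refine Finset.prod_eq_zero (i := Sum.inr a) (by simp) ?_
      have : x (Sum.inr a) = 1 := by
        have : x (Sum.inr a) ≠ 0 := ha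
        omega
      simp [this, amp0]
    · rfl
  rw [adjoin_ketZero, e]

theorem marginal_inl_apply (ρ : Op (Q ⊕ A)) (s t : Q → Fin 2) :
    marginal Sum.inl ρ s t = ∑ c : A → Fin 2, ρ (Sum.elim s c) (Sum.elim t c) := by
  have h : ∀ F : (Q ⊕ A → Fin 2) → ℂ, ∑ x, F x = ∑ a : Q → Fin 2, ∑ c : A → Fin 2,
      F (Sum.elim a c) := by
    intro F
    rw [← Fintype.sum_prod_type', ← (Equiv.sumArrowEquivProdArrow Q A (Fin 2)).symm.sum_comp]
    rfl
  simp only [marginal, Matrix.of_apply, h]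
  rw [Finset.sum_eq_single s]
  · refine Finset.sum_congr rfl fun c _ => ?_
    rw [Finset.sum_eq_single t, Finset.sum_eq_single c]
    · rw [if_pos]
      exact ⟨Sum.elim_comp_inl _ _, Sum.elim_comp_inl _ _, fun q hq => by
        obtain ⟨a, rfl⟩ := (range_inl_compl q).1 hq; rfl⟩
    · intro c' _ hc
      rw [if_neg]
      rintro ⟨-, -, h3⟩
      exact hc (funext fun a => (h3 (Sum.inr a) (by simp)).symm)
    · simp
    · intro b _ hb
      refine Finset.sum_eq_zero fun c' _ => if_neg ?_
      rintro ⟨-, h2, -⟩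
      exact hb (by rw [← h2, Sum.elim_comp_inl])
    · simp
  · intro a _ ha
    refine Finset.sum_eq_zero fun c _ => Finset.sum_eq_zero fun b _ =>
      Finset.sum_eq_zero fun c' _ => if_neg ?_
    rintro ⟨h1, -⟩
    exact ha (by rw [← h1, Sum.elim_comp_inl])
  · simp

/-- Tracing out the ancillas removes the cross terms between different ancilla states; this turns a
unitary dilation into a Kraus sum. -/
theorem marginal_inl_ancV (c c' : A → Fin 2) (X : Op Q) :
    marginal Sum.inl (ancV Q c * X * (ancV Q c')ᴴ) = if c = c' then X else 0 := by
  ext s t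
  rw [marginal_inl_apply]
  simp only [mul_ancV_conjTranspose_apply, ancV_mul_apply, Sum.elim_comp_inr, Sum.elim_comp_inl]
  split_ifs with h
  · subst h
    simp
  · refine Finset.sum_eq_zero fun d _ => ?_
    by_cases h1 : d = c'
    · rw [if_pos h1]
      exact if_neg fun h2 : d = c => h (h2.symm.trans h1)
    · rw [if_neg h1]

end Ancillas

/-! ### Unitary dilation of channels -/

section Stinespring

variable {Q : Type} [Fintype Q] [DecidableEq Q]

/-- A partially specified isometry extends to a unitary matrix. -/
theorem exists_unitary_extension {ι κ : Type} [Fintype ι] [DecidableEq ι] [Fintype κ]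
    [DecidableEq κ] (J : Matrix ι κ ℂ) (hJ : Jᴴ * J = 1) (f : κ → ι) (hf : f.Injective) :
    ∃ U : Matrix ι ι ℂ, Uᴴ * U = 1 ∧ ∀ i k, U i (f k) = J i k := by
  classical
  let v : ι → EuclideanSpace ℂ ι := fun j => if h : ∃ k, f k = j then
    WithLp.toLp 2 (fun i => J i h.choose) else 0
  have hv : ∀ k, v (f k) = WithLp.toLp 2 (fun i => J i k) := by
    intro k
    have h : ∃ k', f k' = f k := ⟨k, rfl⟩
    simp only [v, dif_pos h]
    rw [hf h.choose_spec]
  have ho : Orthonormal ℂ ((Set.range f).domRestrict v) := by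
    rw [orthonormal_iff_ite]
    rintro ⟨_, k, rfl⟩ ⟨_, k', rfl⟩
    have h1 : inner ℂ (v (f k)) (v (f k')) = (Jᴴ * J) k k' := by
      rw [hv, hv, EuclideanSpace.inner_eq_star_dotProduct, Matrix.mul_apply, dotProduct]
      exact Finset.sum_congr rfl fun i _ => by simp [mul_comm]
    change inner ℂ (v (f k)) (v (f k')) = _
    rw [h1, hJ, Matrix.one_apply]
    by_cases hk : k = k'
    · subst hk
      rw [if_pos rfl, if_pos rfl]
    · rw [if_neg hk, if_neg fun h => hk (hf (congrArg Subtype.val h))]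
  obtain ⟨b, hb⟩ := ho.exists_orthonormalBasis_extension_of_card_eq (by simp)
  refine ⟨Matrix.of fun i j => b j i, ?_, fun i k => ?_⟩
  · ext j j'
    have := orthonormal_iff_ite.1 b.orthonormal j j'
    rw [EuclideanSpace.inner_eq_star_dotProduct, dotProduct] at this
    rw [Matrix.mul_apply, Matrix.one_apply, ← this]
    exact Finset.sum_congr rfl fun i _ => by simp [mul_comm]
  · rw [Matrix.of_apply, hb (f k) ⟨k, rfl⟩, hv]

/-- A channel on the qubits in `A` is obtained from a unitary gate on `A` and some ancillas. -/
theorem exists_dilation (A : Finset Q) {n : ℕ} (K : Fin n → Op {q // q ∈ A})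
    (hK : ∑ i, (K i)ᴴ * K i = 1) : ∃ w : Op (Q ⊕ Fin n),
      w ∈ localAlg (A.map Function.Embedding.inl ∪ Finset.univ.map Function.Embedding.inr) ∧
      wᴴ * w = 1 ∧ ∀ ρ : Op Q, ∑ i, embed A (K i) * ρ * (embed A (K i))ᴴ =
        marginal Sum.inl (w * adjoin Sum.inl (fun _ => ketZero) ρ * wᴴ) := by
  classical
  -- Unary labels: one ancilla for each Kraus operator, and the label `k` is the state in which only
  -- the `k`-th ancilla is set.
  let e : Fin n → Fin n → Fin 2 := fun k => Pi.single k 1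
  have he : ∀ k k', e k = e k' ↔ k = k' := by
    refine fun k k' => ⟨fun h => ?_, fun h => by rw [h]⟩
    by_contra hne
    have := congrFun h k
    simp [e, Pi.single_eq_of_ne hne] at this
  let J : Matrix ({q // q ∈ A} ⊕ Fin n → Fin 2) ({q // q ∈ A} → Fin 2) ℂ :=
    ∑ k, ancV {q // q ∈ A} (e k) * K k
  have hJapp : ∀ x s, J x s = ∑ k, if x ∘ Sum.inr = e k then K k (x ∘ Sum.inl) s else 0 := by
    intro x s
    simp only [J, Matrix.sum_apply, ancV_mul_apply]
  have hanc : ∀ k k', (ancV {q // q ∈ A} (e k))ᴴ * ancV {q // q ∈ A} (e k') =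
      if k = k' then 1 else 0 := by
    intro k k'
    ext s t
    rw [mul_ancV_apply, Matrix.conjTranspose_apply, ancV, Matrix.of_apply, Sum.elim_comp_inl,
      Sum.elim_comp_inr]
    by_cases h : k = k'
    · subst h
      rw [if_pos rfl]
      by_cases hs : s = t
      · subst hs
        simp
      · simp [hs, Ne.symm hs]
    · have h' : ¬ e k' = e k := fun h2 => h ((he _ _).1 h2).symm
      simp [h, h']
  have hJ : Jᴴ * J = 1 := by
    rw [← hK]
    simp only [J, Matrix.conjTranspose_sum, Matrix.sum_mul, Matrix.mul_sum,
      Matrix.conjTranspose_mul]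
    refine Finset.sum_congr rfl fun k _ => ?_
    rw [Finset.sum_eq_single k]
    · rw [Matrix.mul_assoc, ← Matrix.mul_assoc _ _ (K k), hanc, if_pos rfl, Matrix.one_mul]
    · intro k' _ hk
      rw [Matrix.mul_assoc, ← Matrix.mul_assoc _ _ (K _), hanc]
      rw [if_neg hk, Matrix.zero_mul, Matrix.mul_zero]
    · simp
  -- The isometry $\sum_k|e_k\rangle\otimes K_k$ prescribes the unitary on inputs whose ancillas are
  -- all zero; on the other inputs it is arbitrary.
  obtain ⟨u, hu, huJ⟩ := exists_unitary_extension J hJ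
    (fun s : {q // q ∈ A} → Fin 2 => Sum.elim s (0 : Fin n → Fin 2)) fun s t h => by
      have := congrArg (fun x => x ∘ Sum.inl) h
      simpa using this
  let j : {q // q ∈ A} ⊕ Fin n → Q ⊕ Fin n := Sum.map Subtype.val id
  have hj : j.Injective := Sum.map_injective.2 ⟨Subtype.val_injective, Function.injective_id⟩
  have hjr : ∀ q : Q, Sum.inl q ∈ Set.range j ↔ q ∈ A := by
    intro q
    constructor
    · rintro ⟨x | x, hx⟩
      · rw [← Sum.inl_injective hx]; exact x.2
      · cases hx
    · exact fun h => ⟨Sum.inl ⟨q, h⟩, rfl⟩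
  have hw : (emb j u : Matrix (Q ⊕ Fin n → Fin 2) (Q ⊕ Fin n → Fin 2) ℂ) *
      (ancV Q 0 : Matrix (Q ⊕ Fin n → Fin 2) (Q → Fin 2) ℂ) =
      ∑ k, (ancV Q (e k) : Matrix (Q ⊕ Fin n → Fin 2) (Q → Fin 2) ℂ) *
        (embed A (K k) : Matrix (Q → Fin 2) (Q → Fin 2) ℂ) := by
    ext x s
    rw [mul_ancV_apply, emb_apply]
    have e1 : Sum.elim s (0 : Fin n → Fin 2) ∘ j = Sum.elim (fun q => s q.1) 0 := by
      funext y; cases y <;> rfl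
    rw [e1, huJ, hJapp]
    simp only [Matrix.sum_apply, ancV_mul_apply, embed, Matrix.of_apply]
    have e2 : (∀ q, q ∉ Set.range j → x q = Sum.elim s (0 : Fin n → Fin 2) q) ↔
        ∀ q, q ∉ A → (x ∘ Sum.inl) q = s q := by
      constructor
      · exact fun h q hq => h (Sum.inl q) ((hjr q).not.2 hq)
      · rintro h (q | a) hq
        · exact h q ((hjr q).not.1 hq)
        · exact absurd ⟨Sum.inr a, rfl⟩ hq
    simp only [e2]
    split_ifs with h
    · rfl
    · simp
  refine ⟨emb j u, ?_, ?_, fun ρ => ?_⟩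
  · refine mem_localAlg.2 ?_
    let j' : {q // q ∈ A} ⊕ Fin n →
        {q // q ∈ A.map Function.Embedding.inl ∪ Finset.univ.map Function.Embedding.inr} :=
      fun y => ⟨j y, by cases y <;> simp [j]⟩
    refine ⟨emb j' u, ?_⟩
    rw [embed_eq, emb_emb _ _ Subtype.val_injective]
    rfl
  · rw [← emb_conjTranspose, ← emb_mul hj, hu, emb_one hj]
  · rw [adjoin_inl, ← Matrix.mul_assoc, ← Matrix.mul_assoc, hw, Matrix.mul_assoc _ _ (emb j u)ᴴ,
      ← Matrix.conjTranspose_mul, hw]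
    have e3 (F : Fin n → Op (Q ⊕ Fin n)) := map_sum (marginalHom (Sum.inl : Q → Q ⊕ Fin n))
      F Finset.univ
    simp only [Matrix.conjTranspose_sum, Matrix.sum_mul, Matrix.mul_sum]
    change _ = marginalHom _ _
    rw [e3]
    refine Finset.sum_congr rfl fun k _ => ?_
    rw [e3]
    symm
    have e4 : ∀ k k', marginalHom (Sum.inl : Q → Q ⊕ Fin n)
        (ancV Q (e k) * embed A (K k) * ρ * (ancV Q (e k') * embed A (K k'))ᴴ) =
        if k = k' then embed A (K k) * ρ * (embed A (K k'))ᴴ else 0 := by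
      intro k k'
      have := marginal_inl_ancV (e k) (e k') (embed A (K k) * ρ * (embed A (K k'))ᴴ)
      rw [Matrix.conjTranspose_mul]
      simp only [he, Matrix.mul_assoc] at this ⊢
      exact this
    rw [Finset.sum_eq_single k]
    · rw [e4, if_pos rfl]
    · intro k' _ hk
      rw [e4]
      exact if_neg hk
    · simp

end Stinespring

/-! ### Layers of unitary gates -/

section Layers

variable {L : ℕ} {T T' : Type} [Fintype T] [DecidableEq T] [Fintype T'] [DecidableEq T']

/-- Unitary gates, with their supports, that can be applied in parallel. -/
def IsGateList (pos : T → Site L) (g : ℕ) (G : List (Finset T × Op T)) : Prop :=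
  G.Pairwise (fun a b => Disjoint a.1 b.1) ∧
    ∀ p ∈ G, (∀ x ∈ p.1, ∀ y ∈ p.1, siteDist (pos x) (pos y) ≤ g) ∧ p.2 ∈ localAlg p.1 ∧
      p.2ᴴ * p.2 = 1

/-- A layer of gates, as an operator. -/
def IsLayer (pos : T → Site L) (g : ℕ) (W : Op T) : Prop :=
  ∃ G, IsGateList pos g G ∧ W = (G.map Prod.snd).prod

theorem emb_mem_localAlg {e : T → T'} (he : e.Injective) {A : Finset T} {B : Finset T'}
    (h : ∀ x ∈ A, e x ∈ B) {W : Op T} (hW : W ∈ localAlg A) : emb e W ∈ localAlg B := by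
  obtain ⟨u, rfl⟩ := mem_localAlg.1 hW
  refine mem_localAlg.2 ⟨emb (fun x : {q // q ∈ A} => ⟨e x.1, h _ x.2⟩) u, ?_⟩
  rw [embed_eq, embed_eq, emb_emb _ _ Subtype.val_injective, emb_emb _ _ he]
  rfl

theorem mem_localAlg_univ (W : Op T) : W ∈ localAlg (Finset.univ : Finset T) :=
  mem_localAlg_of (fun s t q hq => absurd (Finset.mem_univ q) hq) fun s t s' t' h1 h2 _ _ => by
    rw [show s = s' from funext fun q => h1 q (Finset.mem_univ q),
      show t = t' from funext fun q => h2 q (Finset.mem_univ q)]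

theorem IsGateList.map {pos : T → Site L} {g : ℕ} {G : List (Finset T × Op T)}
    (hG : IsGateList pos g G) {pos' : T' → Site L} (e : T ↪ T') (he : ∀ x, pos' (e x) = pos x) :
    IsGateList pos' g (G.map fun p => (p.1.map e, emb e p.2)) := by
  refine ⟨?_, ?_⟩
  · rw [List.pairwise_map]
    exact hG.1.imp fun h => (Finset.disjoint_map e).2 h
  · intro p hp
    obtain ⟨p, hp', rfl⟩ := List.mem_map.1 hp
    obtain ⟨h1, h2, h3⟩ := hG.2 p hp'
    refine ⟨?_, emb_mem_localAlg e.injective (fun x hx => Finset.mem_map_of_mem e hx) h2, ?_⟩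
    · intro x hx y hy
      obtain ⟨x, hx', rfl⟩ := Finset.mem_map.1 hx
      obtain ⟨y, hy', rfl⟩ := Finset.mem_map.1 hy
      rw [he, he]
      exact h1 x hx' y hy'
    · dsimp only
      rw [← emb_conjTranspose, ← emb_mul e.injective, h3, emb_one e.injective]

theorem emb_list_prod {e : T → T'} (he : e.Injective) (l : List (Op T)) :
    emb e l.prod = (l.map (emb e)).prod := map_list_prod (embHom e he) l

theorem prod_map_snd_emb {e : T → T'} (he : e.Injective) (e' : Finset T → Finset T')
    (G : List (Finset T × Op T)) :
    ((G.map fun p => (e' p.1, emb e p.2)).map Prod.snd).prod = emb e (G.map Prod.snd).prod := by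
  rw [emb_list_prod he, List.map_map, List.map_map]
  rfl

theorem IsLayer.map {pos : T → Site L} {g : ℕ} {W : Op T} (hW : IsLayer pos g W)
    {pos' : T' → Site L} {e : T → T'} (hi : e.Injective) (he : ∀ x, pos' (e x) = pos x) :
    IsLayer pos' g (emb e W) := by
  obtain ⟨G, hG, rfl⟩ := hW
  exact ⟨_, hG.map ⟨e, hi⟩ he, (prod_map_snd_emb hi _ G).symm⟩

theorem IsLayer.one (pos : T → Site L) (g : ℕ) : IsLayer pos g (1 : Op T) :=
  ⟨[], ⟨List.Pairwise.nil, by simp⟩, rfl⟩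

theorem IsLayer.mono {pos : T → Site L} {g g' : ℕ} (h : g ≤ g') {W : Op T}
    (hW : IsLayer pos g W) : IsLayer pos g' W := by
  obtain ⟨G, hG, rfl⟩ := hW
  exact ⟨G, ⟨hG.1, fun p hp => ⟨fun x hx y hy => ((hG.2 p hp).1 x hx y hy).trans h,
    (hG.2 p hp).2⟩⟩, rfl⟩

theorem isometry_of_embed {A : Finset T} {u : Op {q // q ∈ A}}
    (h : (embed A u)ᴴ * embed A u = 1) : uᴴ * u = 1 := by
  apply emb_injective Subtype.val_injective
  rw [emb_mul Subtype.val_injective, emb_conjTranspose, ← embed_eq, h,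
    emb_one Subtype.val_injective]

theorem IsLayer.isGateLayer {pos : T → Site L} {g : ℕ} {W : Op T} (hW : IsLayer pos g W) :
    IsGateLayer pos g W := by
  obtain ⟨G, hG, rfl⟩ := hW
  have hloc : ∀ i : Fin G.length, ∃ u : Op {q // q ∈ G[i].1},
      embed G[i].1 u = G[i].2 := fun i =>
    mem_localAlg.1 (hG.2 _ (List.getElem_mem _)).2.1
  choose u hu using hloc
  have hu1 : ∀ i, (u i)ᴴ * u i = 1 := by
    intro i
    apply isometry_of_embed
    rw [hu]
    exact (hG.2 _ (List.getElem_mem _)).2.2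
  refine ⟨G.length, fun i => G[i].1, u, ?_, ?_, ?_, ?_⟩
  · intro i j hij
    have := List.pairwise_iff_getElem.1 hG.1
    rcases lt_or_gt_of_ne hij with h | h
    · exact this i j i.2 j.2 h
    · exact (this j i j.2 i.2 h).symm
  · exact fun i => (hG.2 _ (List.getElem_mem _)).1
  · exact fun i => ⟨hu1 i, mul_eq_one_comm.1 (hu1 i)⟩
  · simp only [hu]
    congr 1
    apply List.ext_getElem
    · simp
    · intro n h1 h2
      simp

end Layers

/-! ### Composition of dilated circuits -/

section Dilation

variable {L : ℕ} {Q Q' Q'' T T' A : Type} [Fintype Q] [DecidableEq Q] [Fintype Q'] [DecidableEq Q']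
  [Fintype Q''] [DecidableEq Q''] [Fintype T] [DecidableEq T] [Fintype T'] [DecidableEq T']
  [Fintype A] [DecidableEq A]

theorem adjoin_inl_apply (ρ : Op Q) (x y : Q ⊕ A → Fin 2) :
    adjoin (Sum.inl : Q → Q ⊕ A) (fun _ => ketZero) ρ x y =
      if x ∘ Sum.inr = 0 ∧ y ∘ Sum.inr = 0 then ρ (x ∘ Sum.inl) (y ∘ Sum.inl) else 0 := by
  rw [adjoin_inl, mul_ancV_conjTranspose_apply, ancV_mul_apply]
  split_ifs <;> simp_all

/-- Discarding old qubits commutes with adding new ones, so all partial traces can be deferred to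
the end. -/
theorem adjoin_marginal {k : Q → T} (hk : k.Injective) (σ : Op T) :
    adjoin (Sum.inl : Q → Q ⊕ A) (fun _ => ketZero) (marginal k σ) =
      marginal (Sum.map k id) (adjoin (Sum.inl : T → T ⊕ A) (fun _ => ketZero) σ) := by
  have hj : (Sum.map k (id : A → A)).Injective := Sum.map_injective.2 ⟨hk, Function.injective_id⟩
  have hr : ∀ t, (Sum.inl t : T ⊕ A) ∈ Set.range (Sum.map k (id : A → A)) ↔ t ∈ Set.range k := by
    intro t
    constructor
    · rintro ⟨x | x, hx⟩
      · exact ⟨x, Sum.inl_injective hx⟩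
      · cases hx
    · rintro ⟨x, rfl⟩
      exact ⟨Sum.inl x, rfl⟩
  let E : Cf k ≃ Cf (Sum.map k (id : A → A)) :=
    { toFun := fun c => ⟨Sum.inl c.1, (hr _).not.2 c.2⟩
      invFun := fun c => match c with
        | ⟨Sum.inl t, h⟩ => ⟨t, (hr _).not.1 h⟩
        | ⟨Sum.inr a, h⟩ => absurd ⟨Sum.inr a, rfl⟩ h
      left_inv := fun c => rfl
      right_inv := fun c => match c with
        | ⟨Sum.inl t, h⟩ => rfl
        | ⟨Sum.inr a, h⟩ => absurd ⟨Sum.inr a, rfl⟩ h }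
  have hg : ∀ (s : Q ⊕ A → Fin 2) (c : Cf k → Fin 2),
      glue (Sum.map k (id : A → A)) s (c ∘ E.symm) = Sum.elim (glue k (s ∘ Sum.inl) c)
        (s ∘ Sum.inr) := by
    intro s c
    symm
    refine (eq_glue_iff hj _ _ _).1 ⟨?_, ?_⟩
    · funext x
      rcases x with x | x
      · exact glue_apply hk _ _ _
      · rfl
    · funext x
      obtain ⟨x, rfl⟩ := E.surjective x
      simp only [Function.comp, Equiv.symm_apply_apply]
      exact glue_of_notMem k _ _ x.2
  ext s t
  rw [adjoin_inl_apply, marginal_apply hk, marginal_apply hj,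
    ← (Equiv.arrowCongr E (Equiv.refl (Fin 2))).sum_comp]
  have : ∀ c : Cf k → Fin 2, (Equiv.arrowCongr E (Equiv.refl (Fin 2))) c = c ∘ E.symm :=
    fun c => rfl
  simp only [this, hg, adjoin_inl_apply, Sum.elim_comp_inl, Sum.elim_comp_inr]
  by_cases h : s ∘ Sum.inr = 0 ∧ t ∘ Sum.inr = 0
  · rw [if_pos h]
    exact Finset.sum_congr rfl fun c _ => (if_pos h).symm
  · rw [if_neg h]
    exact (Finset.sum_eq_zero fun c _ => if_neg h).symm

/-- The qubits discarded by the first circuit are carried along idle. The second circuit acts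
through `Sum.map k id` on those that were kept and on its own ancillas. -/
theorem dilation_comp {i : Q → T} {k : Q' → T} (hk : k.Injective)
    (k' : Q'' → Q' ⊕ A) (W : Op T) (W' : Op (Q' ⊕ A)) (ρ : Op Q) :
    marginal k' (W' * adjoin Sum.inl (fun _ => ketZero)
      (marginal k (W * adjoin i (fun _ => ketZero) ρ * Wᴴ)) * W'ᴴ) =
    marginal (Sum.map k id ∘ k') ((emb (Sum.map k id) W' * emb Sum.inl W) *
      adjoin (Sum.inl ∘ i) (fun _ => ketZero) ρ *
      (emb (Sum.map k id) W' * emb Sum.inl W)ᴴ) := by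
  have hj : (Sum.map k (id : A → A)).Injective := Sum.map_injective.2 ⟨hk, Function.injective_id⟩
  rw [adjoin_marginal hk, ← marginal_emb hj, marginal_marginal hj, adjoin_emb Sum.inl_injective,
    adjoin_adjoin Sum.inl_injective, Matrix.conjTranspose_mul]
  simp only [Matrix.mul_assoc]

theorem dilation_map {i : Q → T} {k : Q' → T} {e : T → T'} (he : e.Injective)
    (W : Op T) (ρ : Op Q) :
    marginal k (W * adjoin i (fun _ => ketZero) ρ * Wᴴ) =
      marginal (e ∘ k) (emb e W * adjoin (e ∘ i) (fun _ => ketZero) ρ * (emb e W)ᴴ) := by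
  rw [← adjoin_adjoin he, ← adjoin_emb he, ← marginal_marginal he,
    marginal_adjoin he _ fun _ => by simp [ketZero, Matrix.trace_fin_two]]

/-- An LC transformation with gates of diameter at most `g` and depth `d`. -/
def IsLCd (pos : Q → Site L) (pos' : Q' → Site L) (g d : ℕ) (Φ : Op Q → Op Q') : Prop :=
  ∃ (T : Type) (_ : Fintype T) (_ : DecidableEq T) (posT : T → Site L) (i : Q → T) (k : Q' → T)
    (Ws : List (Op T)), i.Injective ∧ k.Injective ∧ (∀ q, posT (i q) = pos q) ∧
    (∀ q, posT (k q) = pos' q) ∧ Ws.length = d ∧ (∀ W ∈ Ws, IsLayer posT g W) ∧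
    ∀ ρ, Φ ρ = marginal k (Ws.prod * adjoin i (fun _ => ketZero) ρ * (Ws.prod)ᴴ)

/-- Returns from an abstract set `T` of qubits to the form required by `IsLC`: the qubits of `T`
outside the image of `i` are numbered and become the ancillas. -/
theorem IsLCd.exists_sum {pos : Q → Site L} {pos' : Q' → Site L} {g d : ℕ} {Φ : Op Q → Op Q'}
    (h : IsLCd pos pos' g d Φ) : ∃ (n : ℕ) (posA : Fin n → Site L) (k : Q' → Q ⊕ Fin n)
      (Ws : List (Op (Q ⊕ Fin n))), k.Injective ∧ (∀ q, Sum.elim pos posA (k q) = pos' q) ∧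
      Ws.length = d ∧ (∀ W ∈ Ws, IsLayer (Sum.elim pos posA) g W) ∧
      ∀ ρ, Φ ρ = marginal k (Ws.prod * adjoin Sum.inl (fun _ => ketZero) ρ * (Ws.prod)ᴴ) := by
  obtain ⟨T, _, _, posT, i, k, Ws, hi, hk, hpi, hpk, hd, hW, hΦ⟩ := h
  let E : Cf i ≃ Fin (Fintype.card (Cf i)) := Fintype.equivFin _
  let F : Q ⊕ Fin (Fintype.card (Cf i)) ≃ T := Equiv.ofBijective
    (Sum.elim i fun c => (E.symm c).1) <| by
      constructor
      · refine hi.sumElim (Subtype.val_injective.comp E.symm.injective) fun q c h => ?_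
        exact (E.symm c).2 ⟨q, h⟩
      · intro t
        by_cases ht : t ∈ Set.range i
        · obtain ⟨q, rfl⟩ := ht
          exact ⟨Sum.inl q, rfl⟩
        · exact ⟨Sum.inr (E ⟨t, ht⟩), congrArg Subtype.val (E.symm_apply_apply _)⟩
  have hF : ∀ t, Sum.elim pos (fun c => posT (E.symm c).1) (F.symm t) = posT t := by
    intro t
    obtain ⟨x, rfl⟩ := F.surjective t
    rw [Equiv.symm_apply_apply]
    rcases x with q | c
    · exact (hpi q).symm
    · rfl
  have hFi : F.symm ∘ i = Sum.inl := by
    funext q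
    exact F.symm_apply_eq.2 rfl
  refine ⟨_, fun c => posT (E.symm c).1, F.symm ∘ k, Ws.map (emb F.symm),
    F.symm.injective.comp hk, fun q => (hF _).trans (hpk q), by simpa using hd, ?_, fun ρ => ?_⟩
  · intro W h
    obtain ⟨W, h', rfl⟩ := List.mem_map.1 h
    exact (hW W h').map F.symm.injective hF
  · rw [hΦ, dilation_map F.symm.injective, hFi, emb_list_prod F.symm.injective]

theorem IsLCd.isLC {pos : Q → Site L} {pos' : Q' → Site L} {g d r : ℕ} {Φ : Op Q → Op Q'}
    (h : IsLCd pos pos' g d Φ) (hr : g * d ≤ r) : IsLC pos pos' r Φ := by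
  obtain ⟨n, posA, k, Ws, hk, hpk, hd, hW, hΦ⟩ := h.exists_sum
  subst hd
  exact ⟨n, posA, Ws.prod, k, ⟨g, Ws.length, fun i => Ws[i], hr,
    fun i => (hW _ (List.getElem_mem _)).isGateLayer, by
      congr 1
      exact List.ext_getElem (by simp) fun n h1 h2 => by simp⟩, hk, hpk, hΦ⟩

/-- Diameter and depth are recorded separately because depths add for gates of a common diameter;
their product alone does not determine the range of a composition. -/
theorem IsLCd.comp {pos : Q → Site L} {pos' : Q' → Site L} {pos'' : Q'' → Site L} {g d d' : ℕ}
    {Φ : Op Q → Op Q'} {Ψ : Op Q' → Op Q''} (hΨ : IsLCd pos' pos'' g d' Ψ)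
    (hΦ : IsLCd pos pos' g d Φ) : IsLCd pos pos'' g (d + d') (fun ρ => Ψ (Φ ρ)) := by
  obtain ⟨T, _, _, posT, i, k, Ws, hi, hk, hpi, hpk, hd, hW, hΦ⟩ := hΦ
  obtain ⟨n, posA, k', Ws', hk', hpk', hd', hW', hΨ⟩ := hΨ.exists_sum
  have hj : (Sum.map k (id : Fin n → Fin n)).Injective :=
    Sum.map_injective.2 ⟨hk, Function.injective_id⟩
  refine ⟨T ⊕ Fin n, inferInstance, inferInstance, Sum.elim posT posA, Sum.inl ∘ i,
    Sum.map k id ∘ k', Ws'.map (emb (Sum.map k id)) ++ Ws.map (emb Sum.inl),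
    Sum.inl_injective.comp hi, hj.comp hk', hpi, fun q => ?_, ?_, ?_, fun ρ => ?_⟩
  · rw [← hpk' q]
    simp only [Function.comp]
    rcases k' q with x | x
    · exact hpk x
    · rfl
  · simp [hd, hd', add_comm]
  · intro W h
    rcases List.mem_append.1 h with h | h
    · obtain ⟨W, h', rfl⟩ := List.mem_map.1 h
      refine (hW' W h').map hj ?_
      rintro (x | x)
      · exact hpk x
      · rfl
    · obtain ⟨W, h', rfl⟩ := List.mem_map.1 h
      exact (hW W h').map Sum.inl_injective fun x => rfl
  · rw [List.prod_append, ← emb_list_prod hj, ← emb_list_prod Sum.inl_injective,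
      ← dilation_comp hk, ← hΦ, ← hΨ]

theorem IsLCd.mono {pos : Q → Site L} {pos' : Q' → Site L} {g g' d d' : ℕ} {Φ : Op Q → Op Q'}
    (h : IsLCd pos pos' g d Φ) (hg : g ≤ g') (hd : d ≤ d') : IsLCd pos pos' g' d' Φ := by
  obtain ⟨T, _, _, posT, i, k, Ws, hi, hk, hpi, hpk, h1, hW, hΦ⟩ := h
  refine ⟨T, inferInstance, inferInstance, posT, i, k, Ws ++ List.replicate (d' - d) 1, hi, hk, hpi, hpk, ?_, ?_, ?_⟩
  · simp [h1, hd]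
  · intro W h
    rcases List.mem_append.1 h with h | h
    · exact (hW W h).mono hg
    · rw [List.eq_of_mem_replicate h]
      exact IsLayer.one posT g'
  · intro ρ
    rw [hΦ, List.prod_append, List.prod_replicate, one_pow, mul_one]

theorem isLCd_marginal {k : Q' → Q} (hk : k.Injective) (pos : Q → Site L) (g : ℕ) :
    IsLCd pos (fun q => pos (k q)) g 0 (marginal k) :=
  ⟨Q, inferInstance, inferInstance, pos, id, k, [], Function.injective_id, hk, fun _ => rfl, fun _ => rfl, rfl, by simp,
    fun ρ => by
      have : adjoin (id : Q → Q) (fun _ => ketZero) ρ = ρ := by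
        ext s t
        simp [adjoin]
      simp [this]⟩

theorem isLCd_id (pos : Q → Site L) (g : ℕ) : IsLCd pos pos g 0 (fun ρ : Op Q => ρ) := by
  have := isLCd_marginal (Function.injective_id : (id : Q → Q).Injective) pos g
  have h : marginal (id : Q → Q) = fun ρ => ρ := by
    funext ρ
    ext s t
    simp [marginal, ite_and]
  rwa [h] at this

end Dilation

/-! ### Layers of channel gates as layers of unitary gates -/

section ChannelLayers

variable {L : ℕ} {Q Q' : Type} [Fintype Q] [DecidableEq Q] [Fintype Q'] [DecidableEq Q']

/-- Channel gates that can be applied in parallel. -/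
def IsChannelLayer (pos : Q → Site L) (g : ℕ) (l : List (ChannelGate Q)) : Prop :=
  l.Pairwise (fun a b => Disjoint a.supp b.supp) ∧
    ∀ a ∈ l, IsChannelOn a.supp a.map ∧
      ∀ x ∈ a.supp, ∀ y ∈ a.supp, siteDist (pos x) (pos y) ≤ g

theorem siteDist_self (x : Site L) : siteDist x x = 0 := by simp [siteDist]

/-- Each channel brings its own ancillas, so the dilated gates still have disjoint supports and form
a single layer. The clause about the system qubits in the support of a gate is carried along to
prove this disjointness in the induction. -/
theorem exists_gateList_of_channelLayer (pos : Q → Site L) (g : ℕ) (l : List (ChannelGate Q))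
    (hl : IsChannelLayer pos g l) :
    ∃ (T : Type) (_ : Fintype T) (_ : DecidableEq T) (posT : T → Site L) (i : Q → T)
      (G : List (Finset T × Op T)), i.Injective ∧ (∀ q, posT (i q) = pos q) ∧
      IsGateList posT g G ∧ (∀ p ∈ G, ∀ q, i q ∈ p.1 → ∃ a ∈ l, q ∈ a.supp) ∧
      ∀ ρ, runGates l ρ = marginal i ((G.map Prod.snd).prod *
        adjoin i (fun _ => ketZero) ρ * ((G.map Prod.snd).prod)ᴴ) := by
  induction l using List.reverseRecOn with
  | nil =>
    refine ⟨Q, inferInstance, inferInstance, pos, id, [], Function.injective_id, fun _ => rfl,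
      ⟨List.Pairwise.nil, by simp⟩, by simp, fun ρ => ?_⟩
    have h := marginal_adjoin (Function.injective_id : (id : Q → Q).Injective)
      (fun _ => ketZero) (fun _ => by simp [ketZero, Matrix.trace_fin_two]) ρ
    simpa [runGates] using h.symm
  | append_singleton l a ih =>
    obtain ⟨hp, hc⟩ := hl
    rw [List.pairwise_append] at hp
    obtain ⟨T, _, _, posT, i, G, hi, hpi, hG, hs, hr⟩ :=
      ih ⟨hp.1, fun b hb => hc b (List.mem_append_left _ hb)⟩
    obtain ⟨⟨n, K, hK, hΦ⟩, hd⟩ := hc a (List.mem_append_right _ (List.mem_singleton_self a))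
    obtain ⟨w, hwl, hwu, hw⟩ := exists_dilation a.supp K hK
    have hj : (Sum.map i (id : Fin n → Fin n)).Injective :=
      Sum.map_injective.2 ⟨hi, Function.injective_id⟩
    -- The ancillas are placed at a site of the support, so the diameter of the gate does not grow;
    -- for an empty support any site will do.
    obtain ⟨p0, hp0⟩ : ∃ p0 : Site L, ∀ x ∈ a.supp, siteDist p0 (pos x) ≤ g ∧
        siteDist (pos x) p0 ≤ g := by
      by_cases hne : a.supp.Nonempty
      · obtain ⟨x, hx⟩ := hne
        exact ⟨pos x, fun y hy => ⟨hd x hx y hy, hd y hy x hx⟩⟩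
      · exact ⟨0, fun y hy => absurd ⟨y, hy⟩ hne⟩
    let S : Finset (T ⊕ Fin n) :=
      (a.supp.map ⟨i, hi⟩).map Function.Embedding.inl ∪ Finset.univ.map Function.Embedding.inr
    refine ⟨T ⊕ Fin n, inferInstance, inferInstance, Sum.elim posT fun _ => p0, Sum.inl ∘ i,
      (S, emb (Sum.map i id) w) ::
        G.map fun p => (p.1.map Function.Embedding.inl, emb Sum.inl p.2),
      Sum.inl_injective.comp hi, hpi, ⟨?_, ?_⟩, ?_, fun ρ => ?_⟩
    · refine List.pairwise_cons.2 ⟨?_, (hG.map (pos' := Sum.elim posT fun _ => p0)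
        Function.Embedding.inl fun x => rfl).1⟩
      intro p hp'
      obtain ⟨p, hpG, rfl⟩ := List.mem_map.1 hp'
      rw [Finset.disjoint_right]
      intro x hx hxS
      obtain ⟨t, ht, rfl⟩ := Finset.mem_map.1 hx
      have : ∃ q ∈ a.supp, i q = t := by simpa [S] using hxS
      obtain ⟨q, hq, rfl⟩ := this
      obtain ⟨b, hb, hqb⟩ := hs p hpG q ht
      exact Finset.disjoint_left.1 (hp.2.2 b hb a (List.mem_singleton_self a)) hqb hq
    · intro p hp'
      rcases List.mem_cons.1 hp' with rfl | hp'
      · refine ⟨?_, emb_mem_localAlg hj (fun x hx => ?_) hwl, ?_⟩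
        · have hS : ∀ x ∈ S, (∃ q ∈ a.supp, x = Sum.inl (i q)) ∨ ∃ c, x = Sum.inr c := by
            rintro (x | x) hx
            · left
              have : ∃ q ∈ a.supp, i q = x := by simpa [S] using hx
              obtain ⟨q, hq, rfl⟩ := this
              exact ⟨q, hq, rfl⟩
            · exact Or.inr ⟨x, rfl⟩
          intro x hx y hy
          rcases hS x hx with ⟨q, hq, rfl⟩ | ⟨c, rfl⟩ <;>
            rcases hS y hy with ⟨q', hq', rfl⟩ | ⟨c', rfl⟩ <;>
            simp only [Sum.elim_inl, Sum.elim_inr, hpi]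
          · exact hd q hq q' hq'
          · exact (hp0 q hq).2
          · exact (hp0 q' hq').1
          · simp [siteDist_self]
        · rcases x with x | x
          · have : x ∈ a.supp := by simpa using hx
            simp only [S, Sum.map_inl, Finset.mem_union]
            exact Or.inl (Finset.mem_map_of_mem _ (Finset.mem_map_of_mem ⟨i, hi⟩ this))
          · simp [S]
        · dsimp only
          rw [← emb_conjTranspose, ← emb_mul hj, hwu, emb_one hj]
      · exact (hG.map (pos' := Sum.elim posT fun _ => p0)
          Function.Embedding.inl fun x => rfl).2 p hp'
    · intro p hp' q hq
      rcases List.mem_cons.1 hp' with rfl | hp'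
      · have : q ∈ a.supp := by
          have : ∃ q' ∈ a.supp, i q' = i q := by simpa [S] using hq
          obtain ⟨q', hq', he⟩ := this
          rwa [← hi he]
        exact ⟨a, by simp, this⟩
      · obtain ⟨p, hpG, rfl⟩ := List.mem_map.1 hp'
        have : i q ∈ p.1 := by simpa using hq
        obtain ⟨b, hb, hqb⟩ := hs p hpG q this
        exact ⟨b, by simp [hb], hqb⟩
    · rw [List.map_cons, List.prod_cons]
      have e1 : ((G.map fun p => (p.1.map Function.Embedding.inl,
          emb (Sum.inl : T → T ⊕ Fin n) p.2)).map Prod.snd).prod =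
          emb Sum.inl (G.map Prod.snd).prod :=
        prod_map_snd_emb Sum.inl_injective (fun A => A.map Function.Embedding.inl) G
      have e2 : runGates (l ++ [a]) ρ = a.map (runGates l ρ) := by
        simp [runGates]
      rw [e1, e2, hΦ, hw, hr, dilation_comp hi]
      rfl

theorem isLCd_channelLayer {pos : Q → Site L} {g : ℕ} {l : List (ChannelGate Q)}
    (hl : IsChannelLayer pos g l) : IsLCd pos pos g 1 (runGates l) := by
  obtain ⟨T, _, _, posT, i, G, hi, hpi, hG, -, hr⟩ := exists_gateList_of_channelLayer pos g l hl
  exact ⟨T, inferInstance, inferInstance, posT, i, i, [(G.map Prod.snd).prod], hi, hi, hpi, hpi,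
    rfl, by simpa using ⟨G, hG, rfl⟩, by simpa using hr⟩

theorem isLCd_channelLayers {pos : Q → Site L} {g : ℕ} (ls : List (List (ChannelGate Q)))
    (h : ∀ l ∈ ls, IsChannelLayer pos g l) : IsLCd pos pos g ls.length (runGates ls.flatten) := by
  induction ls with
  | nil => exact isLCd_id pos g
  | cons l ls ih =>
    have h1 := isLCd_channelLayer (h l List.mem_cons_self)
    have h2 := (ih fun l' hl' => h l' (List.mem_cons_of_mem _ hl')).comp h1
    have e : runGates (l :: ls).flatten = fun ρ => runGates ls.flatten (runGates l ρ) := by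
      funext ρ
      rw [List.flatten_cons, runGates_append]
    rw [e, List.length_cons, add_comm]
    exact h2

end ChannelLayers

/-! ### Preparation of the decoupled qubits -/

section Preparation

variable {L : ℕ} {Q Q' : Type} [Fintype Q] [DecidableEq Q] [Fintype Q'] [DecidableEq Q']

/-- The Hadamard gate. -/
def hadamardGate : Matrix (Fin 2) (Fin 2) ℂ :=
  ((√2 : ℝ) : ℂ)⁻¹ • !![1, 1; 1, -1]

theorem hadamardGate_conjTranspose : hadamardGateᴴ = hadamardGate := by
  ext i j
  fin_cases i <;> fin_cases j <;> simp [hadamardGate, Matrix.conjTranspose_apply]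

theorem sqrt_two_inv_mul : (((√2 : ℝ) : ℂ)⁻¹) * ((√2 : ℝ) : ℂ)⁻¹ = 1 / 2 := by
  rw [← mul_inv, ← Complex.ofReal_mul, Real.mul_self_sqrt (by norm_num)]
  norm_num

theorem hadamardGate_mul_self : hadamardGate * hadamardGate = 1 := by
  rw [hadamardGate, Matrix.smul_mul, Matrix.mul_smul, smul_smul, sqrt_two_inv_mul]
  ext i j
  fin_cases i <;> fin_cases j <;> simp <;> norm_num

theorem hadamardGate_mul_ketZero : hadamardGate * ketZero * hadamardGate = ketPlus := by
  rw [hadamardGate, Matrix.smul_mul, Matrix.smul_mul, Matrix.mul_smul, smul_smul, sqrt_two_inv_mul]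
  ext i j
  fin_cases i <;> fin_cases j <;> simp [ketZero, ketPlus]

theorem tensorOp_mem_localAlg {A : Finset Q} {u : Q → Matrix (Fin 2) (Fin 2) ℂ}
    (h : ∀ q, q ∉ A → u q = 1) : tensorOp u ∈ localAlg A := by
  refine mem_localAlg_of (fun s t q hq hst => ?_) fun s t s' t' h1 h2 h3 h4 => ?_
  · exact Finset.prod_eq_zero (Finset.mem_univ q) (by rw [h q hq, Matrix.one_apply_ne hst])
  · refine Finset.prod_congr rfl fun q _ => ?_
    by_cases hq : q ∈ A
    · rw [h1 q hq, h2 q hq]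
    · rw [h q hq, h3 q hq, h4 q hq, Matrix.one_apply_eq, Matrix.one_apply_eq]

theorem tensorOp_list_prod (v : Q → Matrix (Fin 2) (Fin 2) ℂ) (l : List Q) (hl : l.Nodup) :
    (l.map fun q => tensorOp fun x => if x = q then v q else 1).prod =
      tensorOp fun x => if x ∈ l then v x else 1 := by
  induction l with
  | nil => simp [tensorOp_one]
  | cons a l ih =>
    rw [List.map_cons, List.prod_cons, ih (List.nodup_cons.1 hl).2, tensorOp_mul]
    congr 1
    funext x
    by_cases hx : x = a
    · subst hx
      simp [(List.nodup_cons.1 hl).1]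
    · simp [hx]

theorem isLayer_tensorOp (pos : Q → Site L) (u : Q → Matrix (Fin 2) (Fin 2) ℂ)
    (hu : ∀ q, (u q)ᴴ * u q = 1) : IsLayer pos 0 (tensorOp u) := by
  refine ⟨(Finset.univ : Finset Q).toList.map fun q =>
    ({q}, tensorOp fun x => if x = q then u q else 1), ⟨?_, ?_⟩, ?_⟩
  · rw [List.pairwise_map]
    exact (Finset.nodup_toList _).imp fun h => by simpa using h
  · intro p hp
    obtain ⟨q, -, rfl⟩ := List.mem_map.1 hp
    refine ⟨fun x hx y hy => ?_, tensorOp_mem_localAlg fun x hx => ?_, ?_⟩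
    · rw [Finset.mem_singleton.1 hx, Finset.mem_singleton.1 hy, siteDist_self]
    · exact if_neg fun h => hx (Finset.mem_singleton.2 h)
    · dsimp only
      rw [tensorOp_conjTranspose, tensorOp_mul, ← tensorOp_one]
      congr 1
      funext x
      split_ifs
      · exact hu q
      · simp
  · rw [List.map_map]
    have := tensorOp_list_prod u (Finset.univ : Finset Q).toList (Finset.nodup_toList _)
    simp only [Finset.mem_toList, Finset.mem_univ, if_true] at this
    exact this.symm

open Classical in
theorem adjoin_eq_emb_mul_tensorOp {f : Q' → Q} (hf : f.Injective)
    (φ : Q → Matrix (Fin 2) (Fin 2) ℂ) (ρ : Op Q') :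
    adjoin f φ ρ = emb f ρ * tensorOp fun q => if q ∈ Set.range f then 1 else φ q := by
  ext s t
  rw [Matrix.mul_apply, Finset.sum_eq_single (glue f (t ∘ f) fun q => s q.1)]
  · have h : ∀ q, q ∉ Set.range f → s q = glue f (t ∘ f) (fun q => s q.1) q :=
      fun q hq => (glue_of_notMem f (t ∘ f) (fun q => s q.1) hq).symm
    rw [emb_apply, if_pos h, glue_comp hf, adjoin,
      Matrix.of_apply, tensorOp, Matrix.of_apply, Finset.prod_filter]
    congr 1
    refine Finset.prod_congr rfl fun q _ => ?_
    by_cases hq : q ∈ Set.range f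
    · obtain ⟨x, rfl⟩ := hq
      have e : glue f (t ∘ f) (fun q => s q.1) (f x) = t (f x) := glue_apply hf _ _ x
      rw [if_neg (not_not.2 ⟨x, rfl⟩), if_pos ⟨x, rfl⟩, e, Matrix.one_apply_eq]
    · rw [if_pos hq, if_neg hq, glue_of_notMem f _ _ hq]
  · intro y _ hy
    rw [emb_apply]
    split_ifs with h
    · have : y ∘ f ≠ t ∘ f := by
        intro h'
        refine hy ((eq_glue_iff hf _ _ _).1 ⟨h', funext fun q => (h q.1 q.2).symm⟩)
      obtain ⟨x, hx⟩ := Function.ne_iff.1 this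
      rw [tensorOp, Matrix.of_apply, Finset.prod_eq_zero (Finset.mem_univ (f x)), mul_zero]
      rw [if_pos ⟨x, rfl⟩]
      exact Matrix.one_apply_ne hx
    · rw [zero_mul]
  · simp

theorem tensorOp_conj_adjoin {f : Q' → Q} (hf : f.Injective) (u : Q → Matrix (Fin 2) (Fin 2) ℂ)
    (h : ∀ q, u (f q) = 1) (φ : Q → Matrix (Fin 2) (Fin 2) ℂ) (ρ : Op Q') :
    tensorOp u * adjoin f φ ρ * (tensorOp u)ᴴ = adjoin f (fun q => u q * φ q * (u q)ᴴ) ρ := by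
  classical
  have hc : Commute (tensorOp u) (emb f ρ) := by
    refine localAlg_commute (A := (Finset.univ.image f)ᶜ) (B := Finset.univ.image f)
      disjoint_compl_left (tensorOp_mem_localAlg fun q hq => ?_)
      (emb_mem_localAlg hf (fun x _ => Finset.mem_image_of_mem f (Finset.mem_univ x))
        (mem_localAlg_univ ρ))
    obtain ⟨x, -, rfl⟩ := Finset.mem_image.1 (Finset.notMem_compl.1 hq)
    exact h x
  rw [adjoin_eq_emb_mul_tensorOp hf, adjoin_eq_emb_mul_tensorOp hf,
    ← Matrix.mul_assoc, hc.eq, Matrix.mul_assoc, Matrix.mul_assoc]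
  congr 1
  rw [tensorOp_conjTranspose, tensorOp_mul, tensorOp_mul]
  congr 1
  funext q
  split_ifs with hq
  · obtain ⟨x, rfl⟩ := hq
    simp [h]
  · rw [← Matrix.mul_assoc]

/-- Only $|0\rangle$ is available as an ancilla; one layer of one-qubit Hadamard gates turns the
required ones into $|+\rangle$. -/
theorem isLCd_adjoin {f : Q' → Q} (hf : f.Injective) (pos : Q → Site L) (g : ℕ)
    (φ : Q → Matrix (Fin 2) (Fin 2) ℂ) (hφ : ∀ q, φ q = ketZero ∨ φ q = ketPlus) :
    IsLCd (fun q => pos (f q)) pos g 1 (adjoin f φ) := by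
  classical
  let u : Q → Matrix (Fin 2) (Fin 2) ℂ := fun q =>
    if q ∈ Set.range f ∨ φ q = ketZero then 1 else hadamardGate
  have hu : ∀ q, (u q)ᴴ * u q = 1 := by
    intro q
    simp only [u]
    split_ifs
    · simp
    · rw [hadamardGate_conjTranspose, hadamardGate_mul_self]
  have e : adjoin f φ = fun ρ => tensorOp u * adjoin f (fun _ => ketZero) ρ * (tensorOp u)ᴴ := by
    funext ρ
    rw [tensorOp_conj_adjoin hf u fun q => if_pos (Or.inl ⟨q, rfl⟩)]
    rw [adjoin_eq_emb_mul_tensorOp hf, adjoin_eq_emb_mul_tensorOp hf]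
    congr 2
    funext q
    split_ifs with hq
    · rfl
    · simp only [u, hq, false_or]
      split_ifs with h
      · simp [h]
      · rw [(hφ q).resolve_left h, hadamardGate_conjTranspose, hadamardGate_mul_ketZero]
  rw [e]
  refine ⟨Q, inferInstance, inferInstance, pos, f, id, [tensorOp u], hf, Function.injective_id,
    fun _ => rfl, fun _ => rfl, rfl, ?_, fun ρ => ?_⟩
  · simpa using (isLayer_tensorOp pos u hu).mono (Nat.zero_le g)
  · have h : ∀ σ : Op Q, marginal (id : Q → Q) σ = σ := by
      intro σ
      ext s t
      simp [marginal, ite_and]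
    rw [h, List.prod_singleton]

end Preparation

/-! ### Sorting commuting gates into layers by a colouring -/

section Colouring

/-- A colouring of the cycle with three colours, different on neighbours. -/
def cycleColour {m : ℕ} (x : ZMod m) : ℕ := if x.val + 1 = m then 2 else x.val % 2

theorem cycleColour_lt {m : ℕ} (x : ZMod m) : cycleColour x < 3 := by
  unfold cycleColour
  split_ifs <;> omega

/-- The colours alternate and the last site gets a third one, so the cycle closes up whatever the
parity of its length. -/
theorem cycleColour_add_one {m : ℕ} (hm : 2 ≤ m) (x : ZMod m) :
    cycleColour (x + 1) ≠ cycleColour x := by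
  have : NeZero m := ⟨by omega⟩
  have : Fact (1 < m) := ⟨hm⟩
  have hx := x.val_lt
  unfold cycleColour
  rw [ZMod.val_add, ZMod.val_one]
  by_cases h : x.val + 1 = m
  · rw [if_pos h, h, Nat.mod_self]
    split_ifs <;> omega
  · rw [if_neg h, Nat.mod_eq_of_lt (by omega)]
    split_ifs <;> omega

variable {L : ℕ} {Q ι : Type} [Fintype Q] [DecidableEq Q] [DecidableEq ι]

/-- Commuting gates can be sorted by colour without changing the channel, and each colour class is a
layer of disjoint gates. -/
theorem isLCd_of_colouring {pos : Q → Site L} {g n : ℕ} (f : ι → ChannelGate Q) (c : ι → ℕ)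
    (l : List ι) (hl : l.Nodup) (hc : ∀ b ∈ l, c b < n)
    (hf : ∀ b ∈ l, IsChannelOn (f b).supp (f b).map)
    (hd : ∀ b ∈ l, ∀ x ∈ (f b).supp, ∀ y ∈ (f b).supp, siteDist (pos x) (pos y) ≤ g)
    (hdisj : ∀ b ∈ l, ∀ b' ∈ l, b ≠ b' → c b = c b' → Disjoint (f b).supp (f b').supp)
    (hcomm : ∀ b ∈ l, ∀ b' ∈ l, ∀ ρ, (f b).map ((f b').map ρ) = (f b').map ((f b).map ρ)) :
    IsLCd pos pos g n (runGates (l.map f)) := by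
  have hp : l.Perm ((List.range n).flatMap fun k => l.filter fun b => c b = k) := by
    refine (List.perm_ext_iff_of_nodup hl ?_).2 fun b => ?_
    · refine List.nodup_flatMap.2 ⟨fun k _ => hl.filter _, ?_⟩
      refine List.nodup_range.imp fun {k k'} hk => ?_
      intro b hb hb'
      simp only [List.mem_filter, decide_eq_true_eq] at hb hb'
      exact hk (hb.2.symm.trans hb'.2)
    · simp only [List.mem_flatMap, List.mem_range, List.mem_filter, decide_eq_true_eq]
      exact ⟨fun h => ⟨c b, hc b h, h, rfl⟩, fun ⟨k, _, h, _⟩ => h⟩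
  have e : runGates (l.map f) = runGates
      ((List.range n).map fun k => (l.filter fun b => c b = k).map f).flatten := by
    funext ρ
    have := (hp.map f).foldl_eq' (f := fun σ (a : ChannelGate Q) => a.map σ) (fun x hx y hy z => by
      obtain ⟨b, hb, rfl⟩ := List.mem_map.1 hx
      obtain ⟨b', hb', rfl⟩ := List.mem_map.1 hy
      exact (hcomm b hb b' hb' z).symm) ρ
    rw [List.map_flatMap] at this
    exact this
  rw [e]
  have := isLCd_channelLayers (pos := pos) (g := g)
    ((List.range n).map fun k => (l.filter fun b => c b = k).map f) fun l' hl' => by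
      obtain ⟨k, -, rfl⟩ := List.mem_map.1 hl'
      refine ⟨?_, fun a ha => ?_⟩
      · rw [List.pairwise_map]
        refine List.Pairwise.imp_of_mem ?_ (hl.filter fun b => decide (c b = k))
        intro b b' hb hb' hne
        simp only [List.mem_filter, decide_eq_true_eq] at hb hb'
        exact hdisj b hb.1 b' hb'.1 hne (hb.2.trans hb'.2.symm)
      · obtain ⟨b, hb, rfl⟩ := List.mem_map.1 ha
        have hb := (List.mem_filter.1 hb).1
        exact ⟨hf b hb, hd b hb⟩
  rwa [List.length_map, List.length_range] at this

theorem sum_conj_comm {κ κ' : Type*} [Fintype κ] [Fintype κ'] (A : κ → Op Q) (A' : κ' → Op Q)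
    (h : ∀ i j, Commute (A i) (A' j)) (ρ : Op Q) :
    ∑ i, A i * (∑ j, A' j * ρ * (A' j)ᴴ) * (A i)ᴴ =
      ∑ j, A' j * (∑ i, A i * ρ * (A i)ᴴ) * (A' j)ᴴ := by
  simp only [Matrix.mul_sum, Matrix.sum_mul]
  rw [Finset.sum_comm]
  refine Finset.sum_congr rfl fun j _ => Finset.sum_congr rfl fun i _ => ?_
  have h1 := (h i j).eq
  have h2 : (A' j)ᴴ * (A i)ᴴ = (A i)ᴴ * (A' j)ᴴ := by
    rw [← Matrix.conjTranspose_mul, h1, Matrix.conjTranspose_mul]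
  calc A i * (A' j * ρ * (A' j)ᴴ) * (A i)ᴴ = (A i * A' j) * ρ * ((A' j)ᴴ * (A i)ᴴ) := by
        simp only [Matrix.mul_assoc]
    _ = _ := by rw [h1, h2]; simp only [Matrix.mul_assoc]

end Colouring

/-! ### Commutation of block gates -/

section BlockGates

variable {Q : Type} [Fintype Q] [DecidableEq Q] {B B' : AnyonBlock Q}

theorem commute_siteProj {W : Op Q} {B : AnyonBlock Q} {i : Fin 4} (h : Commute W (B.stab i))
    (x : Fin 2) : Commute W (siteProj B i x) :=
  ((Commute.one_right W).add_right (h.smul_right _)).smul_right _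

theorem commute_configProj {W : Op Q} {B : AnyonBlock Q} (h : ∀ i, Commute W (B.stab i))
    (m : Fin 4 → Fin 2) : Commute W (configProj B m) :=
  (((commute_siteProj (h 0) _).mul_right (commute_siteProj (h 1) _)).mul_right
    (commute_siteProj (h 2) _)).mul_right (commute_siteProj (h 3) _)

theorem commute_moveOp {W : Op Q} {B : AnyonBlock Q} (h : ∀ k, Commute W (B.hop k))
    (m : Fin 4 → Fin 2) : Commute W (moveOp B m) :=
  (((h 0).pow_right _).mul_right ((h 1).pow_right _)).mul_right ((h 2).pow_right _)

theorem commute_moveOp_conjTranspose {W : Op Q} {B : AnyonBlock Q} (hB : IsAnyonBlock B)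
    (h : ∀ k, Commute W (B.hop k)) (m : Fin 4 → Fin 2) : Commute W (moveOp B m)ᴴ := by
  rw [moveOp, Matrix.conjTranspose_mul, Matrix.conjTranspose_mul, Matrix.conjTranspose_pow,
    Matrix.conjTranspose_pow, Matrix.conjTranspose_pow, hB.hop_herm, hB.hop_herm, hB.hop_herm]
  exact ((h 2).pow_right _).mul_right (((h 1).pow_right _).mul_right ((h 0).pow_right _))

theorem coarseK_commute (hss : ∀ i j, Commute (B.stab i) (B'.stab j))
    (hsh : ∀ i k, Commute (B.stab i) (B'.hop k)) (hhs : ∀ k i, Commute (B.hop k) (B'.stab i))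
    (hhh : ∀ k k', Commute (B.hop k) (B'.hop k')) (m m' : Fin 4 → Fin 2) :
    Commute (coarseK B m) (coarseK B' m') := by
  have h1 : ∀ i, Commute (coarseK B m) (B'.stab i) := fun i =>
    (commute_moveOp (fun k => (hhs k i).symm) m).symm.mul_left
      (commute_configProj (fun j => (hss j i).symm) m).symm
  have h2 : ∀ k, Commute (coarseK B m) (B'.hop k) := fun k =>
    (commute_moveOp (fun k' => (hhh k' k).symm) m).symm.mul_left
      (commute_configProj (fun j => (hsh j k).symm) m).symm
  exact (commute_moveOp h2 m').mul_right (commute_configProj h1 m')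

theorem fineK_commute (hB : IsAnyonBlock B) (hB' : IsAnyonBlock B') (β : ℝ)
    (hss : ∀ i j, Commute (B.stab i) (B'.stab j))
    (hsh : ∀ i k, Commute (B.stab i) (B'.hop k)) (hhs : ∀ k i, Commute (B.hop k) (B'.stab i))
    (hhh : ∀ k k', Commute (B.hop k) (B'.hop k')) (m m' : Fin 4 → Fin 2) :
    Commute (fineK β B m) (fineK β B' m') := by
  have h1 : ∀ i, Commute (fineK β B m) (B'.stab i) := fun i =>
    ((commute_moveOp_conjTranspose hB (fun k => (hhs k i).symm) m).symm.mul_left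
      (commute_siteProj (hss 0 i).symm _).symm).smul_left _
  have h2 : ∀ k, Commute (fineK β B m) (B'.hop k) := fun k =>
    ((commute_moveOp_conjTranspose hB (fun k' => (hhh k' k).symm) m).symm.mul_left
      (commute_siteProj (hsh 0 k).symm _).symm).smul_left _
  exact ((commute_moveOp_conjTranspose hB' h2 m').mul_right
    (commute_siteProj (h1 0) _)).smul_right _

end BlockGates

/-! ### Disjointness of blocks of the same colour -/

section Halves

variable {M : ℕ} [NeZero M]

/-- The block coordinate of a coordinate of the fine lattice. -/
def halfCoord (x : ZMod (2 * M)) : ZMod M := ((x.val / 2 : ℕ) : ZMod M)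

theorem halfCoord_two_mul_add (x : ZMod M) (i : Fin 2) :
    halfCoord (((2 * x.val : ℕ) : ZMod (2 * M)) + ((i : ℕ) : ZMod (2 * M))) = x := by
  rw [halfCoord, val_two_mul_add, show (2 * x.val + (i : ℕ)) / 2 = x.val by omega,
    ZMod.natCast_zmod_val]

/-- In each direction the support of a plaquette block meets only its own block coordinate and the
next one. -/
theorem halfCoord_window (x : ZMod M) {a : ℕ} (ha : a ≤ 2) :
    halfCoord (((2 * x.val : ℕ) : ZMod (2 * M)) + (a : ZMod (2 * M))) = x ∨
      halfCoord (((2 * x.val : ℕ) : ZMod (2 * M)) + (a : ZMod (2 * M))) = x + 1 := by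
  interval_cases a
  · exact Or.inl (halfCoord_two_mul_add x 0)
  · exact Or.inl (halfCoord_two_mul_add x 1)
  · right
    have := halfCoord_two_mul_add (x + 1) 0
    rwa [natCast_two_mul_val_add, natCast_two_mul_val_one, Fin.val_zero, Nat.cast_zero,
      add_zero] at this

theorem halfCoord_window_sub (x : ZMod M) {a : ℕ} (ha : a ≤ 2) :
    halfCoord (((2 * x.val : ℕ) : ZMod (2 * M)) - 1 + (a : ZMod (2 * M))) = x ∨
      halfCoord (((2 * x.val : ℕ) : ZMod (2 * M)) - 1 + (a : ZMod (2 * M))) = x - 1 := by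
  interval_cases a
  · right
    have := halfCoord_two_mul_add (x - 1) 1
    have e : ((2 * x.val : ℕ) : ZMod (2 * M)) - 1 + ((0 : ℕ) : ZMod (2 * M)) =
        ((2 * (x - 1).val : ℕ) : ZMod (2 * M)) + (((1 : Fin 2) : ℕ) : ZMod (2 * M)) := by
      conv_lhs => rw [show x = (x - 1) + 1 by ring, natCast_two_mul_val_add,
        natCast_two_mul_val_one]
      simp only [Fin.val_one, Nat.cast_zero, Nat.cast_one]
      ring
    rw [e, this]
  · left
    have := halfCoord_two_mul_add x 0
    rw [Fin.val_zero, Nat.cast_zero, add_zero] at this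
    rwa [Nat.cast_one, sub_add_cancel]
  · left
    have := halfCoord_two_mul_add x 1
    have e : ((2 * x.val : ℕ) : ZMod (2 * M)) - 1 + ((2 : ℕ) : ZMod (2 * M)) =
        ((2 * x.val : ℕ) : ZMod (2 * M)) + (((1 : Fin 2) : ℕ) : ZMod (2 * M)) := by
      simp only [Fin.val_one, Nat.cast_one, Nat.cast_ofNat]
      ring
    rw [e, this]

/-- A colouring of the blocks with nine colours, different on blocks that touch. -/
def siteColour {m m' : ℕ} (b : ZMod m × ZMod m') : ℕ := 3 * cycleColour b.1 + cycleColour b.2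

theorem siteColour_lt {m m' : ℕ} (b : ZMod m × ZMod m') : siteColour b < 9 := by
  have h1 := cycleColour_lt b.1
  have h2 := cycleColour_lt b.2
  unfold siteColour
  omega

theorem siteColour_eq {m m' : ℕ} {b b' : ZMod m × ZMod m'} (h : siteColour b = siteColour b') :
    cycleColour b.1 = cycleColour b'.1 ∧ cycleColour b.2 = cycleColour b'.2 := by
  have h1 := cycleColour_lt b.1
  have h2 := cycleColour_lt b.2
  have h3 := cycleColour_lt b'.1
  have h4 := cycleColour_lt b'.2
  unfold siteColour at h
  omega

/-- Two edges of the cycle that share the vertex `y` and whose initial vertices have the same colour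
must coincide, since neighbours have different colours. -/
theorem eq_of_cycleColour {m : ℕ} (hm : 2 ≤ m) {x x' y : ZMod m}
    (h : cycleColour x = cycleColour x') (hx : y = x ∨ y = x + 1) (hx' : y = x' ∨ y = x' + 1) :
    x = x' := by
  have h1 := cycleColour_add_one hm x
  have h2 := cycleColour_add_one hm x'
  rcases hx with rfl | rfl <;> rcases hx' with hx' | hx'
  · exact hx'
  · rw [hx'] at h
    exact absurd h h2
  · rw [hx'] at h1
    exact absurd h.symm h1
  · exact add_right_cancel hx'

theorem plaqBlock_disjoint (hM : 2 ≤ M) {b b' : Site M} (hb : b ≠ b')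
    (h : siteColour b = siteColour b') : Disjoint (plaqBlock M b).supp (plaqBlock M b').supp := by
  rw [Finset.disjoint_left]
  intro e he he'
  obtain ⟨i, j, hi, hj, h1⟩ := plaqBlock_supp_window b he
  obtain ⟨i', j', hi', hj', h1'⟩ := plaqBlock_supp_window b' he'
  have key : ∀ (b : Site M) (i j : ℕ), i ≤ 2 → j ≤ 2 →
      e.2 = corner b + ((i : ZMod (2 * M)), (j : ZMod (2 * M))) →
      (halfCoord e.2.1 = b.1 ∨ halfCoord e.2.1 = b.1 + 1) ∧
      (halfCoord e.2.2 = b.2 ∨ halfCoord e.2.2 = b.2 + 1) := by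
    intro b i j hi hj h
    rw [h]
    exact ⟨halfCoord_window b.1 hi, halfCoord_window b.2 hj⟩
  have k1 := key b i j hi hj h1
  have k2 := key b' i' j' hi' hj' h1'
  exact hb (Prod.ext (eq_of_cycleColour hM (siteColour_eq h).1 k1.1 k2.1)
    (eq_of_cycleColour hM (siteColour_eq h).2 k1.2 k2.2))

/-- Vertex blocks reach backwards instead of forwards; shifting the block coordinate by one brings
the windows into the form of `eq_of_cycleColour`. -/
theorem vertBlock_disjoint (hM : 2 ≤ M) {b b' : Site M} (hb : b ≠ b')
    (h : siteColour b = siteColour b') : Disjoint (vertBlock M b).supp (vertBlock M b').supp := by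
  rw [Finset.disjoint_left]
  intro e he he'
  obtain ⟨i, j, hi, hj, h1⟩ := vertBlock_supp_window b he
  obtain ⟨i', j', hi', hj', h1'⟩ := vertBlock_supp_window b' he'
  have key : ∀ (b : Site M) (i j : ℕ), i ≤ 2 → j ≤ 2 →
      e.2 = corner b - (1, 1) + ((i : ZMod (2 * M)), (j : ZMod (2 * M))) →
      (halfCoord e.2.1 + 1 = b.1 ∨ halfCoord e.2.1 + 1 = b.1 + 1) ∧
      (halfCoord e.2.2 + 1 = b.2 ∨ halfCoord e.2.2 + 1 = b.2 + 1) := by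
    intro b i j hi hj h
    rw [h]
    refine ⟨?_, ?_⟩
    · rcases halfCoord_window_sub b.1 hi with h | h
      · exact Or.inr (congrArg (· + 1) h)
      · exact Or.inl ((congrArg (· + 1) h).trans (sub_add_cancel _ _))
    · rcases halfCoord_window_sub b.2 hj with h | h
      · exact Or.inr (congrArg (· + 1) h)
      · exact Or.inl ((congrArg (· + 1) h).trans (sub_add_cancel _ _))
  have k1 := key b i j hi hj h1
  have k2 := key b' i' j' hi' hj' h1'
  exact hb (Prod.ext (eq_of_cycleColour hM (siteColour_eq h).1 k1.1 k2.1)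
    (eq_of_cycleColour hM (siteColour_eq h).2 k1.2 k2.2))

/-- Neighbouring blocks share boundary links, so locality is not enough. The Kraus operators commute
because stabilizers commute with stabilizers, hops with hops, and the hops of one block with the
stabilizers of another. -/
theorem plaqBlock_coarse_comm (b b' : Site M) (ρ : Op (Edge (2 * M))) :
    (coarseGate (plaqBlock M b)).map ((coarseGate (plaqBlock M b')).map ρ) =
      (coarseGate (plaqBlock M b')).map ((coarseGate (plaqBlock M b)).map ρ) := by
  by_cases h : b = b'
  · rw [h]
  · simp only [coarseGate_map_eq (plaqBlock_isLocal _).toIsAnyonBlock]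
    refine sum_conj_comm _ _ (coarseK_commute (fun i j => ?_)
      (fun i k => (plaqBlock_family.cross b' b k i (Ne.symm h)).symm)
      (fun k i => plaqBlock_family.cross b b' k i h) fun k k' => ?_) ρ
    · rw [plaqBlock_stab, plaqBlock_stab]
      exact paX_commute _ _
    · rw [plaqBlock_hop, plaqBlock_hop]
      exact paZ_commute _ _

theorem vertBlock_coarse_comm (b b' : Site M) (ρ : Op (Edge (2 * M))) :
    (coarseGate (vertBlock M b)).map ((coarseGate (vertBlock M b')).map ρ) =
      (coarseGate (vertBlock M b')).map ((coarseGate (vertBlock M b)).map ρ) := by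
  by_cases h : b = b'
  · rw [h]
  · simp only [coarseGate_map_eq (vertBlock_isLocal _).toIsAnyonBlock]
    refine sum_conj_comm _ _ (coarseK_commute (fun i j => ?_)
      (fun i k => (vertBlock_family.cross b' b k i (Ne.symm h)).symm)
      (fun k i => vertBlock_family.cross b b' k i h) fun k k' => ?_) ρ
    · rw [vertBlock_stab, vertBlock_stab]
      exact paZ_commute _ _
    · rw [vertBlock_hop, vertBlock_hop]
      exact paX_commute _ _

theorem plaqBlock_fine_comm (β : ℝ) (b b' : Site M) (ρ : Op (Edge (2 * M))) :
    (fineGate β (plaqBlock M b)).map ((fineGate β (plaqBlock M b')).map ρ) =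
      (fineGate β (plaqBlock M b')).map ((fineGate β (plaqBlock M b)).map ρ) := by
  by_cases h : b = b'
  · rw [h]
  · simp only [fineGate_map_eq (plaqBlock_isLocal _).toIsAnyonBlock]
    refine sum_conj_comm _ _ (fineK_commute (plaqBlock_isLocal _).toIsAnyonBlock
      (plaqBlock_isLocal _).toIsAnyonBlock β (fun i j => ?_)
      (fun i k => (plaqBlock_family.cross b' b k i (Ne.symm h)).symm)
      (fun k i => plaqBlock_family.cross b b' k i h) fun k k' => ?_) ρ
    · rw [plaqBlock_stab, plaqBlock_stab]
      exact paX_commute _ _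
    · rw [plaqBlock_hop, plaqBlock_hop]
      exact paZ_commute _ _

theorem vertBlock_fine_comm (β : ℝ) (b b' : Site M) (ρ : Op (Edge (2 * M))) :
    (fineGate β (vertBlock M b)).map ((fineGate β (vertBlock M b')).map ρ) =
      (fineGate β (vertBlock M b')).map ((fineGate β (vertBlock M b)).map ρ) := by
  by_cases h : b = b'
  · rw [h]
  · simp only [fineGate_map_eq (vertBlock_isLocal _).toIsAnyonBlock]
    refine sum_conj_comm _ _ (fineK_commute (vertBlock_isLocal _).toIsAnyonBlock
      (vertBlock_isLocal _).toIsAnyonBlock β (fun i j => ?_)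
      (fun i k => (vertBlock_family.cross b' b k i (Ne.symm h)).symm)
      (fun k i => vertBlock_family.cross b b' k i h) fun k k' => ?_) ρ
    · rw [vertBlock_stab, vertBlock_stab]
      exact paZ_commute _ _
    · rw [vertBlock_hop, vertBlock_hop]
      exact paX_commute _ _

end Halves

/-! ### Range of the iterated RG on the reference lattice -/

section StepRange

variable {L : ℕ} {M : ℕ} [NeZero M]

/-- Positions on a large lattice that stretch the distances of a small lattice by at most `s`. -/
def IsStretch {N : ℕ} (P : Edge N → Site L) (s : ℕ) : Prop :=
  ∀ x y, siteDist (P x) (P y) ≤ s * (siteDist x.2 y.2 + 2)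

theorem isLCd_blocks {P : Edge (2 * M) → Site L} {g : ℕ}
    (f : Site M → ChannelGate (Edge (2 * M)))
    (hf : ∀ b, IsChannelOn (f b).supp (f b).map)
    (hd : ∀ b, ∀ x ∈ (f b).supp, ∀ y ∈ (f b).supp, siteDist (P x) (P y) ≤ g)
    (hdisj : ∀ b b', b ≠ b' → siteColour b = siteColour b' → Disjoint (f b).supp (f b').supp)
    (hcomm : ∀ b b' ρ, (f b).map ((f b').map ρ) = (f b').map ((f b).map ρ))
    {l : List (Site M)} (hl : l.Nodup) : IsLCd P P g 9 (runGates (l.map f)) :=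
  isLCd_of_colouring f siteColour l hl (fun b _ => siteColour_lt b) (fun b _ => hf b)
    (fun b _ => hd b) (fun b _ b' _ => hdisj b b') fun b _ b' _ => hcomm b b'

theorem blocks_nodup : (blocks M).Nodup := Finset.nodup_toList _

theorem layerData_ne : ∀ x ∈ layerData M, x.1 ≠ x.2.1 := by
  intro x hx
  simp only [layerData, List.mem_cons, List.not_mem_nil, or_false] at hx
  rcases hx with h | h | h | h | h | h | h | h | h | h | h | h | h <;> subst h <;> simp

/-- The layers of the disentangling circuit. -/
def disentangleLayers (M : ℕ) [NeZero M] : List (List (ChannelGate (Edge (2 * M)))) :=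
  (layerData M).map fun x => (layerCnots M x.1 x.2.1 x.2.2).map cnotGate

theorem disentangleLayers_flatten : (disentangleLayers M).flatten = disentangleGates M := by
  rw [disentangleGates_eq, allCnots, List.map_flatMap]
  rfl

theorem isChannelLayer_cnots {P : Edge (2 * M) → Site L} {g : ℕ}
    (hd : ∀ e ∈ allCnots M, ∀ x ∈ (cnotGate e).supp, ∀ y ∈ (cnotGate e).supp,
      siteDist (P x) (P y) ≤ g) : ∀ l ∈ disentangleLayers M, IsChannelLayer P g l := by
  intro l hl
  obtain ⟨x, hx, rfl⟩ := List.mem_map.1 hl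
  have hm : ∀ e ∈ layerCnots M x.1 x.2.1 x.2.2, e ∈ allCnots M :=
    fun e he => List.mem_flatMap.2 ⟨x, hx, he⟩
  refine ⟨?_, fun a ha => ?_⟩
  · rw [layerCnots, List.map_map, List.pairwise_map]
    refine blocks_nodup.imp fun {b b'} hb => ?_
    have hne := layerData_ne x hx
    simp only [Function.comp, cnotGate, Finset.disjoint_insert_left,
      Finset.disjoint_singleton_left, Finset.mem_insert, Finset.mem_singleton, link_inj, not_or,
      not_and]
    exact ⟨⟨fun _ => hb, fun h => absurd h hne⟩, fun h => absurd h.symm hne,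
      fun _ h => hb (add_right_cancel h)⟩
  · obtain ⟨e, he, rfl⟩ := List.mem_map.1 ha
    exact ⟨cnotGate_isChannelOn (allCnots_ne e (hm e he)), hd e (hm e he)⟩

theorem IsChannelLayer.reverse {Q : Type} [Fintype Q] [DecidableEq Q] {pos : Q → Site L} {g : ℕ}
    {l : List (ChannelGate Q)} (h : IsChannelLayer pos g l) : IsChannelLayer pos g l.reverse :=
  ⟨List.pairwise_reverse.2 (h.1.imp fun h => h.symm), fun a ha => h.2 a (List.mem_reverse.1 ha)⟩

/-- The factor is $6=4+2$: the diameter of a gate on the current lattice plus the slack in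
`IsStretch`. -/
theorem siteDist_gate {P : Edge (2 * M) → Site L} {s : ℕ} (hP : IsStretch P s) (β : ℝ) :
    ∀ g ∈ rgGates M (blocks M) (blocks M) ++ fineGates M β (blocks M) (blocks M),
      ∀ x ∈ g.supp, ∀ y ∈ g.supp, siteDist (P x) (P y) ≤ 6 * s := by
  intro g hg x hx y hy
  have h1 := gates_diameter β (blocks M) (blocks M) g hg x hx y hy
  refine (hP x y).trans ?_
  rw [mul_comm]
  exact Nat.mul_le_mul_right s (by omega)

theorem mem_blocks (b : Site M) : b ∈ blocks M := Finset.mem_toList.2 (Finset.mem_univ b)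

/-- The depth is $31=9+9+13$: nine colours for each kind of block, and thirteen layers of
controlled-nots. -/
theorem isLCd_rgGates (hM : 2 ≤ M) {P : Edge (2 * M) → Site L} {s : ℕ} (hP : IsStretch P s) :
    IsLCd P P (6 * s) 31 (runGates (rgGates M (blocks M) (blocks M))) := by
  have hd := siteDist_gate hP 0
  have h1 : IsLCd P P (6 * s) 9 (runGates ((blocks M).map fun b => coarseGate (plaqBlock M b))) :=
    isLCd_blocks _ (fun b => (plaqBlock_isLocal b).coarse_isChannelOn)
      (fun b => hd _ (by simp [rgGates, mem_blocks]))
      (fun b b' => plaqBlock_disjoint hM) plaqBlock_coarse_comm blocks_nodup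
  have h2 : IsLCd P P (6 * s) 9 (runGates ((blocks M).map fun b => coarseGate (vertBlock M b))) :=
    isLCd_blocks _ (fun b => (vertBlock_isLocal b).coarse_isChannelOn)
      (fun b => hd _ (by simp [rgGates, mem_blocks]))
      (fun b b' => vertBlock_disjoint hM) vertBlock_coarse_comm blocks_nodup
  have h3 : IsLCd P P (6 * s) 13 (runGates (disentangleGates M)) := by
    have := isLCd_channelLayers (disentangleLayers M) (isChannelLayer_cnots (P := P) (g := 6 * s)
      fun e he => hd _ (by
        rw [rgGates, disentangleGates_eq]
        simp only [List.mem_append]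
        exact Or.inl (Or.inr (List.mem_map_of_mem he))))
    rwa [disentangleLayers_flatten] at this
  have e : runGates (rgGates M (blocks M) (blocks M)) = fun ρ => runGates (disentangleGates M)
      (runGates ((blocks M).map fun b => coarseGate (vertBlock M b))
        (runGates ((blocks M).map fun b => coarseGate (plaqBlock M b)) ρ)) := by
    funext ρ
    rw [rgGates, runGates_append, runGates_append]
  rw [e]
  exact h3.comp (h2.comp h1)

theorem isLCd_rgStep (hM : 2 ≤ M) {P : Edge (2 * M) → Site L} {s : ℕ} (hP : IsStretch P s) :
    IsLCd P (fun e => P (coarseEdge M e)) (6 * s) 31 (rgStep M) :=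
  (isLCd_marginal coarseEdge_injective P (6 * s)).comp (isLCd_rgGates hM hP)

theorem isLCd_fineGates (hM : 2 ≤ M) (β : ℝ) {P : Edge (2 * M) → Site L} {s : ℕ}
    (hP : IsStretch P s) :
    IsLCd P P (6 * s) 31 (runGates (fineGates M β (blocks M) (blocks M))) := by
  have hd := siteDist_gate hP β
  have h1 : IsLCd P P (6 * s) 9
      (runGates ((blocks M).reverse.map fun b => fineGate β (plaqBlock M b))) :=
    isLCd_blocks _ (fun b => (plaqBlock_isLocal b).fine_isChannelOn β)
      (fun b => hd _ (by simp [fineGates, mem_blocks]))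
      (fun b b' => plaqBlock_disjoint hM) (plaqBlock_fine_comm β)
      (List.nodup_reverse.2 blocks_nodup)
  have h2 : IsLCd P P (6 * s) 9
      (runGates ((blocks M).reverse.map fun b => fineGate β (vertBlock M b))) :=
    isLCd_blocks _ (fun b => (vertBlock_isLocal b).fine_isChannelOn β)
      (fun b => hd _ (by simp [fineGates, mem_blocks]))
      (fun b b' => vertBlock_disjoint hM) (vertBlock_fine_comm β)
      (List.nodup_reverse.2 blocks_nodup)
  have h3 : IsLCd P P (6 * s) 13 (runGates (disentangleGates M).reverse) := by
    have h := isChannelLayer_cnots (P := P) (g := 6 * s)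
      fun e he => hd _ (by
        rw [rgGates, disentangleGates_eq]
        simp only [List.mem_append]
        exact Or.inl (Or.inr (List.mem_map_of_mem he)))
    have := isLCd_channelLayers (((disentangleLayers M).map List.reverse).reverse)
      (pos := P) (g := 6 * s) fun l hl => by
        obtain ⟨l', hl', rfl⟩ := List.mem_map.1 (List.mem_reverse.1 hl)
        exact (h l' hl').reverse
    rw [← List.reverse_flatten, disentangleLayers_flatten] at this
    simpa [disentangleLayers, layerData] using this
  have e : runGates (fineGates M β (blocks M) (blocks M)) = fun ρ =>
      runGates ((blocks M).reverse.map fun b => fineGate β (plaqBlock M b))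
        (runGates ((blocks M).reverse.map fun b => fineGate β (vertBlock M b))
          (runGates (disentangleGates M).reverse ρ)) := by
    funext ρ
    rw [fineGates, runGates_append, runGates_append]
  rw [e]
  exact h1.comp (h2.comp h3)

/-- One layer more than forwards, for preparing the decoupled qubits in $|+\rangle$. -/
theorem isLCd_fineStep (hM : 2 ≤ M) (β : ℝ) {P : Edge (2 * M) → Site L} {s : ℕ}
    (hP : IsStretch P s) :
    IsLCd (fun e => P (coarseEdge M e)) P (6 * s) 32 (fineStep M β) :=
  (isLCd_fineGates hM β hP).comp (isLCd_adjoin coarseEdge_injective P (6 * s) (decoupledState M)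
    fun q => by unfold decoupledState; split_ifs <;> simp)

theorem min_val_double_le (x y : ZMod M) (i j : Fin 2) :
    min (((2 * x.val : ℕ) : ZMod (2 * M)) + ((i : ℕ) : ZMod (2 * M)) -
        (((2 * y.val : ℕ) : ZMod (2 * M)) + ((j : ℕ) : ZMod (2 * M)))).val
      (((2 * y.val : ℕ) : ZMod (2 * M)) + ((j : ℕ) : ZMod (2 * M)) -
        (((2 * x.val : ℕ) : ZMod (2 * M)) + ((i : ℕ) : ZMod (2 * M)))).val ≤
      2 * min (x - y).val (y - x).val + 1 := by
  have key : ∀ (x y : ZMod M) (i j : Fin 2),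
      min (((2 * x.val : ℕ) : ZMod (2 * M)) + ((i : ℕ) : ZMod (2 * M)) -
        (((2 * y.val : ℕ) : ZMod (2 * M)) + ((j : ℕ) : ZMod (2 * M)))).val
      (((2 * y.val : ℕ) : ZMod (2 * M)) + ((j : ℕ) : ZMod (2 * M)) -
        (((2 * x.val : ℕ) : ZMod (2 * M)) + ((i : ℕ) : ZMod (2 * M)))).val ≤
      2 * (x - y).val + 1 := by
    intro x y i j
    have e : ((2 * x.val : ℕ) : ZMod (2 * M)) + ((i : ℕ) : ZMod (2 * M)) =
        ((2 * y.val : ℕ) : ZMod (2 * M)) + ((2 * (x - y).val + i : ℕ) : ZMod (2 * M)) := by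
      conv_lhs => rw [show x = y + (x - y) by ring, natCast_two_mul_val_add]
      push_cast
      ring
    rw [e]
    exact min_val_le _ _ _ _ (by omega) (by omega)
  rcases min_choice (x - y).val (y - x).val with h | h <;> rw [h]
  · exact key x y i j
  · rw [min_comm]
    exact key y x j i

/-- Doubling the coordinates, with an offset in each cell, turns a distance $d$ into at most $2d+2$.
The additive slack $2$ is chosen so that $2d+2+2=2(d+2)$, and only `s` doubles. -/
theorem IsStretch.coarse {P : Edge (2 * M) → Site L} {s : ℕ} (hP : IsStretch P s) :
    IsStretch (fun e => P (coarseEdge M e)) (2 * s) := by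
  intro x y
  have h : siteDist (coarseEdge M x).2 (coarseEdge M y).2 ≤ 2 * siteDist x.2 y.2 + 2 := by
    have hc : ∀ e : Edge M, ∃ i j : Fin 2, (coarseEdge M e).2 = cell i j e.2 := by
      intro e
      rw [coarseEdge_eq]
      exact ⟨_, _, rfl⟩
    obtain ⟨i, j, h1⟩ := hc x
    obtain ⟨i', j', h2⟩ := hc y
    rw [h1, h2]
    have k1 := min_val_double_le x.2.1 y.2.1 i i'
    have k2 := min_val_double_le x.2.2 y.2.2 j j'
    simp only [siteDist]
    refine (add_le_add k1 k2).trans ?_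
    omega
  refine (hP _ _).trans ?_
  calc s * (siteDist (coarseEdge M x).2 (coarseEdge M y).2 + 2)
      ≤ s * (2 * siteDist x.2 y.2 + 2 + 2) := Nat.mul_le_mul_left s (by omega)
    _ = 2 * s * (siteDist x.2 y.2 + 2) := by ring

/-- Seen from the reference lattice the gates of each step are twice as large as those of the
previous one. All steps are given one common bound on the diameter, so that their depths add. -/
theorem isLCd_rgIter (hM : 2 ≤ M) (ℓ : ℕ) {P : Edge (latticeSize M ℓ) → Site L} {s : ℕ}
    (hP : IsStretch P s) :
    IsLCd P (fun e => P (coarseEdgeIter M ℓ e)) (6 * s * 2 ^ ℓ) (31 * ℓ) (rgIter M ℓ) := by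
  induction ℓ generalizing s with
  | zero => exact isLCd_id P _
  | succ ℓ ih =>
    have h1 := (isLCd_rgStep (two_le_latticeSize hM ℓ) hP).mono
      (show 6 * s ≤ 6 * s * 2 ^ (ℓ + 1) from Nat.le_mul_of_pos_right _ (by positivity)) le_rfl
    have h2 := ih (P := fun e => P (coarseEdge (latticeSize M ℓ) e)) hP.coarse
    have e : 6 * (2 * s) * 2 ^ ℓ = 6 * s * 2 ^ (ℓ + 1) := by ring
    rw [e] at h2
    have h3 := h2.comp h1
    rwa [show 31 + 31 * ℓ = 31 * (ℓ + 1) by ring] at h3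

theorem isLCd_fineIter (hM : 2 ≤ M) (ℓ : ℕ) (β : ℝ) {P : Edge (latticeSize M ℓ) → Site L} {s : ℕ}
    (hP : IsStretch P s) :
    IsLCd (fun e => P (coarseEdgeIter M ℓ e)) P (6 * s * 2 ^ ℓ) (32 * ℓ) (fineIter M ℓ β) := by
  induction ℓ generalizing s β with
  | zero => exact isLCd_id P _
  | succ ℓ ih =>
    have h1 := (isLCd_fineStep (two_le_latticeSize hM ℓ) β hP).mono
      (show 6 * s ≤ 6 * s * 2 ^ (ℓ + 1) from Nat.le_mul_of_pos_right _ (by positivity)) le_rfl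
    have h2 := ih (rgBeta β) (P := fun e => P (coarseEdge (latticeSize M ℓ) e)) hP.coarse
    have e : 6 * (2 * s) * 2 ^ ℓ = 6 * s * 2 ^ (ℓ + 1) := by ring
    rw [e] at h2
    have h3 := h1.comp h2
    rwa [show 32 * ℓ + 32 = 32 * (ℓ + 1) by ring] at h3

theorem isStretch_snd {N : ℕ} : IsStretch (fun e : Edge N => e.2) 1 :=
  fun x y => by rw [one_mul]; exact Nat.le_add_right _ _

/-- The constant is $192=6\cdot32$, enough for the 32 layers per step of the reversed RG as well. -/
theorem isLC_rgIter (hM : 2 ≤ M) (ℓ : ℕ) : IsLC (L := latticeSize M ℓ) (fun e => e.2)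
    (fun e => (coarseEdgeIter M ℓ e).2) (192 * (ℓ + 1) * 2 ^ ℓ) (rgIter M ℓ) :=
  (isLCd_rgIter hM ℓ isStretch_snd).isLC <| by
    have : 31 * ℓ ≤ 32 * (ℓ + 1) := by omega
    calc 6 * 1 * 2 ^ ℓ * (31 * ℓ) ≤ 6 * 1 * 2 ^ ℓ * (32 * (ℓ + 1)) := Nat.mul_le_mul_left _ this
      _ = _ := by ring

theorem isLC_fineIter (hM : 2 ≤ M) (ℓ : ℕ) (β : ℝ) : IsLC (L := latticeSize M ℓ)
    (fun e => (coarseEdgeIter M ℓ e).2) (fun e => e.2) (192 * (ℓ + 1) * 2 ^ ℓ)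
    (fineIter M ℓ β) :=
  (isLCd_fineIter hM ℓ β isStretch_snd).isLC <| by
    have : 32 * ℓ ≤ 32 * (ℓ + 1) := by omega
    calc 6 * 1 * 2 ^ ℓ * (32 * ℓ) ≤ 6 * 1 * 2 ^ ℓ * (32 * (ℓ + 1)) := Nat.mul_le_mul_left _ this
      _ = _ := by ring

end StepRange

/-! ### Replacement channels and complete depolarization -/

section Channels

open scoped ComplexOrder

variable {Q : Type} [Fintype Q] [DecidableEq Q]

theorem IsChannelOn.comp {A : Finset Q} {Φ Ψ : Op Q → Op Q} (hΨ : IsChannelOn A Ψ)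
    (hΦ : IsChannelOn A Φ) : IsChannelOn A fun ρ => Ψ (Φ ρ) := by
  obtain ⟨n, K, hK, hΦ⟩ := hΦ
  obtain ⟨m, J, hJ, hΨ⟩ := hΨ
  have h1 : ∀ {k : ℕ} (K : Fin k → Op {q // q ∈ A}), ∑ i, (K i)ᴴ * K i = 1 →
      ∑ i, (embed A (K i))ᴴ * embed A (K i) = 1 := by
    intro k K hK
    have := congrArg (embHom (Subtype.val : {q // q ∈ A} → Q) Subtype.val_injective) hK
    rw [map_sum, map_one] at this
    rw [← this]
    refine Finset.sum_congr rfl fun i _ => ?_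
    rw [embed_eq, ← emb_conjTranspose, ← emb_mul Subtype.val_injective]
    rfl
  refine isChannelOn_of_kraus (ι := Fin m × Fin n)
    (fun x => embed A (J x.1) * embed A (K x.2))
    (fun x => mul_mem (mem_localAlg.2 ⟨_, rfl⟩) (mem_localAlg.2 ⟨_, rfl⟩)) ?_ fun ρ => ?_
  · rw [Fintype.sum_prod_type, Finset.sum_comm, ← h1 K hK]
    refine Finset.sum_congr rfl fun i _ => ?_
    have : ∀ j, (embed A (J j) * embed A (K i))ᴴ * (embed A (J j) * embed A (K i)) =
        (embed A (K i))ᴴ * ((embed A (J j))ᴴ * embed A (J j)) * embed A (K i) := by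
      intro j
      rw [Matrix.conjTranspose_mul]
      simp only [Matrix.mul_assoc]
    simp only [this]
    rw [← Finset.sum_mul, ← Finset.mul_sum, h1 J hJ, Matrix.mul_one]
  · rw [hΨ, hΦ, Fintype.sum_prod_type]
    simp only [Matrix.mul_sum, Matrix.sum_mul, Matrix.conjTranspose_mul, Matrix.mul_assoc]

theorem isChannelOn_id (A : Finset Q) : IsChannelOn A fun ρ : Op Q => ρ :=
  isChannelOn_of_kraus (ι := Unit) (fun _ => 1) (fun _ => one_mem _) (by simp) fun ρ => by simp

/-- Discarding everything and preparing a state is a channel. -/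
theorem isChannelOn_replace {σ : Op Q} (hσ : σ.PosSemidef) (htr : σ.trace = 1) :
    IsChannelOn Finset.univ fun ρ : Op Q => ρ.trace • σ := by
  obtain ⟨h1, h2⟩ := posSemidef_cfc_sqrt hσ
  set S := cfc Real.sqrt σ
  have hS : Sᴴ = S := h1.1
  -- The Kraus operators are $\sqrt\sigma\,|i\rangle\langle j|$.
  refine isChannelOn_of_kraus (ι := (Q → Fin 2) × (Q → Fin 2))
    (fun x => S * Matrix.single x.1 x.2 1) (fun x => mem_localAlg_univ _) ?_ fun ρ => ?_
  · have : ∀ x : (Q → Fin 2) × (Q → Fin 2), (S * Matrix.single x.1 x.2 (1 : ℂ))ᴴ *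
        (S * Matrix.single x.1 x.2 1) = σ x.1 x.1 • Matrix.single x.2 x.2 1 := by
      intro x
      rw [Matrix.conjTranspose_mul, hS, Matrix.mul_assoc, ← Matrix.mul_assoc S, h2,
        Matrix.conjTranspose_single, ← Matrix.mul_assoc, Matrix.single_mul_mul_single]
      simp
    simp only [this]
    rw [Fintype.sum_prod_type]
    simp only [← Finset.smul_sum]
    rw [← Finset.sum_smul, show ∑ i, σ i i = 1 from htr, one_smul]
    exact Matrix.sum_single_one
  · have : ∀ x : (Q → Fin 2) × (Q → Fin 2), S * Matrix.single x.1 x.2 (1 : ℂ) * ρ *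
        (S * Matrix.single x.1 x.2 1)ᴴ = ρ x.2 x.2 • (S * Matrix.single x.1 x.1 1 * S) := by
      intro x
      rw [Matrix.conjTranspose_mul, hS, Matrix.conjTranspose_single, Matrix.mul_assoc S,
        Matrix.mul_assoc S, ← Matrix.mul_assoc (_ * ρ), Matrix.single_mul_mul_single]
      have e : Matrix.single x.1 x.1 (ρ x.2 x.2) = ρ x.2 x.2 • Matrix.single x.1 x.1 (1 : ℂ) := by
        simp
      simp only [star_one, one_mul, mul_one, ← Matrix.mul_assoc]
      rw [e, Matrix.mul_smul, Matrix.smul_mul]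
    simp only [this]
    rw [Fintype.sum_prod_type, Finset.sum_comm]
    simp only [← Finset.smul_sum]
    rw [← Finset.sum_smul, ← Finset.sum_mul, ← Finset.mul_sum, Matrix.sum_single_one,
      Matrix.mul_one, h2]
    rfl

/-- The completely depolarizing gate on one qubit. -/
def depolarize (q : Q) : ChannelGate Q where
  supp := {q}
  map ρ := ∑ x : Fin 2 × Fin 2, ((1 / 2 : ℂ) • (paX (Pi.single q x.1) * paZ (Pi.single q x.2))) * ρ *
    ((1 / 2 : ℂ) • (paX (Pi.single q x.1) * paZ (Pi.single q x.2)))ᴴ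

theorem single_mem_localAlg (q : Q) (x : Fin 2) : paX (Pi.single q x) ∈ localAlg ({q} : Finset Q) ∧
    paZ (Pi.single q x) ∈ localAlg ({q} : Finset Q) := by
  have h : ∀ q', q' ∉ ({q} : Finset Q) → (Pi.single q x : Q → Fin 2) q' = 0 := fun q' hq => by
    rw [Pi.single_apply, if_neg fun h => hq (Finset.mem_singleton.2 h)]
  exact ⟨paX_mem_localAlg h, paZ_mem_localAlg h⟩

theorem depolarize_kraus_mem (q : Q) (x : Fin 2 × Fin 2) :
    (1 / 2 : ℂ) • (paX (Pi.single q x.1) * paZ (Pi.single q x.2)) ∈ localAlg ({q} : Finset Q) :=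
  SMulMemClass.smul_mem _ (mul_mem (single_mem_localAlg q _).1 (single_mem_localAlg q _).2)

theorem depolarize_map (q : Q) (ρ : Op Q) : (depolarize q).map ρ =
    ∑ x : Fin 2 × Fin 2, ((1 / 2 : ℂ) • (paX (Pi.single q x.1) * paZ (Pi.single q x.2))) * ρ *
      ((1 / 2 : ℂ) • (paX (Pi.single q x.1) * paZ (Pi.single q x.2)))ᴴ := rfl

theorem depolarize_isChannelOn (q : Q) :
    IsChannelOn (depolarize q).supp (depolarize q).map := by
  refine isChannelOn_of_kraus _ (depolarize_kraus_mem q) ?_ fun ρ => rfl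
  have : ∀ x : Fin 2 × Fin 2,
      ((1 / 2 : ℂ) • (paX (Pi.single q x.1) * paZ (Pi.single q x.2)))ᴴ *
        ((1 / 2 : ℂ) • (paX (Pi.single q x.1) * paZ (Pi.single q x.2))) = (1 / 4 : ℂ) • (1 : Op Q) := by
    intro x
    rw [Matrix.conjTranspose_smul, Matrix.conjTranspose_mul, paX_conjTranspose, paZ_conjTranspose,
      smul_mul_smul_comm, Matrix.mul_assoc, ← Matrix.mul_assoc (paX _), paX_mul_self, Matrix.one_mul,
      paZ_mul_self]
    congr 1
    simp
    norm_num
  simp only [this]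
  rw [Finset.sum_const, ← Nat.cast_smul_eq_nsmul ℂ, smul_smul]
  simp

theorem conj_eq_of_mul_eq {W A ρ : Op Q} (hW : Wᴴ = W) (c : ℂ) (hc : c * star c = 1) {B : Op Q}
    (h : W * A = c • B) : W * (A * ρ * Aᴴ) * W = B * ρ * Bᴴ := by
  have h' : Aᴴ * W = star c • Bᴴ := by
    have := congrArg Matrix.conjTranspose h
    rwa [Matrix.conjTranspose_mul, hW, Matrix.conjTranspose_smul] at this
  calc W * (A * ρ * Aᴴ) * W = (W * A) * ρ * (Aᴴ * W) := by simp only [Matrix.mul_assoc]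
    _ = _ := by
      rw [h, h', Matrix.smul_mul, Matrix.smul_mul, Matrix.mul_smul, smul_smul, hc, one_smul]

theorem commute_of_conj_eq {W σ : Op Q} (hW : W * W = 1) (h : W * σ * W = σ) : Commute W σ := by
  change W * σ = σ * W
  conv_rhs => rw [← h]
  rw [Matrix.mul_assoc (W * σ), hW, Matrix.mul_one]

theorem sgn_mul_star (b s : Q → Fin 2) : sgn b s * star (sgn b s) = 1 := by
  have : star (sgn b s) = sgn b s := by
    rw [sgn, star_prod]
    simp
  rw [this, sgn_mul_self]

/-- Depolarizing averages over the Pauli operators of the qubit; multiplying by one of them permutes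
the Kraus operators up to signs, which cancel in the conjugation. -/
theorem depolarize_commute (q : Q) (c : Fin 2) (ρ : Op Q) :
    Commute (paX (Pi.single q c)) ((depolarize q).map ρ) ∧
      Commute (paZ (Pi.single q c)) ((depolarize q).map ρ) := by
  constructor
  · refine commute_of_conj_eq (paX_mul_self _) ?_
    rw [depolarize_map, Matrix.mul_sum, Matrix.sum_mul]
    refine Fintype.sum_equiv ((Equiv.addLeft c).prodCongr (Equiv.refl _)) _ _ fun x => ?_
    refine conj_eq_of_mul_eq (paX_conjTranspose _) 1 (by simp) ?_
    rw [one_smul, Matrix.mul_smul, ← Matrix.mul_assoc, paX_mul, ← Pi.single_add]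
    rfl
  · refine commute_of_conj_eq (paZ_mul_self _) ?_
    rw [depolarize_map, Matrix.mul_sum, Matrix.sum_mul]
    refine Fintype.sum_equiv ((Equiv.refl _).prodCongr (Equiv.addLeft c)) _ _ fun x => ?_
    refine conj_eq_of_mul_eq (paZ_conjTranspose _) (sgn (Pi.single q c) (Pi.single q x.1))
      (sgn_mul_star _ _) ?_
    rw [Matrix.mul_smul, ← Matrix.mul_assoc, paZ_mul_paX, Matrix.smul_mul, Matrix.mul_assoc,
      paZ_mul, ← Pi.single_add, smul_comm]
    rfl

theorem depolarize_preserves_commute {q : Q} {W ρ : Op Q} {A : Finset Q} (hW : W ∈ localAlg A)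
    (hq : q ∉ A) (h : Commute W ρ) : Commute W ((depolarize q).map ρ) := by
  have hd : Disjoint A {q} := Finset.disjoint_singleton_right.2 hq
  rw [depolarize_map]
  refine Commute.sum_right _ _ _ fun x _ => ?_
  have hK := depolarize_kraus_mem q x
  exact ((localAlg_commute hd hW hK).mul_right h).mul_right
    (localAlg_commute hd hW (star_mem hK))

theorem run_depolarize_commute (l : List Q) (ρ : Op Q) : ∀ q ∈ l, ∀ c,
    Commute (paX (Pi.single q c)) (runGates (l.map depolarize) ρ) ∧
      Commute (paZ (Pi.single q c)) (runGates (l.map depolarize) ρ) := by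
  induction l using List.reverseRecOn with
  | nil => simp
  | append_singleton l a ih =>
    intro q hq c
    have e : runGates ((l ++ [a]).map depolarize) ρ =
        (depolarize a).map (runGates (l.map depolarize) ρ) := by
      simp [runGates]
    rw [e]
    by_cases h : q = a
    · subst h
      exact depolarize_commute q c _
    · have hq' : q ∈ l := by simpa [h] using hq
      have ha : a ∉ ({q} : Finset Q) := fun h' => h (Finset.mem_singleton.1 h').symm
      exact ⟨depolarize_preserves_commute (single_mem_localAlg q c).1 ha (ih q hq' c).1,
        depolarize_preserves_commute (single_mem_localAlg q c).2 ha (ih q hq' c).2⟩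

/-- Commuting with all $Z_q$ makes the operator diagonal, and commuting with all $X_q$ makes the
diagonal constant. -/
theorem eq_smul_one_of_commute {σ : Op Q} (h : ∀ q c, Commute (paX (Pi.single q c)) σ ∧
    Commute (paZ (Pi.single q c)) σ) : σ = σ 0 0 • (1 : Op Q) := by
  have h1 : ∀ q c s t, σ (s + Pi.single q c) (t + Pi.single q c) = σ s t := by
    intro q c s t
    have := congrFun (congrFun (h q c).1.eq s) (t + Pi.single q c)
    rwa [paX_mul_apply, mul_paX_apply, add_assoc, bits_add_self, add_zero] at this
  have h2 : ∀ (S : Finset Q) (s : Q → Fin 2), σ (∑ q ∈ S, Pi.single q (s q))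
      (∑ q ∈ S, Pi.single q (s q)) = σ 0 0 := by
    intro S s
    induction S using Finset.induction_on with
    | empty => simp
    | insert a S ha ih => rw [Finset.sum_insert ha, add_comm, h1, ih]
  ext s t
  rw [Matrix.smul_apply, Matrix.one_apply]
  split_ifs with hst
  · subst hst
    have := h2 Finset.univ s
    rw [Finset.univ_sum_single] at this
    simp [this]
  · obtain ⟨q, hq⟩ := Function.ne_iff.1 hst
    have := congrFun (congrFun (h q 1).2.eq s) t
    rw [paZ, Matrix.diagonal_mul, Matrix.mul_diagonal, sgn_single_left, sgn_single_left] at this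
    have h01 : ∀ x : Fin 2, x = 0 ∨ x = 1 := by decide
    rcases h01 (s q) with h3 | h3 <;> rcases h01 (t q) with h4 | h4
    · exact absurd (h3.trans h4.symm) hq
    · simp [h3, h4] at this
      simp [self_eq_neg.1 this]
    · simp [h3, h4] at this
      simp [neg_eq_self.1 this]
    · exact absurd (h3.trans h4.symm) hq

theorem run_depolarize (ρ : Op Q) :
    runGates ((Finset.univ : Finset Q).toList.map depolarize) ρ = ρ.trace • maxMixed Q := by
  set σ := runGates ((Finset.univ : Finset Q).toList.map depolarize) ρ with hσ
  have h1 : σ = σ 0 0 • (1 : Op Q) := eq_smul_one_of_commute fun q c =>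
    run_depolarize_commute _ ρ q (by simp) c
  have h2 : σ.trace = ρ.trace := runGates_trace _ (fun g hg => by
    obtain ⟨q, -, rfl⟩ := List.mem_map.1 hg
    exact depolarize_isChannelOn q) ρ
  have h3 : σ.trace = σ 0 0 * 2 ^ Fintype.card Q := by
    conv_lhs => rw [h1]
    simp [Matrix.trace_smul, Matrix.trace_one]
  have h4 : (2 : ℂ) ^ Fintype.card Q ≠ 0 := pow_ne_zero _ two_ne_zero
  rw [h1, maxMixed, smul_smul, ← h2, h3, mul_assoc, mul_inv_cancel₀ h4, mul_one]

theorem isLCd_depolarize {L : ℕ} (pos : Q → Site L) (g : ℕ) :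
    IsLCd pos pos g 1 fun ρ : Op Q => ρ.trace • maxMixed Q := by
  have h : IsChannelLayer pos g ((Finset.univ : Finset Q).toList.map depolarize) := by
    refine ⟨?_, fun a ha => ?_⟩
    · rw [List.pairwise_map]
      exact (Finset.nodup_toList _).imp fun h => by simpa [depolarize] using h
    · obtain ⟨q, -, rfl⟩ := List.mem_map.1 ha
      refine ⟨depolarize_isChannelOn q, fun x hx y hy => ?_⟩
      rw [Finset.mem_singleton.1 hx, Finset.mem_singleton.1 hy, siteDist_self]
      exact Nat.zero_le g
  have := isLCd_channelLayer h
  rwa [show runGates ((Finset.univ : Finset Q).toList.map depolarize) = fun ρ => ρ.trace • maxMixed Q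
    from funext run_depolarize] at this

end Channels

/-! ### Splitting one charge into two independent charges -/

section PairGate

variable {Q : Type} [Fintype Q] [DecidableEq Q]

theorem half_one_add_mul_self {X : Op Q} (hX : X * X = 1) (c : ℂ) (hc : c * c = 1) :
    ((1 / 2 : ℂ) • (1 + c • X)) * ((1 / 2 : ℂ) • (1 + c • X)) = (1 / 2 : ℂ) • (1 + c • X) := by
  rw [smul_mul_smul_comm, Matrix.mul_add, Matrix.add_mul, Matrix.add_mul, smul_mul_smul_comm, hX,
    hc, one_smul, Matrix.one_mul, Matrix.mul_one, Matrix.one_mul]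
  module

theorem half_one_add_herm {X : Op Q} (hX : Xᴴ = X) (c : ℂ) (hc : star c = c) :
    ((1 / 2 : ℂ) • (1 + c • X))ᴴ = (1 / 2 : ℂ) • (1 + c • X) := by
  rw [Matrix.conjTranspose_smul, Matrix.conjTranspose_add, Matrix.conjTranspose_smul, hX, hc,
    Matrix.conjTranspose_one]
  simp

theorem neg_one_pow_fin_two_mul_self (a : Fin 2) : ((-1 : ℂ) ^ (a : ℕ)) * (-1) ^ (a : ℕ) = 1 := by
  rw [← mul_pow]
  simp

theorem star_neg_one_pow (n : ℕ) : star ((-1 : ℂ) ^ n) = (-1) ^ n := by simp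

/-- The probability that the first of two anyon sites holds the charge `a`, given the total
charge `π`. -/
def splitProb (u v : ℝ) (π a : Fin 2) : ℝ :=
  (1 + (-1) ^ (a : ℕ) * u) * (1 + (-1) ^ (a : ℕ) * ((-1) ^ (π : ℕ) * v)) /
    (2 * (1 + (-1) ^ (π : ℕ) * (u * v)))

/-- The middle identity is Bayes' rule: conditional probability times the weight of the total charge
`π` is the joint weight of the charges `a` and `a + π`. -/
theorem splitProb_facts {u v : ℝ} (hu : 0 ≤ u) (hu1 : u < 1) (hv : 0 ≤ v) (hv1 : v < 1)
    (π a : Fin 2) : 0 ≤ splitProb u v π a ∧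
      2 * splitProb u v π a * (1 + (-1) ^ (π : ℕ) * (u * v)) =
        (1 + (-1) ^ (a : ℕ) * u) * (1 + (-1) ^ (a : ℕ) * ((-1) ^ (π : ℕ) * v)) ∧
      splitProb u v π 0 + splitProb u v π 1 = 1 := by
  have huv : u * v < 1 := by nlinarith
  have huv0 : 0 ≤ u * v := mul_nonneg hu hv
  have hpos : 0 < 1 + (-1) ^ (π : ℕ) * (u * v) := by
    fin_cases π <;> norm_num <;> linarith
  refine ⟨div_nonneg (mul_nonneg ?_ ?_) (by linarith), ?_, ?_⟩
  · fin_cases a <;> norm_num <;> linarith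
  · fin_cases a <;> fin_cases π <;> norm_num <;> linarith
  · rw [splitProb]
    have hd := hpos.ne'
    generalize 1 + (-1) ^ (π : ℕ) * (u * v) = d at hd ⊢
    field_simp
  · rw [splitProb, splitProb, ← add_div, div_eq_one_iff_eq (by linarith)]
    simp
    ring

/-- For commuting involutions `X` and `V` and an operator `Z` that anticommutes with both, there
is a channel that splits a charge of `X V` into independent charges of `X` and of `V`. -/
theorem exists_split_gate {A : Finset Q} {X V Z : Op Q} (hX : X ∈ localAlg A)
    (hV : V ∈ localAlg A) (hZ : Z ∈ localAlg A) (hXX : X * X = 1) (hVV : V * V = 1)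
    (hZZ : Z * Z = 1) (hXh : Xᴴ = X) (hVh : Vᴴ = V) (hZh : Zᴴ = Z) (hXV : Commute X V)
    (hZX : Z * X = -(X * Z)) (hZV : Z * V = -(V * Z)) {u v : ℝ} (hu : 0 ≤ u) (hu1 : u < 1)
    (hv : 0 ≤ v) (hv1 : v < 1) : ∃ Φ : Op Q → Op Q, IsChannelOn A Φ ∧
      ∀ Y, Commute Y X → Commute Y V → Commute Y Z →
        Φ (Y * (1 + ((u * v : ℝ) : ℂ) • (X * V))) =
          Y * ((1 + (u : ℂ) • X) * (1 + (v : ℂ) • V)) := by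
  set W := X * V with hWdef
  have hWW : W * W = 1 := by
    rw [hWdef, Matrix.mul_assoc, ← Matrix.mul_assoc V, ← hXV.eq, Matrix.mul_assoc X V V, hVV,
      Matrix.mul_one, hXX]
  have hWh : Wᴴ = W := by rw [hWdef, Matrix.conjTranspose_mul, hXh, hVh, hXV.eq]
  have hXW : Commute X W := (Commute.refl X).mul_right hXV
  -- `Z` flips both charges, so it preserves the total charge.
  have hZW : Commute Z W := by
    change Z * (X * V) = X * V * Z
    rw [← Matrix.mul_assoc, hZX, Matrix.neg_mul, Matrix.mul_assoc, hZV, Matrix.mul_neg, neg_neg,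
      Matrix.mul_assoc]
  let p : Fin 2 → Op Q := fun a => (1 / 2 : ℂ) • (1 + (-1 : ℂ) ^ (a : ℕ) • X)
  let w : Fin 2 → Op Q := fun π => (1 / 2 : ℂ) • (1 + (-1 : ℂ) ^ (π : ℕ) • W)
  have hpp : ∀ a, p a * p a = p a := fun a =>
    half_one_add_mul_self hXX _ (neg_one_pow_fin_two_mul_self a)
  have hww : ∀ π, w π * w π = w π := fun π =>
    half_one_add_mul_self hWW _ (neg_one_pow_fin_two_mul_self π)
  have hph : ∀ a, (p a)ᴴ = p a := fun a => half_one_add_herm hXh _ (star_neg_one_pow _)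
  have hwh : ∀ π, (w π)ᴴ = w π := fun π => half_one_add_herm hWh _ (star_neg_one_pow _)
  have cw : ∀ {Y : Op Q}, Commute Y W → ∀ π, Commute Y (w π) := fun h π =>
    ((Commute.one_right _).add_right (h.smul_right _)).smul_right _
  have cp : ∀ {Y : Op Q}, Commute Y X → ∀ a, Commute Y (p a) := fun h a =>
    ((Commute.one_right _).add_right (h.smul_right _)).smul_right _
  have hpw : ∀ a π, Commute (p a) (w π) := fun a π => cw (cp hXW.symm a).symm π
  have hw1 : w 0 + w 1 = 1 := by
    simp only [w, Fin.val_zero, Fin.val_one]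
    module
  have hZp : ∀ a, Z * p a * Z = 1 - p a := by
    intro a
    simp only [p]
    rw [Matrix.mul_smul, Matrix.smul_mul, Matrix.mul_add, Matrix.add_mul, Matrix.mul_one, hZZ,
      Matrix.mul_smul, Matrix.smul_mul, hZX, Matrix.neg_mul, Matrix.mul_assoc, hZZ, Matrix.mul_one]
    module
  let q := splitProb u v
  have hq := splitProb_facts hu hu1 hv hv1
  -- Measure the total charge `π`, then set the charge of `X` to `a` with probability `q π a`: `b =
  -- 0` if it already is `a`, and `b = 1` if `Z` has to flip it first.
  let K : Fin 2 × Fin 2 × Fin 2 → Op Q := fun x =>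
    ((Real.sqrt (q x.1 x.2.1) : ℝ) : ℂ) • (p x.2.1 * w x.1 * Z ^ (x.2.2 : ℕ))
  have hsq : ∀ π a, star (((Real.sqrt (q π a) : ℝ) : ℂ)) * ((Real.sqrt (q π a) : ℝ) : ℂ) =
      (q π a : ℂ) := by
    intro π a
    rw [Complex.star_def, Complex.conj_ofReal, ← Complex.ofReal_mul,
      Real.mul_self_sqrt (hq π a).1]
  have hZb : ∀ b : Fin 2, (Z ^ (b : ℕ))ᴴ = Z ^ (b : ℕ) := fun b => by
    rw [Matrix.conjTranspose_pow, hZh]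
  have hKh : ∀ x, (K x)ᴴ = star (((Real.sqrt (q x.1 x.2.1) : ℝ) : ℂ)) •
      (Z ^ (x.2.2 : ℕ) * (w x.1 * p x.2.1)) := by
    intro x
    rw [Matrix.conjTranspose_smul, Matrix.conjTranspose_mul, Matrix.conjTranspose_mul, hph, hwh,
      hZb]
  have hpA : ∀ a, p a ∈ localAlg A := fun a => SMulMemClass.smul_mem _
    (add_mem (one_mem _) (SMulMemClass.smul_mem _ hX))
  have hwA : ∀ π, w π ∈ localAlg A := fun π => SMulMemClass.smul_mem _
    (add_mem (one_mem _) (SMulMemClass.smul_mem _ (mul_mem hX hV)))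
  refine ⟨fun ρ => ∑ x, K x * ρ * (K x)ᴴ, isChannelOn_of_kraus K (fun x => SMulMemClass.smul_mem _
    (mul_mem (mul_mem (hpA _) (hwA _)) (pow_mem hZ _))) ?_ fun ρ => rfl, ?_⟩
  · have h1 : ∀ x, (K x)ᴴ * K x = (q x.1 x.2.1 : ℂ) •
        (Z ^ (x.2.2 : ℕ) * p x.2.1 * Z ^ (x.2.2 : ℕ) * w x.1) := by
      intro x
      rw [hKh, smul_mul_smul_comm, hsq]
      congr 1
      have e : Commute (Z ^ (x.2.2 : ℕ)) (w x.1) := (cw hZW x.1).pow_left _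
      calc Z ^ (x.2.2 : ℕ) * (w x.1 * p x.2.1) * (p x.2.1 * w x.1 * Z ^ (x.2.2 : ℕ))
          = Z ^ (x.2.2 : ℕ) * (w x.1 * (p x.2.1 * p x.2.1) * w x.1) * Z ^ (x.2.2 : ℕ) := by
            simp only [Matrix.mul_assoc]
        _ = Z ^ (x.2.2 : ℕ) * (p x.2.1 * w x.1) * Z ^ (x.2.2 : ℕ) := by
            rw [hpp, ← (hpw _ _).eq, Matrix.mul_assoc (p x.2.1), hww]
        _ = _ := by
            rw [← Matrix.mul_assoc, Matrix.mul_assoc _ (w x.1), ← e.eq, ← Matrix.mul_assoc]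
    simp only [h1, Fintype.sum_prod_type, Fin.sum_univ_two, Fin.val_zero, Fin.val_one, pow_zero,
      pow_one, Matrix.one_mul, Matrix.mul_one, hZp]
    have e : ∀ π, (q π 0 : ℂ) + (q π 1 : ℂ) = 1 := fun π => by
      exact_mod_cast (hq π 0).2.2
    have e2 : ∀ π a, (q π a : ℂ) • (p a * w π) + (q π a : ℂ) • ((1 - p a) * w π) =
        (q π a : ℂ) • w π := by
      intro π a
      rw [← smul_add, ← Matrix.add_mul, add_sub_cancel, Matrix.one_mul]
    rw [e2, e2, e2, e2, ← add_smul, ← add_smul, e, e, one_smul, one_smul, hw1]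
  · intro Y hYX hYV hYZ
    have hYW : Commute Y W := hYX.mul_right hYV
    set c : ℂ := ((u * v : ℝ) : ℂ) with hc
    set T : Op Q := 1 + c • W with hT
    have hTp : ∀ {D : Op Q}, Commute D W → Commute D T := fun h =>
      (Commute.one_right _).add_right (h.smul_right _)
    have h1 : ∀ x, K x * (Y * T) * (K x)ᴴ =
        (q x.1 x.2.1 : ℂ) • (Y * (T * w x.1 * p x.2.1)) := by
      intro x
      rw [hKh]
      simp only [K]
      rw [Matrix.smul_mul, smul_mul_smul_comm, mul_comm, hsq]
      congr 1
      set R := Z ^ (x.2.2 : ℕ)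
      have hRR : R * R = 1 := by
        simp only [R]
        rw [← (Commute.refl Z).mul_pow, hZZ, one_pow]
      have hRY : Commute R (Y * T) :=
        (hYZ.symm.mul_right (hTp hZW)).pow_left _
      have hpY : Commute (p x.2.1) (Y * T) :=
        (cp hYX _).symm.mul_right (hTp (cp hXW.symm _).symm)
      have hwY : Commute (w x.1) (Y * T) :=
        (cw hYW _).symm.mul_right (hTp (cw (Commute.refl W) _).symm)
      calc p x.2.1 * w x.1 * R * (Y * T) * (R * (w x.1 * p x.2.1))
          = p x.2.1 * w x.1 * (R * (Y * T)) * R * (w x.1 * p x.2.1) := by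
            simp only [Matrix.mul_assoc]
        _ = p x.2.1 * (w x.1 * (Y * T)) * (w x.1 * p x.2.1) := by
            rw [hRY.eq, Matrix.mul_assoc (p x.2.1 * w x.1), Matrix.mul_assoc (Y * T), hRR,
              Matrix.mul_one, Matrix.mul_assoc (p x.2.1)]
        _ = (p x.2.1 * (Y * T)) * (w x.1 * w x.1) * p x.2.1 := by
            rw [hwY.eq]
            simp only [Matrix.mul_assoc]
        _ = Y * T * (p x.2.1 * w x.1 * p x.2.1) := by
            rw [hpY.eq, hww]
            simp only [Matrix.mul_assoc]
        _ = _ := by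
            rw [(hpw _ _).eq, Matrix.mul_assoc (w x.1), hpp]
            simp only [Matrix.mul_assoc]
    have hTw : ∀ π, T * w π = ((1 + (-1) ^ (π : ℕ) * (u * v) : ℝ) : ℂ) • w π := by
      intro π
      have hs := neg_one_pow_fin_two_mul_self π
      have e : W * w π = (-1 : ℂ) ^ (π : ℕ) • w π := by
        simp only [w]
        rw [Matrix.mul_smul, Matrix.mul_add, Matrix.mul_one, Matrix.mul_smul, hWW,
          smul_comm ((-1 : ℂ) ^ (π : ℕ)) (1 / 2 : ℂ), smul_add ((-1 : ℂ) ^ (π : ℕ)), smul_smul, hs,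
          one_smul, add_comm]
      rw [hT, Matrix.add_mul, Matrix.one_mul, Matrix.smul_mul, e, hc, smul_smul]
      push_cast
      rw [add_smul, one_smul, mul_comm]
    -- The cases `b = 0` and `b = 1` contribute equally because `Z` commutes with the input; this is
    -- the origin of the $2$ in the denominator of `splitProb`.
    have h2 : ∀ π a, (q π a : ℂ) • (Y * (T * w π * p a)) + (q π a : ℂ) • (Y * (T * w π * p a)) =
        ((1 + (-1) ^ (a : ℕ) * u : ℂ) * (1 + (-1) ^ (a : ℕ) * ((-1) ^ (π : ℕ) * v))) •
          (Y * (w π * p a)) := by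
      intro π a
      have := (hq π a).2.1
      rw [hTw, ← two_smul ℂ, smul_smul, Matrix.smul_mul, Matrix.mul_smul, smul_smul]
      congr 1
      exact_mod_cast this
    simp only [h1, Fintype.sum_prod_type, Fin.sum_univ_two]
    rw [h2, h2, h2, h2]
    have hWX : W * X = V := by rw [← hXW.eq, hWdef, ← Matrix.mul_assoc, hXX, Matrix.one_mul]
    have hwp : ∀ π a, w π * p a = (1 / 4 : ℂ) • (1 + (-1 : ℂ) ^ (π : ℕ) • W +
        (-1 : ℂ) ^ (a : ℕ) • X + ((-1 : ℂ) ^ (π : ℕ) * (-1 : ℂ) ^ (a : ℕ)) • V) := by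
      intro π a
      simp only [w, p]
      rw [smul_mul_smul_comm, Matrix.mul_add, Matrix.add_mul, Matrix.add_mul, smul_mul_smul_comm,
        hWX]
      simp only [Matrix.mul_one, one_mul]
      module
    have hT2 : (1 + (u : ℂ) • X) * (1 + (v : ℂ) • V) =
        1 + (u : ℂ) • X + (v : ℂ) • V + ((u : ℂ) * (v : ℂ)) • W := by
      rw [Matrix.mul_add, Matrix.add_mul, Matrix.add_mul, smul_mul_smul_comm, ← hWdef]
      simp only [Matrix.one_mul, Matrix.mul_one]
      module
    simp only [hwp, hT2, Matrix.mul_add, Matrix.mul_smul, Fin.val_zero, Fin.val_one, pow_zero,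
      pow_one]
    module

end PairGate

/-! ### Splitting the charge of a chain -/

section ChainGate

variable {Q : Type} [Fintype Q] [DecidableEq Q]

theorem herm_of_involution_prod {ι : Type*} (φ : GA Q →ₐ[ℂ] Op Q)
    (hφ : ∀ a, (φ (xx a))ᴴ = φ (xx a)) (s : Finset ι) (a : ι → Q → Fin 2) :
    (φ (∏ i ∈ s, xx (a i)))ᴴ = φ (∏ i ∈ s, xx (a i)) := by
  have := prod_smul_xx s (fun _ => (1 : ℂ)) a
  simp only [one_smul, Finset.prod_const_one] at this
  rw [this, hφ]

theorem involution_prod {ι : Type*} (s : Finset ι) (a : ι → Q → Fin 2) :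
    (∏ i ∈ s, xx (a i)) * ∏ i ∈ s, xx (a i) = (1 : GA Q) := by
  rw [← Finset.prod_mul_distrib]
  exact Finset.prod_eq_one fun i _ => xx_mul_self _

/-- A charge of a product of `n + 1` stabilizers can be split into independent charges of the
stabilizers, when anyons can hop between consecutive ones. -/
theorem exists_chain_gate (φ : GA Q →ₐ[ℂ] Op Q) (hφ : ∀ a, (φ (xx a))ᴴ = φ (xx a))
    {A : Finset Q} (a : ℕ → Q → Fin 2) (Z : ℕ → Op Q) {t : ℝ} (ht : 0 ≤ t) (ht1 : t < 1) (n : ℕ)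
    (ha : ∀ i ≤ n, φ (xx (a i)) ∈ localAlg A) (hZA : ∀ i < n, Z i ∈ localAlg A)
    (hZZ : ∀ i < n, Z i * Z i = 1) (hZh : ∀ i < n, (Z i)ᴴ = Z i)
    (hanti : ∀ i < n, Z i * φ (xx (a i)) = -(φ (xx (a i)) * Z i) ∧
      Z i * φ (xx (a (i + 1))) = -(φ (xx (a (i + 1))) * Z i))
    (hcomm : ∀ i < n, ∀ j ≤ n, j ≠ i → j ≠ i + 1 → Commute (Z i) (φ (xx (a j)))) :
    ∃ Φ : Op Q → Op Q, IsChannelOn A Φ ∧ ∀ Y, (∀ i ≤ n, Commute Y (φ (xx (a i)))) →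
      (∀ i < n, Commute Y (Z i)) →
      Φ (Y * φ (1 + ((t ^ (n + 1) : ℝ) : ℂ) • ∏ i ∈ Finset.range (n + 1), xx (a i))) =
        Y * φ (∏ i ∈ Finset.range (n + 1), (1 + (t : ℂ) • xx (a i))) := by
  induction n with
  | zero =>
    refine ⟨fun ρ => ρ, isChannelOn_id A, fun Y _ _ => ?_⟩
    simp
  | succ n ih =>
    obtain ⟨Φ, hΦ, h⟩ := ih (fun i hi => ha i (by omega)) (fun i hi => hZA i (by omega))
      (fun i hi => hZZ i (by omega)) (fun i hi => hZh i (by omega))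
      (fun i hi => hanti i (by omega)) fun i hi j hj => hcomm i (by omega) j (by omega)
    set P : GA Q := ∏ i ∈ Finset.range (n + 1), xx (a i) with hP
    have hcP : ∀ {W : Op Q}, (∀ i ≤ n, Commute W (φ (xx (a i)))) → Commute W (φ P) := fun hW =>
      (commute_algHom_prod φ _ _ fun i hi =>
        (hW i (Nat.lt_succ_iff.1 (Finset.mem_range.1 hi))).symm).symm
    -- Of the sites already in the chain, the hop to the new site touches only the last one.
    have hZP : Z n * φ P = -(φ P * Z n) := by
      have hc : Commute (Z n) (φ (∏ i ∈ Finset.range n, xx (a i))) :=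
        (commute_algHom_prod φ _ _ fun i hi => by
          have := Finset.mem_range.1 hi
          exact (hcomm n (by omega) i (by omega) (by omega) (by omega)).symm).symm
      rw [hP, Finset.prod_range_succ, map_mul, ← Matrix.mul_assoc, hc.eq, Matrix.mul_assoc,
        (hanti n (by omega)).1, Matrix.mul_neg, Matrix.mul_assoc]
    have hPA : φ P ∈ localAlg A := by
      have : P ∈ (localAlg A).toSubalgebra.comap φ := prod_mem fun i hi =>
        ha i (by have := Finset.mem_range.1 hi; omega)
      exact this
    -- The last site is split off with bias $t$, leaving the bias $t^{n+1}$ for the rest; the factor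
    -- of the last site then joins the spectator `Y` of the induction hypothesis.
    obtain ⟨Ψ, hΨ, h'⟩ := exists_split_gate (u := t ^ (n + 1)) (v := t) hPA
      (ha (n + 1) le_rfl) (hZA n (by omega))
      (by rw [← map_mul, involution_prod, map_one])
      (by rw [← map_mul, xx_mul_self, map_one]) (hZZ n (by omega))
      (herm_of_involution_prod φ hφ _ _) (hφ _) (hZh n (by omega))
      (by change φ P * φ _ = φ _ * φ P; rw [← map_mul, ← map_mul, mul_comm]) hZP
      (hanti n (by omega)).2
      (by positivity) (pow_lt_one₀ ht ht1 (by omega)) ht ht1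
    refine ⟨fun ρ => Φ (Ψ ρ), hΦ.comp hΨ, fun Y hY hYZ => ?_⟩
    have e1 : φ (1 + ((t ^ (n + 1 + 1) : ℝ) : ℂ) • ∏ i ∈ Finset.range (n + 1 + 1), xx (a i)) =
        1 + ((t ^ (n + 1) * t : ℝ) : ℂ) • (φ P * φ (xx (a (n + 1)))) := by
      rw [Finset.prod_range_succ, map_add, map_one, map_smul, map_mul, pow_succ]
    have e2 : 1 + ((t ^ (n + 1) : ℝ) : ℂ) • φ P = φ (1 + ((t ^ (n + 1) : ℝ) : ℂ) • P) := by
      rw [map_add, map_one, map_smul]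
    have e3 : (1 : Op Q) + (t : ℂ) • φ (xx (a (n + 1))) = φ (1 + (t : ℂ) • xx (a (n + 1))) := by
      rw [map_add, map_one, map_smul]
    dsimp only
    rw [e1, h' Y (hcP fun i hi => hY i (by omega)) (hY _ le_rfl) (hYZ n (by omega)), e2, e3,
      ← map_mul, mul_comm, map_mul, ← Matrix.mul_assoc, h, Matrix.mul_assoc, ← map_mul, mul_comm,
      ← Finset.prod_range_succ fun i => 1 + (t : ℂ) • xx (a i)]
    · intro i hi
      refine (hY i (by omega)).mul_left ?_
      change φ _ * φ _ = φ _ * φ _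
      rw [← map_mul, ← map_mul, mul_comm]
    · intro i hi
      exact (hYZ i (by omega)).mul_left (commute_algHom_one_add φ _
        (hcomm i (by omega) (n + 1) le_rfl (by omega) (by omega)).symm)

end ChainGate

/-! ### Cutting the torus into horizontal strips -/

section Strips

variable {L m s : ℕ} [NeZero L] [NeZero m]

/-- The cycle of length `L` is cut into `m` strips of length `s`, the last of which may be
longer. -/
def stripOf (m s : ℕ) (x : ZMod L) : ZMod m := ((min (x.val / s) (m - 1) : ℕ) : ZMod m)

/-- The length of a strip. -/
def stripLength (L s : ℕ) (k : ZMod m) : ℕ := if k.val + 1 = m then L - s * (m - 1) else s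

theorem stripOf_val (x : ZMod L) : (stripOf m s x).val = min (x.val / s) (m - 1) :=
  ZMod.val_cast_of_lt (by have := NeZero.pos m; omega)

/-- The last strip absorbs the remainder, which is shorter than `s`, so all lengths lie between `s`
and `2 * s`. -/
theorem stripLength_facts (hs : 1 ≤ s) (h1 : m * s ≤ L) (h2 : L < (m + 1) * s) (k : ZMod m) :
    s ≤ stripLength L s k ∧ stripLength L s k ≤ 2 * s ∧ k.val * s + stripLength L s k ≤ L := by
  have hk := k.val_lt
  unfold stripLength
  obtain ⟨n, rfl⟩ : ∃ n, m = n + 1 := ⟨m - 1, by omega⟩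
  simp only [Nat.add_sub_cancel]
  have e1 : (n + 1) * s = s * n + s := by ring
  have e2 : (n + 1 + 1) * s = s * n + 2 * s := by ring
  split_ifs with h
  · have : k.val * s = s * n := by rw [show k.val = n by omega, mul_comm]
    omega
  · have : (k.val + 1) * s ≤ (n + 1) * s := Nat.mul_le_mul_right _ (by omega)
    rw [add_mul, one_mul] at this
    omega

theorem stripOf_natCast (hs : 1 ≤ s) (h1 : m * s ≤ L) (h2 : L < (m + 1) * s) (k : ZMod m) {i : ℕ}
    (hi : i < stripLength L s k) : stripOf m s ((k.val * s + i : ℕ) : ZMod L) = k := by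
  have hf := stripLength_facts hs h1 h2 k
  have hk := k.val_lt
  apply ZMod.val_injective
  rw [stripOf_val, ZMod.val_cast_of_lt (by omega)]
  unfold stripLength at hi
  have hle : k.val ≤ (k.val * s + i) / s := by rw [Nat.le_div_iff_mul_le (by omega)]; omega
  split_ifs at hi with h
  · omega
  · have : (k.val * s + i) / s < k.val + 1 := by
      rw [Nat.div_lt_iff_lt_mul (by omega), add_mul, one_mul]; omega
    omega

theorem exists_of_stripOf_eq (hs : 1 ≤ s) (x : ZMod L) :
    ∃ i < stripLength L s (stripOf m s x), (((stripOf m s x).val * s + i : ℕ) : ZMod L) = x := by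
  have hx := x.val_lt
  have hv := stripOf_val (m := m) (s := s) x
  have hd := Nat.div_mul_le_self x.val s
  have hd2 : x.val < (x.val / s + 1) * s := (Nat.div_lt_iff_lt_mul (by omega)).1 (Nat.lt_succ_self _)
  have hm := NeZero.pos m
  have hle : (stripOf m s x).val * s ≤ x.val :=
    (Nat.mul_le_mul_right _ (by omega)).trans hd
  refine ⟨x.val - (stripOf m s x).val * s, ?_, ?_⟩
  · unfold stripLength
    split_ifs with h
    · have : (stripOf m s x).val * s = s * (m - 1) := by
        rw [show (stripOf m s x).val = m - 1 by omega, mul_comm]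
      omega
    · rw [show (stripOf m s x).val = x.val / s by omega] at hle ⊢
      rw [add_mul, one_mul] at hd2
      omega
  · rw [Nat.add_sub_cancel' hle, ZMod.natCast_zmod_val]

theorem stripOf_add_one (hs : 1 ≤ s) (h1 : m * s ≤ L) (x : ZMod L) :
    stripOf m s (x + 1) = stripOf m s x ∨ stripOf m s (x + 1) = stripOf m s x + 1 := by
  have hx := x.val_lt
  have hm := NeZero.pos m
  by_cases h : x.val + 1 = L
  · right
    have e : x + 1 = 0 := by
      rw [← ZMod.natCast_zmod_val x, ← Nat.cast_one, ← Nat.cast_add, h, ZMod.natCast_self]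
    have : m - 1 ≤ x.val / s := by
      rw [Nat.le_div_iff_mul_le (by omega), Nat.sub_mul]
      omega
    rw [e]
    unfold stripOf
    rw [min_eq_right this, ZMod.val_zero, Nat.zero_div, Nat.zero_min, ← Nat.cast_one (R := ZMod m),
      ← Nat.cast_add, Nat.sub_add_cancel hm, ZMod.natCast_self, Nat.cast_zero]
  · have e : (x + 1).val = x.val + 1 := by
      rw [← ZMod.natCast_zmod_val x, ← Nat.cast_one, ← Nat.cast_add,
        ZMod.val_cast_of_lt (by omega), ZMod.natCast_zmod_val]
    unfold stripOf
    rw [e, ← Nat.cast_one (R := ZMod m), ← Nat.cast_add, Nat.succ_div]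
    split_ifs
    · by_cases h3 : x.val / s + 1 ≤ m - 1
      · right; congr 1; omega
      · left; congr 1; omega
    · left; rfl

/-- The `i`-th site of a strip. -/
def stripSite (s : ℕ) (b : ZMod m × ZMod L) (i : ℕ) : Site L :=
  (((b.1.val * s + i : ℕ) : ZMod L), b.2)

theorem stripSite_succ (b : ZMod m × ZMod L) (i : ℕ) :
    stripSite s b (i + 1) = stripSite s b i + (1, 0) := by
  simp [stripSite, add_assoc]

theorem stripSite_inj (hs : 1 ≤ s) (h1 : m * s ≤ L) (h2 : L < (m + 1) * s)
    {b b' : ZMod m × ZMod L} {i j : ℕ} (hi : i < stripLength L s b.1)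
    (hj : j < stripLength L s b'.1) (h : stripSite s b i = stripSite s b' j) : b = b' ∧ i = j := by
  have e1 := (Prod.ext_iff.1 h).1
  have e2 : b.2 = b'.2 := (Prod.ext_iff.1 h).2
  simp only [stripSite] at e1
  have e3 : b.1 = b'.1 := by
    rw [← stripOf_natCast hs h1 h2 b.1 hi, e1, stripOf_natCast hs h1 h2 b'.1 hj]
  obtain rfl : b = b' := Prod.ext e3 e2
  refine ⟨rfl, ?_⟩
  have hf := stripLength_facts hs h1 h2 b.1
  have := congrArg ZMod.val e1
  rw [ZMod.val_cast_of_lt (by omega), ZMod.val_cast_of_lt (by omega)] at this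
  omega

theorem prod_strips {R : Type*} [CommMonoid R] (hs : 1 ≤ s) (h1 : m * s ≤ L)
    (h2 : L < (m + 1) * s) (u : Site L → R) :
    ∏ b : ZMod m × ZMod L, ∏ i ∈ Finset.range (stripLength L s b.1), u (stripSite s b i) =
      ∏ p, u p := by
  rw [Finset.prod_sigma']
  refine Finset.prod_bij (fun x _ => stripSite s x.1 x.2) (fun _ _ => Finset.mem_univ _) ?_ ?_
    fun _ _ => rfl
  · rintro ⟨b, i⟩ hb ⟨b', j⟩ hb' h
    simp only [Finset.mem_sigma, Finset.mem_univ, Finset.mem_range, true_and] at hb hb'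
    obtain ⟨rfl, rfl⟩ := stripSite_inj hs h1 h2 hb hb' h
    rfl
  · intro p _
    obtain ⟨i, hi, h⟩ := exists_of_stripOf_eq (m := m) hs p.1
    exact ⟨⟨(stripOf m s p.1, p.2), i⟩, by simpa using hi, Prod.ext h rfl⟩

/-- The links at the corners of a unit square at `p`, displaced by `o`. -/
def squareLinks (o : ZMod L) (p : Site L) : Finset (Edge L) := Finset.univ.filter fun e =>
  (e.2.1 - o = p.1 ∨ e.2.1 - o = p.1 + 1) ∧ (e.2.2 - o = p.2 ∨ e.2.2 - o = p.2 + 1)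

/-- The links near a strip. -/
def stripLinks (s : ℕ) (o : ZMod L) (b : ZMod m × ZMod L) : Finset (Edge L) :=
  (Finset.range (stripLength L s b.1)).biUnion fun i => squareLinks o (stripSite s b i)

/-- Horizontally the links spread over at most $2s$ and vertically over at most $1$; and
$2s+1\le3s$. -/
theorem stripLinks_diam (hs : 1 ≤ s) (h1 : m * s ≤ L) (h2 : L < (m + 1) * s) (o : ZMod L)
    (b : ZMod m × ZMod L) : ∀ e ∈ stripLinks s o b, ∀ e' ∈ stripLinks s o b,
      siteDist e.2 e'.2 ≤ 3 * s := by
  have key : ∀ e ∈ stripLinks s o b, (∃ a : ℕ, a ≤ 2 * s ∧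
      e.2.1 = ((b.1.val * s : ℕ) + o) + a) ∧ ∃ a : ℕ, a ≤ 1 ∧ e.2.2 = (b.2 + o) + a := by
    intro e he
    have hf := stripLength_facts hs h1 h2 b.1
    simp only [stripLinks, Finset.mem_biUnion, Finset.mem_range, squareLinks, Finset.mem_filter,
      Finset.mem_univ, true_and, stripSite, sub_eq_iff_eq_add] at he
    obtain ⟨i, hi, hx, hy⟩ := he
    constructor
    · rcases hx with hx | hx
      · exact ⟨i, by omega, by rw [hx]; push_cast; ring⟩
      · exact ⟨i + 1, by omega, by rw [hx]; push_cast; ring⟩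
    · rcases hy with hy | hy
      · exact ⟨0, by omega, by rw [hy]; simp⟩
      · exact ⟨1, by omega, by rw [hy]; push_cast; ring⟩
  intro e he e' he'
  obtain ⟨⟨x, hx, ex⟩, y, hy, ey⟩ := key e he
  obtain ⟨⟨x', hx', ex'⟩, y', hy', ey'⟩ := key e' he'
  have d1 := min_val_le (((b.1.val * s : ℕ) : ZMod L) + o) (2 * s) x x' hx hx'
  have d2 := min_val_le (b.2 + o) 1 y y' hy hy'
  rw [siteDist, ex, ex', ey, ey']
  omega

theorem stripLinks_disjoint (hL : 2 ≤ L) (hs : 1 ≤ s) (h1 : m * s ≤ L) (h2 : L < (m + 1) * s)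
    (o : ZMod L) {b b' : ZMod m × ZMod L} (hb : b ≠ b') (h : siteColour b = siteColour b') :
    Disjoint (stripLinks s o b) (stripLinks s o b') := by
  have key : ∀ (b : ZMod m × ZMod L), ∀ e ∈ stripLinks s o b,
      (stripOf m s (e.2.1 - o) = b.1 ∨ stripOf m s (e.2.1 - o) = b.1 + 1) ∧
        (e.2.2 - o = b.2 ∨ e.2.2 - o = b.2 + 1) := by
    intro b e he
    simp only [stripLinks, Finset.mem_biUnion, Finset.mem_range, squareLinks, Finset.mem_filter,
      Finset.mem_univ, true_and] at he
    obtain ⟨i, hi, hx, hy⟩ := he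
    refine ⟨?_, hy⟩
    have e1 := stripOf_natCast hs h1 h2 b.1 hi
    rcases hx with hx | hx <;> rw [hx]
    · exact Or.inl e1
    · have := stripOf_add_one (m := m) hs h1 (stripSite s b i).1
      simp only [stripSite] at this ⊢
      rwa [e1] at this
  obtain ⟨c1, c2⟩ := siteColour_eq h
  rw [Finset.disjoint_left]
  intro e he he'
  obtain ⟨x1, y1⟩ := key b e he
  obtain ⟨x2, y2⟩ := key b' e he'
  refine hb (Prod.ext ?_ (eq_of_cycleColour hL c2 y1 y2))
  rcases Nat.lt_or_ge 1 m with hm | hm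
  · exact eq_of_cycleColour hm c1 x1 x2
  -- With a single strip around the torus the colouring of the horizontal direction says nothing,
  -- but there is only one horizontal index.
  · obtain rfl : m = 1 := by have := NeZero.pos m; omega
    exact Subsingleton.elim _ _

end Strips

/-! ### Splitting the charges of all strips in parallel -/

section StripCircuit

variable {L m s : ℕ} [NeZero L] [NeZero m]

/-- Stabilizers at the sites of the lattice, with operators that move charges horizontally. -/
structure IsChargeLattice (φ : GA (Edge L) →ₐ[ℂ] Op (Edge L)) (stab : Site L → Edge L → Fin 2)
    (hop : Site L → Op (Edge L)) (o : ZMod L) : Prop where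
  herm : ∀ a, (φ (xx a))ᴴ = φ (xx a)
  stab_mem : ∀ p, φ (xx (stab p)) ∈ localAlg (squareLinks o p)
  hop_mem : ∀ p, hop p ∈ localAlg (squareLinks o p)
  hop_sq : ∀ p, hop p * hop p = 1
  hop_herm : ∀ p, (hop p)ᴴ = hop p
  anti : ∀ p q, q = p ∨ q = p + (1, 0) → hop p * φ (xx (stab q)) = -(φ (xx (stab q)) * hop p)
  comm : ∀ p q, q ≠ p → q ≠ p + (1, 0) → Commute (hop p) (φ (xx (stab q)))

variable {φ : GA (Edge L) →ₐ[ℂ] Op (Edge L)} {stab : Site L → Edge L → Fin 2}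
  {hop : Site L → Op (Edge L)} {o : ZMod L}

/-- The total charge of a strip. -/
def stripBits (s : ℕ) (stab : Site L → Edge L → Fin 2) (b : ZMod m × ZMod L) : Edge L → Fin 2 :=
  ∑ i ∈ Finset.range (stripLength L s b.1), stab (stripSite s b i)

theorem xx_stripBits (b : ZMod m × ZMod L) : xx (stripBits s stab b) =
    ∏ i ∈ Finset.range (stripLength L s b.1), xx (stab (stripSite s b i)) := by
  have := prod_smul_xx (Finset.range (stripLength L s b.1)) (fun _ => (1 : ℂ))
    fun i => stab (stripSite s b i)
  simp only [one_smul, Finset.prod_const_one] at this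
  exact this.symm

/-- The factor of a strip: charges that are independent, or only their sum. -/
def stripFactor (s : ℕ) (stab : Site L → Edge L → Fin 2) (t : ℝ) (S : Finset (ZMod m × ZMod L))
    (b : ZMod m × ZMod L) : GA (Edge L) :=
  if b ∈ S then ∏ i ∈ Finset.range (stripLength L s b.1), (1 + (t : ℂ) • xx (stab (stripSite s b i)))
  else 1 + ((t ^ stripLength L s b.1 : ℝ) : ℂ) • xx (stripBits s stab b)

theorem commute_stripFactor {W : Op (Edge L)} {b : ZMod m × ZMod L} (t : ℝ)
    (S : Finset (ZMod m × ZMod L))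
    (h : ∀ i < stripLength L s b.1, Commute (φ (xx (stab (stripSite s b i)))) W) :
    Commute (φ (stripFactor s stab t S b)) W := by
  unfold stripFactor
  split_ifs
  · exact commute_algHom_prod φ _ _ fun i hi =>
      commute_algHom_one_add φ _ (h i (Finset.mem_range.1 hi))
  · rw [xx_stripBits]
    exact commute_algHom_one_add φ _ (commute_algHom_prod φ _ _ fun i hi =>
      h i (Finset.mem_range.1 hi))

/-- The chain gate of one strip, with `Y` and the factors of all other strips as spectators. It does
not depend on which strips were split before, so one channel serves every `S`. -/
theorem IsChargeLattice.exists_gate (h : IsChargeLattice φ stab hop o) (hs : 1 ≤ s)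
    (h1 : m * s ≤ L) (h2 : L < (m + 1) * s) {t : ℝ} (ht : 0 ≤ t) (ht1 : t < 1)
    (b : ZMod m × ZMod L) : ∃ Φ : Op (Edge L) → Op (Edge L), IsChannelOn (stripLinks s o b) Φ ∧
      ∀ Y, (∀ p, Commute Y (φ (xx (stab p)))) → (∀ p, Commute Y (hop p)) →
        ∀ S : Finset (ZMod m × ZMod L), b ∉ S →
          Φ (Y * φ (∏ b', stripFactor s stab t S b')) =
            Y * φ (∏ b', stripFactor s stab t (insert b S) b') := by
  obtain ⟨n, hn⟩ : ∃ n, stripLength L s b.1 = n + 1 :=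
    ⟨stripLength L s b.1 - 1, by have := (stripLength_facts hs h1 h2 b.1).1; omega⟩
  have hsub : ∀ i ≤ n, squareLinks o (stripSite s b i) ⊆ stripLinks s o b := fun i hi =>
    Finset.subset_biUnion_of_mem (fun i => squareLinks o (stripSite s b i))
      (Finset.mem_range.2 (by omega))
  have hne : ∀ {b' i j}, i ≤ n → j < stripLength L s b'.1 → (b' ≠ b ∨ j ≠ i) →
      stripSite s b' j ≠ stripSite s b i := by
    intro b' i j hi hj hbj e
    obtain ⟨rfl, rfl⟩ := stripSite_inj hs h1 h2 hj (by omega) e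
    simp at hbj
  -- For `i < n` the hop leads to a site of the same strip, so it cannot disturb the charge of a
  -- neighbouring strip.
  have hcross : ∀ {b' i j}, i < n → j < stripLength L s b'.1 → (b' ≠ b ∨ j ≠ i ∧ j ≠ i + 1) →
      Commute (hop (stripSite s b i)) (φ (xx (stab (stripSite s b' j)))) := by
    intro b' i j hi hj hbj
    refine h.comm _ _ (hne hi.le hj (by tauto)) ?_
    rw [← stripSite_succ]
    exact hne hi hj (by tauto)
  obtain ⟨Φ, hΦ, hrun⟩ := exists_chain_gate φ h.herm (A := stripLinks s o b)
    (fun i => stab (stripSite s b i)) (fun i => hop (stripSite s b i)) ht ht1 n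
    (fun i hi => localAlg_mono (hsub i hi) (h.stab_mem _))
    (fun i hi => localAlg_mono (hsub i hi.le) (h.hop_mem _))
    (fun i _ => h.hop_sq _) (fun i _ => h.hop_herm _)
    (fun i _ => ⟨h.anti _ _ (Or.inl rfl), h.anti _ _ (Or.inr (stripSite_succ b i))⟩)
    fun i hi j hj hji hji' => hcross hi (by omega) (Or.inr ⟨hji, hji'⟩)
  refine ⟨Φ, hΦ, fun Y hY hY' S hb => ?_⟩
  have hrest : ∏ b' ∈ Finset.univ.erase b, stripFactor s stab t (insert b S) b' =
      ∏ b' ∈ Finset.univ.erase b, stripFactor s stab t S b' :=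
    Finset.prod_congr rfl fun b' hb' => by
      simp only [stripFactor, Finset.mem_insert, Finset.ne_of_mem_erase hb', false_or]
  rw [← Finset.prod_erase_mul _ _ (Finset.mem_univ b), ← Finset.prod_erase_mul (s := Finset.univ)
    (f := stripFactor s stab t (insert b S)) (h := Finset.mem_univ b), hrest, map_mul, map_mul,
    ← Matrix.mul_assoc, ← Matrix.mul_assoc]
  have e1 : stripFactor s stab t S b = 1 + ((t ^ (n + 1) : ℝ) : ℂ) •
      ∏ i ∈ Finset.range (n + 1), xx (stab (stripSite s b i)) := by
    rw [stripFactor, if_neg hb, xx_stripBits, hn]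
  have e2 : stripFactor s stab t (insert b S) b =
      ∏ i ∈ Finset.range (n + 1), (1 + (t : ℂ) • xx (stab (stripSite s b i))) := by
    rw [stripFactor, if_pos (Finset.mem_insert_self b S), hn]
  rw [e1, e2]
  refine hrun _ (fun i hi => (hY _).mul_left ?_) fun i hi => (hY' _).mul_left ?_
  · change φ _ * φ _ = φ _ * φ _
    rw [← map_mul, ← map_mul, mul_comm]
  · exact commute_algHom_prod φ _ _ fun b' hb' => commute_stripFactor t S fun j hj =>
      (hcross hi hj (Or.inl (Finset.ne_of_mem_erase hb'))).symm

/-- A local circuit that splits the charges of strips into independent charges of sites. -/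
theorem IsChargeLattice.exists_circuit (h : IsChargeLattice φ stab hop o) (hL : 2 ≤ L) (hs : 1 ≤ s)
    (h1 : m * s ≤ L) (h2 : L < (m + 1) * s) {t : ℝ} (ht : 0 ≤ t) (ht1 : t < 1) :
    ∃ l : List (ChannelGate (Edge L)), (∀ g ∈ l, IsChannelOn g.supp g.map) ∧
      IsLCd (L := L) (fun e => e.2) (fun e => e.2) (3 * s) 9 (runGates l) ∧
      ∀ Y, (∀ p, Commute Y (φ (xx (stab p)))) → (∀ p, Commute Y (hop p)) →
        runGates l (Y * φ (stabProd (stripBits (m := m) s stab)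
          fun b => ((t ^ stripLength L s b.1 : ℝ) : ℂ))) =
            Y * φ (stabProd stab fun _ => (t : ℂ)) := by
  choose Φ hΦ hstep using fun b : ZMod m × ZMod L => h.exists_gate hs h1 h2 ht ht1 b
  let f : ZMod m × ZMod L → ChannelGate (Edge L) := fun b => ⟨stripLinks s o b, Φ b⟩
  let c : ℕ → List (ZMod m × ZMod L) := fun k =>
    (Finset.univ : Finset (ZMod m × ZMod L)).toList.filter fun b => siteColour b = k
  have hmem : ∀ {b k}, b ∈ c k ↔ siteColour b = k := by simp [c]
  have hrun : ∀ Y, (∀ p, Commute Y (φ (xx (stab p)))) → (∀ p, Commute Y (hop p)) →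
      ∀ (l : List (ZMod m × ZMod L)), l.Nodup → ∀ S : Finset (ZMod m × ZMod L), (∀ b ∈ l, b ∉ S) →
        runGates (l.map f) (Y * φ (∏ b', stripFactor s stab t S b')) =
          Y * φ (∏ b', stripFactor s stab t (l.toFinset ∪ S) b') := by
    intro Y hY hY' l
    induction l with
    | nil => intro _ S _; simp [runGates]
    | cons b l ih =>
      intro hl S hS
      rw [List.nodup_cons] at hl
      rw [List.map_cons, runGates_cons, show (f b).map = Φ b from rfl,
        hstep b Y hY hY' S (hS b (by simp)),
        ih hl.2 (insert b S) fun b' hb' => ?_, List.toFinset_cons, Finset.insert_union,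
        Finset.union_insert]
      rw [Finset.mem_insert, not_or]
      exact ⟨fun e => hl.1 (e ▸ hb'), hS b' (List.mem_cons_of_mem _ hb')⟩
  refine ⟨((List.range 9).map fun k => (c k).map f).flatten, fun g hg => ?_, ?_, ?_⟩
  · simp only [List.mem_flatten, List.mem_map] at hg
    obtain ⟨_, ⟨k, -, rfl⟩, hg⟩ := hg
    obtain ⟨b, -, rfl⟩ := List.mem_map.1 hg
    exact hΦ b
  · have := isLCd_channelLayers (pos := fun e : Edge L => e.2) (g := 3 * s)
      ((List.range 9).map fun k => (c k).map f) fun l hl => by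
        obtain ⟨k, -, rfl⟩ := List.mem_map.1 hl
        refine ⟨List.pairwise_map.2 ?_, fun g hg => ?_⟩
        · exact (((Finset.nodup_toList _).filter _).imp_of_mem fun ha hb hab =>
            stripLinks_disjoint hL hs h1 h2 o hab ((hmem.1 ha).trans (hmem.1 hb).symm))
        · obtain ⟨b, -, rfl⟩ := List.mem_map.1 hg
          exact ⟨hΦ b, stripLinks_diam hs h1 h2 o b⟩
    rwa [List.length_map, List.length_range] at this
  · intro Y hY hY'
    have e : ((List.range 9).map fun k => (c k).map f).flatten = ((List.range 9).flatMap c).map f :=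
      (List.map_flatMap ..).symm
    have := hrun Y hY hY' ((List.range 9).flatMap c) (List.nodup_flatMap.2
      ⟨fun k _ => (Finset.nodup_toList _).filter _, List.nodup_range.imp fun hk b hb hb' =>
        hk ((hmem.1 hb).symm.trans (hmem.1 hb'))⟩) ∅ fun b _ => Finset.notMem_empty b
    have hall : ((List.range 9).flatMap c).toFinset ∪ ∅ = Finset.univ := by
      ext b
      simpa [hmem] using siteColour_lt b
    rw [hall] at this
    rw [e]
    refine Eq.trans ?_ (this.trans ?_)
    · congr 3
    · rw [stabProd, ← prod_strips hs h1 h2]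
      simp only [stripFactor, Finset.mem_univ, if_true]

end StripCircuit

/-! ### Preparation of thermal states on tori of any size -/

section ThermalPreparation

variable {L : ℕ} [NeZero L]

theorem ibit_add_ibit {p q : Prop} [Decidable p] [Decidable q] (h : p → ¬q) :
    (-1 : ℂ) ^ ((ibit p + ibit q : Fin 2) : ℕ) = if p ∨ q then -1 else 1 := by
  by_cases hp : p <;> by_cases hq : q <;> simp_all [ibit]

/-- A $Z$ on the vertical link between two adjacent plaquettes moves an $m$-anyon. The links of a
plaquette sit at corners of the square from `p` to `p + (1, 1)`, hence the offset `0`. -/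
theorem plaquette_chargeLattice (hL : 2 ≤ L) : IsChargeLattice (L := L) phiX
    (fun p => ind (plaquette p)) (fun p => paZ (Pi.single (vert (p + (1, 0))) 1)) 0 := by
  have key : ∀ p q : Site L, sgn (Pi.single (vert (p + (1, 0))) 1) (ind (plaquette q)) =
      if q = p + (1, 0) ∨ q = p then -1 else 1 := by
    intro p q
    rw [sgn_single_left, Fin.val_one, one_mul, ind_plaquette_vert hL, ibit_add_ibit]
    · simp only [add_left_inj]
    · rintro rfl h
      exact (site_add_ne hL _).2 h
  refine ⟨fun a => ?_, fun p => ?_, fun p => ?_, fun p => paZ_mul_self _,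
    fun p => paZ_conjTranspose _, fun p q h => ?_, fun p q h h' => ?_⟩
  · rw [phiX_xx, paX_conjTranspose]
  · rw [phiX_xx]
    refine paX_mem_localAlg fun e he => ?_
    rw [ind, if_neg]
    contrapose! he
    simp only [plaquette, Finset.mem_insert, Finset.mem_singleton] at he
    rw [squareLinks, Finset.mem_filter]
    rcases he with rfl | rfl | rfl | rfl <;> simp [horiz, vert]
  · refine paZ_mem_localAlg fun e he => Pi.single_eq_of_ne ?_ _
    rintro rfl
    exact he (by simp [squareLinks, vert])
  · rw [phiX_xx, paZ_mul_paX, key, if_pos h.symm, neg_one_smul]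
  · rw [phiX_xx]
    exact paZ_commute_paX (by rw [key, if_neg (by tauto)])

/-- An $X$ on a horizontal link moves an $e$-anyon between its ends. Stars extend to the left and
down, hence the offset `-1`. -/
theorem vertexStar_chargeLattice (hL : 2 ≤ L) : IsChargeLattice (L := L) phiZ
    (fun p => ind (vertexStar p)) (fun p => paX (Pi.single (horiz p) 1)) (-1) := by
  have key : ∀ p q : Site L, sgn (ind (vertexStar q)) (Pi.single (horiz p) 1) =
      if q = p ∨ q = p + (1, 0) then -1 else 1 := by
    intro p q
    rw [sgn_single_right, Fin.val_one, one_mul, ind_vertexStar_horiz hL, ibit_add_ibit]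
    rintro rfl h
    exact (site_add_ne hL _).2 h.symm
  refine ⟨fun a => ?_, fun p => ?_, fun p => ?_, fun p => paX_mul_self _,
    fun p => paX_conjTranspose _, fun p q h => ?_, fun p q h h' => ?_⟩
  · rw [phiZ_xx, paZ_conjTranspose]
  · rw [phiZ_xx]
    refine paZ_mem_localAlg fun e he => ?_
    rw [ind, if_neg]
    contrapose! he
    simp only [vertexStar, Finset.mem_insert, Finset.mem_singleton] at he
    rw [squareLinks, Finset.mem_filter]
    rcases he with rfl | rfl | rfl | rfl <;> simp [horiz, vert]
  · refine paX_mem_localAlg fun e he => Pi.single_eq_of_ne ?_ _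
    rintro rfl
    exact he (by simp [squareLinks, horiz])
  · rw [phiZ_xx, paZ_mul_paX, key, if_pos h, neg_one_smul, neg_neg]
  · rw [phiZ_xx]
    exact (paZ_commute_paX (by rw [key, if_neg (by tauto)])).symm

theorem commute_phiX_paZ {κ : Type*} [Fintype κ] {Q : Type} [Fintype Q] [DecidableEq Q]
    {a : κ → Q → Fin 2} (f : κ → ℂ) {b : Q → Fin 2} (h : ∀ k, sgn b (a k) = 1) :
    Commute (phiX (stabProd a f)) (paZ b) :=
  commute_algHom_prod _ _ _ fun k _ => commute_algHom_one_add _ _ (by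
    rw [phiX_xx]
    exact (paZ_commute_paX (h k)).symm)

theorem commute_phiZ_paX {κ : Type*} [Fintype κ] {Q : Type} [Fintype Q] [DecidableEq Q]
    {b : κ → Q → Fin 2} (f : κ → ℂ) {a : Q → Fin 2} (h : ∀ k, sgn (b k) a = 1) :
    Commute (phiZ (stabProd b f)) (paX a) :=
  commute_algHom_prod _ _ _ fun k _ => commute_algHom_one_add _ _ (by
    rw [phiZ_xx]
    exact paZ_commute_paX (h k))

theorem commute_phiX_phiZ {ι κ : Type*} [Fintype ι] [Fintype κ] {Q : Type} [Fintype Q]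
    [DecidableEq Q] {a : ι → Q → Fin 2} {b : κ → Q → Fin 2} (f : ι → ℂ) (g : κ → ℂ)
    (h : ∀ i j, sgn (b j) (a i) = 1) :
    Commute (phiX (stabProd a f)) (phiZ (stabProd b g)) :=
  (commute_algHom_prod _ _ _ fun k _ => commute_algHom_one_add _ _ (by
    rw [phiZ_xx]
    exact (commute_phiX_paZ f fun i => h i k).symm)).symm

theorem commute_algHom {Q : Type} [Fintype Q] [DecidableEq Q] (φ : GA Q →ₐ[ℂ] Op Q) (u v : GA Q) :
    Commute (φ u) (φ v) := by
  change φ u * φ v = φ v * φ u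
  rw [← map_mul, mul_comm, map_mul]

/-- There are at most $L^2$ strips, and each factor is at most $1+t^s\le\exp(t^s)$. -/
theorem prod_strips_le {s : ℕ} (hs : 1 ≤ s) [NeZero (L / s)] {t : ℝ} (ht : 0 ≤ t)
    (ht1 : t ≤ 1) : ∏ b : ZMod (L / s) × ZMod L, (1 + t ^ stripLength L s b.1) ≤
      Real.exp ((L : ℝ) ^ 2 * t ^ s) := by
  have h1 : ∀ b : ZMod (L / s) × ZMod L, 1 + t ^ stripLength L s b.1 ≤ Real.exp (t ^ s) := by
    intro b
    have := (stripLength_facts hs (Nat.div_mul_le_self L s)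
      ((Nat.div_lt_iff_lt_mul (by omega)).1 (Nat.lt_succ_self _)) b.1).1
    have := pow_le_pow_of_le_one ht ht1 this
    have := Real.add_one_le_exp (t ^ s)
    linarith
  refine (Finset.prod_le_prod (fun b _ => by positivity) fun b _ => h1 b).trans ?_
  rw [Finset.prod_const, Finset.card_univ, Fintype.card_prod, ZMod.card, ZMod.card,
    ← Real.exp_nat_mul, Real.exp_le_exp]
  refine mul_le_mul_of_nonneg_right ?_ (by positivity)
  rw [sq]
  exact_mod_cast Nat.mul_le_mul_right L (Nat.div_le_self L s)

/-- The circuit maps the state with strip charges of bias $t^n$, for a strip of length $n\ge s$,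
exactly to the thermal state. The maximally mixed state dominates that strip state with hardly any
loss, and the domination is carried through the circuit. -/
theorem exists_thermalizing_circuit (hL : 2 ≤ L) {s : ℕ} (hs : 1 ≤ s) (hsL : s ≤ L) {β : ℝ}
    (hβ : 0 ≤ β) : ∃ l : List (ChannelGate (Edge L)),
      IsLCd (L := L) (fun e => e.2) (fun e => e.2) (3 * s) 18 (runGates l) ∧
      Real.exp (-((L : ℝ) ^ 2 * Real.tanh β ^ s)) ≤
        fidelity (runGates l (maxMixed (Edge L))) (gibbs L β) := by
  have hm : NeZero (L / s) := ⟨(Nat.div_pos hsL (by omega)).ne'⟩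
  have h1 : L / s * s ≤ L := Nat.div_mul_le_self L s
  have h2 : L < (L / s + 1) * s := (Nat.div_lt_iff_lt_mul (by omega)).1 (Nat.lt_succ_self _)
  have ht := real_tanh_nonneg hβ
  have ht1 := real_tanh_lt_one β
  obtain ⟨lX, hlX, hdX, hX⟩ := (plaquette_chargeLattice hL).exists_circuit hL hs h1 h2 ht ht1
  obtain ⟨lZ, hlZ, hdZ, hZ⟩ := (vertexStar_chargeLattice hL).exists_circuit hL hs h1 h2 ht ht1
  have hc := sgn_vertexStar_plaquette hL
  set a : ZMod (L / s) × ZMod L → Edge L → Fin 2 := stripBits s fun p => ind (plaquette p)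
  set b : ZMod (L / s) × ZMod L → Edge L → Fin 2 := stripBits s fun p => ind (vertexStar p)
  let f : ZMod (L / s) × ZMod L → ℝ := fun b => Real.tanh β ^ stripLength L s b.1
  have hab : ∀ i j, sgn (b j) (a i) = 1 := fun i j =>
    sgn_sum_sum _ _ (fun k => ind (plaquette (stripSite s i k)))
      (fun k => ind (vertexStar (stripSite s j k))) fun _ _ => hc _ _
  have hpb : ∀ p j, sgn (b j) (ind (plaquette p)) = 1 := fun p j =>
    sgn_sum_left _ _ _ fun _ _ => hc _ _
  have hrun : runGates (lX ++ lZ) (phiX (stabProd a fun i => (f i : ℂ)) *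
      phiZ (stabProd b fun i => (f i : ℂ))) = therm L β := by
    rw [runGates_append, (commute_phiX_phiZ _ _ hab).eq, hX, (commute_phiX_phiZ _ _ hpb).symm.eq,
      hZ]
    · rfl
    · intro p
      rw [phiZ_xx]
      exact commute_phiX_paZ _ fun q => hc q p
    · intro p
      rw [← phiX_xx]
      exact commute_algHom _ _ _
    · intro p
      rw [phiX_xx]
      exact commute_phiZ_paX _ fun q => hpb p q
    · intro p
      rw [← phiZ_xx]
      exact commute_algHom _ _ _
  have hl : ∀ g ∈ lX ++ lZ, IsChannelOn g.supp g.map := fun g hg =>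
    (List.mem_append.1 hg).elim (hlX g) (hlZ g)
  refine ⟨lX ++ lZ, ?_, ?_⟩
  · have := hdZ.comp hdX
    have e : runGates (lX ++ lZ) = fun ρ => runGates lZ (runGates lX ρ) :=
      funext fun ρ => runGates_append _ _ _
    rw [e]
    exact this
  have hpos := isPositiveMap_runGates _ hl
  obtain ⟨r, hr, htr⟩ := trace_therm (L := L) hβ
  have hf : ∀ i, 0 ≤ f i := fun i => pow_nonneg ht _
  -- Any normalization $r\ge2^{|Q|}$ is admissible here; taking the trace of the final state makes
  -- the output the normalized Gibbs state.
  have h3 := hpos.sub_smul (maxMixed_sub_stab hab hf hf hr)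
  rw [hrun] at h3
  have hP : ∏ i, (1 + f i) ≤ Real.exp ((L : ℝ) ^ 2 * Real.tanh β ^ s) :=
    prod_strips_le hs ht ht1.le
  have hP0 : 0 < ∏ i, (1 + f i) := Finset.prod_pos fun i _ => by linarith [hf i]
  generalize ∏ i, (1 + f i) = P at h3 hP hP0
  have e : (((P * P * r : ℝ) : ℂ))⁻¹ • therm L β = (((P * P)⁻¹ : ℝ) : ℂ) • gibbs L β := by
    rw [gibbs_eq hL, htr, smul_smul, Complex.ofReal_mul, Complex.ofReal_inv, mul_inv]
  rw [e] at h3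
  refine le_trans ?_ (sqrt_le_fidelity (hpos.2 _ maxMixed_posSemidef) (gibbs_posSemidef β)
    (trace_gibbs hL hβ) (by positivity) h3)
  -- Plaquette and vertex strips contribute the same product, so the square root leaves one copy.
  rw [Real.exp_neg, mul_inv, Real.sqrt_mul_self (inv_nonneg.2 hP0.le)]
  exact inv_anti₀ hP0 hP

open scoped ComplexOrder in
theorem one_le_fidelity_self {Q : Type} [Fintype Q] [DecidableEq Q] {ρ : Op Q}
    (hρ : ρ.PosSemidef) (htr : ρ.trace = 1) : 1 ≤ fidelity ρ ρ := by
  have := sqrt_le_fidelity hρ hρ htr zero_le_one (by simp [Matrix.PosSemidef.zero])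
  rwa [Real.sqrt_one] at this

theorem siteDist_le_two_mul (p q : Site L) : siteDist p q ≤ 2 * L := by
  have h1 := (p.1 - q.1).val_lt
  have h2 := (p.2 - q.2).val_lt
  unfold siteDist
  omega

/-- The range is $57s=3s\,(18+1)$: two circuits of nine layers, after one depolarizing layer that
erases everything about the input except its trace. -/
theorem exists_thermalization (hL : 2 ≤ L) {s : ℕ} (hs : 1 ≤ s) {β : ℝ} (hβ : 0 ≤ β) {ε : ℝ}
    (hε : 0 < ε) (h : (L : ℝ) ^ 2 * Real.tanh β ^ s < ε) :
    ∃ Φ : Op (Edge L) → Op (Edge L), IsLC (L := L) (fun e => e.2) (fun e => e.2) (57 * s) Φ ∧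
      ∀ ρ, ρ.trace = 1 → 1 - ε < fidelity (Φ ρ) (gibbs L β) := by
  rcases le_or_gt s L with hsL | hsL
  · obtain ⟨l, hl, hF⟩ := exists_thermalizing_circuit hL hs hsL hβ
    refine ⟨_, (hl.comp (isLCd_depolarize (fun e : Edge L => e.2) (3 * s))).isLC (by omega),
      fun ρ hρ => ?_⟩
    rw [hρ, one_smul]
    exact one_sub_lt_of_exp_le h hF
  -- For strips longer than the torus a single gate may act on the whole torus, of diameter at most
  -- $2L<2s$, and the Gibbs state is simply prepared.
  · have hc := isChannelOn_replace (gibbs_posSemidef (L := L) β) (trace_gibbs hL hβ)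
    have := isLCd_channelLayers (pos := fun e : Edge L => e.2) (g := 2 * L)
      [[⟨Finset.univ, fun ρ => ρ.trace • gibbs L β⟩]] fun l hl => by
        obtain rfl := List.mem_singleton.1 hl
        refine ⟨List.pairwise_singleton _ _, fun g hg => ?_⟩
        obtain rfl := List.mem_singleton.1 hg
        exact ⟨hc, fun x _ y _ => siteDist_le_two_mul _ _⟩
    refine ⟨_, this.isLC (by simp; omega), fun ρ hρ => ?_⟩
    have e : runGates [[(⟨Finset.univ, fun ρ => ρ.trace • gibbs L β⟩ : ChannelGate (Edge L))]].flatten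
        ρ = gibbs L β := by
      change ρ.trace • gibbs L β = _
      rw [hρ, one_smul]
    rw [e]
    have := one_le_fidelity_self (gibbs_posSemidef (L := L) β) (trace_gibbs hL hβ)
    linarith

theorem lcConvertible_gibbs {β : ℝ} (hβ : 0 ≤ β) (ρ : (L : ℕ) → [NeZero L] → Op (Edge L))
    (hρ : ∀ (L : ℕ) [NeZero L], 2 ≤ L → (ρ L).trace = 1) :
    LCConvertible ρ fun L _ => gibbs L β := by
  have ht0 := real_tanh_nonneg hβ
  obtain ⟨t, ht, ht1⟩ := exists_between (real_tanh_lt_one β)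
  have hpos : 0 < t := ht0.trans_lt ht
  have ha : 0 < -Real.log t := by have := Real.log_neg hpos ht1; linarith
  set a := -Real.log t with had
  have hl2 : 0 < Real.log 2 := Real.log_pos (by norm_num)
  -- A first power of the logarithm is enough. The term $1/\log2$ absorbs the rounding of the strip
  -- length, by $\Lambda\ge\log2$.
  refine ⟨57 * (2 / a + 1 / Real.log 2), 1, fun L _ hL ε h0 h1 => ?_⟩
  have hΛ := log_two_le_log_div hL h0 h1
  have hLpos : (0 : ℝ) < L := by exact_mod_cast (by omega : 0 < L)
  set Λ := Real.log (L / ε) with hΛd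
  -- Just long enough for $as>2\Lambda$, that is $t^s<(\varepsilon/L)^2$; then
  -- $L^2t^s<\varepsilon^2\le\varepsilon$.
  set s := ⌊2 * Λ / a⌋₊ + 1 with hs
  have hs1 : 2 * Λ < a * s := by
    have := Nat.lt_floor_add_one (2 * Λ / a)
    rw [div_lt_iff₀ ha] at this
    rw [hs]
    push_cast
    linarith
  have hs2 : (s : ℝ) ≤ 2 * Λ / a + 1 := by
    have := Nat.floor_le (a := 2 * Λ / a) (by have := hl2.le.trans hΛ; positivity)
    rw [hs]
    push_cast
    linarith
  have hsmall : (L : ℝ) ^ 2 * Real.tanh β ^ s < ε := by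
    have e1 : t ^ s = Real.exp (-(a * s)) := by
      rw [had, neg_mul, neg_neg, mul_comm, Real.exp_nat_mul, Real.exp_log hpos]
    have e2 : Real.exp (-(2 * Λ)) = (ε / L) ^ 2 := by
      rw [hΛd, show -(2 * Real.log (L / ε)) = ((2 : ℕ) : ℝ) * -Real.log (L / ε) by push_cast; ring,
        Real.exp_nat_mul, Real.exp_neg, Real.exp_log (by positivity), inv_div]
    have e3 : Real.tanh β ^ s < (ε / L) ^ 2 := by
      refine (pow_le_pow_left₀ ht0 ht.le s).trans_lt ?_
      rw [e1, ← e2, Real.exp_lt_exp]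
      linarith
    calc (L : ℝ) ^ 2 * Real.tanh β ^ s < (L : ℝ) ^ 2 * (ε / L) ^ 2 := by gcongr
      _ = ε ^ 2 := by field_simp
      _ ≤ ε := by nlinarith
  obtain ⟨Φ, hΦ, hF⟩ := exists_thermalization hL (s := s) (by omega) hβ h0 hsmall
  refine ⟨57 * s, Φ, ?_, hΦ, hF _ (hρ L hL)⟩
  have : 1 ≤ 1 / Real.log 2 * Λ := by
    rw [one_div_mul_eq_div, le_div_iff₀ hl2]
    linarith
  rw [pow_one]
  push_cast
  calc (57 : ℝ) * s ≤ 57 * (2 * Λ / a + 1 / Real.log 2 * Λ) := by linarith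
    _ = _ := by ring

/-- One layer of one-qubit depolarizing gates does this without error, and gates of diameter zero
have range zero. -/
theorem lcConvertible_maxMixed (ρ : (L : ℕ) → [NeZero L] → Op (Edge L))
    (hρ : ∀ (L : ℕ) [NeZero L], 2 ≤ L → (ρ L).trace = 1) :
    LCConvertible ρ fun L _ => maxMixed (Edge L) := by
  refine ⟨0, 0, fun L _ hL ε h0 _ => ⟨0, fun σ => σ.trace • maxMixed (Edge L), by simp,
    (isLCd_depolarize (fun e : Edge L => e.2) 0).isLC (by omega), ?_⟩⟩
  beta_reduce
  rw [hρ L hL, one_smul]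
  have := one_le_fidelity_self (maxMixed_posSemidef (Q := Edge L)) trace_maxMixed
  linarith

end ThermalPreparation
end

/-! ### The theorem -/

theorem mainTheorem4 :
    -- one step of the renormalization group is an exact ideal RG with `tanh β' = tanh^4 β`
    (∀ (M : ℕ) [NeZero M], 2 ≤ M → ∀ β : ℝ, 0 ≤ β →
      ∀ lX lZ : List (Site M), lX.Perm (blocks M) → lZ.Perm (blocks M) →
        (∀ g ∈ rgGates M lX lZ ++ fineGates M β lX lZ, IsChannelOn g.supp g.map ∧
          ∀ x ∈ g.supp, ∀ y ∈ g.supp, siteDist x.2 y.2 ≤ 4) ∧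
        IsIdeal (rgGates M lX lZ) (gibbs (2 * M) β) ∧
        runGates (rgGates M lX lZ) (gibbs (2 * M) β) =
          adjoin (coarseEdge M) (decoupledState M) (gibbs M (rgBeta β)) ∧
        runGates (fineGates M β lX lZ) (runGates (rgGates M lX lZ) (gibbs (2 * M) β)) =
          gibbs (2 * M) β ∧
        rgStep M (gibbs (2 * M) β) = gibbs M (rgBeta β) ∧
        fineStep M β (gibbs M (rgBeta β)) = gibbs (2 * M) β) ∧
    -- the renormalized temperature
    (∀ β : ℝ, Real.tanh (rgBeta β) = Real.tanh β ^ 4) ∧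
    (∀ β β' : ℝ, anyonProb β' =
        4 * anyonProb β * (1 - anyonProb β) ^ 3 + 4 * anyonProb β ^ 3 * (1 - anyonProb β) ↔
      Real.tanh β' = Real.tanh β ^ 4) ∧
    -- iterated RG, exact reversal, and flow to infinite temperature
    (∀ (M : ℕ) [NeZero M], 2 ≤ M → ∀ (ℓ : ℕ) (β : ℝ), 0 ≤ β →
      rgIter M ℓ (gibbs (latticeSize M ℓ) β) = gibbs M (rgBeta^[ℓ] β) ∧
      fineIter M ℓ β (gibbs M (rgBeta^[ℓ] β)) = gibbs (latticeSize M ℓ) β) ∧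
    (∀ β : ℝ, 0 ≤ β → Tendsto (fun ℓ : ℕ => rgBeta^[ℓ] β) atTop (𝓝 0)) ∧
    (∀ (L : ℕ) [NeZero L], gibbs L 0 = maxMixed (Edge L)) ∧
    -- fidelity and convergence estimates
    (∀ (L : ℕ) [NeZero L], 2 ≤ L → ∀ β : ℝ, 0 ≤ β →
      Real.exp (-(β * (L : ℝ) ^ 2)) ≤ fidelity (gibbs L β) (maxMixed (Edge L))) ∧
    Tendsto (fun β : ℝ => rgBeta β / β ^ 4) (𝓝[>] 0) (𝓝 1) ∧
    -- the RG and the reversed RG are local channel transformations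
    (∃ K : ℕ, ∀ (M : ℕ) [NeZero M], 2 ≤ M → ∀ (ℓ : ℕ) (β : ℝ), 0 ≤ β →
      IsLC (L := latticeSize M ℓ) (fun e => e.2) (fun e => (coarseEdgeIter M ℓ e).2)
        (K * (ℓ + 1) * 2 ^ ℓ) (rgIter M ℓ) ∧
      IsLC (L := latticeSize M ℓ) (fun e => (coarseEdgeIter M ℓ e).2) (fun e => e.2)
        (K * (ℓ + 1) * 2 ^ ℓ) (fineIter M ℓ β)) ∧
    -- `O(log log (L/ε))` steps suffice, and have polylogarithmic range
    (∀ β : ℝ, 0 ≤ β → ∃ (c C : ℝ) (k : ℕ), 0 < c ∧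
      ∀ (M : ℕ) [NeZero M], 2 ≤ M → ∀ (ℓ : ℕ) (ε : ℝ), 0 < ε → ε < 1 →
        (c * Real.log (1 + Real.log ((latticeSize M ℓ : ℝ) / ε)) ≤ ℓ →
          1 - ε < fidelity (rgIter M ℓ (gibbs (latticeSize M ℓ) β)) (maxMixed (Edge M)) ∧
          1 - ε < fidelity (fineIter M ℓ β (maxMixed (Edge M))) (gibbs (latticeSize M ℓ) β)) ∧
        ((ℓ : ℝ) ≤ c * Real.log (1 + Real.log ((latticeSize M ℓ : ℝ) / ε)) + 1 →
          ∃ r : ℕ, (r : ℝ) ≤ C * Real.log ((latticeSize M ℓ : ℝ) / ε) ^ k ∧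
            IsLC (L := latticeSize M ℓ) (fun e => e.2) (fun e => (coarseEdgeIter M ℓ e).2)
              r (rgIter M ℓ) ∧
            IsLC (L := latticeSize M ℓ) (fun e => (coarseEdgeIter M ℓ e).2) (fun e => e.2)
              r (fineIter M ℓ β))) ∧
    -- two-way connection to the maximally mixed state, and the trivial phase
    (∀ β : ℝ, 0 ≤ β →
      SamePhase (fun L _ => gibbs L β) (fun L _ => maxMixed (Edge L)) ∧
      InTrivialPhase (fun L _ => gibbs L β)) := by
  refine ⟨fun M _ hM β hβ lX lZ hX hZ => ⟨fun g hg => ⟨?_, gates_diameter β lX lZ g hg⟩,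
    rgGates_isIdeal β hX hZ, run_rgGates hM hβ hX hZ, run_fineGates β hX hZ, rgStep_gibbs hM hβ,
    fineStep_gibbs hM hβ⟩, tanh_rgBeta, fun β β' => anyonProb_iff β β', fun M _ hM ℓ β hβ =>
    ⟨rgIter_gibbs hM ℓ hβ, fineIter_gibbs hM ℓ hβ⟩, fun β hβ => tendsto_iterate_rgBeta hβ,
    fun L _ => gibbs_zero, fun L _ hL β hβ => fidelity_gibbs_maxMixed hL hβ, tendsto_rgBeta_div,
    ⟨192, fun M _ hM ℓ β _ => ⟨isLC_rgIter hM ℓ, isLC_fineIter hM ℓ β⟩⟩, fun β hβ => ?_,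
    fun β hβ => ⟨⟨lcConvertible_maxMixed _ fun L _ hL => trace_gibbs hL hβ,
      lcConvertible_gibbs hβ _ fun L _ _ => trace_maxMixed⟩,
      lcConvertible_gibbs hβ _ fun L _ _ => ?_⟩⟩
  · exact (List.mem_append.1 hg).elim (rgGates_isChannelOn lX lZ g)
      (fineGates_isChannelOn β lX lZ g)
  · obtain ⟨c, C, k, hc, h⟩ := exists_flow_constants hβ 192
    refine ⟨c, C, k, hc, fun M _ hM ℓ ε h0 h1 => ⟨fun hℓ => ?_, fun hℓ =>
      ⟨_, (h M hM ℓ ε h0 h1).2 hℓ, isLC_rgIter hM ℓ, isLC_fineIter hM ℓ β⟩⟩⟩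
    have hs := (h M hM ℓ ε h0 h1).1 hℓ
    refine ⟨one_sub_lt_of_exp_le hs ?_, one_sub_lt_of_exp_le hs (fidelity_fineIter hM ℓ hβ)⟩
    rw [rgIter_gibbs hM ℓ hβ]
    exact fidelity_gibbs_maxMixed hM (iterate_rgBeta_nonneg ℓ hβ)
  · rw [zeroState, trace_tensorOp]
    exact Finset.prod_eq_one fun _ _ => by simp [ketZero, Matrix.trace]
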